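/- **Setting.** For $a\in\mathbb R$, $d>0$ let $U(y)=-\frac a2y(y-d)+\frac yd$ be the laminar flow with constant vorticity $a$ and depth $d$, $\kappa=U'(d)=\frac1d-\frac{ad}2$, $\mathcal R(d)=\frac12\bigl(\frac1{d^2}-a+\frac{a^2d^2}4\bigr)+d$ its Bernoulli constant, $d_c(a)$ the minimum point of $\mathcal R$ on $(0,\infty)$, $d_s(a)=\sqrt{2/|a|}$, and $\Upsilon_-=\{(a,d):a<0,\ d>d_s(a)\}$. Let $\gamma(y;\tau)=\sinh(\tau y)/\sinh(\tau d)$ ($\gamma(y;0)=y/d$), $\gamma'=\partial_y\gamma$, $\sigma(\tau)=\kappa^2\gamma'(d;\tau)+a\kappa-1$, let $\tau_*$ be the positive root of $\sigma$, and $\Lambda_*=2\pi/\tau_*$. A *Stokes branch* from $(U,d)$ is a family $(\psi(x,y;t),\eta(x;t),\lambda(t))$, $0\le t<T$, of functions analytic in all variables up to the boundary, with $\lambda,\eta>0$, even and $\Lambda_*$-periodic in $x$, such that $\lambda^2\psi_{xx}+\psi_{yy}+a=0$ for $0<y<\eta$; $\psi=0$ for $y=0$; $\psi=1$ and $\frac12(\psi_y^2+\lambda^2\psi_x^2)+\eta=\mathcal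 R(d)$ for $y=\eta$; and, as $t\to0^+$, $\psi=U-t\kappa\gamma(y;\tau_*)\cos\tau_*x+O(t^2)$, $\eta=d+t\cos\tau_*x+O(t^2)$, $\lambda=1+\lambda_2't^2+O(t^3)$ for some real number $\lambda_2'$. The spectral problem of the Fréchet derivative at such a wave, for even $\Lambda_*$-periodic $v$ which are $C^2$ up to the boundary, is $$\lambda^2v_{xx}+v_{yy}=0\ (0<y<\eta),\quad v|_{y=0}=0,\quad \lambda^2\psi_xv_x+\psi_yv_y-\frac{\widehat\rho}{\psi_y}v=\frac{\mu}{\psi_y}v\ (y=\eta),\quad \widehat\rho=1+\lambda^2\psi_{xy}\psi_x+\psi_{yy}\psi_y .$$ Its eigenvalues are numbered in increasing order, counted with multiplicity. Write $g_k=\gamma'(d;k\tau_*)$, $\sigma_k=\sigma(k\tau_*)$ and put $A_1=-\frac a4-\frac{\kappa g_1}2$, $C_1=\frac{\tau_*^2\kappa^2}2$, $B_1=-\frac34\tau_*^2\kappa^2+\frac{a^2}4+\frac{a\kappa g_1}2+\frac{\kappa^2g_1^2}4$; $a_1=\frac{(B_1+C_1)d-A_1\kappa}{d\sigma_0}$,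 $c_1=\frac{A_1(1-a\kappa)-\kappa(B_1+C_1)}{d\sigma_0}$, $b_1=\frac{B_1-A_1\kappa g_2}{\sigma_2}$, $d_1=\frac{A_1(1-a\kappa)-\kappa B_1}{\sigma_2}$; $\Xi=-a-\kappa g_1$; $A_2=(a_1+\frac{b_1}2)\Xi+c_1+\frac{g_2d_1}2-\frac38\kappa\tau_*^2$; $C_2=-(a_1+\frac{b_1}2)(a\Xi+\kappa^2\tau_*^2)+c_1\Xi+d_1\bigl(\kappa\tau_*^2+\frac{\Xi g_2}2\bigr)+\frac34a\kappa\tau_*^2+\frac58\kappa^2\tau_*^2g_1$; $$\lambda_2=\frac{\kappa C_2-(1-a\kappa)A_2}{\kappa^3(d\tau_*^2+g_1)-d\kappa(1-a\kappa)g_1},\qquad \mu_2(a,d)=-2\kappa^2\tau_*\lambda_2\Bigl(\tau_*d+\Bigl(1-\frac{(1-a\kappa)d}{\kappa^2}\Bigr)\coth\tau_*d\Bigr).$$ **Theorem.** There is a unique $n_->0$ with $n_-=\frac43\tanh n_-$; with $$M=\frac{729n_-^6-3078n_-^4+3168n_-^2-512}{54n_-^2}$$ one has $|n_--1.034021|<10^{-6}$,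 $|M-4.287466|<10^{-6}$, and $M>0$. (a) Let $d>0$ and $a=-4/d^2$. Then $(a,d)\in\Upsilon_-$, $d>d_c(a)$, and there is $y_*\in(0,d/2)$ with $U'<0$ on $[0,y_*)$, $U'(y_*)=0$, $U'>0$ on $(y_*,d]$ (a counter-current near the bottom). The equation $\sigma(\tau)=0$ has exactly one positive root $\tau_*$. For every Stokes branch from $(U,d)$ the spectral problem has, for all small $t>0$, a second eigenvalue $\mu(t)$, and $\mu(t)=\mu_2(a,d)\,t^2+O(t^3)$ as $t\to0^+$. (b) On the curve $a=-4/d^2$, $\mu_2(a,d)=M\,d^{-5}+O(d^{-2})$ as $d\to0^+$. (c) Consequently $\mu_2(-4/d^2,d)>0$ for all sufficiently small $d>0$; so $\mu_2>0$ for some laminar flows with a counter-current near the bottom. -/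

import Mathlib

open Filter Topology Asymptotics

noncomputable section

/-! ### Laminar flows with constant vorticity `a` and depth `d` -/

/-- The stream function `U` of the laminar flow: `U'' + a = 0`, `U 0 = 0`, `U d = 1`. -/
def laminarU (a d y : ℝ) : ℝ := -a / 2 * y * (y - d) + y / d

/-- The velocity of the laminar flow on the surface, `κ = U'(d)`. -/
def kappa (a d : ℝ) : ℝ := 1 / d - a * d / 2

/-- The Bernoulli constant of the laminar flow of depth `d`. -/
def bernoulliR (a d : ℝ) : ℝ := (1 / d ^ 2 - a + a ^ 2 * d ^ 2 / 4) / 2 + d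

/-- `dc` is the critical depth: the point where `bernoulliR a` is minimal on `(0, ∞)`. -/
def IsCriticalDepth (a dc : ℝ) : Prop :=
  0 < dc ∧ ∀ d : ℝ, 0 < d → bernoulliR a dc ≤ bernoulliR a d

/-- The depth at which a stagnation point appears on the surface or at the bottom. -/
def stagnationDepth (a : ℝ) : ℝ := √(2 / |a|)

/-- The region `Υ₋` of the parameters `(a, d)`. -/
def UpsilonMinus : Set (ℝ × ℝ) := {p | p.1 < 0 ∧ stagnationDepth p.1 < p.2}

/-- The horizontal velocity of the laminar flow changes its sign, at a stagnation point in the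
lower half of the layer; the flow below this point is the counter-current near the bottom. -/
def HasBottomCounterCurrent (a d : ℝ) : Prop :=
  ∃ ys : ℝ, 0 < ys ∧ ys < d / 2 ∧ deriv (laminarU a d) ys = 0 ∧
    (∀ y : ℝ, 0 ≤ y → y < ys → deriv (laminarU a d) y < 0) ∧
    (∀ y : ℝ, ys < y → y ≤ d → 0 < deriv (laminarU a d) y)

/-! ### The dispersion equation -/

/-- The solution of `γ'' - τ² γ = 0`, `γ 0 = 0`, `γ d = 1`. -/
def gammaFn (d τ y : ℝ) : ℝ :=
  if τ = 0 then y / d else Real.sinh (τ * y) / Real.sinh (τ * d)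

/-- `γ'(d; τ)`, the derivative in `y` at `y = d`. -/
def gammaD (d τ : ℝ) : ℝ := deriv (gammaFn d τ) d

/-- The dispersion function `σ`. -/
def sigmaFn (a d τ : ℝ) : ℝ := kappa a d ^ 2 * gammaD d τ + a * kappa a d - 1

/-- The positive root `τ_*` of the dispersion equation (when it exists and is unique). -/
def tauStar (a d : ℝ) : ℝ := sInf {τ : ℝ | 0 < τ ∧ sigmaFn a d τ = 0}

/-! ### Steady water waves and the branch of Stokes waves -/

/-- Partial derivative in the first (horizontal) variable. -/
def dX (f : ℝ → ℝ → ℝ) (x y : ℝ) : ℝ := deriv (fun s => f s y) x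

/-- Partial derivative in the second (vertical) variable. -/
def dY (f : ℝ → ℝ → ℝ) (x y : ℝ) : ℝ := deriv (fun s => f x s) y

/-- `(ψ, η, lam)` is an even wave of period `Λ` in the rescaled variable `x` with constant
vorticity `a` and Bernoulli constant `R`. Only the values of `ψ` near the closed fluid domain
`0 ≤ y ≤ η x` matter. -/
structure IsSteadyWave (a R Λ : ℝ) (ψ : ℝ → ℝ → ℝ) (η : ℝ → ℝ) (lam : ℝ) : Prop where
  lam_pos : 0 < lam
  eta_pos : ∀ x, 0 < η x
  eta_even : ∀ x, η (-x) = η x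
  eta_periodic : ∀ x, η (x + Λ) = η x
  psi_even : ∀ x y, 0 ≤ y → y ≤ η x → ψ (-x) y = ψ x y
  psi_periodic : ∀ x y, 0 ≤ y → y ≤ η x → ψ (x + Λ) y = ψ x y
  equation : ∀ x y, 0 < y → y < η x →
    lam ^ 2 * dX (dX ψ) x y + dY (dY ψ) x y + a = 0
  bottom : ∀ x, ψ x 0 = 0
  surface : ∀ x, ψ x (η x) = 1
  bernoulli : ∀ x,
    (dY ψ x (η x) ^ 2 + lam ^ 2 * dX ψ x (η x) ^ 2) / 2 + η x = R

/-- The local branch of Stokes waves, `0 ≤ t < T`, that bifurcates from the laminar flow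
`(U, d)`: waves of the fixed period `2π/τ_*` (in the rescaled variable) with the Bernoulli
constant of the laminar flow, which are analytic in all variables up to the boundary, and which
have the given expansions at `t = 0`. -/
structure IsStokesBranch (a d T : ℝ) (ψ : ℝ → ℝ → ℝ → ℝ) (η : ℝ → ℝ → ℝ) (lam : ℝ → ℝ) :
    Prop where
  T_pos : 0 < T
  wave : ∀ t, 0 ≤ t → t < T →
    IsSteadyWave a (bernoulliR a d) (2 * Real.pi / tauStar a d) (ψ t) (η t) (lam t)
  analytic_lam : ∀ t, 0 ≤ t → t < T → AnalyticAt ℝ lam t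
  analytic_eta : ∀ t x, 0 ≤ t → t < T → AnalyticAt ℝ (fun p : ℝ × ℝ => η p.1 p.2) (t, x)
  analytic_psi : ∀ t x y, 0 ≤ t → t < T → 0 ≤ y → y ≤ η t x →
    AnalyticAt ℝ (fun p : ℝ × ℝ × ℝ => ψ p.1 p.2.1 p.2.2) (t, x, y)
  expand_psi : ∀ x y, 0 ≤ y → y ≤ d →
    (fun t => ψ t x y - (laminarU a d y - t * (kappa a d * gammaFn d (tauStar a d) y *
      Real.cos (tauStar a d * x)))) =O[𝓝[>] 0] (fun t => t ^ 2)
  expand_eta : ∀ x,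
    (fun t => η t x - (d + t * Real.cos (tauStar a d * x))) =O[𝓝[>] 0] (fun t => t ^ 2)
  expand_lam : ∃ lam₂ : ℝ,
    (fun t => lam t - (1 + lam₂ * t ^ 2)) =O[𝓝[>] 0] (fun t => t ^ 3)

/-! ### The spectral problem of the Fréchet derivative -/

/-- The closed fluid domain. -/
def fluidDomain (η : ℝ → ℝ) : Set (ℝ × ℝ) := {p | 0 ≤ p.2 ∧ p.2 ≤ η p.1}

/-- The coefficient `ρ̂ = 1 + lam² ψ_xy ψ_x + ψ_yy ψ_y` on the surface. -/
def rhoHat (ψ : ℝ → ℝ → ℝ) (η : ℝ → ℝ) (lam x : ℝ) : ℝ :=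
  1 + lam ^ 2 * dY (dX ψ) x (η x) * dX ψ x (η x) + dY (dY ψ) x (η x) * dY ψ x (η x)

/-- `v` is zero or an eigenfunction, for the eigenvalue `μ`, of the spectral problem of the
Fréchet derivative at the wave `(ψ, η, lam)`, in the class of even functions of period `Λ`. (The
vorticity function is constant, so that its derivative does not occur.) -/
structure SolvesSpectralProblem (Λ : ℝ) (ψ : ℝ → ℝ → ℝ) (η : ℝ → ℝ) (lam μ : ℝ)
    (v : ℝ → ℝ → ℝ) : Prop where
  smooth : ∀ x y, 0 ≤ y → y ≤ η x → ContDiffAt ℝ 2 (fun p : ℝ × ℝ => v p.1 p.2) (x, y)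
  even : ∀ x y, 0 ≤ y → y ≤ η x → v (-x) y = v x y
  periodic : ∀ x y, 0 ≤ y → y ≤ η x → v (x + Λ) y = v x y
  equation : ∀ x y, 0 < y → y < η x → lam ^ 2 * dX (dX v) x y + dY (dY v) x y = 0
  bottom : ∀ x, v x 0 = 0
  surface : ∀ x,
    lam ^ 2 * dX ψ x (η x) * dX v x (η x) + dY ψ x (η x) * dY v x (η x)
        - rhoHat ψ η lam x / dY ψ x (η x) * v x (η x)
      = μ / dY ψ x (η x) * v x (η x)

/-- The span of all eigenfunctions with eigenvalues `≤ μ`, as functions on the closed fluid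
domain. -/
def eigenspaceUpTo (Λ : ℝ) (ψ : ℝ → ℝ → ℝ) (η : ℝ → ℝ) (lam μ : ℝ) :
    Submodule ℝ (fluidDomain η → ℝ) :=
  Submodule.span ℝ {w | ∃ ν ≤ μ, ∃ v : ℝ → ℝ → ℝ,
    SolvesSpectralProblem Λ ψ η lam ν v ∧ w = fun p => v p.1.1 p.1.2}

/-- `μ` is the `k`-th eigenvalue, in increasing order and counted with multiplicity: the least
number up to which there are `k` linearly independent eigenfunctions. -/
def IsKthEigenvalue (k : ℕ) (Λ : ℝ) (ψ : ℝ → ℝ → ℝ) (η : ℝ → ℝ) (lam μ : ℝ) : Prop :=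
  IsLeast {m : ℝ | (k : Cardinal) ≤ Module.rank ℝ (eigenspaceUpTo Λ ψ η lam m)} μ

/-! ### The explicit expression for `μ₂` -/

/-- The coefficients at `1 + cos 2τ_*x` in the surface conditions of second order, and the
additional constant term `C₁`. -/
def coefA1 (a d : ℝ) : ℝ := -a / 4 - kappa a d * gammaD d (tauStar a d) / 2

def coefC1 (a d : ℝ) : ℝ := tauStar a d ^ 2 * kappa a d ^ 2 / 2

def coefB1 (a d : ℝ) : ℝ :=
  -(3 / 4) * tauStar a d ^ 2 * kappa a d ^ 2 + a ^ 2 / 4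
    + a * kappa a d * gammaD d (tauStar a d) / 2
    + kappa a d ^ 2 * gammaD d (tauStar a d) ^ 2 / 4

/-- `(coefa1, coefc1)` solves `κ a₁ + d c₁ + A₁ = 0`, `(1 - aκ) a₁ + κ c₁ + B₁ + C₁ = 0`. -/
def coefa1 (a d : ℝ) : ℝ :=
  ((coefB1 a d + coefC1 a d) * d - coefA1 a d * kappa a d) / (d * sigmaFn a d 0)

def coefc1 (a d : ℝ) : ℝ :=
  (coefA1 a d * (1 - a * kappa a d) - kappa a d * (coefB1 a d + coefC1 a d))
    / (d * sigmaFn a d 0)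

/-- `(coefb1, coefd1)` solves
`κ b₁ + d₁ + A₁ = 0`, `(1 - aκ) b₁ + κ γ'(d; 2τ_*) d₁ + B₁ = 0`. -/
def coefb1 (a d : ℝ) : ℝ :=
  (coefB1 a d - coefA1 a d * kappa a d * gammaD d (2 * tauStar a d))
    / sigmaFn a d (2 * tauStar a d)

def coefd1 (a d : ℝ) : ℝ :=
  (coefA1 a d * (1 - a * kappa a d) - kappa a d * coefB1 a d)
    / sigmaFn a d (2 * tauStar a d)

def coefXi (a d : ℝ) : ℝ := -a - kappa a d * gammaD d (tauStar a d)

/-- The coefficients at `cos τ_*x` in the surface conditions of third order. -/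
def coefA2 (a d : ℝ) : ℝ :=
  (coefa1 a d + coefb1 a d / 2) * coefXi a d + coefc1 a d
    + gammaD d (2 * tauStar a d) * coefd1 a d / 2 - 3 / 8 * kappa a d * tauStar a d ^ 2

def coefC2 (a d : ℝ) : ℝ :=
  -(coefa1 a d + coefb1 a d / 2) * (a * coefXi a d + kappa a d ^ 2 * tauStar a d ^ 2)
    + coefc1 a d * coefXi a d
    + coefd1 a d * (kappa a d * tauStar a d ^ 2
        + coefXi a d * gammaD d (2 * tauStar a d) / 2)
    + 3 / 4 * a * kappa a d * tauStar a d ^ 2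
    + 5 / 8 * kappa a d ^ 2 * tauStar a d ^ 2 * gammaD d (tauStar a d)

/-- The coefficient in `lam t = 1 + lambda2 t² + …`; it makes the system
`κ a₂ - d κ γ' λ₂ + c₂ + A₂ = 0`, `(1 - aκ) a₂ - κ² (d τ_*² + γ') λ₂ + κ γ' c₂ + C₂ = 0`
with `γ' = γ'(d; τ_*)` solvable for `(a₂, c₂)`. -/
def lambda2 (a d : ℝ) : ℝ :=
  (kappa a d * coefC2 a d - (1 - a * kappa a d) * coefA2 a d)
    / (kappa a d ^ 3 * (d * tauStar a d ^ 2 + gammaD d (tauStar a d))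
        - d * kappa a d * (1 - a * kappa a d) * gammaD d (tauStar a d))

/-- The coefficient `μ₂` of the second eigenvalue, explicitly. -/
def mu2 (a d : ℝ) : ℝ :=
  -2 * kappa a d ^ 2 * tauStar a d * lambda2 a d *
    (tauStar a d * d + (1 - (1 - a * kappa a d) * d / kappa a d ^ 2) *
      (Real.cosh (tauStar a d * d) / Real.sinh (tauStar a d * d)))

/-- The constant `M` as a function of `n₋`. -/
def leadingM (n : ℝ) : ℝ :=
  (729 * n ^ 6 - 3078 * n ^ 4 + 3168 * n ^ 2 - 512) / (54 * n ^ 2)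

end

/-- Persistence of a simple eigenvalue: if `m = 0` is a simple solution of `A x = m B x`, then the
perturbed problem has a solution at a distance controlled by the size of the perturbation. -/
theorem exists_perturbed_eigenpair {X Y : Type*} [NormedAddCommGroup X] [NormedSpace ℝ X]
    [CompleteSpace X] [NormedAddCommGroup Y] [NormedSpace ℝ Y] [CompleteSpace Y]
    (A B : X →L[ℝ] Y) (ℓ : X →L[ℝ] ℝ) (x₀ : X) (hA : A x₀ = 0)
    (hbij : Function.Bijective (fun p : X × ℝ => (A p.1 - p.2 • B x₀, ℓ p.1))) :
    ∃ δ > 0, ∃ C > 0, ∀ ε, 0 < ε → ε ≤ δ → ∀ E₁ E₂ : X →L[ℝ] Y, ‖E₁‖ ≤ ε → ‖E₂‖ ≤ ε →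
      ∃ (x : X) (m : ℝ), A x + E₁ x = m • (B x + E₂ x) ∧ |m| ≤ C * ε ∧ ‖x - x₀‖ ≤ C * ε := by
  let f : ((X →L[ℝ] Y) × (X →L[ℝ] Y)) × (X × ℝ) → Y × ℝ := fun u =>
    (A u.2.1 + u.1.1 u.2.1 - u.2.2 • (B u.2.1 + u.1.2 u.2.1), ℓ u.2.1)
  let u₀ : ((X →L[ℝ] Y) × (X →L[ℝ] Y)) × (X × ℝ) := (0, (x₀, 0))
  have hf : ContDiff ℝ 1 f := by
    refine ContDiff.prodMk (ContDiff.sub (ContDiff.add ?_ ?_) (ContDiff.smul ?_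
      (ContDiff.add ?_ ?_))) ?_
    · exact A.contDiff.comp (contDiff_fst.comp contDiff_snd)
    · exact (contDiff_fst.comp contDiff_fst).clm_apply (contDiff_fst.comp contDiff_snd)
    · exact contDiff_snd.comp contDiff_snd
    · exact B.contDiff.comp (contDiff_fst.comp contDiff_snd)
    · exact (contDiff_snd.comp contDiff_fst).clm_apply (contDiff_fst.comp contDiff_snd)
    · exact ℓ.contDiff.comp (contDiff_fst.comp contDiff_snd)
  have hs : HasStrictFDerivAt f (fderiv ℝ f u₀) u₀ :=
    hf.contDiffAt.hasStrictFDerivAt one_ne_zero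
  let Φ : X × ℝ →L[ℝ] Y × ℝ :=
    (A.comp (ContinuousLinearMap.fst ℝ X ℝ)
      - (ContinuousLinearMap.snd ℝ X ℝ).smulRight (B x₀)).prod
      (ℓ.comp (ContinuousLinearMap.fst ℝ X ℝ))
  have hΦ : fderiv ℝ f u₀ ∘L .inr ℝ _ _ = Φ := by
    have h1 : HasFDerivAt (fun p : X × ℝ => f (0, p)) (fderiv ℝ f u₀ ∘L .inr ℝ _ _) (x₀, 0) :=
      HasFDerivAt.comp (x₀, (0 : ℝ)) (f := fun p : X × ℝ =>
        ((0, p) : ((X →L[ℝ] Y) × (X →L[ℝ] Y)) × (X × ℝ))) hs.hasFDerivAt (hasFDerivAt_prodMk_right _ _)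
    have h2 : HasFDerivAt (fun p : X × ℝ => f (0, p)) Φ (x₀, 0) := by
      have e : (fun p : X × ℝ => f (0, p)) = fun p => (A p.1 - p.2 • B p.1, ℓ p.1) := by
        ext p <;> simp [f]
      rw [e]
      have hfst : HasFDerivAt (fun p : X × ℝ => p.1) (ContinuousLinearMap.fst ℝ X ℝ) (x₀, 0) :=
        hasFDerivAt_fst
      have hsnd : HasFDerivAt (fun p : X × ℝ => p.2) (ContinuousLinearMap.snd ℝ X ℝ) (x₀, 0) :=
        hasFDerivAt_snd
      have hAf := A.hasFDerivAt.comp (x₀, (0 : ℝ)) hfst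
      have hBf := B.hasFDerivAt.comp (x₀, (0 : ℝ)) hfst
      have hlf := ℓ.hasFDerivAt.comp (x₀, (0 : ℝ)) hfst
      have h3 := (hAf.sub (hsnd.smul hBf)).prodMk hlf
      refine h3.congr_fderiv ?_
      ext p <;> simp [Φ]
    exact h1.unique h2
  have hinv : (fderiv ℝ f u₀ ∘L .inr ℝ _ _).IsInvertible := by
    rw [hΦ]
    have hi : Function.Injective Φ := hbij.injective
    have hsu : Function.Surjective Φ := hbij.surjective
    exact ⟨ContinuousLinearEquiv.ofBijective Φ (LinearMap.ker_eq_bot.2 hi)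
      (LinearMap.range_eq_top.2 hsu), by ext p <;> simp⟩
  set φ := hs.implicitFunctionOfProdDomain hinv
  have hO := (hs.hasStrictFDerivAt_implicitFunctionOfProdDomain hinv).hasFDerivAt.isBigO_sub
  have hφ0 : φ u₀.1 = u₀.2 :=
    (hs.eventually_apply_eq_iff_implicitFunctionOfProdDomain hinv).self_of_nhds.mp rfl
  obtain ⟨C, hC, hCb⟩ := hO.exists_pos
  rw [IsBigOWith] at hCb
  obtain ⟨δ, hδ, hb⟩ := Metric.eventually_nhds_iff.1
    (hCb.and (hs.eventually_apply_implicitFunctionOfProdDomain hinv))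
  refine ⟨δ / 2, by positivity, C, hC, fun ε hε hεδ E₁ E₂ h1 h2 => ?_⟩
  have hn : ‖((E₁, E₂) : (X →L[ℝ] Y) × (X →L[ℝ] Y))‖ ≤ ε := by
    rw [Prod.norm_def]; exact max_le h1 h2
  obtain ⟨hb1, hb2⟩ := hb (y := (E₁, E₂)) (by
    simp only [u₀, dist_zero_right]; linarith)
  change ‖φ (E₁, E₂) - φ u₀.1‖ ≤ C * ‖((E₁, E₂) : (X →L[ℝ] Y) × (X →L[ℝ] Y)) - 0‖ at hb1
  rw [hφ0, sub_zero] at hb1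
  have hb3 : ‖φ (E₁, E₂) - u₀.2‖ ≤ C * ε := hb1.trans (by gcongr)
  rw [Prod.norm_def] at hb3
  refine ⟨(φ (E₁, E₂)).1, (φ (E₁, E₂)).2, ?_, ?_, ?_⟩
  · have h4 := congrArg Prod.fst hb2
    simp only [f, u₀, hA] at h4
    have h5 : A (φ (E₁, E₂)).1 + E₁ (φ (E₁, E₂)).1
      - (φ (E₁, E₂)).2 • (B (φ (E₁, E₂)).1 + E₂ (φ (E₁, E₂)).1) = 0 := by
      rw [h4]; simp
    exact sub_eq_zero.1 h5
  · simpa [u₀] using (le_max_right _ _).trans hb3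
  · simpa [u₀] using (le_max_left _ _).trans hb3

/-! ### One mode of the flattened problem -/

theorem HasDerivAt.ite_le {f g : ℝ → ℝ} {c f' : ℝ} (hf : HasDerivAt f f' c)
    (hg : HasDerivAt g f' c) (h : f c = g c) :
    HasDerivAt (fun s => if s ≤ c then f s else g s) f' c := by
  have h1 : HasDerivWithinAt (fun s => if s ≤ c then f s else g s) f' (Set.Iic c) c :=
    hf.hasDerivWithinAt.congr (fun s hs => if_pos hs) (if_pos le_rfl)
  have h2 : HasDerivWithinAt (fun s => if s ≤ c then f s else g s) f' (Set.Ici c) c := by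
    refine hg.hasDerivWithinAt.congr (fun s hs => ?_) (by simp [h])
    rcases eq_or_lt_of_le (show c ≤ s from hs) with rfl | h'
    · simp [h]
    · simp [not_le.2 h']
  have h3 := h1.union h2
  rwa [Set.Iic_union_Ici, hasDerivWithinAt_univ] at h3

theorem hasDerivAt_ite_le {f g f' g' : ℝ → ℝ} (hf : ∀ s, HasDerivAt f (f' s) s)
    (hg : ∀ s, HasDerivAt g (g' s) s) {c : ℝ} (h : f c = g c) (h' : f' c = g' c) (s : ℝ) :
    HasDerivAt (fun s => if s ≤ c then f s else g s) (if s ≤ c then f' s else g' s) s := by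
  rcases lt_trichotomy s c with hs | rfl | hs
  · rw [if_pos hs.le]
    refine (hf s).congr_of_eventuallyEq ?_
    filter_upwards [Iio_mem_nhds hs] with r hr using if_pos (le_of_lt hr)
  · rw [if_pos le_rfl]
    exact HasDerivAt.ite_le (hf s) (h' ▸ hg s) h
  · rw [if_neg (not_le.2 hs)]
    refine (hg s).congr_of_eventuallyEq ?_
    filter_upwards [Ioi_mem_nhds hs] with r hr using if_neg (not_le.2 hr)

/-- A bounded `C²` function that coincides with `exp` on the negative half-line. -/
noncomputable def expCut (s : ℝ) : ℝ := if s ≤ 0 then Real.exp s else 2 + Real.sin s - Real.cos s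
/-- The derivative of `expCut`. -/
noncomputable def expCut1 (s : ℝ) : ℝ := if s ≤ 0 then Real.exp s else Real.cos s + Real.sin s
/-- The second derivative of `expCut`. -/
noncomputable def expCut2 (s : ℝ) : ℝ := if s ≤ 0 then Real.exp s else -Real.sin s + Real.cos s

theorem hasDerivAt_expCut (s : ℝ) : HasDerivAt expCut (expCut1 s) s :=
  hasDerivAt_ite_le (f := Real.exp) (f' := Real.exp) (c := 0) Real.hasDerivAt_exp
    (g := fun s => 2 + Real.sin s - Real.cos s) (g' := fun s => Real.cos s + Real.sin s)
    (fun s => (((Real.hasDerivAt_sin s).const_add 2).fun_sub (Real.hasDerivAt_cos s)).congr_deriv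
      (by ring)) (by norm_num) (by simp) s

theorem hasDerivAt_expCut1 (s : ℝ) : HasDerivAt expCut1 (expCut2 s) s :=
  hasDerivAt_ite_le (f := Real.exp) (f' := Real.exp) Real.hasDerivAt_exp
    (fun s => (Real.hasDerivAt_cos s).add (Real.hasDerivAt_sin s)) (by norm_num) (by simp) s

theorem continuous_expCut2 : Continuous expCut2 := by
  unfold expCut2
  exact Continuous.if_le Real.continuous_exp (by fun_prop) continuous_id continuous_const
    (by rintro s rfl; simp)

theorem abs_expCut_le (s : ℝ) : |expCut s| ≤ 4 := by
  unfold expCut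
  split_ifs with h
  · rw [abs_of_pos (Real.exp_pos s)]; linarith [Real.exp_le_one_iff.2 h]
  · rw [abs_le]; constructor <;>
      linarith [Real.neg_one_le_sin s, Real.sin_le_one s, Real.neg_one_le_cos s, Real.cos_le_one s]

theorem abs_expCut1_le (s : ℝ) : |expCut1 s| ≤ 4 := by
  unfold expCut1
  split_ifs with h
  · rw [abs_of_pos (Real.exp_pos s)]; linarith [Real.exp_le_one_iff.2 h]
  · rw [abs_le]; constructor <;>
      linarith [Real.neg_one_le_sin s, Real.sin_le_one s, Real.neg_one_le_cos s, Real.cos_le_one s]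

theorem abs_expCut2_le (s : ℝ) : |expCut2 s| ≤ 4 := by
  unfold expCut2
  split_ifs with h
  · rw [abs_of_pos (Real.exp_pos s)]; linarith [Real.exp_le_one_iff.2 h]
  · rw [abs_le]; constructor <;>
      linarith [Real.neg_one_le_sin s, Real.sin_le_one s, Real.neg_one_le_cos s, Real.cos_le_one s]

theorem expCut_of_nonpos {s : ℝ} (h : s ≤ 0) : expCut s = Real.exp s := if_pos h
theorem expCut1_of_nonpos {s : ℝ} (h : s ≤ 0) : expCut1 s = Real.exp s := if_pos h
theorem expCut2_of_nonpos {s : ℝ} (h : s ≤ 0) : expCut2 s = Real.exp s := if_pos h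

/-- The upward half of the Green function of `∂² - p²`. -/
noncomputable def greenUp (p : ℝ) (F : ℝ → ℝ) (z : ℝ) : ℝ :=
  Real.exp (-(p * z)) * ∫ s in (-1 : ℝ)..z, Real.exp (p * s) * F s

/-- The downward half of the Green function of `∂² - p²`. -/
noncomputable def greenDown (p : ℝ) (F : ℝ → ℝ) (z : ℝ) : ℝ :=
  Real.exp (p * z) * ∫ s in z..(2 : ℝ), Real.exp (-(p * s)) * F s

theorem hasDerivAt_greenUp {p : ℝ} {F : ℝ → ℝ} (hF : Continuous F) (z : ℝ) :
    HasDerivAt (greenUp p F) (F z - p * greenUp p F z) z := by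
  have hc : Continuous fun s => Real.exp (p * s) * F s := by fun_prop
  have h1 : HasDerivAt (fun z => ∫ s in (-1 : ℝ)..z, Real.exp (p * s) * F s)
      (Real.exp (p * z) * F z) z :=
    intervalIntegral.integral_hasDerivAt_right (hc.intervalIntegrable _ _)
      (hc.stronglyMeasurableAtFilter _ _) hc.continuousAt
  have h2 : HasDerivAt (fun z => Real.exp (-(p * z))) (Real.exp (-(p * z)) * (-p)) z := by
    have := ((hasDerivAt_id z).const_mul p).neg.exp
    simpa using this
  refine (h2.mul h1).congr_deriv ?_
  have h3 : Real.exp (-(p * z)) * Real.exp (p * z) = 1 := by rw [← Real.exp_add]; simp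
  unfold greenUp
  linear_combination F z * h3

theorem hasDerivAt_greenDown {p : ℝ} {F : ℝ → ℝ} (hF : Continuous F) (z : ℝ) :
    HasDerivAt (greenDown p F) (-F z + p * greenDown p F z) z := by
  have hc : Continuous fun s => Real.exp (-(p * s)) * F s := by fun_prop
  have h1 : HasDerivAt (fun z => ∫ s in z..(2 : ℝ), Real.exp (-(p * s)) * F s)
      (-(Real.exp (-(p * z)) * F z)) z :=
    intervalIntegral.integral_hasDerivAt_left (hc.intervalIntegrable _ _)
      (hc.stronglyMeasurableAtFilter _ _) hc.continuousAt
  have h2 : HasDerivAt (fun z => Real.exp (p * z)) (Real.exp (p * z) * p) z := by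
    have := ((hasDerivAt_id z).const_mul p).exp
    simpa using this
  refine (h2.mul h1).congr_deriv ?_
  have h3 : Real.exp (p * z) * Real.exp (-(p * z)) = 1 := by rw [← Real.exp_add]; simp
  unfold greenDown
  linear_combination -F z * h3

theorem abs_greenUp_le {p N : ℝ} (hp : 0 < p) {F : ℝ → ℝ}
    (hN : ∀ s, |F s| ≤ N) {z : ℝ} (hz : -1 ≤ z) : |greenUp p F z| ≤ N / p := by
  have hN0 : 0 ≤ N := (abs_nonneg _).trans (hN 0)
  have h1 : |∫ s in (-1 : ℝ)..z, Real.exp (p * s) * F s| ≤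
      ∫ s in (-1 : ℝ)..z, N * Real.exp (p * s) := by
    rw [← Real.norm_eq_abs]
    refine intervalIntegral.norm_integral_le_of_norm_le hz (Filter.Eventually.of_forall
      fun s _ => ?_) (Continuous.intervalIntegrable (by fun_prop) _ _)
    rw [Real.norm_eq_abs, abs_mul, abs_of_pos (Real.exp_pos _), mul_comm]
    gcongr; exact hN s
  have h2 : ∫ s in (-1 : ℝ)..z, N * Real.exp (p * s)
      = N * ((Real.exp (p * z) - Real.exp (p * (-1))) / p) := by
    rw [intervalIntegral.integral_const_mul]
    congr 1
    rw [intervalIntegral.integral_comp_mul_left (fun s => Real.exp s) hp.ne', integral_exp]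
    simp [div_eq_inv_mul]
  unfold greenUp
  rw [abs_mul, abs_of_pos (Real.exp_pos _)]
  have h3 : Real.exp (-(p * z)) * Real.exp (p * z) = 1 := by rw [← Real.exp_add]; simp
  calc _ ≤ Real.exp (-(p * z)) * (N * ((Real.exp (p * z) - Real.exp (p * (-1))) / p)) := by
        rw [← h2]; gcongr
    _ ≤ Real.exp (-(p * z)) * (N * (Real.exp (p * z) / p)) := by
        gcongr; linarith [Real.exp_pos (p * (-1))]
    _ = N / p := by linear_combination (N / p) * h3

theorem abs_greenDown_le {p N : ℝ} (hp : 0 < p) {F : ℝ → ℝ}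
    (hN : ∀ s, |F s| ≤ N) {z : ℝ} (hz : z ≤ 2) : |greenDown p F z| ≤ N / p := by
  have hN0 : 0 ≤ N := (abs_nonneg _).trans (hN 0)
  have h1 : |∫ s in z..(2 : ℝ), Real.exp (-(p * s)) * F s| ≤
      ∫ s in z..(2 : ℝ), N * Real.exp (-p * s) := by
    rw [← Real.norm_eq_abs]
    refine intervalIntegral.norm_integral_le_of_norm_le hz (Filter.Eventually.of_forall
      fun s _ => ?_) (Continuous.intervalIntegrable (by fun_prop) _ _)
    rw [Real.norm_eq_abs, abs_mul, abs_of_pos (Real.exp_pos _), mul_comm, neg_mul]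
    gcongr; exact hN s
  have h2 : ∫ s in z..(2 : ℝ), N * Real.exp (-p * s)
      = N * ((Real.exp (-p * z) - Real.exp (-p * 2)) / p) := by
    rw [intervalIntegral.integral_const_mul]
    congr 1
    rw [intervalIntegral.integral_comp_mul_left (fun s => Real.exp s) (neg_ne_zero.2 hp.ne'),
      integral_exp]
    simp only [smul_eq_mul]
    field_simp
    ring
  unfold greenDown
  rw [abs_mul, abs_of_pos (Real.exp_pos _)]
  have h3 : Real.exp (p * z) * Real.exp (-p * z) = 1 := by rw [← Real.exp_add]; simp
  calc _ ≤ Real.exp (p * z) * (N * ((Real.exp (-p * z) - Real.exp (-p * 2)) / p)) := by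
        rw [← h2]; gcongr
    _ ≤ Real.exp (p * z) * (N * (Real.exp (-p * z) / p)) := by
        gcongr; linarith [Real.exp_pos (-p * 2)]
    _ = N / p := by linear_combination (N / p) * h3

theorem greenUp_add {p : ℝ} {F G : ℝ → ℝ} (hF : Continuous F) (hG : Continuous G) (z : ℝ) :
    greenUp p (fun s => F s + G s) z = greenUp p F z + greenUp p G z := by
  unfold greenUp
  rw [← mul_add, ← intervalIntegral.integral_add
    (Continuous.intervalIntegrable (by fun_prop) _ _)
    (Continuous.intervalIntegrable (by fun_prop) _ _)]
  simp only [mul_add]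

theorem greenDown_add {p : ℝ} {F G : ℝ → ℝ} (hF : Continuous F) (hG : Continuous G) (z : ℝ) :
    greenDown p (fun s => F s + G s) z = greenDown p F z + greenDown p G z := by
  unfold greenDown
  rw [← mul_add, ← intervalIntegral.integral_add
    (Continuous.intervalIntegrable (by fun_prop) _ _)
    (Continuous.intervalIntegrable (by fun_prop) _ _)]
  simp only [mul_add]

theorem greenUp_smul (p c : ℝ) (F : ℝ → ℝ) (z : ℝ) :
    greenUp p (fun s => c * F s) z = c * greenUp p F z := by
  unfold greenUp
  simp only [mul_left_comm _ c, intervalIntegral.integral_const_mul]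

theorem greenDown_smul (p c : ℝ) (F : ℝ → ℝ) (z : ℝ) :
    greenDown p (fun s => c * F s) z = c * greenDown p F z := by
  unfold greenDown
  simp only [mul_left_comm _ c, intervalIntegral.integral_const_mul]

/-- The solution of `w'' - (q k)² w = F` on `[0, 1]` with `w 0 = 0` and a free parameter `g`,
continued to a `C²` function on the line (`j = 0`), and its derivatives (`j = 1, 2`). -/
noncomputable def modeFn (q : ℝ) (j k : ℕ) (F : ℝ → ℝ) (g z : ℝ) : ℝ :=
  let p := q * k
  let c := greenUp p F 0 + greenDown p F 0
  match j, k with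
  | 0, 0 => (∫ r in (0 : ℝ)..z, ∫ s in (0 : ℝ)..r, F s) + g * z
  | 1, 0 => (∫ s in (0 : ℝ)..z, F s) + g
  | 0, _ => -(greenUp p F z + greenDown p F z) / (2 * p) + c / (2 * p) * expCut (-(p * z))
      + g / (1 + k) ^ 2 * (expCut (p * (z - 1)) - Real.exp (-p) * expCut (-(p * z)))
  | 1, _ => (greenUp p F z - greenDown p F z) / 2 - c / 2 * expCut1 (-(p * z))
      + g / (1 + k) ^ 2 * (p * (expCut1 (p * (z - 1)) + Real.exp (-p) * expCut1 (-(p * z))))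
  | _, 0 => F z
  | _, _ => F z - p * (greenUp p F z + greenDown p F z) / 2 + p * c / 2 * expCut2 (-(p * z))
      + g / (1 + k) ^ 2 * (p ^ 2 * (expCut2 (p * (z - 1)) - Real.exp (-p) * expCut2 (-(p * z))))

theorem modeFn_add {q : ℝ} {j k : ℕ} {F G : ℝ → ℝ} (hF : Continuous F) (hG : Continuous G)
    (g h z : ℝ) :
    modeFn q j k (fun s => F s + G s) (g + h) z = modeFn q j k F g z + modeFn q j k G h z := by
  have hi : ∀ r, ∫ s in (0 : ℝ)..r, (F s + G s) = (∫ s in (0 : ℝ)..r, F s) + ∫ s in (0 : ℝ)..r, G s :=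
    fun r => intervalIntegral.integral_add (hF.intervalIntegrable _ _) (hG.intervalIntegrable _ _)
  have hcF : Continuous fun r => ∫ s in (0 : ℝ)..r, F s :=
    intervalIntegral.continuous_primitive (fun a b => hF.intervalIntegrable a b) 0
  have hcG : Continuous fun r => ∫ s in (0 : ℝ)..r, G s :=
    intervalIntegral.continuous_primitive (fun a b => hG.intervalIntegrable a b) 0
  unfold modeFn
  split <;> simp only [greenUp_add hF hG, greenDown_add hF hG, hi]
  · rw [intervalIntegral.integral_add (hcF.intervalIntegrable _ _) (hcG.intervalIntegrable _ _)]
    ring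
  all_goals ring

theorem modeFn_smul (q c : ℝ) (j k : ℕ) (F : ℝ → ℝ) (g z : ℝ) :
    modeFn q j k (fun s => c * F s) (c * g) z = c * modeFn q j k F g z := by
  unfold modeFn
  split <;> simp only [greenUp_smul, greenDown_smul, intervalIntegral.integral_const_mul] <;> ring

theorem hasDerivAt_modeFn_zero {q : ℝ} (hq : 0 < q) (k : ℕ) {F : ℝ → ℝ} (hF : Continuous F)
    (g z : ℝ) : HasDerivAt (modeFn q 0 k F g) (modeFn q 1 k F g z) z := by
  rcases k with _ | k
  · have hcF : Continuous fun r => ∫ s in (0 : ℝ)..r, F s :=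
      intervalIntegral.continuous_primitive (fun a b => hF.intervalIntegrable a b) 0
    have h1 := intervalIntegral.integral_hasDerivAt_right (hcF.intervalIntegrable 0 z)
      (hcF.stronglyMeasurableAtFilter _ _) hcF.continuousAt
    exact (h1.add ((hasDerivAt_id z).const_mul g)).congr_deriv (by simp [modeFn])
  · set p : ℝ := q * (k + 1 : ℕ) with hp
    have hp0 : 0 < p := by positivity
    have e1 : HasDerivAt (fun z => expCut (-(p * z))) (expCut1 (-(p * z)) * (-p)) z :=
      (hasDerivAt_expCut _).comp z (by simpa using ((hasDerivAt_id' z).const_mul p).fun_neg)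
    have e2 : HasDerivAt (fun z => expCut (p * (z - 1))) (expCut1 (p * (z - 1)) * p) z :=
      (hasDerivAt_expCut _).comp z (by
        simpa using ((hasDerivAt_id' z).sub_const 1).const_mul p)
    have h := ((((hasDerivAt_greenUp (p := p) hF z).add (hasDerivAt_greenDown (p := p) hF z)).neg.div_const
      (2 * p)).add (e1.const_mul ((greenUp p F 0 + greenDown p F 0) / (2 * p)))).add
      ((e2.sub (e1.const_mul (Real.exp (-p)))).const_mul (g / (1 + (k + 1 : ℕ)) ^ 2))
    refine h.congr_deriv ?_
    simp only [modeFn, ← hp]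
    field_simp
    ring

theorem hasDerivAt_modeFn_one {q : ℝ} (k : ℕ) {F : ℝ → ℝ} (hF : Continuous F)
    (g z : ℝ) : HasDerivAt (modeFn q 1 k F g) (modeFn q 2 k F g z) z := by
  rcases k with _ | k
  · have h1 := intervalIntegral.integral_hasDerivAt_right (hF.intervalIntegrable 0 z)
      (hF.stronglyMeasurableAtFilter _ _) hF.continuousAt
    exact (h1.add_const g).congr_deriv (by simp [modeFn])
  · set p : ℝ := q * (k + 1 : ℕ) with hp
    have e1 : HasDerivAt (fun z => expCut1 (-(p * z))) (expCut2 (-(p * z)) * (-p)) z :=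
      (hasDerivAt_expCut1 _).comp z (by simpa using ((hasDerivAt_id' z).const_mul p).fun_neg)
    have e2 : HasDerivAt (fun z => expCut1 (p * (z - 1))) (expCut2 (p * (z - 1)) * p) z :=
      (hasDerivAt_expCut1 _).comp z (by
        simpa using ((hasDerivAt_id' z).sub_const 1).const_mul p)
    have h := ((((hasDerivAt_greenUp (p := p) hF z).sub (hasDerivAt_greenDown (p := p) hF z)).div_const
      2).sub (e1.const_mul ((greenUp p F 0 + greenDown p F 0) / 2))).add
      (((e2.add (e1.const_mul (Real.exp (-p)))).const_mul p).const_mul (g / (1 + (k + 1 : ℕ)) ^ 2))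
    refine h.congr_deriv ?_
    simp only [modeFn, ← hp]
    ring

theorem continuous_modeFn {q : ℝ} (hq : 0 < q) (j k : ℕ) {F : ℝ → ℝ} (hF : Continuous F) (g : ℝ) :
    Continuous (modeFn q j k F g) := by
  match j, k with
  | 0, k =>
    rw [continuous_iff_continuousAt]
    exact fun z => (hasDerivAt_modeFn_zero hq k hF g z).continuousAt
  | 1, k =>
    rw [continuous_iff_continuousAt]
    exact fun z => (hasDerivAt_modeFn_one k hF g z).continuousAt
  | j + 2, 0 => exact hF
  | j + 2, k + 1 =>
    set p : ℝ := q * (k + 1 : ℕ) with hp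
    have h1 : Continuous (greenUp p F) := continuous_iff_continuousAt.2
      fun z => (hasDerivAt_greenUp hF z).continuousAt
    have h2 : Continuous (greenDown p F) := continuous_iff_continuousAt.2
      fun z => (hasDerivAt_greenDown (p := p) hF z).continuousAt
    have h3 := continuous_expCut2
    unfold modeFn
    simp only [← hp]
    fun_prop

theorem modeFn_zero_apply_zero {q : ℝ} (hq : 0 < q) (k : ℕ) (F : ℝ → ℝ) (g : ℝ) :
    modeFn q 0 k F g 0 = 0 := by
  rcases k with _ | k
  · simp [modeFn]
  · have hp0 : 0 < q * (k + 1 : ℕ) := by positivity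
    simp only [modeFn, mul_zero, neg_zero, expCut_of_nonpos le_rfl, Real.exp_zero, zero_sub]
    rw [expCut_of_nonpos (by linarith)]
    simp only [mul_neg, mul_one]
    ring

theorem modeFn_equation {q : ℝ} (hq : 0 < q) (k : ℕ) (F : ℝ → ℝ) (g : ℝ) {z : ℝ} (h0 : 0 ≤ z)
    (h1 : z ≤ 1) : modeFn q 2 k F g z - (q * k) ^ 2 * modeFn q 0 k F g z = F z := by
  rcases k with _ | k
  · simp [modeFn]
  · have hp0 : 0 < q * (k + 1 : ℕ) := by positivity
    set p : ℝ := q * (k + 1 : ℕ) with hp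
    have e1 : -(p * z) ≤ 0 := by nlinarith
    have e2 : p * (z - 1) ≤ 0 := by nlinarith
    simp only [modeFn, ← hp, expCut_of_nonpos e1, expCut_of_nonpos e2, expCut2_of_nonpos e1,
      expCut2_of_nonpos e2]
    field_simp
    ring

/-- A bound for the modes that is uniform in the frequency. -/
noncomputable def modeBound (q : ℝ) : ℝ := 20 / q ^ 2 + 10 / q + 10 + 8 * q + 8 * q ^ 2

theorem modeBound_pos {q : ℝ} (hq : 0 < q) : 0 < modeBound q := by
  unfold modeBound; positivity

theorem abs_modeFn_le {q : ℝ} (hq : 0 < q) {j : ℕ} (hj : j ≤ 2) (k : ℕ) {F : ℝ → ℝ} {N : ℝ}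
    (hN : ∀ s, |F s| ≤ N) (g : ℝ) {z : ℝ} (h1 : -1 ≤ z) (h2 : z ≤ 2) :
    (1 + (k : ℝ)) ^ (2 - j) * |modeFn q j k F g z| ≤ modeBound q * (N + |g|) := by
  have hN0 : 0 ≤ N := (abs_nonneg _).trans (hN 0)
  have hz : |z| ≤ 2 := abs_le.2 ⟨by linarith, h2⟩
  have hb : 10 ≤ modeBound q := by
    have : 0 ≤ 20 / q ^ 2 + 10 / q + 8 * q + 8 * q ^ 2 := by positivity
    unfold modeBound; linarith
  have hint : ∀ r : ℝ, |∫ s in (0 : ℝ)..r, F s| ≤ N * |r| := fun r => by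
    have := intervalIntegral.norm_integral_le_of_norm_le_const (a := 0) (b := r) (f := F) (C := N)
      (fun s _ => hN s)
    simpa using this
  have hgn := abs_nonneg g
  rcases k with _ | k
  · simp only [Nat.cast_zero, add_zero, one_pow, one_mul]
    suffices |modeFn q j 0 F g z| ≤ 4 * N + 2 * |g| by nlinarith
    interval_cases j
    · have h3 : |∫ r in (0 : ℝ)..z, ∫ s in (0 : ℝ)..r, F s| ≤ (2 * N) * |z| := by
        have := intervalIntegral.norm_integral_le_of_norm_le_const (a := 0) (b := z)
          (f := fun r => ∫ s in (0 : ℝ)..r, F s) (C := 2 * N) (fun r hr => by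
            refine (hint r).trans ?_
            have : |r| ≤ 2 := by
              rw [Set.uIoc, Set.mem_Ioc] at hr
              rw [abs_le]
              constructor
              · have := le_min (show (-1 : ℝ) ≤ 0 by norm_num) h1; linarith
              · exact hr.2.trans (max_le (by norm_num) h2)
            nlinarith)
        simpa using this
      calc |modeFn q 0 0 F g z| ≤ (2 * N) * |z| + |g * z| :=
            (abs_add_le _ _).trans (by gcongr)
        _ ≤ (2 * N) * 2 + |g| * 2 := by rw [abs_mul]; gcongr
        _ = _ := by ring
    · calc |modeFn q 1 0 F g z| ≤ N * |z| + |g| := (abs_add_le _ _).trans (by gcongr; exact hint z)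
        _ ≤ N * 2 + |g| := by gcongr
        _ ≤ _ := by linarith
    · exact (hN z).trans (by linarith)
  · set p : ℝ := q * (k + 1 : ℕ) with hp
    have hp0 : 0 < p := by positivity
    set m : ℝ := 1 + ((k + 1 : ℕ) : ℝ) with hm
    have hk1 : (1 : ℝ) ≤ (k + 1 : ℕ) := by exact_mod_cast Nat.le_add_left 1 k
    have hm0 : 0 < m := by positivity
    have hmp : m / p ≤ 2 / q := by
      rw [div_le_div_iff₀ hp0 hq, hp, hm]; nlinarith
    have hpm : p / m ≤ q := by
      rw [div_le_iff₀ hm0, hp, hm]; nlinarith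
    have hmp0 : 0 ≤ m / p := by positivity
    have hpm0 : 0 ≤ p / m := by positivity
    have hU := abs_greenUp_le hp0 hN h1
    have hD := abs_greenDown_le hp0 hN h2
    have hU0 := abs_greenUp_le hp0 hN (z := 0) (by norm_num)
    have hD0 := abs_greenDown_le hp0 hN (z := 0) (by norm_num)
    have he0 := Real.exp_pos (-p)
    have he1 : Real.exp (-p) ≤ 1 := Real.exp_le_one_iff.2 (by linarith)
    have hlin : ∀ a b c : ℝ, |a| ≤ 4 → |b| ≤ 4 → 0 ≤ c → c ≤ 1 → |a - c * b| ≤ 8 := by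
      intro a b c ha hb' hc hc1
      calc |a - c * b| ≤ |a| + |c * b| := abs_sub _ _
        _ ≤ 4 + 1 * 4 := by rw [abs_mul, abs_of_nonneg hc]; gcongr
        _ = 8 := by norm_num
    have hc : |greenUp p F 0 + greenDown p F 0| ≤ 2 * (N / p) :=
      (abs_add_le _ _).trans (by linarith)
    have hs : |greenUp p F z + greenDown p F z| ≤ 2 * (N / p) :=
      (abs_add_le _ _).trans (by linarith)
    have hd : |greenUp p F z - greenDown p F z| ≤ 2 * (N / p) :=
      (abs_sub _ _).trans (by linarith)
    interval_cases j
    · have h3 : |modeFn q 0 (k + 1) F g z| ≤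
          2 * (N / p) / (2 * p) + 2 * (N / p) / (2 * p) * 4 + |g| / m ^ 2 * 8 := by
        simp only [modeFn, ← hp, ← hm]
        refine (abs_add_le _ _).trans (add_le_add ((abs_add_le _ _).trans (add_le_add ?_ ?_)) ?_)
        · rw [abs_div, abs_neg, abs_of_pos (show 0 < 2 * p by positivity)]; gcongr
        · rw [abs_mul, abs_div, abs_of_pos (show 0 < 2 * p by positivity)]
          gcongr; exact abs_expCut_le _
        · rw [abs_mul, abs_div, abs_of_pos (show 0 < m ^ 2 by positivity)]
          gcongr
          exact hlin _ _ _ (abs_expCut_le _) (abs_expCut_le _) he0.le he1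
      calc m ^ (2 - 0) * |modeFn q 0 (k + 1) F g z| ≤ m ^ 2 *
          (2 * (N / p) / (2 * p) + 2 * (N / p) / (2 * p) * 4 + |g| / m ^ 2 * 8) := by gcongr
        _ = 5 * N * (m / p) ^ 2 + 8 * |g| := by field_simp; ring
        _ ≤ 5 * N * (2 / q) ^ 2 + 8 * |g| := by gcongr
        _ = (20 / q ^ 2) * N + 8 * |g| := by ring
        _ ≤ modeBound q * (N + |g|) := by
          have : 20 / q ^ 2 ≤ modeBound q := by
            have : 0 ≤ 10 / q + 10 + 8 * q + 8 * q ^ 2 := by positivity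
            unfold modeBound; linarith
          nlinarith
    · have h3 : |modeFn q 1 (k + 1) F g z| ≤
          2 * (N / p) / 2 + 2 * (N / p) / 2 * 4 + |g| / m ^ 2 * (p * 8) := by
        simp only [modeFn, ← hp, ← hm]
        refine (abs_add_le _ _).trans (add_le_add ((abs_sub _ _).trans (add_le_add ?_ ?_)) ?_)
        · rw [abs_div, abs_two]; gcongr
        · rw [abs_mul, abs_div, abs_two]
          gcongr; exact abs_expCut1_le _
        · rw [abs_mul, abs_div, abs_of_pos (show 0 < m ^ 2 by positivity), abs_mul,
            abs_of_pos hp0]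
          gcongr
          have := hlin (expCut1 (p * (z - 1))) (-expCut1 (-(p * z))) (Real.exp (-p))
            (abs_expCut1_le _) (by rw [abs_neg]; exact abs_expCut1_le _) he0.le he1
          simpa using this
      calc m ^ (2 - 1) * |modeFn q 1 (k + 1) F g z| ≤ m ^ 1 *
          (2 * (N / p) / 2 + 2 * (N / p) / 2 * 4 + |g| / m ^ 2 * (p * 8)) := by gcongr
        _ = 5 * N * (m / p) + 8 * |g| * (p / m) := by field_simp; ring
        _ ≤ 5 * N * (2 / q) + 8 * |g| * q := by gcongr
        _ = (10 / q) * N + (8 * q) * |g| := by ring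
        _ ≤ modeBound q * N + modeBound q * |g| := by
          have e1 : 10 / q ≤ modeBound q := by
            have : 0 ≤ 20 / q ^ 2 + 10 + 8 * q + 8 * q ^ 2 := by positivity
            unfold modeBound; linarith
          have e2 : 8 * q ≤ modeBound q := by
            have : 0 ≤ 20 / q ^ 2 + 10 / q + 10 + 8 * q ^ 2 := by positivity
            unfold modeBound; linarith
          gcongr
        _ = _ := by ring
    · have h3 : |modeFn q 2 (k + 1) F g z| ≤
          N + p * (2 * (N / p)) / 2 + p * (2 * (N / p)) / 2 * 4 + |g| / m ^ 2 * (p ^ 2 * 8) := by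
        simp only [modeFn, ← hp, ← hm]
        refine (abs_add_le _ _).trans (add_le_add ((abs_add_le _ _).trans (add_le_add
          ((abs_sub _ _).trans (add_le_add (hN z) ?_)) ?_)) ?_)
        · rw [abs_div, abs_two, abs_mul, abs_of_pos hp0]; gcongr
        · rw [abs_mul, abs_div, abs_two, abs_mul, abs_of_pos hp0]
          gcongr; exact abs_expCut2_le _
        · rw [abs_mul, abs_div, abs_of_pos (show 0 < m ^ 2 by positivity), abs_mul,
            abs_of_pos (show 0 < p ^ 2 by positivity)]
          gcongr
          exact hlin _ _ _ (abs_expCut2_le _) (abs_expCut2_le _) he0.le he1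
      calc m ^ (2 - 2) * |modeFn q 2 (k + 1) F g z| ≤ m ^ 0 *
          (N + p * (2 * (N / p)) / 2 + p * (2 * (N / p)) / 2 * 4 + |g| / m ^ 2 * (p ^ 2 * 8)) := by
            gcongr
        _ = 6 * N + 8 * |g| * (p / m) ^ 2 := by field_simp; ring
        _ ≤ 6 * N + 8 * |g| * q ^ 2 := by gcongr
        _ = 6 * N + (8 * q ^ 2) * |g| := by ring
        _ ≤ modeBound q * N + modeBound q * |g| := by
          have e1 : 6 ≤ modeBound q := by linarith
          have e2 : 8 * q ^ 2 ≤ modeBound q := by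
            have : 0 ≤ 20 / q ^ 2 + 10 / q + 10 + 8 * q := by positivity
            unfold modeBound; linarith
          gcongr
        _ = _ := by ring

/-! ### Trigonometric series with coefficients in spaces of bounded continuous functions -/

/-- Bounded families of coefficients that depend continuously on a parameter in `Z`. -/
def Coef (Z : Type) [TopologicalSpace Z] := BoundedContinuousFunction (ℕ × Z) ℝ

section Series

variable {Z : Type} [TopologicalSpace Z]

noncomputable instance : NormedAddCommGroup (Coef Z) :=
  inferInstanceAs (NormedAddCommGroup (BoundedContinuousFunction (ℕ × Z) ℝ))

noncomputable instance : NormedSpace ℝ (Coef Z) :=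
  inferInstanceAs (NormedSpace ℝ (BoundedContinuousFunction (ℕ × Z) ℝ))

instance : CompleteSpace (Coef Z) :=
  inferInstanceAs (CompleteSpace (BoundedContinuousFunction (ℕ × Z) ℝ))

/-- The values of the coefficients. -/
def Coef.eval (u : Coef Z) : ℕ × Z → ℝ :=
  DFunLike.coe (F := BoundedContinuousFunction (ℕ × Z) ℝ) u

instance : CoeFun (Coef Z) (fun _ => ℕ × Z → ℝ) := ⟨Coef.eval⟩

namespace Coef

/-- A bounded continuous family of coefficients. -/
noncomputable def mk (f : ℕ × Z → ℝ) (hf : Continuous f) (C : ℝ) (h : ∀ p, |f p| ≤ C) : Coef Z :=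
  BoundedContinuousFunction.ofNormedAddCommGroup f hf C h

@[simp] theorem mk_apply (f : ℕ × Z → ℝ) (hf : Continuous f) (C : ℝ) (h : ∀ p, |f p| ≤ C)
    (p : ℕ × Z) : mk f hf C h p = f p := rfl

@[ext] theorem ext {u v : Coef Z} (h : ∀ n z, u (n, z) = v (n, z)) : u = v :=
  BoundedContinuousFunction.ext (fun p => h p.1 p.2)

@[simp] theorem add_apply (u v : Coef Z) (p : ℕ × Z) : (u + v) p = u p + v p := rfl

@[simp] theorem sub_apply (u v : Coef Z) (p : ℕ × Z) : (u - v) p = u p - v p := rfl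

@[simp] theorem smul_apply (r : ℝ) (u : Coef Z) (p : ℕ × Z) : (r • u) p = r * u p := rfl

@[simp] theorem zero_apply (p : ℕ × Z) : (0 : Coef Z) p = 0 := rfl

theorem abs_apply_le (u : Coef Z) (p : ℕ × Z) : |u p| ≤ ‖u‖ :=
  BoundedContinuousFunction.norm_coe_le_norm (α := ℕ × Z) u p

theorem norm_le {u : Coef Z} {C : ℝ} (hC : 0 ≤ C) (h : ∀ p, |u p| ≤ C) : ‖u‖ ≤ C :=
  (BoundedContinuousFunction.norm_le (α := ℕ × Z) hC).2 h

theorem continuous (u : Coef Z) : Continuous (fun p => u p) :=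
  BoundedContinuousFunction.continuous (α := ℕ × Z) u

theorem continuous_mode (u : Coef Z) (n : ℕ) : Continuous (fun z => u (n, z)) :=
  u.continuous.comp (by fun_prop)

end Coef

/-- Reindexing of coefficients followed by multiplication. -/
noncomputable def coefOp (m : ℕ → ℕ) (c : Coef Z) : Coef Z →L[ℝ] Coef Z :=
  LinearMap.mkContinuous
    { toFun := fun u => Coef.mk (fun p => c p * u (m p.1, p.2))
        (c.continuous.mul (u.continuous.comp
          (((continuous_of_discreteTopology (f := m)).comp continuous_fst).prodMk continuous_snd)))
        (‖c‖ * ‖u‖) (fun p => by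
          rw [abs_mul]
          exact mul_le_mul (c.abs_apply_le p) (u.abs_apply_le _) (abs_nonneg _) (norm_nonneg _))
      map_add' := fun u v => by ext n z; simp [mul_add]
      map_smul' := fun r u => by ext n z; simp [mul_left_comm] }
    ‖c‖ (fun u => Coef.norm_le (by positivity) fun p => by
      simp only [LinearMap.coe_mk, AddHom.coe_mk, Coef.mk_apply]
      rw [abs_mul]
      exact mul_le_mul (c.abs_apply_le p) (u.abs_apply_le _) (abs_nonneg _) (norm_nonneg _))

@[simp] theorem coefOp_apply (m : ℕ → ℕ) (c u : Coef Z) (n : ℕ) (z : Z) :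
    coefOp m c u (n, z) = c (n, z) * u (m n, z) := rfl

theorem norm_coefOp_le (m : ℕ → ℕ) (c : Coef Z) : ‖coefOp m c‖ ≤ ‖c‖ :=
  LinearMap.mkContinuous_norm_le _ (norm_nonneg c) _

/-- Coefficients that do not depend on the parameter. -/
noncomputable def constCoef (c : ℕ → ℝ) (C : ℝ) (hc : ∀ n, |c n| ≤ C) : Coef Z :=
  Coef.mk (fun p : ℕ × Z => c p.1)
    ((continuous_of_discreteTopology (f := c)).comp continuous_fst) C (fun p => hc p.1)

@[simp] theorem constCoef_apply (c : ℕ → ℝ) (C : ℝ) (hc : ∀ n, |c n| ≤ C) (n : ℕ) (z : Z) :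
    constCoef c C hc (n, z) = c n := rfl

theorem norm_constCoef_le (c : ℕ → ℝ) (C : ℝ) (hc : ∀ n, |c n| ≤ C) (hC : 0 ≤ C) :
    ‖(constCoef c C hc : Coef Z)‖ ≤ C :=
  Coef.norm_le hC fun p => hc p.1

theorem shift_weight_le (s : ℕ) (n j : ℤ) :
    (1 + |(n : ℝ)|) ^ s / (1 + |((n + j : ℤ) : ℝ)|) ^ s ≤ (1 + |(j : ℝ)|) ^ s := by
  rw [div_le_iff₀ (by positivity), ← mul_pow]
  gcongr
  have h : |(n : ℝ)| ≤ |((n + j : ℤ) : ℝ)| + |(j : ℝ)| := by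
    have := abs_sub ((n + j : ℤ) : ℝ) (j : ℝ)
    simpa using this
  nlinarith [mul_nonneg (abs_nonneg (j : ℝ)) (abs_nonneg ((n + j : ℤ) : ℝ))]

/-- The weighted shift of a series of cosines (`e = 0`) or sines (`e = 1`). -/
noncomputable def shiftCoef (s e : ℕ) (j : ℤ) : Coef Z →L[ℝ] Coef Z :=
  coefOp (fun n => ((n : ℤ) + j).natAbs)
    (constCoef (fun n => (((n : ℤ) + j).sign : ℝ) ^ e
      * ((1 + |((n : ℤ) : ℝ)|) ^ s / (1 + |(((n : ℤ) + j : ℤ) : ℝ)|) ^ s)) ((1 + |(j : ℝ)|) ^ s)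
      (fun n => by
        rw [abs_mul, abs_pow]
        have h1 : |(((n : ℤ) + j).sign : ℝ)| ≤ 1 := by
          rcases Int.sign_trichotomy ((n : ℤ) + j) with h | h | h <;> simp [h]
        have h2 := shift_weight_le s n j
        rw [abs_of_nonneg (by positivity : (0 : ℝ) ≤
          (1 + |((n : ℤ) : ℝ)|) ^ s / (1 + |(((n : ℤ) + j : ℤ) : ℝ)|) ^ s)]
        calc _ ≤ 1 ^ e * (1 + |(j : ℝ)|) ^ s := by gcongr
          _ ≤ _ := by rw [one_pow, one_mul]))

theorem norm_shiftCoef_le (s e : ℕ) (j : ℤ) :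
    ‖(shiftCoef s e j : Coef Z →L[ℝ] Coef Z)‖ ≤ (1 + |(j : ℝ)|) ^ s :=
  (norm_coefOp_le _ _).trans (norm_constCoef_le _ _ _ (by positivity))

/-- Multiplication of a cosine series by `cos (jτx)` (`e = 0`), or of a sine series by
`sin (jτx)` (`e = 1`), on the level of coefficients. -/
noncomputable def trigMul (s e : ℕ) (j : ℤ) : Coef Z →L[ℝ] Coef Z :=
  (1 / 2 : ℝ) • (shiftCoef s e j + (-1 : ℝ) ^ e • shiftCoef s e (-j))

theorem norm_trigMul_le (s e : ℕ) (j : ℤ) :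
    ‖(trigMul s e j : Coef Z →L[ℝ] Coef Z)‖ ≤ (1 + |(j : ℝ)|) ^ s := by
  have h1 := norm_shiftCoef_le (Z := Z) s e j
  have h2 := norm_shiftCoef_le (Z := Z) s e (-j)
  have h3 : ‖(-1 : ℝ) ^ e • (shiftCoef s e (-j) : Coef Z →L[ℝ] Coef Z)‖ ≤ (1 + |(j : ℝ)|) ^ s := by
    rw [norm_smul, norm_pow]
    simpa using h2
  unfold trigMul
  rw [norm_smul]
  calc _ ≤ ‖(1 / 2 : ℝ)‖ * ((1 + |(j : ℝ)|) ^ s + (1 + |(j : ℝ)|) ^ s) := by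
        gcongr; exact (norm_add_le _ _).trans (add_le_add h1 h3)
    _ = _ := by norm_num; ring

/-- `cos` for `e = 0`, and `sin` for `e = 1`, of an integral multiple. -/
noncomputable def trigFn (e : ℕ) (j : ℤ) (y : ℝ) : ℝ :=
  if e = 0 then Real.cos (j * y) else Real.sin (j * y)

theorem abs_trigFn_le (e : ℕ) (j : ℤ) (y : ℝ) : |trigFn e j y| ≤ 1 := by
  unfold trigFn; split_ifs
  · exact Real.abs_cos_le_one _
  · exact Real.abs_sin_le_one _

/-- The sum of a cosine series (`e = 0`) or a sine series (`e = 1`) with weighted coefficients. -/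
noncomputable def trigSum (s e : ℕ) (u : Coef Z) (y : ℝ) (z : Z) : ℝ :=
  ∑' k : ℤ, (k.sign : ℝ) ^ e * trigFn e k y / (1 + |(k : ℝ)|) ^ s * u (k.natAbs, z)

theorem summable_weight {s : ℕ} (hs : 2 ≤ s) :
    Summable fun k : ℤ => 1 / (1 + |(k : ℝ)|) ^ s := by
  have h : Summable fun k : ℤ => 2 * |1 / (k : ℝ) ^ 2| + (if k = 0 then 1 else 0) :=
    ((Real.summable_one_div_int_pow.2 (by norm_num : 1 < 2)).abs.mul_left 2).add
      (summable_of_hasFiniteSupport ((Set.finite_singleton (0 : ℤ)).subset (by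
        intro k; simp)))
  refine Summable.of_nonneg_of_le (fun k => by positivity) (fun k => ?_) h
  by_cases hk : k = 0
  · simp [hk]
  · have hk0 : (0 : ℝ) < |(k : ℝ)| := by positivity
    have h1 : 1 / (1 + |(k : ℝ)|) ^ s ≤ 1 / (1 + |(k : ℝ)|) ^ 2 := by
      apply one_div_le_one_div_of_le (by positivity)
      exact pow_le_pow_right₀ (by linarith) hs
    have h2 : 1 / (1 + |(k : ℝ)|) ^ 2 ≤ 1 / |(k : ℝ)| ^ 2 := by
      apply one_div_le_one_div_of_le (by positivity)
      gcongr; linarith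
    rw [if_neg hk, abs_div, abs_one, abs_pow]
    have h3 : 0 ≤ 1 / |(k : ℝ)| ^ 2 := by positivity
    linarith

theorem abs_sign_pow_le (e : ℕ) (k : ℤ) : |(k.sign : ℝ) ^ e| ≤ 1 := by
  rw [abs_pow]
  apply pow_le_one₀ (abs_nonneg _)
  rcases Int.sign_trichotomy k with h | h | h <;> simp [h]

theorem abs_trigSum_term_le (s e : ℕ) (u : Coef Z) (y : ℝ) (z : Z) (k : ℤ) :
    |(k.sign : ℝ) ^ e * trigFn e k y / (1 + |(k : ℝ)|) ^ s * u (k.natAbs, z)|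
      ≤ 1 / (1 + |(k : ℝ)|) ^ s * ‖u‖ := by
  rw [abs_mul, abs_div, abs_mul, abs_of_pos (show 0 < (1 + |(k : ℝ)|) ^ s by positivity)]
  have h1 := abs_sign_pow_le e k
  have h2 := abs_trigFn_le e k y
  have h3 : |u (k.natAbs, z)| ≤ ‖u‖ := u.abs_apply_le _
  have h4 : |(k.sign : ℝ) ^ e| * |trigFn e k y| ≤ 1 := mul_le_one₀ h1 (abs_nonneg _) h2
  gcongr

theorem summable_trigSum {s : ℕ} (hs : 2 ≤ s) (e : ℕ) (u : Coef Z) (y : ℝ) (z : Z) :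
    Summable fun k : ℤ =>
      (k.sign : ℝ) ^ e * trigFn e k y / (1 + |(k : ℝ)|) ^ s * u (k.natAbs, z) :=
  Summable.of_norm_bounded ((summable_weight hs).mul_right ‖u‖)
    (fun k => abs_trigSum_term_le s e u y z k)

/-- The sum of the series as a continuous linear functional. -/
noncomputable def trigSumCLM {s : ℕ} (hs : 2 ≤ s) (e : ℕ) (y : ℝ) (z : Z) : Coef Z →L[ℝ] ℝ :=
  LinearMap.mkContinuous
    { toFun := fun u => trigSum s e u y z
      map_add' := fun u v => by
        unfold trigSum
        rw [← (summable_trigSum hs e u y z).tsum_add (summable_trigSum hs e v y z)]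
        simp [mul_add]
      map_smul' := fun r u => by
        simp only [trigSum, Coef.smul_apply, smul_eq_mul, RingHom.id_apply]
        rw [← tsum_mul_left]
        simp only [mul_left_comm r] }
    (∑' k : ℤ, 1 / (1 + |(k : ℝ)|) ^ s) (fun u => by
      rw [← tsum_mul_right]
      exact tsum_of_norm_bounded ((summable_weight hs).mul_right ‖u‖).hasSum
        (fun k => abs_trigSum_term_le s e u y z k))

@[simp] theorem trigSumCLM_apply {s : ℕ} (hs : 2 ≤ s) (e : ℕ) (y : ℝ) (z : Z) (u : Coef Z) :
    trigSumCLM hs e y z u = trigSum s e u y z := rfl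

theorem abs_trigSum_le {s : ℕ} (hs : 2 ≤ s) (e : ℕ) (u : Coef Z) (y : ℝ) (z : Z) :
    |trigSum s e u y z| ≤ (∑' k : ℤ, 1 / (1 + |(k : ℝ)|) ^ s) * ‖u‖ := by
  rw [← tsum_mul_right, ← Real.norm_eq_abs]
  exact tsum_of_norm_bounded ((summable_weight hs).mul_right ‖u‖).hasSum
    (fun k => abs_trigSum_term_le s e u y z k)

theorem trigSum_trigMul {s : ℕ} (hs : 2 ≤ s) {e : ℕ} (he : e ≤ 1) (j : ℤ) (u : Coef Z) (y : ℝ)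
    (z : Z) : trigSum s 0 (trigMul s e j u) y z = trigFn e j y * trigSum s e u y z := by
  set a : ℤ → ℝ := fun m => (m.sign : ℝ) ^ e / (1 + |(m : ℝ)|) ^ s * u (m.natAbs, z) with ha
  have hodd : ∀ m, a (-m) = (-1) ^ e * a m := by
    intro m
    simp only [ha, Int.sign_neg, Int.natAbs_neg, Int.cast_neg, abs_neg]
    rw [neg_pow]; ring
  have hb : ∀ m, |a m| ≤ 1 / (1 + |(m : ℝ)|) ^ s * ‖u‖ := fun m => by
    simp only [ha]
    rw [abs_mul, abs_div, abs_of_pos (show 0 < (1 + |(m : ℝ)|) ^ s by positivity)]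
    have h3 : |u (m.natAbs, z)| ≤ ‖u‖ := u.abs_apply_le _
    gcongr; exact abs_sign_pow_le e m
  have hsum : ∀ θ : ℤ → ℝ, (∀ m, |θ m| ≤ 1) → Summable fun m => a m * θ m := fun θ hθ =>
    Summable.of_norm_bounded ((summable_weight hs).mul_right ‖u‖) (fun m => by
      rw [Real.norm_eq_abs, abs_mul]
      calc _ ≤ |a m| * 1 := by gcongr; exact hθ m
        _ ≤ _ := by rw [mul_one]; exact hb m)
  have hcoef : ∀ n : ℤ, (trigMul s e j u) (n.natAbs, z) / (1 + |(n : ℝ)|) ^ s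
      = 1 / 2 * (a (n + j) + (-1) ^ e * a (n - j)) := by
    have key : ∀ (n : ℕ), (trigMul s e j u) (n, z) / (1 + |((n : ℤ) : ℝ)|) ^ s
      = 1 / 2 * (a (n + j) + (-1) ^ e * a (n - j)) := by
      intro n
      have hw : (1 + |((n : ℤ) : ℝ)|) ^ s ≠ 0 := by positivity
      simp only [trigMul, shiftCoef, _root_.smul_apply, _root_.add_apply,
        Coef.smul_apply, Coef.add_apply,
        coefOp_apply, constCoef_apply, ha, ← sub_eq_add_neg]
      field_simp
    intro n
    rcases Int.natAbs_eq n with h | h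
    · have := key n.natAbs
      rw [← h] at this
      exact this
    · have := key n.natAbs
      have h' : ((n.natAbs : ℕ) : ℤ) = -n := by omega
      rw [h', Int.cast_neg, abs_neg] at this
      rw [this, show -n + j = -(n - j) by ring, show -n - j = -(n + j) by ring, hodd, hodd]
      have : ((-1 : ℝ) ^ e) * (-1) ^ e = 1 := by rw [← mul_pow]; simp
      linear_combination (1 / 2 * a (n + j)) * this
  have hcos : ∀ m : ℤ, |Real.cos (m * y)| ≤ 1 := fun m => Real.abs_cos_le_one _
  have e1 : trigSum s 0 (trigMul s e j u) y z =
      ∑' n : ℤ, (1 / 2 * (a (n + j) * Real.cos (n * y))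
        + (-1) ^ e * (1 / 2 * (a (n - j) * Real.cos (n * y)))) := by
    unfold trigSum
    refine tsum_congr fun n => ?_
    have := hcoef n
    simp only [pow_zero, one_mul, trigFn, if_pos]
    linear_combination Real.cos (n * y) * this
  have s1 : Summable fun m : ℤ => a m * Real.cos ((m - j : ℤ) * y) := hsum _ fun m => hcos _
  have s2 : Summable fun m : ℤ => a m * Real.cos ((m + j : ℤ) * y) := hsum _ fun m => hcos _
  have t1 : ∑' n : ℤ, a (n + j) * Real.cos (n * y) = ∑' m : ℤ, a m * Real.cos ((m - j : ℤ) * y) := by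
    rw [← (Equiv.addRight j).tsum_eq (fun m : ℤ => a m * Real.cos ((m - j : ℤ) * y))]
    simp
  have t2 : ∑' n : ℤ, a (n - j) * Real.cos (n * y) = ∑' m : ℤ, a m * Real.cos ((m + j : ℤ) * y) := by
    rw [← (Equiv.subRight j).tsum_eq (fun m : ℤ => a m * Real.cos ((m + j : ℤ) * y))]
    simp
  have s1' : Summable fun n : ℤ => a (n + j) * Real.cos (n * y) := by
    have := (Equiv.addRight j).summable_iff.2 s1
    simpa [Function.comp_def] using this
  have s2' : Summable fun n : ℤ => a (n - j) * Real.cos (n * y) := by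
    have := (Equiv.subRight j).summable_iff.2 s2
    simpa [Function.comp_def] using this
  rw [e1, Summable.tsum_add (s1'.mul_left _) ((s2'.mul_left _).mul_left _), tsum_mul_left,
    tsum_mul_left, tsum_mul_left, t1, t2]
  have e2 : trigSum s e u y z = ∑' m : ℤ, a m * trigFn e m y := by
    unfold trigSum
    refine tsum_congr fun m => ?_
    simp only [ha]; ring
  rw [e2, ← tsum_mul_left, ← tsum_mul_left, ← tsum_mul_left, ← tsum_mul_left,
    ← Summable.tsum_add (s1.mul_left _) ((s2.mul_left _).mul_left _)]
  refine tsum_congr fun m => ?_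
  have c1 : Real.cos ((m - j : ℤ) * y) =
    Real.cos (m * y) * Real.cos (j * y) + Real.sin (m * y) * Real.sin (j * y) := by
    push_cast; rw [sub_mul, Real.cos_sub]
  have c2 : Real.cos ((m + j : ℤ) * y) =
    Real.cos (m * y) * Real.cos (j * y) - Real.sin (m * y) * Real.sin (j * y) := by
    push_cast; rw [add_mul, Real.cos_add]
  rw [c1, c2]
  interval_cases e <;> simp [trigFn] <;> ring

/-- `a` is a family of Fourier coefficients of weighted norm at most `ε`. -/
def FourierBound (s : ℕ) (ε : ℝ) (a : ℤ → ℝ) : Prop :=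
  Summable (fun j => |a j| * (1 + |(j : ℝ)|) ^ s) ∧ ∑' j, |a j| * (1 + |(j : ℝ)|) ^ s ≤ ε

theorem FourierBound.mono {s s' : ℕ} (h : s ≤ s') {ε : ℝ} {a : ℤ → ℝ} (ha : FourierBound s' ε a) :
    FourierBound s ε a := by
  have hle : ∀ j : ℤ, |a j| * (1 + |(j : ℝ)|) ^ s ≤ |a j| * (1 + |(j : ℝ)|) ^ s' := fun j => by
    gcongr
    linarith [abs_nonneg (j : ℝ)]
  have hsum := Summable.of_nonneg_of_le (fun j => by positivity) hle ha.1
  exact ⟨hsum, (hsum.tsum_le_tsum hle ha.1).trans ha.2⟩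

/-- Multiplication by a trigonometric series. -/
noncomputable def seriesMul (s e : ℕ) (a : ℤ → ℝ) : Coef Z →L[ℝ] Coef Z :=
  ∑' j, a j • trigMul s e j

theorem FourierBound.norm_term_le (s e : ℕ) (a : ℤ → ℝ) (j : ℤ) :
    ‖a j • (trigMul s e j : Coef Z →L[ℝ] Coef Z)‖ ≤ |a j| * (1 + |(j : ℝ)|) ^ s := by
  rw [norm_smul, Real.norm_eq_abs]
  gcongr
  exact norm_trigMul_le s e j

theorem FourierBound.norm_seriesMul_le {s : ℕ} (e : ℕ) {ε : ℝ} {a : ℤ → ℝ}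
    (ha : FourierBound s ε a) : ‖(seriesMul s e a : Coef Z →L[ℝ] Coef Z)‖ ≤ ε :=
  (tsum_of_norm_bounded ha.1.hasSum (FourierBound.norm_term_le s e a)).trans ha.2

theorem FourierBound.trigSum_seriesMul {s : ℕ} (hs : 2 ≤ s) {e : ℕ} (he : e ≤ 1) {ε : ℝ} {a : ℤ → ℝ}
    (ha : FourierBound s ε a) (u : Coef Z) (y : ℝ) (z : Z) :
    trigSum s 0 (seriesMul s e a u) y z = (∑' j, a j * trigFn e j y) * trigSum s e u y z := by
  have hsum : Summable fun j => a j • (trigMul s e j : Coef Z →L[ℝ] Coef Z) :=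
    Summable.of_norm_bounded ha.1 (FourierBound.norm_term_le s e a)
  have h := (((trigSumCLM hs 0 y z).comp
    (ContinuousLinearMap.apply ℝ (Coef Z) u)).hasSum hsum.hasSum).tsum_eq
  simp only [ContinuousLinearMap.comp_apply, ContinuousLinearMap.apply_apply,
    map_smul, trigSumCLM_apply, smul_eq_mul,
    trigSum_trigMul hs he] at h
  unfold seriesMul
  rw [← h, ← tsum_mul_right]
  refine tsum_congr fun j => ?_
  ring

end Series

/-! ### Functions of two variables with continuous partial derivatives -/

theorem contDiffAt_one_of_partials {f fx fy : ℝ → ℝ → ℝ} {U : Set (ℝ × ℝ)} (hU : IsOpen U)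
    (hx : ∀ p ∈ U, HasDerivAt (fun s => f s p.2) (fx p.1 p.2) p.1)
    (hy : ∀ p ∈ U, HasDerivAt (fun s => f p.1 s) (fy p.1 p.2) p.2)
    (cx : ContinuousOn (fun p : ℝ × ℝ => fx p.1 p.2) U)
    (cy : ContinuousOn (fun p : ℝ × ℝ => fy p.1 p.2) U) {p : ℝ × ℝ} (hp : p ∈ U) :
    HasFDerivAt (fun p : ℝ × ℝ => f p.1 p.2)
      (fx p.1 p.2 • ContinuousLinearMap.fst ℝ ℝ ℝ + fy p.1 p.2 • ContinuousLinearMap.snd ℝ ℝ ℝ) p ∧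
    ContDiffAt ℝ 1 (fun p : ℝ × ℝ => f p.1 p.2) p := by
  have key : ∀ p ∈ U, HasFDerivAt (fun p : ℝ × ℝ => f p.1 p.2)
      (fx p.1 p.2 • ContinuousLinearMap.fst ℝ ℝ ℝ + fy p.1 p.2 • ContinuousLinearMap.snd ℝ ℝ ℝ)
      p := by
    intro p hp
    have hn := hU.mem_nhds hp
    have h := hasStrictFDerivAt_uncurry_coprod (𝕜 := ℝ) (u := p) (f := f)
      (f₁ := fun x y => ContinuousLinearMap.toSpanSingleton ℝ (fx x y))
      (f₂ := fun x y => ContinuousLinearMap.toSpanSingleton ℝ (fy x y))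
      (by filter_upwards [hn] with v hv using (hx v hv).hasFDerivAt)
      (by filter_upwards [hn] with v hv using (hy v hv).hasFDerivAt)
      ((ContinuousLinearMap.toSpanSingletonCLE (𝕜 := ℝ) (E := ℝ)).continuous.continuousAt.comp
        (cx.continuousAt hn))
      ((ContinuousLinearMap.toSpanSingletonCLE (𝕜 := ℝ) (E := ℝ)).continuous.continuousAt.comp
        (cy.continuousAt hn))
    refine h.hasFDerivAt.congr_fderiv ?_
    ext <;> simp [Function.HasUncurry.uncurry]
  refine ⟨key p hp, ?_⟩
  rw [show (1 : WithTop ℕ∞) = ((0 : ℕ) : WithTop ℕ∞) + 1 by norm_num, contDiffAt_succ_iff_hasFDerivAt]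
  refine ⟨_, ⟨U, hU.mem_nhds hp, key⟩, contDiffAt_zero.2 ⟨U, hU.mem_nhds hp, ?_⟩⟩
  exact (cx.smul continuousOn_const).add (cy.smul continuousOn_const)

theorem contDiffAt_two_of_partials {f fx fy fxx fxy fyx fyy : ℝ → ℝ → ℝ} {U : Set (ℝ × ℝ)}
    (hU : IsOpen U)
    (hx : ∀ p ∈ U, HasDerivAt (fun s => f s p.2) (fx p.1 p.2) p.1)
    (hy : ∀ p ∈ U, HasDerivAt (fun s => f p.1 s) (fy p.1 p.2) p.2)
    (hxx : ∀ p ∈ U, HasDerivAt (fun s => fx s p.2) (fxx p.1 p.2) p.1)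
    (hxy : ∀ p ∈ U, HasDerivAt (fun s => fx p.1 s) (fxy p.1 p.2) p.2)
    (hyx : ∀ p ∈ U, HasDerivAt (fun s => fy s p.2) (fyx p.1 p.2) p.1)
    (hyy : ∀ p ∈ U, HasDerivAt (fun s => fy p.1 s) (fyy p.1 p.2) p.2)
    (cxx : ContinuousOn (fun p : ℝ × ℝ => fxx p.1 p.2) U)
    (cxy : ContinuousOn (fun p : ℝ × ℝ => fxy p.1 p.2) U)
    (cyx : ContinuousOn (fun p : ℝ × ℝ => fyx p.1 p.2) U)
    (cyy : ContinuousOn (fun p : ℝ × ℝ => fyy p.1 p.2) U) {p : ℝ × ℝ} (hp : p ∈ U) :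
    ContDiffAt ℝ 2 (fun p : ℝ × ℝ => f p.1 p.2) p := by
  have c1 : ∀ p ∈ U, ContDiffAt ℝ 1 (fun p : ℝ × ℝ => fx p.1 p.2) p := fun p hp =>
    (contDiffAt_one_of_partials hU hxx hxy cxx cxy hp).2
  have c2 : ∀ p ∈ U, ContDiffAt ℝ 1 (fun p : ℝ × ℝ => fy p.1 p.2) p := fun p hp =>
    (contDiffAt_one_of_partials hU hyx hyy cyx cyy hp).2
  rw [show (2 : WithTop ℕ∞) = ((1 : ℕ) : WithTop ℕ∞) + 1 by norm_num, contDiffAt_succ_iff_hasFDerivAt]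
  refine ⟨_, ⟨U, hU.mem_nhds hp, fun p hp => (contDiffAt_one_of_partials hU hx hy
    (fun p hp => (c1 p hp).continuousAt.continuousWithinAt)
    (fun p hp => (c2 p hp).continuousAt.continuousWithinAt) hp).1⟩, ?_⟩
  exact ((c1 p hp).smul contDiffAt_const).add ((c2 p hp).smul contDiffAt_const)

/-! ### Calculus of trigonometric series -/

theorem continuous_trigSum {Z : Type} [TopologicalSpace Z] {s : ℕ} (hs : 2 ≤ s) (e : ℕ)
    (u : Coef Z) : Continuous (fun p : ℝ × Z => trigSum s e u p.1 p.2) := by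
  unfold trigSum
  refine continuous_tsum (fun k => ?_) ((summable_weight hs).mul_right ‖u‖)
    (fun k p => abs_trigSum_term_le s e u p.1 p.2 k)
  have h1 : Continuous fun p : ℝ × Z => trigFn e k p.1 := by
    unfold trigFn; split_ifs <;> fun_prop
  exact ((continuous_const.mul h1).div_const _).mul ((u.continuous_mode _).comp continuous_snd)

theorem hasDerivAt_trigSum_snd {s : ℕ} (hs : 2 ≤ s) (e : ℕ) {u v : Coef ℝ} {a b : ℝ}
    (h : ∀ n, ∀ z ∈ Set.Ioo a b, HasDerivAt (fun z => u (n, z)) (v (n, z)) z) (y : ℝ) {z : ℝ}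
    (hz : z ∈ Set.Ioo a b) :
    HasDerivAt (fun z => trigSum s e u y z) (trigSum s e v y z) z := by
  unfold trigSum
  refine hasDerivAt_tsum_of_isPreconnected ((summable_weight hs).mul_right ‖v‖) isOpen_Ioo
    isPreconnected_Ioo (fun k z hz => (h k.natAbs z hz).const_mul _)
    (fun k z _ => abs_trigSum_term_le s e v y z k) hz (summable_trigSum hs e u y z) hz

theorem sign_mul_natAbs (k : ℤ) : (k.sign : ℝ) * (k.natAbs : ℝ) = k := by
  rw [show (k.natAbs : ℝ) = ((k.natAbs : ℤ) : ℝ) from (Int.cast_natCast _).symm, ← Int.cast_mul,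
    Int.sign_mul_natAbs]

theorem hasDerivAt_trigSum_cos {Z : Type} [TopologicalSpace Z] {s : ℕ} (hs : 2 ≤ s) {u v : Coef Z}
    (h : ∀ n z, v (n, z) = n * u (n, z)) (y : ℝ) (z : Z) :
    HasDerivAt (fun y => trigSum s 0 u y z) (-trigSum s 1 v y z) y := by
  unfold trigSum
  rw [← tsum_neg]
  refine hasDerivAt_tsum (g' := fun (k : ℤ) y =>
    -((k.sign : ℝ) ^ 1 * trigFn 1 k y / (1 + |(k : ℝ)|) ^ s * v (k.natAbs, z)))
    ((summable_weight hs).mul_right ‖v‖) (fun k y => ?_)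
    (fun k y => (norm_neg _).trans_le (abs_trigSum_term_le s 1 v y z k))
    (summable_trigSum hs 0 u y z) y
  have h1 : HasDerivAt (fun y : ℝ => Real.cos (k * y)) (-Real.sin (k * y) * k) y := by
    exact (((hasDerivAt_id' y).const_mul (k : ℝ)).cos).congr_deriv (by ring)
  have h2 := (((h1.const_mul ((k.sign : ℝ) ^ 0)).div_const
    ((1 + |(k : ℝ)|) ^ s)).mul_const (u (k.natAbs, z)))
  refine h2.congr_deriv ?_
  rw [h]
  have := sign_mul_natAbs k
  simp only [trigFn, one_ne_zero, if_false, pow_one, pow_zero, one_mul]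
  rw [← this]; ring

theorem hasDerivAt_trigSum_sin {Z : Type} [TopologicalSpace Z] {s : ℕ} (hs : 2 ≤ s) {u v : Coef Z}
    (h : ∀ n z, v (n, z) = n * u (n, z)) (y : ℝ) (z : Z) :
    HasDerivAt (fun y => trigSum s 1 u y z) (trigSum s 0 v y z) y := by
  unfold trigSum
  refine hasDerivAt_tsum (g' := fun (k : ℤ) y =>
    (k.sign : ℝ) ^ 0 * trigFn 0 k y / (1 + |(k : ℝ)|) ^ s * v (k.natAbs, z))
    ((summable_weight hs).mul_right ‖v‖) (fun k y => ?_)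
    (fun k y => abs_trigSum_term_le s 0 v y z k)
    (summable_trigSum hs 1 u y z) y
  have h1 : HasDerivAt (fun y : ℝ => Real.sin (k * y)) (Real.cos (k * y) * k) y := by
    exact (((hasDerivAt_id' y).const_mul (k : ℝ)).sin).congr_deriv (by ring)
  have h2 := (((h1.const_mul ((k.sign : ℝ) ^ 1)).div_const
    ((1 + |(k : ℝ)|) ^ s)).mul_const (u (k.natAbs, z)))
  refine h2.congr_deriv ?_
  rw [h]
  have h3 : (k.sign : ℝ) * k = k.natAbs := by
    rw [show (k.natAbs : ℝ) = ((k.natAbs : ℤ) : ℝ) from (Int.cast_natCast _).symm,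
      ← Int.cast_mul, Int.sign_mul_self_eq_natAbs]
  simp only [trigFn, if_pos, pow_one, pow_zero, one_mul]
  rw [← h3]; ring

theorem trigSum_cos_neg {Z : Type} [TopologicalSpace Z] (s : ℕ) (u : Coef Z) (y : ℝ) (z : Z) :
    trigSum s 0 u (-y) z = trigSum s 0 u y z := by
  simp [trigSum, trigFn]

theorem trigSum_add_two_pi {Z : Type} [TopologicalSpace Z] (s e : ℕ) (u : Coef Z) (y : ℝ) (z : Z) :
    trigSum s e u (y + 2 * Real.pi) z = trigSum s e u y z := by
  unfold trigSum
  refine tsum_congr fun k => ?_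
  congr 3
  unfold trigFn
  rw [mul_add]
  split_ifs
  · exact Real.cos_add_int_mul_two_pi _ k
  · exact Real.sin_add_int_mul_two_pi _ k

/-! ### The modes as bounded operators -/

/-- The space of sources and boundary parameters of the modes. -/
abbrev ModeData := Coef ℝ × Coef Unit

/-- The restriction of `z` to the interval on which the modes are controlled. -/
noncomputable def clampZ (z : ℝ) : ℝ := max (-1) (min 2 z)

theorem continuous_clampZ : Continuous clampZ := by unfold clampZ; fun_prop

theorem clampZ_of_mem {z : ℝ} (hz : z ∈ Set.Icc (-1 : ℝ) 2) : clampZ z = z := by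
  unfold clampZ; rw [min_eq_right hz.2, max_eq_right hz.1]

/-- The `j`-th derivative of the modes, with multipliers. -/
noncomputable def modeOp {q : ℝ} (hq : 0 < q) {j : ℕ} (hj : j ≤ 2) (c : ℕ → ℝ)
    (hc : ∀ k : ℕ, |c k| ≤ (1 + (k : ℝ)) ^ (2 - j)) : ModeData →L[ℝ] Coef ℝ :=
  have hb : ∀ (w : ModeData) (k : ℕ) (z : ℝ),
      |c k * modeFn q j k (fun s => w.1 (k, s)) (w.2 (k, ())) (clampZ z)|
        ≤ modeBound q * 2 * ‖w‖ := fun w k z => by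
    have h1 := abs_modeFn_le hq hj k (F := fun s => w.1 (k, s)) (N := ‖w.1‖)
      (fun s => w.1.abs_apply_le _) (w.2 (k, ())) (z := clampZ z) (le_max_left _ _)
      (max_le (by norm_num) (min_le_left _ _))
    rw [abs_mul]
    calc _ ≤ (1 + (k : ℝ)) ^ (2 - j) * |modeFn q j k (fun s => w.1 (k, s)) (w.2 (k, ()))
          (clampZ z)| := by gcongr; exact hc k
      _ ≤ _ := h1
      _ ≤ modeBound q * (‖w‖ + ‖w‖) := by
        have := modeBound_pos hq
        gcongr
        · exact le_max_left _ _
        · exact (w.2.abs_apply_le _).trans (le_max_right _ _)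
      _ = _ := by ring
  LinearMap.mkContinuous
    { toFun := fun w => Coef.mk
        (fun p => c p.1 * modeFn q j p.1 (fun s => w.1 (p.1, s)) (w.2 (p.1, ())) (clampZ p.2))
        (by
          rw [continuous_prod_of_discrete_left]
          intro k
          have := continuous_modeFn hq j k (w.1.continuous_mode k) (w.2 (k, ()))
          change Continuous fun z => c k * modeFn q j k (fun s => w.1 (k, s)) (w.2 (k, ())) (clampZ z)
          exact continuous_const.mul (this.comp continuous_clampZ))
        (modeBound q * 2 * ‖w‖) (fun p => hb w p.1 p.2)
      map_add' := fun w w' => by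
        ext n z
        simp only [Prod.fst_add, Prod.snd_add, Coef.add_apply, Coef.mk_apply]
        rw [modeFn_add (w.1.continuous_mode n) (w'.1.continuous_mode n), mul_add]
      map_smul' := fun r w => by
        ext n z
        simp only [Prod.smul_fst, Prod.smul_snd, Coef.smul_apply, Coef.mk_apply, RingHom.id_apply]
        rw [modeFn_smul, mul_left_comm] }
    (modeBound q * 2) (fun w => Coef.norm_le
      (by have := modeBound_pos hq; positivity) (fun p => hb w p.1 p.2))

theorem modeOp_apply {q : ℝ} (hq : 0 < q) {j : ℕ} (hj : j ≤ 2) (c : ℕ → ℝ)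
    (hc : ∀ k : ℕ, |c k| ≤ (1 + (k : ℝ)) ^ (2 - j)) (w : ModeData) (k : ℕ) (z : ℝ) :
    modeOp hq hj c hc w (k, z)
      = c k * modeFn q j k (fun s => w.1 (k, s)) (w.2 (k, ())) (clampZ z) := rfl

/-- The values of the coefficients at `z = 1`. -/
noncomputable def traceOp : Coef ℝ →L[ℝ] Coef Unit :=
  LinearMap.mkContinuous
    { toFun := fun u => Coef.mk (fun p => u (p.1, 1)) (u.continuous.comp (by fun_prop)) ‖u‖
        (fun p => u.abs_apply_le _)
      map_add' := fun u v => by ext; simp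
      map_smul' := fun r u => by ext; simp }
    1 (fun u => by
      rw [one_mul]
      exact Coef.norm_le (norm_nonneg _) (fun p => u.abs_apply_le _))

@[simp] theorem traceOp_apply (u : Coef ℝ) (n : ℕ) (x : Unit) : traceOp u (n, x) = u (n, 1) := rfl

/-- Multiplication by the `i`-th power of `z`, where `z` is restricted to `[-1, 2]`. -/
noncomputable def powZ (i : ℕ) : Coef ℝ →L[ℝ] Coef ℝ :=
  coefOp id (Coef.mk (fun p => clampZ p.2 ^ i)
    ((continuous_clampZ.comp continuous_snd).pow i) (2 ^ i) (fun p => by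
    rw [abs_pow]
    gcongr
    rw [abs_le]
    exact ⟨by linarith [le_max_left (-1 : ℝ) (min 2 p.2), show clampZ p.2 = max (-1) (min 2 p.2) from rfl],
      max_le (by norm_num) (min_le_left _ _)⟩))

theorem powZ_apply (i : ℕ) (u : Coef ℝ) (n : ℕ) (z : ℝ) :
    powZ i u (n, z) = clampZ z ^ i * u (n, z) := rfl

theorem trigSum_powZ (s e i : ℕ) (u : Coef ℝ) (y : ℝ) {z : ℝ} (hz : z ∈ Set.Icc (-1 : ℝ) 2) :
    trigSum s e (powZ i u) y z = z ^ i * trigSum s e u y z := by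
  unfold trigSum
  rw [← tsum_mul_left]
  refine tsum_congr fun k => ?_
  rw [powZ_apply, clampZ_of_mem hz]; ring

/-! ### The function `x coth x` -/

/-- The function `x coth x`. -/
noncomputable def xCoth (x : ℝ) : ℝ := x * (Real.cosh x / Real.sinh x)

theorem hasDerivAt_xCoth {x : ℝ} (hx : 0 < x) :
    HasDerivAt xCoth ((Real.cosh x * Real.sinh x - x) / Real.sinh x ^ 2) x := by
  have hs := (Real.sinh_pos_iff.2 hx).ne'
  have h := (hasDerivAt_id' x).mul ((Real.hasDerivAt_cosh x).div (Real.hasDerivAt_sinh x) hs)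
  refine h.congr_deriv ?_
  have := Real.cosh_sq x
  simp only [Pi.div_apply]
  field_simp
  linear_combination (-x) * this

theorem cosh_mul_sinh_sub_pos {x : ℝ} (hx : 0 < x) : 0 < Real.cosh x * Real.sinh x - x := by
  have h1 : 2 * x < Real.sinh (2 * x) := Real.self_lt_sinh_iff.2 (by linarith)
  rw [Real.sinh_two_mul] at h1
  linarith

theorem strictMonoOn_xCoth : StrictMonoOn xCoth (Set.Ioi 0) := by
  refine strictMonoOn_of_deriv_pos (convex_Ioi 0)
    (fun x hx => (hasDerivAt_xCoth hx).continuousAt.continuousWithinAt) (fun x hx => ?_)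
  rw [interior_Ioi] at hx
  rw [(hasDerivAt_xCoth hx).deriv]
  have := cosh_mul_sinh_sub_pos hx
  have := Real.sinh_pos_iff.2 hx
  positivity

theorem lt_xCoth {x : ℝ} (hx : 0 < x) : x < xCoth x := by
  have hs := Real.sinh_pos_iff.2 hx
  unfold xCoth
  rw [mul_div_assoc', lt_div_iff₀ hs]
  exact mul_lt_mul_of_pos_left (Real.sinh_lt_cosh x) hx

theorem one_lt_xCoth {x : ℝ} (hx : 0 < x) : 1 < xCoth x := by
  have hs := Real.sinh_pos_iff.2 hx
  have hd : ∀ y, HasDerivAt (fun y => y * Real.cosh y - Real.sinh y) (y * Real.sinh y) y := fun y =>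
    (((hasDerivAt_id' y).fun_mul (Real.hasDerivAt_cosh y)).fun_sub
      (Real.hasDerivAt_sinh y)).congr_deriv (by ring)
  have hmono : StrictMonoOn (fun y => y * Real.cosh y - Real.sinh y) (Set.Ici 0) := by
    refine strictMonoOn_of_deriv_pos (convex_Ici 0)
      (fun y _ => (hd y).continuousAt.continuousWithinAt) (fun y hy => ?_)
    rw [interior_Ici] at hy
    rw [(hd y).deriv]
    exact mul_pos hy (Real.sinh_pos_iff.2 hy)
  have := hmono Set.self_mem_Ici hx.le hx
  simp only [zero_mul, Real.sinh_zero, sub_zero] at this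
  unfold xCoth
  rw [mul_div_assoc', lt_div_iff₀ hs]
  linarith

/-- The Dirichlet-to-Neumann symbol of the `k`-th mode. -/
noncomputable def modeNu (q : ℝ) (k : ℕ) : ℝ := if k = 0 then 1 else xCoth (q * k)

theorem strictMono_modeNu {q : ℝ} (hq : 0 < q) : StrictMono (modeNu q) := by
  intro i k hik
  have hk : k ≠ 0 := by omega
  have hk0 : 0 < q * (k : ℝ) := by positivity
  unfold modeNu
  rw [if_neg hk]
  split_ifs with hi
  · exact one_lt_xCoth hk0
  · have hi0 : 0 < q * (i : ℝ) := by positivity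
    exact strictMonoOn_xCoth hi0 hk0 (by gcongr)

/-- The value at `z = 1` of the homogeneous mode. -/
noncomputable def modeH (q : ℝ) (k : ℕ) : ℝ :=
  if k = 0 then 1 else (1 - Real.exp (-(2 * (q * k)))) / (1 + k) ^ 2

theorem modeH_pos {q : ℝ} (hq : 0 < q) (k : ℕ) : 0 < modeH q k := by
  unfold modeH
  split_ifs with hk
  · norm_num
  · have hk0 : 0 < q * (k : ℝ) := by positivity
    have : Real.exp (-(2 * (q * k))) < 1 := Real.exp_lt_one_iff.2 (by linarith)
    have : 0 < 1 - Real.exp (-(2 * (q * k))) := by linarith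
    positivity

theorem modeFn_zero_source (q : ℝ) (hq : 0 < q) (k : ℕ) (g : ℝ) :
    modeFn q 0 k (fun _ => 0) g 1 = g * modeH q k ∧
    modeFn q 1 k (fun _ => 0) g 1 = g * (modeNu q k * modeH q k) := by
  have hU : ∀ p z, greenUp p (fun _ => 0) z = 0 := by intro p z; simp [greenUp]
  have hD : ∀ p z, greenDown p (fun _ => 0) z = 0 := by intro p z; simp [greenDown]
  rcases k with _ | k
  · simp [modeFn, modeH, modeNu]
  · have hp0 : 0 < q * ((k + 1 : ℕ) : ℝ) := by positivity
    set p := q * ((k + 1 : ℕ) : ℝ) with hp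
    have he : Real.exp (-p) * Real.exp (-p) = Real.exp (-(2 * p)) := by
      rw [← Real.exp_add]; congr 1; ring
    have hm : (1 + ((k + 1 : ℕ) : ℝ)) ≠ 0 := by positivity
    constructor
    · simp only [modeFn, ← hp, hU, hD, modeH]
      rw [if_neg (Nat.succ_ne_zero k), mul_one, sub_self, mul_zero, expCut_of_nonpos le_rfl,
        expCut_of_nonpos (by linarith), he, Real.exp_zero]
      ring
    · simp only [modeFn, ← hp, hU, hD, modeH, modeNu]
      rw [if_neg (Nat.succ_ne_zero k), if_neg (Nat.succ_ne_zero k), mul_one, sub_self (1 : ℝ), mul_zero,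
        expCut1_of_nonpos le_rfl, expCut1_of_nonpos (by linarith), he, Real.exp_zero]
      have h1 : xCoth p * (1 - Real.exp (-(2 * p))) = p * (1 + Real.exp (-(2 * p))) := by
        have hs := (Real.sinh_pos_iff.2 hp0)
        have e1 : Real.exp (-p) * Real.exp p = 1 := by rw [← Real.exp_add]; simp
        have e2 : 1 - Real.exp (-(2 * p)) = 2 * Real.exp (-p) * Real.sinh p := by
          rw [Real.sinh_eq, ← he]; linear_combination -e1
        have e3 : 1 + Real.exp (-(2 * p)) = 2 * Real.exp (-p) * Real.cosh p := by
          rw [Real.cosh_eq, ← he]; linear_combination -e1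
        rw [e2, e3, xCoth]
        field_simp
      field_simp
      linear_combination (-2 * g) * h1

theorem exists_inv_bound {q : ℝ} (hq : 0 < q) (K : ℕ) :
    ∃ C, 0 ≤ C ∧ ∀ k, k ≠ K →
      (1 + (k : ℝ)) * modeH q k * (modeNu q k - modeNu q K) ≠ 0 ∧
      |((1 + (k : ℝ)) * modeH q k * (modeNu q k - modeNu q K))⁻¹| ≤ C := by
  set s : ℕ → ℝ := fun k => (1 + (k : ℝ)) * modeH q k * (modeNu q k - modeNu q K) with hs
  have hne : ∀ k, k ≠ K → s k ≠ 0 := fun k hk => by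
    have h1 := (modeH_pos hq k).ne'
    have h2 : modeNu q k - modeNu q K ≠ 0 :=
      sub_ne_zero.2 ((strictMono_modeNu hq).injective.ne hk)
    have h3 : (1 + (k : ℝ)) ≠ 0 := by positivity
    exact mul_ne_zero (mul_ne_zero h3 h1) h2
  have hev : ∀ᶠ k : ℕ in atTop, (1 - Real.exp (-(2 * q))) * (q / 4) ≤ s k := by
    filter_upwards [eventually_ge_atTop 1, eventually_ge_atTop ⌈2 * |modeNu q K| / q⌉₊]
      with k hk1 hk2
    have hk0 : k ≠ 0 := by omega
    have hk1' : (1 : ℝ) ≤ k := by exact_mod_cast hk1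
    have hk2' : 2 * |modeNu q K| / q ≤ k := Nat.ceil_le.1 hk2
    rw [div_le_iff₀ hq] at hk2'
    have hnu : q * k < modeNu q k := by
      unfold modeNu; rw [if_neg hk0]; exact lt_xCoth (by positivity)
    have h1 : q * k / 2 ≤ modeNu q k - modeNu q K := by
      have := le_abs_self (modeNu q K); nlinarith
    have h2 : 1 - Real.exp (-(2 * q)) ≤ 1 - Real.exp (-(2 * (q * k))) := by
      have : Real.exp (-(2 * (q * k))) ≤ Real.exp (-(2 * q)) := Real.exp_le_exp.2 (by nlinarith)
      linarith
    have h0 : 0 ≤ 1 - Real.exp (-(2 * q)) := by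
      have := Real.exp_le_one_iff.2 (show -(2 * q) ≤ 0 by linarith); linarith
    have h3 : q / 4 ≤ (q * k / 2) / (1 + k) := by
      rw [le_div_iff₀ (by positivity)]; nlinarith
    calc (1 - Real.exp (-(2 * q))) * (q / 4)
        ≤ (1 - Real.exp (-(2 * (q * k)))) * ((q * k / 2) / (1 + k)) := by
          gcongr; exact h0.trans h2
      _ ≤ (1 - Real.exp (-(2 * (q * k)))) * ((modeNu q k - modeNu q K) / (1 + k)) := by
          gcongr; exact h0.trans h2
      _ = s k := by
          simp only [hs, modeH, if_neg hk0]; field_simp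
  have hb : 0 < (1 - Real.exp (-(2 * q))) * (q / 4) := by
    have : Real.exp (-(2 * q)) < 1 := Real.exp_lt_one_iff.2 (by linarith)
    have : 0 < 1 - Real.exp (-(2 * q)) := by linarith
    positivity
  obtain ⟨N, hN⟩ := eventually_atTop.1 hev
  refine ⟨((1 - Real.exp (-(2 * q))) * (q / 4))⁻¹ + ∑ k ∈ Finset.range N, |(s k)⁻¹|,
    by positivity, fun k hk => ⟨hne k hk, ?_⟩⟩
  rcases lt_or_ge k N with h | h
  · have := Finset.single_le_sum (f := fun k => |(s k)⁻¹|) (fun i _ => abs_nonneg _)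
      (Finset.mem_range.2 h)
    have h' : 0 ≤ ((1 - Real.exp (-(2 * q))) * (q / 4))⁻¹ := by positivity
    linarith
  · have h1 := hN k h
    have h2 : |(s k)⁻¹| ≤ ((1 - Real.exp (-(2 * q))) * (q / 4))⁻¹ := by
      rw [abs_of_pos (inv_pos.2 (hb.trans_le h1))]
      exact inv_anti₀ hb h1
    have h3 : 0 ≤ ∑ k ∈ Finset.range N, |(s k)⁻¹| := Finset.sum_nonneg fun _ _ => abs_nonneg _
    linarith

/-- Evaluation of a coefficient. -/
noncomputable def coefEval {Z : Type} [TopologicalSpace Z] (p : ℕ × Z) : Coef Z →L[ℝ] ℝ :=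
  LinearMap.mkContinuous
    { toFun := fun u => u p, map_add' := fun u v => by simp, map_smul' := fun r u => by simp }
    1 (fun u => by rw [one_mul]; exact u.abs_apply_le p)

section ModeOps

variable {q : ℝ} (hq : 0 < q)

/-- The coefficients of `w`. -/
noncomputable def opW0 : ModeData →L[ℝ] Coef ℝ :=
  modeOp hq (j := 0) (by norm_num) (fun _ => 1) (fun k => by
    rw [abs_one]; exact one_le_pow₀ (by linarith [Nat.cast_nonneg (α := ℝ) k]))

/-- The coefficients of `w_z`. -/
noncomputable def opW1 : ModeData →L[ℝ] Coef ℝ :=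
  modeOp hq (j := 1) (by norm_num) (fun _ => 1) (fun k => by
    rw [abs_one]; exact one_le_pow₀ (by linarith [Nat.cast_nonneg (α := ℝ) k]))

/-- The coefficients of `w_zz`. -/
noncomputable def opW2 : ModeData →L[ℝ] Coef ℝ :=
  modeOp hq (j := 2) (by norm_num) (fun _ => 1) (fun k => by simp)

/-- The coefficients of `w_x`. -/
noncomputable def opX1 : ModeData →L[ℝ] Coef ℝ :=
  modeOp hq (j := 0) (by norm_num) (fun k => k) (fun k => by
    have := Nat.cast_nonneg (α := ℝ) k
    rw [abs_of_nonneg this]; norm_num; nlinarith)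

/-- The coefficients of `w_xx`. -/
noncomputable def opX2 : ModeData →L[ℝ] Coef ℝ :=
  modeOp hq (j := 0) (by norm_num) (fun k => k * k) (fun k => by
    have := Nat.cast_nonneg (α := ℝ) k
    rw [abs_of_nonneg (by positivity)]; norm_num; nlinarith)

/-- The coefficients of `w_xz`. -/
noncomputable def opX11 : ModeData →L[ℝ] Coef ℝ :=
  modeOp hq (j := 1) (by norm_num) (fun k => k) (fun k => by
    have := Nat.cast_nonneg (α := ℝ) k
    rw [abs_of_nonneg this]; norm_num)

/-- The coefficients of the trace of `w`. -/
noncomputable def opT0 : ModeData →L[ℝ] Coef Unit :=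
  traceOp.comp (modeOp hq (j := 0) (by norm_num) (fun k => 1 + k) (fun k => by
    have := Nat.cast_nonneg (α := ℝ) k
    rw [abs_of_nonneg (by positivity)]; norm_num; nlinarith))

/-- The coefficients of the trace of `w_z`. -/
noncomputable def opT1 : ModeData →L[ℝ] Coef Unit :=
  traceOp.comp (modeOp hq (j := 1) (by norm_num) (fun k => 1 + k) (fun k => by
    have := Nat.cast_nonneg (α := ℝ) k
    rw [abs_of_nonneg (by positivity)]; norm_num))

/-- The coefficients of the trace of `w_x`. -/
noncomputable def opTX : ModeData →L[ℝ] Coef Unit :=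
  traceOp.comp (modeOp hq (j := 0) (by norm_num) (fun k => (1 + k) * k) (fun k => by
    have := Nat.cast_nonneg (α := ℝ) k
    rw [abs_of_nonneg (by positivity)]; norm_num; nlinarith))

theorem one_mem_Icc : (1 : ℝ) ∈ Set.Icc (-1 : ℝ) 2 := by constructor <;> norm_num

theorem opT0_apply (w : ModeData) (k : ℕ) (x : Unit) : opT0 hq w (k, x)
    = (1 + k) * modeFn q 0 k (fun s => w.1 (k, s)) (w.2 (k, ())) 1 := by
  simp only [opT0, ContinuousLinearMap.comp_apply, traceOp_apply, modeOp_apply,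
    clampZ_of_mem one_mem_Icc]

theorem opT1_apply (w : ModeData) (k : ℕ) (x : Unit) : opT1 hq w (k, x)
    = (1 + k) * modeFn q 1 k (fun s => w.1 (k, s)) (w.2 (k, ())) 1 := by
  simp only [opT1, ContinuousLinearMap.comp_apply, traceOp_apply, modeOp_apply,
    clampZ_of_mem one_mem_Icc]

theorem trigSum_three_of_eq {u : Coef Unit} {v : Coef ℝ} (e : ℕ)
    (h : ∀ k : ℕ, u (k, ()) = (1 + k) * v (k, 1)) (y : ℝ) :
    trigSum 3 e u y () = trigSum 2 e v y 1 := by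
  unfold trigSum
  refine tsum_congr fun k => ?_
  rw [h]
  have : (k.natAbs : ℝ) = |(k : ℝ)| := by rw [Nat.cast_natAbs, Int.cast_abs]
  rw [this]
  have : 1 + |(k : ℝ)| ≠ 0 := by positivity
  field_simp

theorem modeFn_split {k : ℕ} {j : ℕ} {F : ℝ → ℝ} (hF : Continuous F) (g z : ℝ) :
    modeFn q j k F g z = modeFn q j k F 0 z + modeFn q j k (fun _ => 0) g z := by
  rw [← modeFn_add hF continuous_const]; simp

/-- The linearization at a simple eigenvalue is invertible. -/
theorem bijective_linearization (K : ℕ) {e₃ : ℝ} (he₃ : e₃ ≠ 0) {c : ℝ} (hc : c ≠ 0) (x₀ : ModeData)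
    (hx₁ : x₀.1 = 0) (hx₂ : ∀ k, k ≠ K → x₀.2 (k, ()) = 0) (hx₃ : x₀.2 (K, ()) ≠ 0) :
    Function.Bijective (fun p : ModeData × ℝ =>
      ((p.1.1, opT1 hq p.1 - modeNu q K • opT0 hq p.1) - p.2 • ((0, e₃ • opT0 hq x₀) : ModeData),
        c * opT0 hq p.1 (K, ()))) := by
  set R : Coef ℝ → ℕ → ℝ := fun F k => (1 + k) * (modeFn q 1 k (fun s => F (k, s)) 0 1
    - modeNu q K * modeFn q 0 k (fun s => F (k, s)) 0 1) with hR
  set S : ℕ → ℝ := fun k => (1 + (k : ℝ)) * modeH q k * (modeNu q k - modeNu q K) with hS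
  have hT : ∀ (w : ModeData) (k : ℕ), (opT1 hq w - modeNu q K • opT0 hq w) (k, ())
      = R w.1 k + S k * w.2 (k, ()) := by
    intro w k
    have h1 := modeFn_zero_source q hq k (w.2 (k, ()))
    simp only [Coef.sub_apply, Coef.smul_apply, opT0_apply, opT1_apply, hR, hS]
    rw [modeFn_split (j := 1) (w.1.continuous_mode k) (w.2 (k, ())),
      modeFn_split (j := 0) (w.1.continuous_mode k) (w.2 (k, ())), h1.1, h1.2]
    ring
  have hT0 : ∀ (w : ModeData) (k : ℕ), opT0 hq w (k, ())
      = (1 + k) * (modeFn q 0 k (fun s => w.1 (k, s)) 0 1 + w.2 (k, ()) * modeH q k) := by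
    intro w k
    rw [opT0_apply, modeFn_split (j := 0) (w.1.continuous_mode k) (w.2 (k, ())),
      (modeFn_zero_source q hq k (w.2 (k, ()))).1]
  have hx₀ : ∀ k, opT0 hq x₀ (k, ()) = (1 + k) * (x₀.2 (k, ()) * modeH q k) := by
    intro k
    rw [hT0, hx₁]
    have h0 : modeFn q 0 k (fun s => (0 : Coef ℝ) (k, s)) 0 1 = 0 := by
      have := (modeFn_zero_source q hq k 0).1
      simpa using this
    rw [h0, zero_add]
  have hK : opT0 hq x₀ (K, ()) ≠ 0 := by
    rw [hx₀]
    have := (modeH_pos hq K).ne'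
    positivity
  have hSK : S K = 0 := by simp [hS]
  have hH := modeH_pos hq
  obtain ⟨C, hC0, hC⟩ := exists_inv_bound hq K
  constructor
  · rintro ⟨u, m⟩ ⟨u', m'⟩ h
    simp only [Prod.mk.injEq] at h
    obtain ⟨h1, h2⟩ := h
    have h11 : u.1 = u'.1 := by simpa using congrArg Prod.fst h1
    have h12 : ∀ k, R u.1 k + S k * u.2 (k, ()) - m * (e₃ * opT0 hq x₀ (k, ()))
        = R u'.1 k + S k * u'.2 (k, ()) - m' * (e₃ * opT0 hq x₀ (k, ())) := by
      intro k
      have := congrArg (fun w : ModeData => w.2 (k, ())) h1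
      simp only [Prod.snd_sub, Prod.smul_snd] at this
      simp only [Coef.sub_apply _ (_ • _), Coef.smul_apply] at this
      rw [← hT, ← hT]
      simpa using this
    have hm : m = m' := by
      have := h12 K
      rw [hSK, h11] at this
      have h3 : (m - m') * (e₃ * opT0 hq x₀ (K, ())) = 0 := by linear_combination -this
      rcases mul_eq_zero.1 h3 with h4 | h4
      · linarith
      · exact absurd h4 (mul_ne_zero he₃ hK)
    have hg : ∀ k, u.2 (k, ()) = u'.2 (k, ()) := by
      intro k
      by_cases hk : k = K
      · subst hk
        have h3 := mul_left_cancel₀ hc h2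
        rw [hT0, hT0, h11] at h3
        have h4 : (1 + (k : ℝ)) ≠ 0 := by positivity
        have h5 := add_left_cancel (mul_left_cancel₀ h4 h3)
        exact mul_right_cancel₀ (hH k).ne' h5
      · have h3 := h12 k
        rw [h11, hm] at h3
        have h4 : S k * u.2 (k, ()) = S k * u'.2 (k, ()) := by linear_combination h3
        exact mul_left_cancel₀ (hC k hk).1 h4
    have : u = u' := Prod.ext h11 (Coef.ext fun n z => hg n)
    rw [this, hm]
  · rintro ⟨⟨F, β⟩, r⟩
    set g : ℕ → ℝ := fun k => if k = K then
      (r / (c * (1 + K)) - modeFn q 0 K (fun s => F (K, s)) 0 1) / modeH q K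
      else (S k)⁻¹ * (β (k, ()) - R F k) with hg
    have hRb : ∀ k, |R F k| ≤ ‖opT1 hq (F, 0) - modeNu q K • opT0 hq (F, 0)‖ := by
      intro k
      have h1 := hT (F, 0) k
      have h2 := (opT1 hq (F, 0) - modeNu q K • opT0 hq (F, 0)).abs_apply_le (k, ())
      rw [h1] at h2
      simpa using h2
    set D := ‖opT1 hq (F, 0) - modeNu q K • opT0 hq (F, 0)‖ with hD
    have hgb : ∀ k, |g k| ≤ |g K| + C * (‖β‖ + D) := by
      intro k
      by_cases hk : k = K
      · subst hk
        have : 0 ≤ C * (‖β‖ + D) := by positivity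
        linarith
      · have e1 : |g k| ≤ C * (‖β‖ + D) := by
          simp only [hg, if_neg hk]
          rw [abs_mul]
          have := (hC k hk).2
          have h3 : |β (k, ()) - R F k| ≤ ‖β‖ + D :=
            (abs_sub _ _).trans (add_le_add (β.abs_apply_le _) (hRb k))
          gcongr
        linarith [abs_nonneg (g K)]
    refine ⟨((F, constCoef g _ hgb), (R F K - β (K, ())) / (e₃ * opT0 hq x₀ (K, ()))), ?_⟩
    have hcomp : ∀ k, R F k + S k * g k
        - (R F K - β (K, ())) / (e₃ * opT0 hq x₀ (K, ())) * (e₃ * opT0 hq x₀ (k, ()))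
        = β (k, ()) := by
      intro k
      by_cases hk : k = K
      · subst hk
        rw [hSK, div_mul_cancel₀ _ (mul_ne_zero he₃ hK)]
        ring
      · rw [hx₀ k, hx₂ k hk]
        simp only [hg, if_neg hk]
        have h1 : S k * (S k)⁻¹ = 1 := mul_inv_cancel₀ (hC k hk).1
        linear_combination (β (k, ()) - R F k) * h1
    refine Prod.ext (Prod.ext ?_ ?_) ?_
    · simp
    · refine Coef.ext fun n z => ?_
      simp only [Prod.snd_sub, Prod.smul_snd]
      simp only [Coef.sub_apply _ (_ • _), Coef.smul_apply]
      have h5 := hT (F, constCoef g _ hgb) n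
      simp only [Coef.sub_apply, Coef.smul_apply, constCoef_apply] at h5
      have h6 := hcomp n
      cases z
      linear_combination h5 + h6
    · simp only [hT0, constCoef_apply, hg, if_pos]
      have h4 : (1 + (K : ℝ)) ≠ 0 := by positivity
      have := (hH K).ne'
      field_simp
      ring

end ModeOps

section ModeOps

variable {q : ℝ} (hq : 0 < q)

/-- The sum of the modes. -/
noncomputable def modeSum (τ : ℝ) (u : ModeData) (x z : ℝ) : ℝ := trigSum 2 0 (opW0 hq u) (τ * x) z

theorem HasDerivAt.trig_comp {f : ℝ → ℝ} {f' τ x : ℝ} (h : HasDerivAt f f' (τ * x)) :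
    HasDerivAt (fun x => f (τ * x)) (τ * f') x := by
  have h1 : HasDerivAt (fun x : ℝ => τ * x) τ x := by simpa using (hasDerivAt_id' x).const_mul τ
  exact (h.comp x h1).congr_deriv (mul_comm _ _)

theorem hasDerivAt_op {j : ℕ} (hj : j ≤ 1) (c : ℕ → ℝ)
    (hc : ∀ k : ℕ, |c k| ≤ (1 + (k : ℝ)) ^ (2 - j))
    (hc' : ∀ k : ℕ, |c k| ≤ (1 + (k : ℝ)) ^ (2 - (j + 1))) (u : ModeData) (n : ℕ) {z : ℝ}
    (hz : z ∈ Set.Ioo (-1 : ℝ) 2) :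
    HasDerivAt (fun z => modeOp hq (j := j) (by omega) c hc u (n, z))
      (modeOp hq (j := j + 1) (by omega) c hc' u (n, z)) z := by
  have hF := u.1.continuous_mode n
  have h1 : HasDerivAt (modeFn q j n (fun s => u.1 (n, s)) (u.2 (n, ())))
      (modeFn q (j + 1) n (fun s => u.1 (n, s)) (u.2 (n, ())) z) z := by
    interval_cases j
    · exact hasDerivAt_modeFn_zero hq n hF _ z
    · exact hasDerivAt_modeFn_one n hF _ z
  rw [modeOp_apply, clampZ_of_mem (Set.Ioo_subset_Icc_self hz)]
  refine (h1.const_mul (c n)).congr_of_eventuallyEq ?_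
  filter_upwards [isOpen_Ioo.mem_nhds hz] with s hs
  rw [modeOp_apply, clampZ_of_mem (Set.Ioo_subset_Icc_self hs)]

variable {τ : ℝ} (u : ModeData)

theorem hasDerivAt_modeSum_x (x z : ℝ) : HasDerivAt (fun x => modeSum hq τ u x z)
    (-(τ * trigSum 2 1 (opX1 hq u) (τ * x) z)) x := by
  have h := HasDerivAt.trig_comp (hasDerivAt_trigSum_cos le_rfl (u := opW0 hq u) (v := opX1 hq u)
    (fun n z => by simp [opW0, opX1, modeOp_apply]) (τ * x) z)
  exact h.congr_deriv (by ring)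

theorem hasDerivAt_modeSum_z (x : ℝ) {z : ℝ} (hz : z ∈ Set.Ioo (-1 : ℝ) 2) :
    HasDerivAt (fun z => modeSum hq τ u x z) (trigSum 2 0 (opW1 hq u) (τ * x) z) z :=
  hasDerivAt_trigSum_snd le_rfl 0 (fun n z hz => hasDerivAt_op hq (by norm_num) _ _ _ u n hz) _ hz

theorem hasDerivAt_modeSum_xx (x z : ℝ) :
    HasDerivAt (fun x => -(τ * trigSum 2 1 (opX1 hq u) (τ * x) z))
    (-(τ ^ 2 * trigSum 2 0 (opX2 hq u) (τ * x) z)) x := by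
  have h := (HasDerivAt.trig_comp (hasDerivAt_trigSum_sin le_rfl (u := opX1 hq u)
    (v := opX2 hq u) (fun n z => by simp [opX2, opX1, modeOp_apply, mul_assoc]) (τ * x) z))
  exact (h.const_mul τ).fun_neg.congr_deriv (by ring)

theorem hasDerivAt_modeSum_xz (x : ℝ) {z : ℝ} (hz : z ∈ Set.Ioo (-1 : ℝ) 2) :
    HasDerivAt (fun z => -(τ * trigSum 2 1 (opX1 hq u) (τ * x) z))
      (-(τ * trigSum 2 1 (opX11 hq u) (τ * x) z)) z :=
  ((hasDerivAt_trigSum_snd le_rfl 1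
    (fun n z hz => hasDerivAt_op hq (by norm_num) _ _ _ u n hz) _ hz).const_mul τ).fun_neg

theorem hasDerivAt_modeSum_zx (x z : ℝ) :
    HasDerivAt (fun x => trigSum 2 0 (opW1 hq u) (τ * x) z)
      (-(τ * trigSum 2 1 (opX11 hq u) (τ * x) z)) x := by
  have h := HasDerivAt.trig_comp (hasDerivAt_trigSum_cos le_rfl (u := opW1 hq u) (v := opX11 hq u)
    (fun n z => by simp [opW1, opX11, modeOp_apply]) (τ * x) z)
  exact h.congr_deriv (by ring)

theorem hasDerivAt_modeSum_zz (x : ℝ) {z : ℝ} (hz : z ∈ Set.Ioo (-1 : ℝ) 2) :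
    HasDerivAt (fun z => trigSum 2 0 (opW1 hq u) (τ * x) z)
      (trigSum 2 0 (opW2 hq u) (τ * x) z) z :=
  hasDerivAt_trigSum_snd le_rfl 0 (fun n z hz => hasDerivAt_op hq (by norm_num) _ _ _ u n hz) _ hz

theorem contDiffAt_modeSum (x : ℝ) {z : ℝ} (hz : z ∈ Set.Ioo (-1 : ℝ) 2) :
    ContDiffAt ℝ 2 (fun p : ℝ × ℝ => modeSum hq τ u p.1 p.2) (x, z) := by
  have hc : ∀ (e : ℕ) (v : Coef ℝ), Continuous fun p : ℝ × ℝ => trigSum 2 e v (τ * p.1) p.2 :=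
    fun e v => Continuous.comp (g := fun p : ℝ × ℝ => trigSum 2 e v p.1 p.2)
      (f := fun p : ℝ × ℝ => (τ * p.1, p.2)) (continuous_trigSum le_rfl e v)
      ((continuous_const.mul continuous_fst).prodMk continuous_snd)
  have hU : IsOpen {p : ℝ × ℝ | p.2 ∈ Set.Ioo (-1 : ℝ) 2} := isOpen_Ioo.preimage continuous_snd
  refine contDiffAt_two_of_partials hU (f := modeSum hq τ u)
    (fx := fun x z => -(τ * trigSum 2 1 (opX1 hq u) (τ * x) z))
    (fy := fun x z => trigSum 2 0 (opW1 hq u) (τ * x) z)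
    (fxx := fun x z => -(τ ^ 2 * trigSum 2 0 (opX2 hq u) (τ * x) z))
    (fxy := fun x z => -(τ * trigSum 2 1 (opX11 hq u) (τ * x) z))
    (fyx := fun x z => -(τ * trigSum 2 1 (opX11 hq u) (τ * x) z))
    (fyy := fun x z => trigSum 2 0 (opW2 hq u) (τ * x) z)
    (fun p _ => hasDerivAt_modeSum_x hq u p.1 p.2)
    (fun p hp => hasDerivAt_modeSum_z hq u p.1 hp)
    (fun p _ => hasDerivAt_modeSum_xx hq u p.1 p.2)
    (fun p hp => hasDerivAt_modeSum_xz hq u p.1 hp)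
    (fun p _ => hasDerivAt_modeSum_zx hq u p.1 p.2)
    (fun p hp => hasDerivAt_modeSum_zz hq u p.1 hp) ?_ ?_ ?_ ?_ hz
  · exact ((hc 0 _).const_smul (τ ^ 2)).neg.continuousOn
  · exact ((hc 1 _).const_smul τ).neg.continuousOn
  · exact ((hc 1 _).const_smul τ).neg.continuousOn
  · exact (hc 0 _).continuousOn

theorem dX_modeSum (x z : ℝ) :
    dX (modeSum hq τ u) x z = -(τ * trigSum 2 1 (opX1 hq u) (τ * x) z) :=
  (hasDerivAt_modeSum_x hq u x z).deriv

theorem dXX_modeSum (x z : ℝ) :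
    dX (dX (modeSum hq τ u)) x z = -(τ ^ 2 * trigSum 2 0 (opX2 hq u) (τ * x) z) := by
  unfold dX
  simp only [(hasDerivAt_modeSum_x hq u _ _).deriv]
  exact (hasDerivAt_modeSum_xx hq u x z).deriv

theorem dY_modeSum (x : ℝ) {z : ℝ} (hz : z ∈ Set.Ioo (-1 : ℝ) 2) :
    dY (modeSum hq τ u) x z = trigSum 2 0 (opW1 hq u) (τ * x) z :=
  (hasDerivAt_modeSum_z hq u x hz).deriv

theorem dXY_modeSum (x : ℝ) {z : ℝ} (hz : z ∈ Set.Ioo (-1 : ℝ) 2) :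
    dX (dY (modeSum hq τ u)) x z = -(τ * trigSum 2 1 (opX11 hq u) (τ * x) z) := by
  rw [dX]
  simp only [dY_modeSum hq u _ hz]
  exact (hasDerivAt_modeSum_zx hq u x z).deriv

theorem dYY_modeSum (x : ℝ) {z : ℝ} (hz : z ∈ Set.Ioo (-1 : ℝ) 2) :
    dY (dY (modeSum hq τ u)) x z = trigSum 2 0 (opW2 hq u) (τ * x) z := by
  refine HasDerivAt.deriv ((hasDerivAt_modeSum_zz hq u x hz).congr_of_eventuallyEq ?_)
  filter_upwards [isOpen_Ioo.mem_nhds hz] with s hs using dY_modeSum hq u x hs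

theorem modeSum_zero (x : ℝ) : modeSum hq τ u x 0 = 0 := by
  unfold modeSum trigSum
  have h : ∀ k : ℕ, opW0 hq u (k, 0) = 0 := fun k => by
    rw [opW0, modeOp_apply, clampZ_of_mem (by constructor <;> norm_num), modeFn_zero_apply_zero hq,
      mul_zero]
  simp [h]

theorem modeSum_equation (x : ℝ) {z : ℝ} (h0 : 0 ≤ z) (h1 : z ≤ 1) :
    trigSum 2 0 (opW2 hq u) (τ * x) z - q ^ 2 * trigSum 2 0 (opX2 hq u) (τ * x) z
      = trigSum 2 0 u.1 (τ * x) z := by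
  unfold trigSum
  rw [← tsum_mul_left, ← Summable.tsum_sub (summable_trigSum le_rfl 0 _ _ z)
    ((summable_trigSum le_rfl 0 _ _ z).mul_left _)]
  refine tsum_congr fun k => ?_
  have h := modeFn_equation hq k.natAbs (fun s => u.1 (k.natAbs, s)) (u.2 (k.natAbs, ())) h0 h1
  rw [opW2, opX2, modeOp_apply, modeOp_apply, clampZ_of_mem ⟨by linarith, by linarith⟩, ← h]
  ring

theorem trigSum_add_coef {Z : Type} [TopologicalSpace Z] {s : ℕ} (hs : 2 ≤ s) (e : ℕ)
    (v w : Coef Z) (y : ℝ) (z : Z) :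
    trigSum s e (v + w) y z = trigSum s e v y z + trigSum s e w y z :=
  map_add (trigSumCLM hs e y z) v w

theorem trigSum_sub_coef {Z : Type} [TopologicalSpace Z] {s : ℕ} (hs : 2 ≤ s) (e : ℕ)
    (v w : Coef Z) (y : ℝ) (z : Z) :
    trigSum s e (v - w) y z = trigSum s e v y z - trigSum s e w y z :=
  map_sub (trigSumCLM hs e y z) v w

theorem trigSum_smul_coef {Z : Type} [TopologicalSpace Z] {s : ℕ} (hs : 2 ≤ s) (e : ℕ) (r : ℝ)
    (v : Coef Z) (y : ℝ) (z : Z) :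
    trigSum s e (r • v) y z = r * trigSum s e v y z :=
  map_smul (trigSumCLM hs e y z) r v

end ModeOps

/-- The sum of a trigonometric series. -/
noncomputable def trigSeries (τ : ℝ) (e : ℕ) (a : ℤ → ℝ) (x : ℝ) : ℝ := ∑' j, a j * trigFn e j (τ * x)

section

variable {q : ℝ} (hq : 0 < q)

/-- The amplitude of the mode `K` of `cos K`. -/
noncomputable def cosWeight (K : ℕ) : ℝ := if K = 0 then 1 else (1 + K) ^ 2 / 2

theorem cosWeight_pos (K : ℕ) : 0 < cosWeight K := by
  rw [cosWeight]; split_ifs <;> positivity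

/-- The data of the unperturbed eigenfunction with the trace `cos K`. -/
noncomputable def cosDatum (K : ℕ) : ModeData :=
  (0, constCoef (fun k => if k = K then cosWeight K / modeH q K else 0)
    (cosWeight K / modeH q K) (fun k => by
      have := modeH_pos hq K
      have := cosWeight_pos K
      split_ifs
      · rw [abs_of_pos (by positivity)]
      · rw [abs_zero]; positivity))

theorem cosDatum_snd (K k : ℕ) :
    (cosDatum hq K).2 (k, ()) = if k = K then cosWeight K / modeH q K else 0 := rfl

theorem modeFn_zero_cosDatum (K k : ℕ) :
    modeFn q 0 k (fun s => (cosDatum hq K).1 (k, s)) ((cosDatum hq K).2 (k, ())) 1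
      = if k = K then cosWeight K else 0 := by
  have := (modeFn_zero_source q hq k ((cosDatum hq K).2 (k, ()))).1
  rw [show (fun s => (cosDatum hq K).1 (k, s)) = fun _ => (0 : ℝ) from rfl, this, cosDatum_snd]
  have hH := (modeH_pos hq K).ne'
  split_ifs with h
  · rw [h]; field_simp
  · ring

theorem modeFn_one_cosDatum (K k : ℕ) :
    modeFn q 1 k (fun s => (cosDatum hq K).1 (k, s)) ((cosDatum hq K).2 (k, ())) 1
      = if k = K then modeNu q K * cosWeight K else 0 := by
  have := (modeFn_zero_source q hq k ((cosDatum hq K).2 (k, ()))).2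
  rw [show (fun s => (cosDatum hq K).1 (k, s)) = fun _ => (0 : ℝ) from rfl, this, cosDatum_snd]
  have hH := (modeH_pos hq K).ne'
  split_ifs with h
  · rw [h]; field_simp
  · ring

theorem trigSum_cosDatum (K : ℕ) (y : ℝ) :
    trigSum 2 0 (opW0 hq (cosDatum hq K)) y 1 = Real.cos (K * y) := by
  have hw : ∀ k : ℕ, opW0 hq (cosDatum hq K) (k, 1) = if k = K then cosWeight K else 0 := by
    intro k
    rw [opW0, modeOp_apply, clampZ_of_mem one_mem_Icc, modeFn_zero_cosDatum, one_mul]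
  unfold trigSum
  simp only [hw]
  have hz : ∀ k : ℤ, k ∉ ({(K : ℤ), -(K : ℤ)} : Finset ℤ) →
      (k.sign : ℝ) ^ 0 * trigFn 0 k y / (1 + |(k : ℝ)|) ^ 2
        * (if k.natAbs = K then cosWeight K else 0) = 0 := by
    intro k hk
    simp only [Finset.mem_insert, Finset.mem_singleton, not_or] at hk
    rw [if_neg (by omega), mul_zero]
  rw [tsum_eq_sum hz]
  by_cases hK : K = 0
  · subst hK
    simp [trigFn, cosWeight]
  · rw [Finset.sum_pair (by omega)]
    simp only [Int.natAbs_neg, Int.natAbs_natCast]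
    rw [if_pos trivial, cosWeight, if_neg hK]
    simp only [trigFn, if_pos, pow_zero, Int.cast_neg, Int.cast_natCast, abs_neg, neg_mul,
      Real.cos_neg, Nat.abs_cast]
    have : (1 + (K : ℝ)) ≠ 0 := by positivity
    field_simp
    ring

variable (τ : ℝ)

/-- The perturbation of the equation. -/
noncomputable def pertEquation (a₁ a₂ a₃ a₄ : ℤ → ℝ) : ModeData →L[ℝ] Coef ℝ :=
  (-τ) • (seriesMul 2 1 a₁).comp ((powZ 1).comp (opX11 hq))
    + (seriesMul 2 0 a₂).comp ((powZ 2).comp (opW2 hq)) + (seriesMul 2 0 a₃).comp (opW2 hq)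
    + (seriesMul 2 0 a₄).comp ((powZ 1).comp (opW1 hq))

/-- The perturbation of the boundary condition. -/
noncomputable def pertBoundary (b₁ b₂ : ℤ → ℝ) : ModeData →L[ℝ] Coef Unit :=
  (-τ) • (seriesMul 3 1 b₁).comp (opTX hq) + (seriesMul 3 0 b₂).comp (opT0 hq)

theorem FourierBound.norm_comp_le {Z : Type} [TopologicalSpace Z] {s : ℕ} {ε : ℝ} {a : ℤ → ℝ}
    (ha : FourierBound s ε a) (e : ℕ) (T : ModeData →L[ℝ] Coef Z) :
    ‖(seriesMul s e a).comp T‖ ≤ ε * ‖T‖ := by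
  refine (ContinuousLinearMap.opNorm_comp_le _ _).trans ?_
  gcongr
  exact ha.norm_seriesMul_le e

theorem norm_pertEquation_le {τ : ℝ} (hτ : 0 < τ) {ε : ℝ} (hε : 0 < ε) {a₁ a₂ a₃ a₄ : ℤ → ℝ}
    (ha₁ : FourierBound 2 ε a₁) (ha₂ : FourierBound 2 ε a₂) (ha₃ : FourierBound 2 ε a₃)
    (ha₄ : FourierBound 2 ε a₄) :
    ‖pertEquation hq τ a₁ a₂ a₃ a₄‖ ≤ ε * (τ * (‖powZ 1‖ * ‖opX11 hq‖) + ‖powZ 2‖ * ‖opW2 hq‖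
      + ‖opW2 hq‖ + ‖powZ 1‖ * ‖opW1 hq‖) := by
  have n1 := (ha₁.norm_comp_le 1 ((powZ 1).comp (opX11 hq))).trans
    (mul_le_mul_of_nonneg_left ((powZ 1).opNorm_comp_le (opX11 hq)) hε.le)
  have n2 := (ha₂.norm_comp_le 0 ((powZ 2).comp (opW2 hq))).trans
    (mul_le_mul_of_nonneg_left ((powZ 2).opNorm_comp_le (opW2 hq)) hε.le)
  have n3 := ha₃.norm_comp_le 0 (opW2 hq)
  have n4 := (ha₄.norm_comp_le 0 ((powZ 1).comp (opW1 hq))).trans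
    (mul_le_mul_of_nonneg_left ((powZ 1).opNorm_comp_le (opW1 hq)) hε.le)
  have n1' := mul_le_mul_of_nonneg_left n1 hτ.le
  have hs : ‖(-τ) • (seriesMul 2 1 a₁).comp ((powZ 1).comp (opX11 hq))‖
      = τ * ‖(seriesMul 2 1 a₁).comp ((powZ 1).comp (opX11 hq))‖ := by
    rw [norm_smul, norm_neg, Real.norm_eq_abs, abs_of_pos hτ]
  refine (norm_add₄_le (E := ModeData →L[ℝ] Coef ℝ)).trans ?_
  rw [hs]
  linarith

theorem norm_pertBoundary_le {τ : ℝ} (hτ : 0 < τ) {ε : ℝ} {b₁ b₂ : ℤ → ℝ}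
    (hb₁ : FourierBound 3 ε b₁) (hb₂ : FourierBound 3 ε b₂) :
    ‖pertBoundary hq τ b₁ b₂‖ ≤ ε * (τ * ‖opTX hq‖ + ‖opT0 hq‖) := by
  have n1 := mul_le_mul_of_nonneg_left (hb₁.norm_comp_le 1 (opTX hq)) hτ.le
  have n2 := hb₂.norm_comp_le 0 (opT0 hq)
  have hs : ‖(-τ) • (seriesMul 3 1 b₁).comp (opTX hq)‖
      = τ * ‖(seriesMul 3 1 b₁).comp (opTX hq)‖ := by
    rw [norm_smul, norm_neg, Real.norm_eq_abs, abs_of_pos hτ]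
  refine (norm_add_le (E := ModeData →L[ℝ] Coef Unit) _ _).trans ?_
  rw [hs]
  linarith

theorem modeSum_trace {u v : ModeData} (y : ℝ) :
    trigSum 2 0 (opW0 hq u) y 1 - trigSum 2 0 (opW0 hq v) y 1
      = trigSum 2 0 (opW0 hq (u - v)) y 1 := by
  rw [map_sub, trigSum_sub_coef le_rfl]

theorem abs_modeSum_trace_le (u : ModeData) (y : ℝ) :
    |trigSum 2 0 (opW0 hq u) y 1| ≤ (∑' k : ℤ, 1 / (1 + |(k : ℝ)|) ^ 2) * ‖opW0 hq‖ * ‖u‖ := by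
  refine (abs_trigSum_le le_rfl _ _ _ _).trans ?_
  have : 0 ≤ ∑' k : ℤ, 1 / (1 + |(k : ℝ)|) ^ 2 := tsum_nonneg fun k => by positivity
  rw [mul_assoc]
  gcongr
  exact (opW0 hq).le_opNorm _

theorem trigSum_opT0 (v : ModeData) (y : ℝ) :
    trigSum 3 0 (opT0 hq v) y () = trigSum 2 0 (opW0 hq v) y 1 :=
  trigSum_three_of_eq 0 (fun k => by
    rw [opT0_apply, opW0, modeOp_apply, clampZ_of_mem one_mem_Icc, one_mul]) y

theorem trigSum_opT1 (v : ModeData) (y : ℝ) :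
    trigSum 3 0 (opT1 hq v) y () = trigSum 2 0 (opW1 hq v) y 1 :=
  trigSum_three_of_eq 0 (fun k => by
    rw [opT1_apply, opW1, modeOp_apply, clampZ_of_mem one_mem_Icc, one_mul]) y

theorem trigSum_opTX (v : ModeData) (y : ℝ) :
    trigSum 3 1 (opTX hq v) y () = trigSum 2 1 (opX1 hq v) y 1 :=
  trigSum_three_of_eq 1 (fun k => by
    rw [opTX, ContinuousLinearMap.comp_apply, traceOp_apply, opX1, modeOp_apply, modeOp_apply,
      mul_assoc]) y

variable {τ}

theorem modeSum_pertEquation {ε : ℝ} {a₁ a₂ a₃ a₄ : ℤ → ℝ} (hτ : 0 < τ)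
    (ha₁ : FourierBound 2 ε a₁) (ha₂ : FourierBound 2 ε a₂) (ha₃ : FourierBound 2 ε a₃)
    (ha₄ : FourierBound 2 ε a₄) {u : ModeData} (hu : u.1 = pertEquation hq τ a₁ a₂ a₃ a₄ u)
    (x : ℝ) {z : ℝ} (h0 : 0 ≤ z) (h1 : z ≤ 1) :
    dY (dY (modeSum hq τ u)) x z + (q / τ) ^ 2 * dX (dX (modeSum hq τ u)) x z
      = trigSeries τ 1 a₁ x * (z * dX (dY (modeSum hq τ u)) x z)
        + (trigSeries τ 0 a₂ x * z ^ 2 + trigSeries τ 0 a₃ x) * dY (dY (modeSum hq τ u)) x z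
        + trigSeries τ 0 a₄ x * (z * dY (modeSum hq τ u) x z) := by
  have hz : z ∈ Set.Ioo (-1 : ℝ) 2 := ⟨by linarith, by linarith⟩
  have hz' := Set.Ioo_subset_Icc_self hz
  have heq := modeSum_equation hq (τ := τ) u x h0 h1
  have h4 : trigSum 2 0 u.1 (τ * x) z = -τ * (trigSeries τ 1 a₁ x
        * (z ^ 1 * trigSum 2 1 (opX11 hq u) (τ * x) z))
      + trigSeries τ 0 a₂ x * (z ^ 2 * trigSum 2 0 (opW2 hq u) (τ * x) z)
      + trigSeries τ 0 a₃ x * trigSum 2 0 (opW2 hq u) (τ * x) z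
      + trigSeries τ 0 a₄ x * (z ^ 1 * trigSum 2 0 (opW1 hq u) (τ * x) z) := by
    rw [hu]
    change trigSum 2 0 ((-τ) • seriesMul 2 1 a₁ (powZ 1 (opX11 hq u))
      + seriesMul 2 0 a₂ (powZ 2 (opW2 hq u)) + seriesMul 2 0 a₃ (opW2 hq u)
      + seriesMul 2 0 a₄ (powZ 1 (opW1 hq u))) (τ * x) z = _
    rw [trigSum_add_coef le_rfl, trigSum_add_coef le_rfl, trigSum_add_coef le_rfl,
      trigSum_smul_coef le_rfl, ha₁.trigSum_seriesMul le_rfl le_rfl,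
      ha₂.trigSum_seriesMul le_rfl (by norm_num),
      ha₃.trigSum_seriesMul le_rfl (by norm_num),
      ha₄.trigSum_seriesMul le_rfl (by norm_num),
      trigSum_powZ _ _ _ _ _ hz', trigSum_powZ _ _ _ _ _ hz', trigSum_powZ _ _ _ _ _ hz']
    simp only [trigSeries]
  rw [h4] at heq
  rw [dYY_modeSum hq u x hz, dXX_modeSum, dXY_modeSum hq u x hz, dY_modeSum hq u x hz]
  have h3 : (q / τ) ^ 2 * -(τ ^ 2 * trigSum 2 0 (opX2 hq u) (τ * x) z)
      = -(q ^ 2 * trigSum 2 0 (opX2 hq u) (τ * x) z) := by field_simp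
  rw [h3]
  linear_combination heq

theorem modeSum_pertBoundary {ε : ℝ} {b₁ b₂ b₃ : ℤ → ℝ} (hb₁ : FourierBound 3 ε b₁)
    (hb₂ : FourierBound 3 ε b₂) (hb₃ : FourierBound 3 ε b₃) {u : ModeData} {K : ℕ} {m e₃ : ℝ}
    (hu : opT1 hq u - modeNu q K • opT0 hq u + -pertBoundary hq τ b₁ b₂ u
      = m • (e₃ • opT0 hq u + seriesMul 3 0 b₃ (opT0 hq u))) (x : ℝ) :
    dY (modeSum hq τ u) x 1 = trigSeries τ 1 b₁ x * dX (modeSum hq τ u) x 1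
      + (modeNu q K + trigSeries τ 0 b₂ x + m * (e₃ + trigSeries τ 0 b₃ x))
        * modeSum hq τ u x 1 := by
  have h2 : (2 : ℕ) ≤ 3 := by norm_num
  have one_mem : (1 : ℝ) ∈ Set.Ioo (-1 : ℝ) 2 := by constructor <;> norm_num
  have h3 := congrArg (fun v => trigSum 3 0 v (τ * x) ()) hu
  have h4 : pertBoundary hq τ b₁ b₂ u = (-τ) • seriesMul 3 1 b₁ (opTX hq u)
    + seriesMul 3 0 b₂ (opT0 hq u) := rfl
  simp only [h4] at h3
  rw [← sub_eq_add_neg, trigSum_sub_coef h2, trigSum_sub_coef h2, trigSum_smul_coef h2,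
    trigSum_add_coef h2, trigSum_smul_coef h2, trigSum_smul_coef h2, trigSum_add_coef h2,
    trigSum_smul_coef h2, hb₁.trigSum_seriesMul h2 le_rfl,
    hb₂.trigSum_seriesMul h2 (by norm_num), hb₃.trigSum_seriesMul h2 (by norm_num),
    trigSum_opT0, trigSum_opT1, trigSum_opTX] at h3
  rw [dY_modeSum hq u x one_mem, dX_modeSum]
  unfold trigSeries modeSum
  linear_combination h3

end

/-- The flattened spectral problem has an eigenfunction close to `cos (Kτx)` on `z = 1`, if the
coefficients are close to the ones of the unperturbed problem. -/
theorem exists_flattened_eigenfunction {q τ : ℝ} (hq : 0 < q) (hτ : 0 < τ) (K : ℕ) {e₃ : ℝ}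
    (he₃ : e₃ ≠ 0) :
    ∃ δ > 0, ∃ C > 0, ∀ ε, 0 < ε → ε ≤ δ → ∀ a₁ a₂ a₃ a₄ b₁ b₂ b₃ : ℤ → ℝ,
      FourierBound 3 ε a₁ → FourierBound 3 ε a₂ → FourierBound 3 ε a₃ → FourierBound 3 ε a₄ →
      FourierBound 3 ε b₁ → FourierBound 3 ε b₂ → FourierBound 3 ε b₃ →
      ∃ (m : ℝ) (w : ℝ → ℝ → ℝ), |m| ≤ C * ε ∧
        (∀ x, |w x 1 - Real.cos (K * (τ * x))| ≤ C * ε) ∧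
        (∀ x, ∀ z ∈ Set.Ioo (-1 : ℝ) 2, ContDiffAt ℝ 2 (fun p : ℝ × ℝ => w p.1 p.2) (x, z)) ∧
        (∀ x z, w (-x) z = w x z) ∧ (∀ x z, w (x + 2 * Real.pi / τ) z = w x z) ∧
        (∀ x, w x 0 = 0) ∧
        (∀ x z, 0 ≤ z → z ≤ 1 → dY (dY w) x z + (q / τ) ^ 2 * dX (dX w) x z
          = trigSeries τ 1 a₁ x * (z * dX (dY w) x z)
            + (trigSeries τ 0 a₂ x * z ^ 2 + trigSeries τ 0 a₃ x) * dY (dY w) x z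
            + trigSeries τ 0 a₄ x * (z * dY w x z)) ∧
        (∀ x, dY w x 1 = trigSeries τ 1 b₁ x * dX w x 1
          + (modeNu q K + trigSeries τ 0 b₂ x + m * (e₃ + trigSeries τ 0 b₃ x)) * w x 1) := by
  have hH := modeH_pos hq K
  have hN0 := cosWeight_pos K
  set A : ModeData →L[ℝ] ModeData := (ContinuousLinearMap.fst ℝ _ _).prod
    (opT1 hq - modeNu q K • opT0 hq) with hA
  set B : ModeData →L[ℝ] ModeData := (0 : ModeData →L[ℝ] Coef ℝ).prod (e₃ • opT0 hq) with hB
  set ℓ : ModeData →L[ℝ] ℝ := (1 : ℝ) • (coefEval (K, ())).comp (opT0 hq) with hl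
  have hAx : A (cosDatum hq K) = 0 := by
    refine Prod.ext rfl (Coef.ext fun k x => ?_)
    change (opT1 hq (cosDatum hq K) - modeNu q K • opT0 hq (cosDatum hq K)) (k, x) = 0
    rw [Coef.sub_apply, Coef.smul_apply, opT1_apply, opT0_apply, modeFn_zero_cosDatum,
      modeFn_one_cosDatum]
    split_ifs <;> ring
  have hbij := bijective_linearization hq K he₃ one_ne_zero (cosDatum hq K) rfl
    (fun k hk => by rw [cosDatum_snd, if_neg hk]) (by rw [cosDatum_snd, if_pos rfl]; positivity)
  obtain ⟨δ, hδ, C, hC, hLS⟩ := exists_perturbed_eigenpair A B ℓ (cosDatum hq K) hAx hbij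
  set D₁ : ℝ := τ * (‖powZ 1‖ * ‖opX11 hq‖) + ‖powZ 2‖ * ‖opW2 hq‖ + ‖opW2 hq‖
    + ‖powZ 1‖ * ‖opW1 hq‖ with hD₁
  set D₂ : ℝ := τ * ‖opTX hq‖ + ‖opT0 hq‖ with hD₂
  have hD₁0 : 0 ≤ D₁ := by positivity
  have hD₂0 : 0 ≤ D₂ := by positivity
  set D : ℝ := 1 + D₁ + D₂ with hD
  have hD0 : 0 < D := by positivity
  set S : ℝ := (∑' k : ℤ, 1 / (1 + |(k : ℝ)|) ^ 2) * ‖opW0 hq‖ with hS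
  have hS0 : 0 ≤ S := by
    have : 0 ≤ ∑' k : ℤ, 1 / (1 + |(k : ℝ)|) ^ 2 := tsum_nonneg fun k => by positivity
    positivity
  refine ⟨δ / D, by positivity, C * D * (1 + S), by positivity, ?_⟩
  intro ε hε hεδ a₁ a₂ a₃ a₄ b₁ b₂ b₃ ha₁ ha₂ ha₃ ha₄ hb₁ hb₂ hb₃
  have h2 : (2 : ℕ) ≤ 3 := by norm_num
  have hE1 : ‖(-pertEquation hq τ a₁ a₂ a₃ a₄).prod (-pertBoundary hq τ b₁ b₂)‖ ≤ D * ε := by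
    rw [ContinuousLinearMap.opNorm_prod, Prod.norm_def]
    refine max_le ?_ ?_
    · refine (norm_neg (pertEquation hq τ a₁ a₂ a₃ a₄)).trans_le
        ((norm_pertEquation_le hq hτ hε (ha₁.mono h2) (ha₂.mono h2) (ha₃.mono h2)
          (ha₄.mono h2)).trans ?_)
      rw [mul_comm]; gcongr; linarith
    · refine (norm_neg (pertBoundary hq τ b₁ b₂)).trans_le
        ((norm_pertBoundary_le hq hτ hb₁ hb₂).trans ?_)
      rw [mul_comm]; gcongr; linarith
  have hE2 : ‖(0 : ModeData →L[ℝ] Coef ℝ).prod ((seriesMul 3 0 b₃).comp (opT0 hq))‖ ≤ D * ε := by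
    rw [ContinuousLinearMap.opNorm_prod, Prod.norm_def]
    refine max_le (norm_zero.trans_le (by positivity)) ((hb₃.norm_comp_le 0 (opT0 hq)).trans ?_)
    have : ‖opT0 hq‖ ≤ D₂ := by rw [hD₂]; linarith [show 0 ≤ τ * ‖opTX hq‖ by positivity]
    rw [mul_comm]; gcongr; linarith
  obtain ⟨u, m, hu, hm, hux⟩ := hLS (D * ε) (by positivity)
    (by rw [le_div_iff₀ (by positivity)] at hεδ; linarith) _ _ hE1 hE2
  have hu1 : u.1 = pertEquation hq τ a₁ a₂ a₃ a₄ u := by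
    have h := congrArg Prod.fst hu
    have h' : u.1 + -pertEquation hq τ a₁ a₂ a₃ a₄ u = m • ((0 : Coef ℝ) + 0) := h
    rw [add_zero, smul_zero] at h'
    exact (sub_eq_zero.1 (by rw [sub_eq_add_neg]; exact h'))
  have hu2 : opT1 hq u - modeNu q K • opT0 hq u + -pertBoundary hq τ b₁ b₂ u
      = m • (e₃ • opT0 hq u + seriesMul 3 0 b₃ (opT0 hq u)) := congrArg Prod.snd hu
  refine ⟨m, modeSum hq τ u, ?_, ?_, fun x z hz => contDiffAt_modeSum hq u x hz, ?_, ?_,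
    fun x => modeSum_zero hq u x, fun x z h0 h1 => modeSum_pertEquation hq hτ (ha₁.mono h2)
      (ha₂.mono h2) (ha₃.mono h2) (ha₄.mono h2) hu1 x h0 h1,
    fun x => modeSum_pertBoundary hq hb₁ hb₂ hb₃ hu2 x⟩
  · calc |m| ≤ C * (D * ε) := hm
      _ = C * D * 1 * ε := by ring
      _ ≤ _ := by gcongr; linarith
  · intro x
    rw [modeSum, ← trigSum_cosDatum hq K (τ * x), modeSum_trace]
    calc _ ≤ S * ‖u - cosDatum hq K‖ := abs_modeSum_trace_le hq _ _
      _ ≤ (1 + S) * (C * (D * ε)) := by gcongr; linarith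
      _ = _ := by ring
  · intro x z
    unfold modeSum
    rw [mul_neg, trigSum_cos_neg]
  · intro x z
    unfold modeSum
    rw [mul_add, mul_div_cancel₀ _ hτ.ne', trigSum_add_two_pi]

section Partials

theorem hasDerivAt_prodMk_left (x y : ℝ) : HasDerivAt (fun s : ℝ => (s, y)) ((1 : ℝ), (0 : ℝ)) x :=
  (hasDerivAt_id' x).prodMk (hasDerivAt_const x y)

theorem hasDerivAt_prodMk_right (x y : ℝ) : HasDerivAt (fun s : ℝ => (x, s)) ((0 : ℝ), (1 : ℝ)) y :=
  (hasDerivAt_const y x).prodMk (hasDerivAt_id' y)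

theorem DifferentiableAt.hasDerivAt_curve {E : Type*} [NormedAddCommGroup E] [NormedSpace ℝ E]
    {F : E → ℝ} {p : E} (h : DifferentiableAt ℝ F p) {γ : ℝ → E} {γ' : E} {r : ℝ}
    (hγ : HasDerivAt γ γ' r) (hp : γ r = p) : HasDerivAt (fun s => F (γ s)) (fderiv ℝ F p γ') r := by
  subst hp
  exact h.hasFDerivAt.comp_hasDerivAt r hγ

theorem AnalyticAt.fderiv_apply {E : Type*} [NormedAddCommGroup E] [NormedSpace ℝ E]
    {F : E → ℝ} {p : E} (h : AnalyticAt ℝ F p) (e : E) :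
    AnalyticAt ℝ (fun r => fderiv ℝ F r e) p :=
  ((ContinuousLinearMap.apply ℝ ℝ e).analyticAt _).comp h.fderiv

variable {v : ℝ → ℝ → ℝ} {x y : ℝ}

theorem DifferentiableAt.hasDerivAt_dX
    (h : DifferentiableAt ℝ (fun p : ℝ × ℝ => v p.1 p.2) (x, y)) :
    HasDerivAt (fun s => v s y) (dX v x y) x :=
  (h.hasDerivAt_curve (hasDerivAt_prodMk_left x y) rfl).differentiableAt.hasDerivAt

theorem DifferentiableAt.hasDerivAt_dY
    (h : DifferentiableAt ℝ (fun p : ℝ × ℝ => v p.1 p.2) (x, y)) :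
    HasDerivAt (fun s => v x s) (dY v x y) y :=
  (h.hasDerivAt_curve (hasDerivAt_prodMk_right x y) rfl).differentiableAt.hasDerivAt

theorem DifferentiableAt.dX_eq (h : DifferentiableAt ℝ (fun p : ℝ × ℝ => v p.1 p.2) (x, y)) :
    dX v x y = fderiv ℝ (fun p : ℝ × ℝ => v p.1 p.2) (x, y) (1, 0) :=
  (h.hasDerivAt_curve (hasDerivAt_prodMk_left x y) rfl).deriv

theorem DifferentiableAt.dY_eq (h : DifferentiableAt ℝ (fun p : ℝ × ℝ => v p.1 p.2) (x, y)) :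
    dY v x y = fderiv ℝ (fun p : ℝ × ℝ => v p.1 p.2) (x, y) (0, 1) :=
  (h.hasDerivAt_curve (hasDerivAt_prodMk_right x y) rfl).deriv

theorem DifferentiableAt.hasDerivAt_comp₂ {f g : ℝ → ℝ} {f' g' r : ℝ}
    (h : DifferentiableAt ℝ (fun p : ℝ × ℝ => v p.1 p.2) (f r, g r))
    (hf : HasDerivAt f f' r) (hg : HasDerivAt g g' r) :
    HasDerivAt (fun s => v (f s) (g s)) (dX v (f r) (g r) * f' + dY v (f r) (g r) * g') r := by
  have h1 := h.hasDerivAt_curve (hf.prodMk hg) rfl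
  have h2 : ((f', g') : ℝ × ℝ) = f' • (1, 0) + g' • (0, 1) := by simp
  rw [h2, map_add, map_smul, map_smul, ← h.dX_eq, ← h.dY_eq] at h1
  refine h1.congr_deriv ?_
  simp only [smul_eq_mul]
  ring

theorem ContDiffAt.eventually_differentiableAt {n : ℕ} {v : ℝ × ℝ → ℝ} {p : ℝ × ℝ}
    (h : ContDiffAt ℝ (n + 1) v p) : ∀ᶠ r in 𝓝 p, DifferentiableAt ℝ v r := by
  filter_upwards [h.eventually (by exact_mod_cast WithTop.coe_ne_top)] with r hr
  exact hr.differentiableAt (by simp)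

theorem ContDiffAt.dX {n : ℕ} {p : ℝ × ℝ}
    (h : ContDiffAt ℝ (n + 1) (fun p : ℝ × ℝ => v p.1 p.2) p) :
    ContDiffAt ℝ n (fun p : ℝ × ℝ => dX v p.1 p.2) p := by
  have h1 : ContDiffAt ℝ n (fun r => fderiv ℝ (fun p : ℝ × ℝ => v p.1 p.2) r (1, 0)) p :=
    (h.fderiv_right le_rfl).clm_apply contDiffAt_const
  refine h1.congr_of_eventuallyEq ?_
  filter_upwards [h.eventually_differentiableAt] with r hr using hr.dX_eq

theorem ContDiffAt.dY {n : ℕ} {p : ℝ × ℝ}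
    (h : ContDiffAt ℝ (n + 1) (fun p : ℝ × ℝ => v p.1 p.2) p) :
    ContDiffAt ℝ n (fun p : ℝ × ℝ => dY v p.1 p.2) p := by
  have h1 : ContDiffAt ℝ n (fun r => fderiv ℝ (fun p : ℝ × ℝ => v p.1 p.2) r (0, 1)) p :=
    (h.fderiv_right le_rfl).clm_apply contDiffAt_const
  refine h1.congr_of_eventuallyEq ?_
  filter_upwards [h.eventually_differentiableAt] with r hr using hr.dY_eq

theorem ContDiffAt.dX_dY_comm (h : ContDiffAt ℝ 2 (fun p : ℝ × ℝ => v p.1 p.2) (x, y)) :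
    _root_.dX (_root_.dY v) x y = _root_.dY (_root_.dX v) x y := by
  have h' : ContDiffAt ℝ ((1 : ℕ) + 1) (fun p : ℝ × ℝ => v p.1 p.2) (x, y) := by
    norm_num; exact h
  have hd := (h'.fderiv_right (m := 1) (by norm_num)).differentiableAt (by simp)
  have hsym := h.isSymmSndFDerivAt (by simp)
  have e1 := h'.eventually_differentiableAt
  have hD : ∀ e, DifferentiableAt ℝ (fun r => fderiv ℝ (fun p : ℝ × ℝ => v p.1 p.2) r e) (x, y) ∧
      ∀ e', fderiv ℝ (fun r => fderiv ℝ (fun p : ℝ × ℝ => v p.1 p.2) r e) (x, y) e'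
        = fderiv ℝ (fderiv ℝ (fun p : ℝ × ℝ => v p.1 p.2)) (x, y) e' e := by
    intro e
    have := (ContinuousLinearMap.apply ℝ ℝ e).hasFDerivAt.comp (x, y) hd.hasFDerivAt
    exact ⟨this.differentiableAt, fun e' => by
      rw [show fderiv ℝ (fun r => fderiv ℝ (fun p : ℝ × ℝ => v p.1 p.2) r e) (x, y) = _ from
        this.fderiv]; rfl⟩
  have hX : _root_.dX (_root_.dY v) x y
      = fderiv ℝ (fun r => fderiv ℝ (fun p : ℝ × ℝ => v p.1 p.2) r (0, 1)) (x, y) (1, 0) := by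
    rw [← ((hD (0, 1)).1.hasDerivAt_curve (hasDerivAt_prodMk_left x y) rfl).deriv]
    refine Filter.EventuallyEq.deriv_eq ?_
    have := (hasDerivAt_prodMk_left x y).continuousAt.eventually e1
    filter_upwards [this] with s hs using hs.dY_eq
  have hY : _root_.dY (_root_.dX v) x y
      = fderiv ℝ (fun r => fderiv ℝ (fun p : ℝ × ℝ => v p.1 p.2) r (1, 0)) (x, y) (0, 1) := by
    rw [← ((hD (1, 0)).1.hasDerivAt_curve (hasDerivAt_prodMk_right x y) rfl).deriv]
    refine Filter.EventuallyEq.deriv_eq ?_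
    have := (hasDerivAt_prodMk_right x y).continuousAt.eventually e1
    filter_upwards [this] with s hs using hs.dX_eq
  rw [hX, hY, (hD _).2, (hD _).2]
  exact hsym.eq _ _

theorem AnalyticAt.dX {p : ℝ × ℝ} (h : AnalyticAt ℝ (fun p : ℝ × ℝ => v p.1 p.2) p) :
    AnalyticAt ℝ (fun p : ℝ × ℝ => dX v p.1 p.2) p := by
  have h1 : AnalyticAt ℝ (fun r => fderiv ℝ (fun p : ℝ × ℝ => v p.1 p.2) r (1, 0)) p :=
    h.fderiv_apply _
  refine h1.congr ?_
  filter_upwards [h.eventually_analyticAt] with r hr using hr.differentiableAt.dX_eq.symm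

theorem AnalyticAt.dY {p : ℝ × ℝ} (h : AnalyticAt ℝ (fun p : ℝ × ℝ => v p.1 p.2) p) :
    AnalyticAt ℝ (fun p : ℝ × ℝ => dY v p.1 p.2) p := by
  have h1 : AnalyticAt ℝ (fun r => fderiv ℝ (fun p : ℝ × ℝ => v p.1 p.2) r (0, 1)) p :=
    h.fderiv_apply _
  refine h1.congr ?_
  filter_upwards [h.eventually_analyticAt] with r hr using hr.differentiableAt.dY_eq.symm

end Partials

section ThreeVariables

variable {ψ : ℝ → ℝ → ℝ → ℝ} {t x y : ℝ}

/-- The partial derivative in the first of three variables. -/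
noncomputable def dT (ψ : ℝ → ℝ → ℝ → ℝ) (t x y : ℝ) : ℝ := deriv (fun s => ψ s x y) t

/-- Joint analyticity of a function of three variables. -/
def Analytic₃ (ψ : ℝ → ℝ → ℝ → ℝ) (t x y : ℝ) : Prop :=
  AnalyticAt ℝ (fun p : ℝ × ℝ × ℝ => ψ p.1 p.2.1 p.2.2) (t, x, y)

theorem analyticAt_prodMk₃ {f g h : ℝ × ℝ → ℝ} {p : ℝ × ℝ} (hf : AnalyticAt ℝ f p)
    (hg : AnalyticAt ℝ g p) (hh : AnalyticAt ℝ h p) :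
    AnalyticAt ℝ (fun r => (f r, g r, h r)) p := hf.prod (hg.prod hh)

theorem Analytic₃.comp₂ {f g h : ℝ × ℝ → ℝ} {p : ℝ × ℝ} (hψ : Analytic₃ ψ (f p) (g p) (h p))
    (hf : AnalyticAt ℝ f p) (hg : AnalyticAt ℝ g p) (hh : AnalyticAt ℝ h p) :
    AnalyticAt ℝ (fun r => ψ (f r) (g r) (h r)) p :=
  AnalyticAt.fun_comp (g := fun q : ℝ × ℝ × ℝ => ψ q.1 q.2.1 q.2.2)
    (f := fun r => (f r, g r, h r)) hψ (analyticAt_prodMk₃ hf hg hh)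

theorem Analytic₃.slice_xy (h : Analytic₃ ψ t x y) :
    AnalyticAt ℝ (fun p : ℝ × ℝ => ψ t p.1 p.2) (x, y) :=
  Analytic₃.comp₂ (f := fun _ => t) (g := Prod.fst) (h := Prod.snd) (p := (x, y)) h
    analyticAt_const analyticAt_fst analyticAt_snd

theorem Analytic₃.slice_ty (h : Analytic₃ ψ t x y) :
    AnalyticAt ℝ (fun p : ℝ × ℝ => ψ p.1 x p.2) (t, y) :=
  Analytic₃.comp₂ (f := Prod.fst) (g := fun _ => x) (h := Prod.snd) (p := (t, y)) h
    analyticAt_fst analyticAt_const analyticAt_snd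

theorem Analytic₃.slice_tx (h : Analytic₃ ψ t x y) :
    AnalyticAt ℝ (fun p : ℝ × ℝ => ψ p.1 p.2 y) (t, x) :=
  Analytic₃.comp₂ (f := Prod.fst) (g := Prod.snd) (h := fun _ => y) (p := (t, x)) h
    analyticAt_fst analyticAt_snd analyticAt_const

theorem Analytic₃.eventually (h : Analytic₃ ψ t x y) :
    ∀ᶠ r : ℝ × ℝ × ℝ in 𝓝 (t, x, y), Analytic₃ ψ r.1 r.2.1 r.2.2 :=
  h.eventually_analyticAt

theorem Analytic₃.partial {D : ℝ → ℝ → ℝ → ℝ} (e : ℝ × ℝ × ℝ) (h : Analytic₃ ψ t x y)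
    (hD : ∀ t x y, Analytic₃ ψ t x y →
      D t x y = fderiv ℝ (fun p : ℝ × ℝ × ℝ => ψ p.1 p.2.1 p.2.2) (t, x, y) e) :
    Analytic₃ D t x y := by
  have h1 : AnalyticAt ℝ (fun r => fderiv ℝ (fun p : ℝ × ℝ × ℝ => ψ p.1 p.2.1 p.2.2) r e) (t, x, y) :=
    AnalyticAt.fderiv_apply h _
  refine h1.congr ?_
  filter_upwards [h.eventually] with r hr using (hD _ _ _ hr).symm

theorem Analytic₃.dT (h : Analytic₃ ψ t x y) : Analytic₃ (dT ψ) t x y :=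
  h.partial (1, 0, 0) fun t x y h =>
    (DifferentiableAt.hasDerivAt_curve (F := fun p : ℝ × ℝ × ℝ => ψ p.1 p.2.1 p.2.2)
      (AnalyticAt.differentiableAt h) (r := t)
      ((hasDerivAt_id' t).prodMk (hasDerivAt_const t (x, y))) rfl).deriv

theorem Analytic₃.dX (h : Analytic₃ ψ t x y) : Analytic₃ (fun t => dX (ψ t)) t x y :=
  h.partial (0, 1, 0) fun t x y h =>
    (DifferentiableAt.hasDerivAt_curve (F := fun p : ℝ × ℝ × ℝ => ψ p.1 p.2.1 p.2.2)
      (AnalyticAt.differentiableAt h) (r := x)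
      ((hasDerivAt_const x t).prodMk ((hasDerivAt_id' x).prodMk (hasDerivAt_const x y))) rfl).deriv

theorem Analytic₃.dY (h : Analytic₃ ψ t x y) : Analytic₃ (fun t => dY (ψ t)) t x y :=
  h.partial (0, 0, 1) fun t x y h =>
    (DifferentiableAt.hasDerivAt_curve (F := fun p : ℝ × ℝ × ℝ => ψ p.1 p.2.1 p.2.2)
      (AnalyticAt.differentiableAt h) (r := y)
      ((hasDerivAt_const y t).prodMk ((hasDerivAt_const y x).prodMk (hasDerivAt_id' y))) rfl).deriv

theorem Analytic₃.dT_dX (h : Analytic₃ ψ t x y) :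
    _root_.dT (fun t => _root_.dX (ψ t)) t x y = _root_.dX (_root_.dT ψ t) x y :=
  ContDiffAt.dX_dY_comm (v := fun t x => ψ t x y) (x := t) (y := x) h.slice_tx.contDiffAt

theorem Analytic₃.dT_dY (h : Analytic₃ ψ t x y) :
    _root_.dT (fun t => _root_.dY (ψ t)) t x y = _root_.dY (_root_.dT ψ t) x y :=
  ContDiffAt.dX_dY_comm (v := fun t y => ψ t x y) (x := t) (y := y) h.slice_ty.contDiffAt

end ThreeVariables

section ParametricIntegral

theorem continuousOn_prod_Icc {f : ℝ → ℝ → ℝ}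
    (hf : ∀ x, ∀ z ∈ Set.Icc (0 : ℝ) 1, ContinuousAt (fun p : ℝ × ℝ => f p.1 p.2) (x, z)) :
    ContinuousOn (fun p : ℝ × ℝ => f p.1 p.2) (Set.univ ×ˢ Set.Icc 0 1) :=
  fun p hp => (hf p.1 p.2 hp.2).continuousWithinAt

theorem continuous_clamped {f : ℝ → ℝ → ℝ}
    (hf : ContinuousOn (fun p : ℝ × ℝ => f p.1 p.2) (Set.univ ×ˢ Set.Icc 0 1)) :
    Continuous (fun p : ℝ × ℝ => f p.1 (max 0 (min 1 p.2))) := by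
  refine hf.comp_continuous (f := fun p : ℝ × ℝ => (p.1, max 0 (min 1 p.2))) (by fun_prop)
    fun p => ⟨trivial, le_max_left _ _, max_le zero_le_one (min_le_left _ _)⟩

theorem clamped_of_mem {z : ℝ} (hz : z ∈ Set.Icc (0 : ℝ) 1) : max 0 (min 1 z) = z := by
  rw [min_eq_right hz.2, max_eq_right hz.1]

theorem integral_clamped (f : ℝ → ℝ → ℝ) (x : ℝ) :
    ∫ z in (0 : ℝ)..1, f x (max 0 (min 1 z)) = ∫ z in (0 : ℝ)..1, f x z := by
  refine intervalIntegral.integral_congr fun z hz => ?_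
  rw [Set.uIcc_of_le zero_le_one] at hz
  simp only [clamped_of_mem hz]

theorem continuous_integral_param {f : ℝ → ℝ → ℝ}
    (hf : ContinuousOn (fun p : ℝ × ℝ => f p.1 p.2) (Set.univ ×ˢ Set.Icc 0 1)) :
    Continuous (fun x => ∫ z in (0 : ℝ)..1, f x z) := by
  simp_rw [← integral_clamped f]
  exact intervalIntegral.continuous_parametric_intervalIntegral_of_continuous'
    (f := fun x z => f x (max 0 (min 1 z))) (continuous_clamped hf) 0 1

theorem continuousOn_slice {f : ℝ → ℝ → ℝ}
    (hf : ContinuousOn (fun p : ℝ × ℝ => f p.1 p.2) (Set.univ ×ˢ Set.Icc 0 1)) (x : ℝ) :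
    ContinuousOn (f x) (Set.Icc 0 1) :=
  hf.comp (f := fun z => (x, z)) (by fun_prop) fun _ hz => ⟨trivial, hz⟩

theorem intervalIntegrable_slice {f : ℝ → ℝ → ℝ}
    (hf : ContinuousOn (fun p : ℝ × ℝ => f p.1 p.2) (Set.univ ×ˢ Set.Icc 0 1)) (x : ℝ) :
    IntervalIntegrable (f x) MeasureTheory.volume 0 1 := by
  refine ContinuousOn.intervalIntegrable ?_
  rw [Set.uIcc_of_le zero_le_one]
  exact continuousOn_slice hf x

theorem hasDerivAt_integral_param {f f' : ℝ → ℝ → ℝ}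
    (hf : ContinuousOn (fun p : ℝ × ℝ => f p.1 p.2) (Set.univ ×ˢ Set.Icc 0 1))
    (hf' : ContinuousOn (fun p : ℝ × ℝ => f' p.1 p.2) (Set.univ ×ˢ Set.Icc 0 1))
    (h : ∀ x, ∀ z ∈ Set.Icc (0 : ℝ) 1, HasDerivAt (fun x => f x z) (f' x z) x) (x : ℝ) :
    HasDerivAt (fun x => ∫ z in (0 : ℝ)..1, f x z) (∫ z in (0 : ℝ)..1, f' x z) x := by
  have hK : IsCompact (Set.Icc (x - 1) (x + 1) ×ˢ Set.Icc (0 : ℝ) 1) :=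
    isCompact_Icc.prod isCompact_Icc
  obtain ⟨C, hC⟩ := hK.exists_bound_of_continuousOn
    (hf'.mono (Set.prod_mono (Set.subset_univ _) subset_rfl))
  refine (intervalIntegral.hasDerivAt_integral_of_dominated_loc_of_deriv_le
    (F := f) (F' := f') (bound := fun _ => C) (s := Set.Icc (x - 1) (x + 1))
    (Icc_mem_nhds (by linarith) (by linarith)) ?_ (intervalIntegrable_slice hf x) ?_ ?_ ?_ ?_).2
  · exact Eventually.of_forall fun s => (intervalIntegrable_slice hf s).def'.aestronglyMeasurable
  · exact (intervalIntegrable_slice hf' x).def'.aestronglyMeasurable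
  · refine Eventually.of_forall fun z hz s hs => hC (s, z) ⟨hs, ?_⟩
    rw [Set.uIoc_of_le zero_le_one] at hz
    exact Set.Ioc_subset_Icc_self hz
  · exact intervalIntegrable_const
  · refine Eventually.of_forall fun z hz s _ => h s z ?_
    rw [Set.uIoc_of_le zero_le_one] at hz
    exact Set.Ioc_subset_Icc_self hz

theorem integral_congr_Ioo {f g : ℝ → ℝ} {a b : ℝ} (hab : a ≤ b)
    (h : ∀ z ∈ Set.Ioo a b, f z = g z) : ∫ z in a..b, f z = ∫ z in a..b, g z := by
  rw [intervalIntegral.integral_of_le hab, intervalIntegral.integral_of_le hab,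
    MeasureTheory.integral_Ioc_eq_integral_Ioo, MeasureTheory.integral_Ioc_eq_integral_Ioo]
  exact MeasureTheory.setIntegral_congr_fun measurableSet_Ioo h

end ParametricIntegral

/-- A solution of `lam² v_xx + v_yy = 0` below the graph of `η`, which vanishes on the bottom. -/
structure HarmonicBelow (Λ : ℝ) (η : ℝ → ℝ) (lam : ℝ) (v : ℝ → ℝ → ℝ) : Prop where
  smooth : ∀ x y, 0 ≤ y → y ≤ η x → ContDiffAt ℝ 2 (fun p : ℝ × ℝ => v p.1 p.2) (x, y)
  periodic : ∀ x y, 0 ≤ y → y ≤ η x → v (x + Λ) y = v x y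
  equation : ∀ x y, 0 < y → y < η x → lam ^ 2 * dX (dX v) x y + dY (dY v) x y = 0
  bottom : ∀ x, v x 0 = 0

theorem SolvesSpectralProblem.harmonicBelow {Λ lam μ : ℝ} {ψ v : ℝ → ℝ → ℝ} {η : ℝ → ℝ}
    (h : SolvesSpectralProblem Λ ψ η lam μ v) : HarmonicBelow Λ η lam v :=
  ⟨h.smooth, h.periodic, h.equation, h.bottom⟩

/-- The conormal derivative on the surface. -/
noncomputable def conormal (η : ℝ → ℝ) (lam : ℝ) (v : ℝ → ℝ → ℝ) (x : ℝ) : ℝ :=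
  dY v x (η x) - lam ^ 2 * deriv η x * dX v x (η x)

/-- The density of the Dirichlet form in the flattened variable `z = y / η x`. -/
noncomputable def energyDensity (η : ℝ → ℝ) (lam : ℝ) (u v : ℝ → ℝ → ℝ) (x z : ℝ) : ℝ :=
  (lam ^ 2 * dX u x (z * η x) * dX v x (z * η x) + dY u x (z * η x) * dY v x (z * η x)) * η x

/-- The Dirichlet form. -/
noncomputable def dirichletForm (Λ : ℝ) (η : ℝ → ℝ) (lam : ℝ) (u v : ℝ → ℝ → ℝ) : ℝ :=
  ∫ x in (0 : ℝ)..Λ, ∫ z in (0 : ℝ)..1, energyDensity η lam u v x z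

/-- A periodic positive `C¹` function. -/
structure SurfaceProfile (Λ : ℝ) (η : ℝ → ℝ) : Prop where
  period_pos : 0 < Λ
  smooth : ContDiff ℝ 1 η
  pos : ∀ x, 0 < η x
  periodic : ∀ x, η (x + Λ) = η x

section Green

variable {Λ lam : ℝ} {η : ℝ → ℝ} {u v : ℝ → ℝ → ℝ}

theorem SurfaceProfile.hasDerivAt (hη : SurfaceProfile Λ η) (x : ℝ) :
    HasDerivAt η (deriv η x) x := (hη.smooth.differentiable (by simp) x).hasDerivAt

theorem SurfaceProfile.continuous (hη : SurfaceProfile Λ η) : Continuous η := hη.smooth.continuous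

theorem SurfaceProfile.continuous_deriv (hη : SurfaceProfile Λ η) : Continuous (deriv η) :=
  hη.smooth.continuous_deriv (by simp)

theorem SurfaceProfile.mem (hη : SurfaceProfile Λ η) (x : ℝ) {z : ℝ} (hz : z ∈ Set.Icc (0 : ℝ) 1) :
    0 ≤ z * η x ∧ z * η x ≤ η x :=
  ⟨mul_nonneg hz.1 (hη.pos x).le, mul_le_of_le_one_left (hη.pos x).le hz.2⟩

/-- A function near the closed domain, in the flattened variable, is continuous. -/
theorem SurfaceProfile.continuousOn_flatten (hη : SurfaceProfile Λ η) {g : ℝ → ℝ → ℝ}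
    (hg : ∀ x y, 0 ≤ y → y ≤ η x → ContinuousAt (fun p : ℝ × ℝ => g p.1 p.2) (x, y)) :
    ContinuousOn (fun p : ℝ × ℝ => g p.1 (p.2 * η p.1)) (Set.univ ×ˢ Set.Icc 0 1) := by
  refine continuousOn_prod_Icc (f := fun x z => g x (z * η x)) fun x z hz => ?_
  have h1 := hη.mem x hz
  have hc : Continuous fun p : ℝ × ℝ => (p.1, p.2 * η p.1) :=
    continuous_fst.prodMk (continuous_snd.mul (hη.continuous.comp continuous_fst))
  exact ContinuousAt.comp (g := fun p : ℝ × ℝ => g p.1 p.2)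
    (f := fun p : ℝ × ℝ => (p.1, p.2 * η p.1)) (hg x _ h1.1 h1.2) hc.continuousAt

theorem SurfaceProfile.continuous_trace (hη : SurfaceProfile Λ η) {g : ℝ → ℝ → ℝ}
    (hg : ∀ x y, 0 ≤ y → y ≤ η x → ContinuousAt (fun p : ℝ × ℝ => g p.1 p.2) (x, y)) :
    Continuous fun x => g x (η x) := by
  have h := (hη.continuousOn_flatten hg).comp_continuous (f := fun x : ℝ => (x, (1 : ℝ)))
    (by fun_prop) fun x => ⟨trivial, by simp⟩
  exact h.congr fun x => by simp

namespace HarmonicBelow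

theorem contDiffAt_dX (hu : HarmonicBelow Λ η lam u) {x y : ℝ} (h0 : 0 ≤ y) (h1 : y ≤ η x) :
    ContDiffAt ℝ (1 : ℕ) (fun p : ℝ × ℝ => dX u p.1 p.2) (x, y) :=
  ContDiffAt.dX (by norm_num; exact hu.smooth x y h0 h1)

theorem contDiffAt_dY (hu : HarmonicBelow Λ η lam u) {x y : ℝ} (h0 : 0 ≤ y) (h1 : y ≤ η x) :
    ContDiffAt ℝ (1 : ℕ) (fun p : ℝ × ℝ => dY u p.1 p.2) (x, y) :=
  ContDiffAt.dY (by norm_num; exact hu.smooth x y h0 h1)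

theorem continuousAt (hu : HarmonicBelow Λ η lam u) (x y : ℝ) (h0 : 0 ≤ y) (h1 : y ≤ η x) :
    ContinuousAt (fun p : ℝ × ℝ => u p.1 p.2) (x, y) := (hu.smooth x y h0 h1).continuousAt

theorem continuousAt_dX (hu : HarmonicBelow Λ η lam u) (x y : ℝ) (h0 : 0 ≤ y) (h1 : y ≤ η x) :
    ContinuousAt (fun p : ℝ × ℝ => dX u p.1 p.2) (x, y) := (hu.contDiffAt_dX h0 h1).continuousAt

theorem continuousAt_dY (hu : HarmonicBelow Λ η lam u) (x y : ℝ) (h0 : 0 ≤ y) (h1 : y ≤ η x) :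
    ContinuousAt (fun p : ℝ × ℝ => dY u p.1 p.2) (x, y) := (hu.contDiffAt_dY h0 h1).continuousAt

theorem continuousAt_dXX (hu : HarmonicBelow Λ η lam u) (x y : ℝ) (h0 : 0 ≤ y) (h1 : y ≤ η x) :
    ContinuousAt (fun p : ℝ × ℝ => dX (dX u) p.1 p.2) (x, y) :=
  (ContDiffAt.dX (n := 0) (by simpa using hu.contDiffAt_dX h0 h1)).continuousAt

theorem continuousAt_dYX (hu : HarmonicBelow Λ η lam u) (x y : ℝ) (h0 : 0 ≤ y) (h1 : y ≤ η x) :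
    ContinuousAt (fun p : ℝ × ℝ => dY (dX u) p.1 p.2) (x, y) :=
  (ContDiffAt.dY (n := 0) (by simpa using hu.contDiffAt_dX h0 h1)).continuousAt

theorem continuousAt_dYY (hu : HarmonicBelow Λ η lam u) (x y : ℝ) (h0 : 0 ≤ y) (h1 : y ≤ η x) :
    ContinuousAt (fun p : ℝ × ℝ => dY (dY u) p.1 p.2) (x, y) :=
  (ContDiffAt.dY (n := 0) (by simpa using hu.contDiffAt_dY h0 h1)).continuousAt

theorem differentiableAt (hu : HarmonicBelow Λ η lam u) {x y : ℝ} (h0 : 0 ≤ y) (h1 : y ≤ η x) :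
    DifferentiableAt ℝ (fun p : ℝ × ℝ => u p.1 p.2) (x, y) :=
  (hu.smooth x y h0 h1).differentiableAt (by simp)

theorem differentiableAt_dX (hu : HarmonicBelow Λ η lam u) {x y : ℝ} (h0 : 0 ≤ y) (h1 : y ≤ η x) :
    DifferentiableAt ℝ (fun p : ℝ × ℝ => dX u p.1 p.2) (x, y) :=
  (hu.contDiffAt_dX h0 h1).differentiableAt (by simp)

theorem differentiableAt_dY (hu : HarmonicBelow Λ η lam u) {x y : ℝ} (h0 : 0 ≤ y) (h1 : y ≤ η x) :
    DifferentiableAt ℝ (fun p : ℝ × ℝ => dY u p.1 p.2) (x, y) :=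
  (hu.contDiffAt_dY h0 h1).differentiableAt (by simp)

theorem dX_periodic (hη : SurfaceProfile Λ η) (hu : HarmonicBelow Λ η lam u) {x y : ℝ}
    (h0 : 0 < y) (h1 : y < η x) : dX u (x + Λ) y = dX u x y := by
  rw [dX, dX, ← deriv_comp_add_const]
  refine Filter.EventuallyEq.deriv_eq ?_
  filter_upwards [hη.continuous.continuousAt.eventually (lt_mem_nhds h1)] with s hs
    using hu.periodic s y h0.le (le_of_lt hs)

end HarmonicBelow

theorem SurfaceProfile.continuousOn_energyDensity (hη : SurfaceProfile Λ η)
    (hu : HarmonicBelow Λ η lam u) (hv : HarmonicBelow Λ η lam v) :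
    ContinuousOn (fun p : ℝ × ℝ => energyDensity η lam u v p.1 p.2) (Set.univ ×ˢ Set.Icc 0 1) := by
  have h1 := hη.continuousOn_flatten hu.continuousAt_dX
  have h2 := hη.continuousOn_flatten hv.continuousAt_dX
  have h3 := hη.continuousOn_flatten hu.continuousAt_dY
  have h4 := hη.continuousOn_flatten hv.continuousAt_dY
  have h5 : ContinuousOn (fun p : ℝ × ℝ => η p.1) (Set.univ ×ˢ Set.Icc 0 1) :=
    (hη.continuous.comp continuous_fst).continuousOn
  exact (((continuousOn_const.mul h1).mul h2).add (h3.mul h4)).mul h5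

theorem SurfaceProfile.continuous_conormal (hη : SurfaceProfile Λ η)
    (hu : HarmonicBelow Λ η lam u) : Continuous (conormal η lam u) :=
  (hη.continuous_trace hu.continuousAt_dY).sub
    ((continuous_const.mul hη.continuous_deriv).mul (hη.continuous_trace hu.continuousAt_dX))

theorem dirichletForm_comm : dirichletForm Λ η lam u v = dirichletForm Λ η lam v u := by
  unfold dirichletForm energyDensity
  congr 1; ext x; congr 1; ext z; ring

/-- Integration by parts. -/
theorem dirichletForm_eq (hη : SurfaceProfile Λ η) (hu : HarmonicBelow Λ η lam u)
    (hv : HarmonicBelow Λ η lam v) :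
    dirichletForm Λ η lam u v = ∫ x in (0 : ℝ)..Λ, conormal η lam u x * v x (η x) := by
  set A : ℝ → ℝ → ℝ := fun x z => lam ^ 2 * dX u x (z * η x) * v x (z * η x) * η x with hA
  set A' : ℝ → ℝ → ℝ := fun x z =>
    lam ^ 2 * ((dX (dX u) x (z * η x) + dY (dX u) x (z * η x) * (z * deriv η x)) * v x (z * η x)
      + dX u x (z * η x) * (dX v x (z * η x) + dY v x (z * η x) * (z * deriv η x))) * η x
      + lam ^ 2 * dX u x (z * η x) * v x (z * η x) * deriv η x with hA'
  set G' : ℝ → ℝ → ℝ := fun x z =>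
    dY (dY u) x (z * η x) * η x * v x (z * η x) + dY u x (z * η x) * (dY v x (z * η x) * η x)
    - lam ^ 2 * deriv η x * (dX u x (z * η x) * v x (z * η x)
      + z * (dY (dX u) x (z * η x) * η x * v x (z * η x)
        + dX u x (z * η x) * (dY v x (z * η x) * η x))) with hG'
  have c0 : ContinuousOn (fun p : ℝ × ℝ => η p.1) (Set.univ ×ˢ Set.Icc 0 1) :=
    (hη.continuous.comp continuous_fst).continuousOn
  have c1 : ContinuousOn (fun p : ℝ × ℝ => deriv η p.1) (Set.univ ×ˢ Set.Icc 0 1) :=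
    (hη.continuous_deriv.comp continuous_fst).continuousOn
  have cz : ContinuousOn (fun p : ℝ × ℝ => p.2) (Set.univ ×ˢ Set.Icc 0 1) :=
    continuous_snd.continuousOn
  have cu := hη.continuousOn_flatten hu.continuousAt_dX
  have cuy := hη.continuousOn_flatten hu.continuousAt_dY
  have cuxx := hη.continuousOn_flatten hu.continuousAt_dXX
  have cuyx := hη.continuousOn_flatten hu.continuousAt_dYX
  have cuyy := hη.continuousOn_flatten hu.continuousAt_dYY
  have cv := hη.continuousOn_flatten hv.continuousAt
  have cvx := hη.continuousOn_flatten hv.continuousAt_dX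
  have cvy := hη.continuousOn_flatten hv.continuousAt_dY
  have cA : ContinuousOn (fun p : ℝ × ℝ => A p.1 p.2) (Set.univ ×ˢ Set.Icc 0 1) :=
    ((continuousOn_const.mul cu).mul cv).mul c0
  have cA' : ContinuousOn (fun p : ℝ × ℝ => A' p.1 p.2) (Set.univ ×ˢ Set.Icc 0 1) :=
    ((continuousOn_const.mul (((cuxx.add (cuyx.mul (cz.mul c1))).mul cv).add
      (cu.mul (cvx.add (cvy.mul (cz.mul c1)))))).mul c0).add
      (((continuousOn_const.mul cu).mul cv).mul c1)
  have cG' : ContinuousOn (fun p : ℝ × ℝ => G' p.1 p.2) (Set.univ ×ˢ Set.Icc 0 1) :=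
    (((cuyy.mul c0).mul cv).add (cuy.mul (cvy.mul c0))).sub ((continuousOn_const.mul c1).mul
      ((cu.mul cv).add (cz.mul (((cuyx.mul c0).mul cv).add (cu.mul (cvy.mul c0))))))
  have hdA : ∀ x, ∀ z ∈ Set.Icc (0 : ℝ) 1, HasDerivAt (fun x => A x z) (A' x z) x := by
    intro x z hz
    have hm := hη.mem x hz
    have hg : HasDerivAt (fun s => z * η s) (z * deriv η x) x := (hη.hasDerivAt x).const_mul z
    have d1 := (hu.differentiableAt_dX hm.1 hm.2).hasDerivAt_comp₂ (f := fun s => s)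
      (g := fun s => z * η s) (hasDerivAt_id' x) hg
    have d2 := (hv.differentiableAt hm.1 hm.2).hasDerivAt_comp₂ (f := fun s => s)
      (g := fun s => z * η s) (hasDerivAt_id' x) hg
    refine (((d1.const_mul (lam ^ 2)).mul d2).mul (hη.hasDerivAt x)).congr_deriv ?_
    simp only [hA', Pi.mul_apply]; ring
  have hdG : ∀ x, ∀ z ∈ Set.Icc (0 : ℝ) 1, HasDerivAt (fun z =>
      dY u x (z * η x) * v x (z * η x)
        - lam ^ 2 * deriv η x * (z * (dX u x (z * η x) * v x (z * η x)))) (G' x z) z := by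
    intro x z hz
    have hm := hη.mem x hz
    have hg : HasDerivAt (fun s => s * η x) (η x) z := by
      simpa using (hasDerivAt_id' z).mul_const (η x)
    have d1 := (hu.differentiableAt_dX hm.1 hm.2).hasDerivAt_comp₂ (f := fun _ => x)
      (g := fun s => s * η x) (hasDerivAt_const z x) hg
    have d2 := (hv.differentiableAt hm.1 hm.2).hasDerivAt_comp₂ (f := fun _ => x)
      (g := fun s => s * η x) (hasDerivAt_const z x) hg
    have d3 := (hu.differentiableAt_dY hm.1 hm.2).hasDerivAt_comp₂ (f := fun _ => x)
      (g := fun s => s * η x) (hasDerivAt_const z x) hg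
    refine ((d3.mul d2).sub (((hasDerivAt_id' z).mul (d1.mul d2)).const_mul
      (lam ^ 2 * deriv η x))).congr_deriv ?_
    simp only [hG', Pi.mul_apply]; ring
  have hint : ∀ x, ∫ z in (0 : ℝ)..1, energyDensity η lam u v x z
      = (∫ z in (0 : ℝ)..1, A' x z) + conormal η lam u x * v x (η x) := by
    intro x
    have h1 : ∫ z in (0 : ℝ)..1, energyDensity η lam u v x z
        = ∫ z in (0 : ℝ)..1, (A' x z + G' x z) := by
      refine integral_congr_Ioo zero_le_one fun z hz => ?_
      have heq := hu.equation x (z * η x) (mul_pos hz.1 (hη.pos x))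
        (mul_lt_of_lt_one_left (hη.pos x) hz.2)
      simp only [energyDensity, hA', hG']
      linear_combination (-(v x (z * η x) * η x)) * heq
    have h2 : ∫ z in (0 : ℝ)..1, G' x z = conormal η lam u x * v x (η x) := by
      rw [intervalIntegral.integral_eq_sub_of_hasDerivAt (fun z hz => hdG x z
        (by rwa [Set.uIcc_of_le zero_le_one] at hz)) (intervalIntegrable_slice cG' x)]
      simp only [one_mul, zero_mul, hv.bottom, conormal]
      ring
    rw [h1, intervalIntegral.integral_add (intervalIntegrable_slice cA' x)
      (intervalIntegrable_slice cG' x), h2]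
  have hF := hasDerivAt_integral_param cA cA' hdA
  have hFc := continuous_integral_param cA'
  have hFint : ∫ x in (0 : ℝ)..Λ, ∫ z in (0 : ℝ)..1, A' x z = 0 := by
    rw [intervalIntegral.integral_eq_sub_of_hasDerivAt (fun x _ => hF x)
      (hFc.intervalIntegrable _ _), sub_eq_zero]
    refine integral_congr_Ioo zero_le_one fun z hz => ?_
    have hη0 : η Λ = η 0 := by simpa using hη.periodic 0
    have hz0 := mul_pos hz.1 (hη.pos 0)
    have hz1 := mul_lt_of_lt_one_left (hη.pos 0) hz.2
    have e1 := hu.dX_periodic hη hz0 hz1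
    have e2 := hv.periodic 0 _ hz0.le hz1.le
    rw [zero_add] at e1 e2
    simp only [hA, hη0, e1, e2]
  have hc : Continuous fun x => conormal η lam u x * v x (η x) :=
    (hη.continuous_conormal hu).mul (hη.continuous_trace hv.continuousAt)
  unfold dirichletForm
  simp_rw [hint]
  rw [intervalIntegral.integral_add (hFc.intervalIntegrable _ _) (hc.intervalIntegrable _ _),
    hFint, zero_add]

/-- Green's identity. -/
theorem integral_conormal_comm (hη : SurfaceProfile Λ η) (hu : HarmonicBelow Λ η lam u)
    (hv : HarmonicBelow Λ η lam v) :
    ∫ x in (0 : ℝ)..Λ, conormal η lam u x * v x (η x)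
      = ∫ x in (0 : ℝ)..Λ, conormal η lam v x * u x (η x) := by
  rw [← dirichletForm_eq hη hu hv, ← dirichletForm_eq hη hv hu, dirichletForm_comm]

/-- A function without energy vanishes. -/
theorem HarmonicBelow.eq_zero_of_dirichletForm_nonpos (hη : SurfaceProfile Λ η)
    (hu : HarmonicBelow Λ η lam u) (h : dirichletForm Λ η lam u u ≤ 0) {x y : ℝ}
    (hx : x ∈ Set.Icc 0 Λ) (h0 : 0 ≤ y) (h1 : y ≤ η x) : u x y = 0 := by
  have cE := hη.continuousOn_energyDensity hu hu
  have hE0 : ∀ x z, 0 ≤ energyDensity η lam u u x z := fun x z => by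
    have := (hη.pos x).le
    have h2 : energyDensity η lam u u x z
      = ((lam * dX u x (z * η x)) ^ 2 + dY u x (z * η x) ^ 2) * η x := by
      unfold energyDensity; ring
    rw [h2]; positivity
  have hz : ∀ z ∈ Set.Icc (0 : ℝ) 1, energyDensity η lam u u x z = 0 := by
    by_contra! hne
    obtain ⟨z, hz, hne⟩ := hne
    have hpos : 0 < ∫ z in (0 : ℝ)..1, energyDensity η lam u u x z :=
      intervalIntegral.integral_pos zero_lt_one (continuousOn_slice cE x) (fun z _ => hE0 x z)
        ⟨z, hz, lt_of_le_of_ne (hE0 x z) hne.symm⟩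
    have : 0 < dirichletForm Λ η lam u u :=
      intervalIntegral.integral_pos hη.period_pos (continuous_integral_param cE).continuousOn
        (fun x _ => intervalIntegral.integral_nonneg zero_le_one fun z _ => hE0 x z) ⟨x, hx, hpos⟩
    linarith
  have hdY : ∀ s, 0 ≤ s → s ≤ η x → dY u x s = 0 := by
    intro s hs0 hs1
    have h2 := hz (s / η x) ⟨div_nonneg hs0 (hη.pos x).le, (div_le_one (hη.pos x)).2 hs1⟩
    unfold energyDensity at h2
    rw [div_mul_cancel₀ _ (hη.pos x).ne'] at h2
    have h3 := (mul_eq_zero.1 h2).resolve_right (hη.pos x).ne'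
    nlinarith [sq_nonneg (lam * dX u x s), sq_nonneg (dY u x s)]
  have h2 := constant_of_derivWithin_zero (f := u x) (a := 0) (b := η x)
    (fun s hs => (hu.differentiableAt hs.1 hs.2).hasDerivAt_dY.differentiableAt.differentiableWithinAt)
    (fun s hs => by
      rw [((hu.differentiableAt hs.1 hs.2.le).hasDerivAt_dY.hasDerivWithinAt.derivWithin
        (uniqueDiffOn_Icc (hη.pos x) s ⟨hs.1, hs.2.le⟩)), hdY s hs.1 hs.2.le]) y ⟨h0, h1⟩
  rw [h2, hu.bottom]

end Green

section FourierCoefficients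

/-- The cosine coefficients of a function of the period `2π/τ`. -/
noncomputable def cosCoef (τ : ℝ) (f : ℝ → ℝ) (n : ℤ) : ℝ :=
  τ / (2 * Real.pi) * ∫ x in (0 : ℝ)..2 * Real.pi / τ, f x * Real.cos (n * (τ * x))

/-- The sine coefficients of a function of the period `2π/τ`. -/
noncomputable def sinCoef (τ : ℝ) (f : ℝ → ℝ) (n : ℤ) : ℝ :=
  τ / (2 * Real.pi) * ∫ x in (0 : ℝ)..2 * Real.pi / τ, f x * Real.sin (n * (τ * x))

variable {τ : ℝ} {f f' : ℝ → ℝ}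

theorem period_pos (hτ : 0 < τ) : 0 < 2 * Real.pi / τ := by positivity

theorem cos_periodic_int (hτ : 0 < τ) (n : ℤ) (x : ℝ) :
    Real.cos (n * (τ * (x + 2 * Real.pi / τ))) = Real.cos (n * (τ * x)) := by
  have : n * (τ * (x + 2 * Real.pi / τ)) = n * (τ * x) + n * (2 * Real.pi) := by field_simp
  rw [this, Real.cos_add_int_mul_two_pi]

theorem sin_periodic_int (hτ : 0 < τ) (n : ℤ) (x : ℝ) :
    Real.sin (n * (τ * (x + 2 * Real.pi / τ))) = Real.sin (n * (τ * x)) := by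
  have : n * (τ * (x + 2 * Real.pi / τ)) = n * (τ * x) + n * (2 * Real.pi) := by field_simp
  rw [this, Real.sin_add_int_mul_two_pi]

theorem integral_odd_periodic {Λ : ℝ} {h : ℝ → ℝ} (hp : ∀ x, h (x + Λ) = h x)
    (ho : ∀ x, h (-x) = -h x) : ∫ x in (0 : ℝ)..Λ, h x = 0 := by
  have h1 : ∫ x in (0 : ℝ)..Λ, h (Λ - x) = ∫ x in (0 : ℝ)..Λ, h x := by
    rw [intervalIntegral.integral_comp_sub_left]; simp
  have h2 : ∀ x, h (Λ - x) = -h x := fun x => by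
    rw [sub_eq_neg_add, hp, ho]
  simp_rw [h2, intervalIntegral.integral_neg] at h1
  linarith

theorem sinCoef_of_even (hτ : 0 < τ) (hp : ∀ x, f (x + 2 * Real.pi / τ) = f x)
    (he : ∀ x, f (-x) = f x) (n : ℤ) : sinCoef τ f n = 0 := by
  rw [sinCoef, integral_odd_periodic, mul_zero]
  · intro x; rw [hp, sin_periodic_int hτ]
  · intro x; rw [he, mul_neg, mul_neg, Real.sin_neg, mul_neg]

theorem cosCoef_of_odd (hτ : 0 < τ) (hp : ∀ x, f (x + 2 * Real.pi / τ) = f x)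
    (ho : ∀ x, f (-x) = -f x) (n : ℤ) : cosCoef τ f n = 0 := by
  rw [cosCoef, integral_odd_periodic, mul_zero]
  · intro x; rw [hp, cos_periodic_int hτ]
  · intro x; rw [ho, mul_neg, mul_neg, Real.cos_neg, neg_mul]

theorem fourier_integrand (n : ℤ) (x r : ℝ) :
    (fourier (-n) (x : AddCircle (2 * Real.pi / τ - 0)) : ℂ) • (r : ℂ)
      = ((r * Real.cos (n * (τ * x)) : ℝ) : ℂ)
        - ((r * Real.sin (n * (τ * x)) : ℝ) : ℂ) * Complex.I := by
  rw [fourier_coe_apply]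
  have h : 2 * (Real.pi : ℂ) * Complex.I * ((-n : ℤ) : ℂ) * (x : ℂ)
      / ((2 * Real.pi / τ - 0 : ℝ) : ℂ) = (-(n * (τ * x)) : ℝ) * Complex.I := by
    have : (Real.pi : ℂ) ≠ 0 := by exact_mod_cast Real.pi_ne_zero
    rw [sub_zero]
    push_cast
    by_cases hτ : (τ : ℂ) = 0
    · simp [hτ]
    · field_simp
  rw [h, Complex.exp_mul_I, ← Complex.ofReal_cos, ← Complex.ofReal_sin, Real.cos_neg,
    Real.sin_neg]
  push_cast
  rw [smul_eq_mul]
  ring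

theorem fourierCoeffOn_eq (hτ : 0 < τ) (hf : Continuous f) (n : ℤ) :
    fourierCoeffOn (period_pos hτ) (fun x => (f x : ℂ)) n
      = (cosCoef τ f n : ℂ) - (sinCoef τ f n : ℂ) * Complex.I := by
  rw [fourierCoeffOn_eq_integral]
  simp_rw [fourier_integrand]
  have c1 : Continuous fun x : ℝ => ((f x * Real.cos (n * (τ * x)) : ℝ) : ℂ) :=
    Complex.continuous_ofReal.comp (by fun_prop)
  have c2 : Continuous fun x : ℝ => ((f x * Real.sin (n * (τ * x)) : ℝ) : ℂ) * Complex.I :=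
    (Complex.continuous_ofReal.comp (by fun_prop)).mul continuous_const
  rw [intervalIntegral.integral_sub (c1.intervalIntegrable _ _) (c2.intervalIntegrable _ _),
    intervalIntegral.integral_mul_const, intervalIntegral.integral_ofReal,
    intervalIntegral.integral_ofReal, cosCoef, sinCoef, sub_zero, one_div_div]
  simp only [Complex.real_smul]
  push_cast
  ring

theorem sq_add_sq_fourier (hτ : 0 < τ) (hf : Continuous f) (n : ℤ) :
    ‖fourierCoeffOn (period_pos hτ) (fun x => (f x : ℂ)) n‖ ^ 2
      = cosCoef τ f n ^ 2 + sinCoef τ f n ^ 2 := by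
  rw [fourierCoeffOn_eq hτ hf, Complex.sq_norm, Complex.normSq_apply]
  simp
  ring

theorem hasSum_sq_coef (hτ : 0 < τ) (hf : Continuous f) :
    HasSum (fun n => cosCoef τ f n ^ 2 + sinCoef τ f n ^ 2)
      (τ / (2 * Real.pi) * ∫ x in (0 : ℝ)..2 * Real.pi / τ, f x ^ 2) := by
  have hL : MeasureTheory.MemLp (fun x => (f x : ℂ)) 2
      (MeasureTheory.volume.restrict (Set.Ioc 0 (2 * Real.pi / τ))) := by
    have hc : Continuous fun x => (f x : ℂ) := Complex.continuous_ofReal.comp hf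
    obtain ⟨C, hC⟩ := (isCompact_Icc (a := (0 : ℝ)) (b := 2 * Real.pi / τ)).exists_bound_of_continuousOn
      hc.continuousOn
    refine MeasureTheory.MemLp.of_bound hc.aestronglyMeasurable C ?_
    filter_upwards [MeasureTheory.ae_restrict_mem measurableSet_Ioc] with x hx
      using hC x (Set.Ioc_subset_Icc_self hx)
  have h := hasSum_sq_fourierCoeffOn (period_pos hτ) hL
  simp_rw [sq_add_sq_fourier hτ hf] at h
  simpa [smul_eq_mul] using h

theorem cosCoef_deriv (hτ : 0 < τ) (hf : ∀ x, HasDerivAt f (f' x) x) (hf' : Continuous f')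
    (hp : ∀ x, f (x + 2 * Real.pi / τ) = f x) (n : ℤ) :
    cosCoef τ f' n = n * τ * sinCoef τ f n := by
  have hd : ∀ x : ℝ, HasDerivAt (fun x : ℝ => Real.cos (n * (τ * x)))
      (-(n * τ * Real.sin (n * (τ * x)))) x := fun x =>
    ((((hasDerivAt_id' x).const_mul τ).const_mul (n : ℝ)).cos).congr_deriv (by ring)
  have hfc : Continuous f := continuous_iff_continuousAt.2 fun x => (hf x).continuousAt
  have h := intervalIntegral.integral_mul_deriv_eq_deriv_mul (a := 0) (b := 2 * Real.pi / τ)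
    (u := fun x => Real.cos (n * (τ * x))) (v := f) (fun x _ => hd x) (fun x _ => hf x)
    (Continuous.intervalIntegrable (by fun_prop) _ _) (hf'.intervalIntegrable _ _)
  have h1 := hp 0
  have h2 := cos_periodic_int hτ n 0
  rw [zero_add] at h1 h2
  rw [h1, h2, sub_self, zero_sub] at h
  have h3 : ∫ x in (0 : ℝ)..2 * Real.pi / τ, f' x * Real.cos (n * (τ * x))
      = n * τ * ∫ x in (0 : ℝ)..2 * Real.pi / τ, f x * Real.sin (n * (τ * x)) := by
    rw [← intervalIntegral.integral_const_mul]
    simp_rw [mul_comm (f' _)]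
    rw [h, ← intervalIntegral.integral_neg]
    refine intervalIntegral.integral_congr fun x _ => ?_
    ring
  rw [cosCoef, sinCoef, h3]
  ring

theorem sinCoef_deriv (hτ : 0 < τ) (hf : ∀ x, HasDerivAt f (f' x) x) (hf' : Continuous f')
    (hp : ∀ x, f (x + 2 * Real.pi / τ) = f x) (n : ℤ) :
    sinCoef τ f' n = -(n * τ * cosCoef τ f n) := by
  have hd : ∀ x : ℝ, HasDerivAt (fun x : ℝ => Real.sin (n * (τ * x)))
      (n * τ * Real.cos (n * (τ * x))) x := fun x =>
    ((((hasDerivAt_id' x).const_mul τ).const_mul (n : ℝ)).sin).congr_deriv (by ring)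
  have h := intervalIntegral.integral_mul_deriv_eq_deriv_mul (a := 0) (b := 2 * Real.pi / τ)
    (u := fun x => Real.sin (n * (τ * x))) (v := f) (fun x _ => hd x) (fun x _ => hf x)
    (Continuous.intervalIntegrable (by fun_prop) _ _) (hf'.intervalIntegrable _ _)
  have h1 := hp 0
  have h2 := sin_periodic_int hτ n 0
  rw [zero_add] at h1 h2
  rw [h1, h2, sub_self, zero_sub] at h
  have h3 : ∫ x in (0 : ℝ)..2 * Real.pi / τ, f' x * Real.sin (n * (τ * x))
      = -(n * τ * ∫ x in (0 : ℝ)..2 * Real.pi / τ, f x * Real.cos (n * (τ * x))) := by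
    rw [← intervalIntegral.integral_const_mul]
    simp_rw [mul_comm (f' _)]
    rw [h]
    congr 1
    refine intervalIntegral.integral_congr fun x _ => ?_
    ring
  rw [cosCoef, sinCoef, h3]
  ring

theorem abs_cosCoef_le (hτ : 0 < τ) {C : ℝ} (h : ∀ x ∈ Set.Icc 0 (2 * Real.pi / τ), |f x| ≤ C)
    (n : ℤ) : |cosCoef τ f n| ≤ C := by
  have h1 := intervalIntegral.norm_integral_le_of_norm_le_const (a := 0) (b := 2 * Real.pi / τ)
    (C := C) (f := fun x => f x * Real.cos (n * (τ * x))) (fun x hx => by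
      rw [Set.uIoc_of_le (period_pos hτ).le] at hx
      rw [Real.norm_eq_abs, abs_mul]
      exact (mul_le_of_le_one_right (abs_nonneg _) (Real.abs_cos_le_one _)).trans
        (h x (Set.Ioc_subset_Icc_self hx)))
  rw [sub_zero, abs_of_pos (period_pos hτ), Real.norm_eq_abs] at h1
  rw [cosCoef, abs_mul, abs_of_pos (by positivity)]
  calc _ ≤ τ / (2 * Real.pi) * (C * (2 * Real.pi / τ)) := by gcongr
    _ = C := by field_simp

theorem abs_sinCoef_le (hτ : 0 < τ) {C : ℝ} (h : ∀ x ∈ Set.Icc 0 (2 * Real.pi / τ), |f x| ≤ C)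
    (n : ℤ) : |sinCoef τ f n| ≤ C := by
  have h1 := intervalIntegral.norm_integral_le_of_norm_le_const (a := 0) (b := 2 * Real.pi / τ)
    (C := C) (f := fun x => f x * Real.sin (n * (τ * x))) (fun x hx => by
      rw [Set.uIoc_of_le (period_pos hτ).le] at hx
      rw [Real.norm_eq_abs, abs_mul]
      exact (mul_le_of_le_one_right (abs_nonneg _) (Real.abs_sin_le_one _)).trans
        (h x (Set.Ioc_subset_Icc_self hx)))
  rw [sub_zero, abs_of_pos (period_pos hτ), Real.norm_eq_abs] at h1
  rw [sinCoef, abs_mul, abs_of_pos (by positivity)]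
  calc _ ≤ τ / (2 * Real.pi) * (C * (2 * Real.pi / τ)) := by gcongr
    _ = C := by field_simp

/-- Wirtinger's inequality for even functions without the modes `0` and `1`. -/
theorem wirtinger_two (hτ : 0 < τ) (hf : ∀ x, HasDerivAt f (f' x) x) (hf' : Continuous f')
    (hp : ∀ x, f (x + 2 * Real.pi / τ) = f x) (he : ∀ x, f (-x) = f x) :
    4 * τ ^ 2 * ((∫ x in (0 : ℝ)..2 * Real.pi / τ, f x ^ 2)
        - 2 * Real.pi / τ * (cosCoef τ f 0 ^ 2 + 2 * cosCoef τ f 1 ^ 2))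
      ≤ ∫ x in (0 : ℝ)..2 * Real.pi / τ, f' x ^ 2 := by
  have hfc : Continuous f := continuous_iff_continuousAt.2 fun x => (hf x).continuousAt
  have s1 := hasSum_sq_coef hτ hfc
  have s2 := hasSum_sq_coef hτ hf'
  have hsin := sinCoef_of_even hτ hp he
  have hneg : cosCoef τ f (-1) = cosCoef τ f 1 := by
    unfold cosCoef
    congr 1
    refine intervalIntegral.integral_congr fun x _ => ?_
    simp
  set S : Finset ℤ := {0, 1, -1} with hS
  set c : ℤ → ℝ := fun n => if n ∈ S then cosCoef τ f n ^ 2 else 0 with hc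
  have s3 : HasSum c (cosCoef τ f 0 ^ 2 + 2 * cosCoef τ f 1 ^ 2) := by
    have h : ∑ n ∈ S, c n = cosCoef τ f 0 ^ 2 + 2 * cosCoef τ f 1 ^ 2 := by
      rw [hS, Finset.sum_insert (by decide), Finset.sum_pair (by decide)]
      simp only [hc, hS, Finset.mem_insert, Finset.mem_singleton]
      norm_num [hneg]
      ring
    rw [← h]
    exact hasSum_sum_of_ne_finset_zero fun n hn => by simp only [hc, if_neg hn]
  have h := hasSum_le (fun n => ?_) ((s1.sub s3).mul_left (4 * τ ^ 2)) s2
  · have hπ := Real.pi_pos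
    have h4 := mul_le_mul_of_nonneg_left h (period_pos hτ).le
    calc _ = 2 * Real.pi / τ * (4 * τ ^ 2 * (τ / (2 * Real.pi) *
          (∫ x in (0 : ℝ)..2 * Real.pi / τ, f x ^ 2)
            - (cosCoef τ f 0 ^ 2 + 2 * cosCoef τ f 1 ^ 2))) := by field_simp
      _ ≤ _ := h4
      _ = _ := by field_simp
  · rw [cosCoef_deriv hτ hf hf' hp, sinCoef_deriv hτ hf hf' hp, hsin]
    simp only [hc]
    split_ifs with hn
    · nlinarith [sq_nonneg (n * τ * cosCoef τ f n)]
    · have h2 : (2 : ℝ) ^ 2 ≤ (n : ℝ) ^ 2 := by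
        have : 2 ≤ |n| := by
          simp only [hS, Finset.mem_insert, Finset.mem_singleton, not_or] at hn
          rcases abs_cases n with h | h <;> omega
        rw [← sq_abs (n : ℝ), ← Int.cast_abs]
        have h3 : (2 : ℝ) ≤ (|n| : ℤ) := by exact_mod_cast this
        gcongr
      nlinarith [mul_le_mul_of_nonneg_right h2 (sq_nonneg (τ * cosCoef τ f n))]

/-- A continuous periodic function as a function on the circle. -/
noncomputable def circleFn (τ : ℝ) (f : ℝ → ℝ) (hf : Continuous f)
    (hp : ∀ x, f (x + 2 * Real.pi / τ) = f x) : C(AddCircle (2 * Real.pi / τ), ℂ) where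
  toFun := Function.Periodic.lift (f := fun x => (f x : ℂ)) (c := 2 * Real.pi / τ)
    fun x => by simp only [hp]
  continuous_toFun := continuous_coinduced_dom.mpr (Complex.continuous_ofReal.comp hf)

theorem hasSum_fourier_real (hτ : 0 < τ) (hf : Continuous f)
    (hp : ∀ x, f (x + 2 * Real.pi / τ) = f x)
    (hs : Summable fun n => |cosCoef τ f n| + |sinCoef τ f n|) (x : ℝ) :
    HasSum (fun n : ℤ => cosCoef τ f n * Real.cos (n * (τ * x))
      + sinCoef τ f n * Real.sin (n * (τ * x))) (f x) := by
  have := Fact.mk (period_pos hτ)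
  have hcoef : ∀ n, fourierCoeff (circleFn τ f hf hp) n
      = (cosCoef τ f n : ℂ) - (sinCoef τ f n : ℂ) * Complex.I := by
    intro n
    rw [← fourierCoeffOn_eq hτ hf, fourierCoeffOn_eq_integral,
      fourierCoeff_eq_intervalIntegral _ _ 0, zero_add, sub_zero]
    congr 1
  have hsum : Summable (fourierCoeff (circleFn τ f hf hp)) := by
    refine Summable.of_norm_bounded hs fun n => ?_
    rw [hcoef]
    refine (norm_sub_le _ _).trans (le_of_eq ?_)
    simp
  have h := has_pointwise_sum_fourier_series_of_summable hsum (x : AddCircle (2 * Real.pi / τ))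
  have h2 := Complex.hasSum_re h
  have h3 : ((circleFn τ f hf hp) (x : AddCircle (2 * Real.pi / τ))).re = f x := rfl
  rw [h3] at h2
  convert h2 using 1
  ext n
  rw [hcoef, fourier_coe_apply]
  have h4 : 2 * (Real.pi : ℂ) * Complex.I * (n : ℂ) * (x : ℂ) / ((2 * Real.pi / τ : ℝ) : ℂ)
      = (n * (τ * x) : ℝ) * Complex.I := by
    have : (Real.pi : ℂ) ≠ 0 := by exact_mod_cast Real.pi_ne_zero
    have : (τ : ℂ) ≠ 0 := by exact_mod_cast hτ.ne'
    push_cast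
    field_simp
  rw [h4, Complex.exp_mul_I, ← Complex.ofReal_cos, ← Complex.ofReal_sin]
  simp only [smul_eq_mul, Complex.mul_re, Complex.sub_re, Complex.add_re, Complex.add_im,
    Complex.sub_im, Complex.mul_im, Complex.ofReal_re, Complex.ofReal_im, Complex.I_re,
    Complex.I_im]
  ring

/-- The expansion of an even function. -/
theorem eq_cos_series (hτ : 0 < τ) (hf : Continuous f) (hp : ∀ x, f (x + 2 * Real.pi / τ) = f x)
    (he : ∀ x, f (-x) = f x) (hs : Summable fun n => |cosCoef τ f n|) (x : ℝ) :
    trigSeries τ 0 (cosCoef τ f) x = f x := by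
  have h := hasSum_fourier_real hτ hf hp (by simpa [sinCoef_of_even hτ hp he] using hs) x
  simp only [sinCoef_of_even hτ hp he, zero_mul, add_zero] at h
  rw [trigSeries, ← h.tsum_eq]
  rfl

/-- The expansion of an odd function. -/
theorem eq_sin_series (hτ : 0 < τ) (hf : Continuous f) (hp : ∀ x, f (x + 2 * Real.pi / τ) = f x)
    (ho : ∀ x, f (-x) = -f x) (hs : Summable fun n => |sinCoef τ f n|) (x : ℝ) :
    trigSeries τ 1 (sinCoef τ f) x = f x := by
  have h := hasSum_fourier_real hτ hf hp (by simpa [cosCoef_of_odd hτ hp ho] using hs) x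
  simp only [cosCoef_of_odd hτ hp ho, zero_mul, zero_add] at h
  rw [trigSeries, ← h.tsum_eq]
  rfl

theorem abs_coef_le_of_deriv (hτ : 0 < τ) {F : ℕ → ℝ → ℝ}
    (hF : ∀ k x, HasDerivAt (F k) (F (k + 1) x) x)
    (hp : ∀ k x, F k (x + 2 * Real.pi / τ) = F k x) {C : ℝ}
    (hC : ∀ k ≤ 5, ∀ x ∈ Set.Icc 0 (2 * Real.pi / τ), |F k x| ≤ C) (n : ℤ) :
    |cosCoef τ (F 0) n| ≤ 32 * (1 + 1 / τ ^ 5) * C * (1 / (1 + |(n : ℝ)|) ^ 5) ∧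
    |sinCoef τ (F 0) n| ≤ 32 * (1 + 1 / τ ^ 5) * C * (1 / (1 + |(n : ℝ)|) ^ 5) := by
  have hc : ∀ k, Continuous (F k) := fun k =>
    continuous_iff_continuousAt.2 fun x => (hF k x).continuousAt
  have hC0 : 0 ≤ C := (abs_nonneg _).trans (hC 0 (by norm_num) 0 ⟨le_rfl, (period_pos hτ).le⟩)
  have e1 : ∀ k, |cosCoef τ (F (k + 1)) n| = |(n : ℝ)| * τ * |sinCoef τ (F k) n| := fun k => by
    rw [cosCoef_deriv hτ (hF k) (hc _) (hp k), abs_mul, abs_mul, abs_of_pos hτ]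
  have e2 : ∀ k, |sinCoef τ (F (k + 1)) n| = |(n : ℝ)| * τ * |cosCoef τ (F k) n| := fun k => by
    rw [sinCoef_deriv hτ (hF k) (hc _) (hp k), abs_neg, abs_mul, abs_mul, abs_of_pos hτ]
  have key : ∀ r : ℝ, r ≤ C → (|(n : ℝ)| * τ) ^ 5 * r ≤ C →
      r ≤ 32 * (1 + 1 / τ ^ 5) * C * (1 / (1 + |(n : ℝ)|) ^ 5) := by
    intro r h0 h5
    rcases eq_or_ne n 0 with hn | hn
    · subst hn
      simp only [Int.cast_zero, abs_zero, add_zero, one_pow, div_one, mul_one]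
      refine h0.trans (le_mul_of_one_le_left hC0 ?_)
      have : 0 ≤ 1 / τ ^ 5 := by positivity
      linarith
    · have hn1 : 1 ≤ |(n : ℝ)| := by
        rw [← Int.cast_abs]; exact_mod_cast Int.one_le_abs hn
      have h2 : (1 + |(n : ℝ)|) ^ 5 ≤ 32 * |(n : ℝ)| ^ 5 := by
        calc (1 + |(n : ℝ)|) ^ 5 ≤ (2 * |(n : ℝ)|) ^ 5 := by gcongr; linarith
          _ = _ := by ring
      have h3 : r * |(n : ℝ)| ^ 5 ≤ 1 / τ ^ 5 * C := by
        rw [one_div_mul_eq_div, le_div_iff₀ (by positivity)]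
        calc _ = (|(n : ℝ)| * τ) ^ 5 * r := by ring
          _ ≤ C := h5
      rw [mul_one_div, le_div_iff₀ (by positivity)]
      by_cases hr : 0 ≤ r
      · calc r * (1 + |(n : ℝ)|) ^ 5 ≤ r * (32 * |(n : ℝ)| ^ 5) := by gcongr
          _ = 32 * (r * |(n : ℝ)| ^ 5) := by ring
          _ ≤ 32 * (1 / τ ^ 5 * C) := by gcongr
          _ ≤ _ := by nlinarith
      · exact (mul_nonpos_of_nonpos_of_nonneg (not_le.1 hr).le (by positivity)).trans
          (by positivity)
  constructor
  · refine key _ (abs_cosCoef_le hτ (hC 0 (by norm_num)) n) ?_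
    refine le_trans (le_of_eq ?_) (abs_sinCoef_le hτ (hC 5 le_rfl) n)
    rw [e2, e1, e2, e1, e2]; ring
  · refine key _ (abs_sinCoef_le hτ (hC 0 (by norm_num)) n) ?_
    refine le_trans (le_of_eq ?_) (abs_cosCoef_le hτ (hC 5 le_rfl) n)
    rw [e1, e2, e1, e2, e1]; ring

/-- The constant in the bound of the coefficients by five derivatives. -/
noncomputable def coefConst (τ : ℝ) : ℝ :=
  32 * (1 + 1 / τ ^ 5) * ∑' n : ℤ, 1 / (1 + |(n : ℝ)|) ^ 2

theorem fourierBound_of_abs_le {a : ℤ → ℝ} {D : ℝ}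
    (h : ∀ n : ℤ, |a n| ≤ D * (1 / (1 + |(n : ℝ)|) ^ 5)) :
    FourierBound 3 (D * ∑' n : ℤ, 1 / (1 + |(n : ℝ)|) ^ 2) a := by
  have h1 : ∀ n : ℤ, |a n| * (1 + |(n : ℝ)|) ^ 3 ≤ D * (1 / (1 + |(n : ℝ)|) ^ 2) := fun n => by
    calc _ ≤ D * (1 / (1 + |(n : ℝ)|) ^ 5) * (1 + |(n : ℝ)|) ^ 3 := by gcongr; exact h n
      _ = _ := by
        have : 1 + |(n : ℝ)| ≠ 0 := by positivity
        field_simp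
  have hs := (summable_weight le_rfl).mul_left D
  have hsum := Summable.of_nonneg_of_le (fun n => by positivity) h1 hs
  exact ⟨hsum, (hsum.tsum_le_tsum h1 hs).trans (le_of_eq tsum_mul_left)⟩

theorem summable_abs_of_fourierBound {s : ℕ} {ε : ℝ} {a : ℤ → ℝ} (h : FourierBound s ε a) :
    Summable fun n => |a n| := by
  simpa using (h.mono (Nat.zero_le s)).1

theorem exists_cos_series (hτ : 0 < τ) {F : ℕ → ℝ → ℝ}
    (hF : ∀ k x, HasDerivAt (F k) (F (k + 1) x) x)
    (hp : ∀ k x, F k (x + 2 * Real.pi / τ) = F k x) (he : ∀ x, F 0 (-x) = F 0 x) {C : ℝ}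
    (hC : ∀ k ≤ 5, ∀ x ∈ Set.Icc 0 (2 * Real.pi / τ), |F k x| ≤ C) :
    ∃ a, FourierBound 3 (coefConst τ * C) a ∧ ∀ x, trigSeries τ 0 a x = F 0 x := by
  have h := fourierBound_of_abs_le fun n => (abs_coef_le_of_deriv hτ hF hp hC n).1
  refine ⟨cosCoef τ (F 0), ?_, eq_cos_series hτ (continuous_iff_continuousAt.2 fun x =>
    (hF 0 x).continuousAt) (hp 0) he (summable_abs_of_fourierBound h)⟩
  convert h using 1
  rw [coefConst]; ring

theorem exists_sin_series (hτ : 0 < τ) {F : ℕ → ℝ → ℝ}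
    (hF : ∀ k x, HasDerivAt (F k) (F (k + 1) x) x)
    (hp : ∀ k x, F k (x + 2 * Real.pi / τ) = F k x) (ho : ∀ x, F 0 (-x) = -F 0 x) {C : ℝ}
    (hC : ∀ k ≤ 5, ∀ x ∈ Set.Icc 0 (2 * Real.pi / τ), |F k x| ≤ C) :
    ∃ a, FourierBound 3 (coefConst τ * C) a ∧ ∀ x, trigSeries τ 1 a x = F 0 x := by
  have h := fourierBound_of_abs_le fun n => (abs_coef_le_of_deriv hτ hF hp hC n).2
  refine ⟨sinCoef τ (F 0), ?_, eq_sin_series hτ (continuous_iff_continuousAt.2 fun x =>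
    (hF 0 x).continuousAt) (hp 0) ho (summable_abs_of_fourierBound h)⟩
  convert h using 1
  rw [coefConst]; ring

end FourierCoefficients

section Gap

/-- The one-dimensional inequality behind the spectral gap. -/
theorem xCoth_mul_sq_le {b : ℝ} (hb : 0 < b) {g g' : ℝ → ℝ} (hg : ContinuousOn g (Set.Icc 0 1))
    (hd : ∀ z ∈ Set.Ioo (0 : ℝ) 1, HasDerivAt g (g' z) z) (hg' : ContinuousOn g' (Set.Icc 0 1))
    (h0 : g 0 = 0) :
    xCoth b * g 1 ^ 2 ≤ ∫ z in (0 : ℝ)..1, (g' z ^ 2 + b ^ 2 * g z ^ 2) := by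
  have hs : 0 < Real.sinh b := Real.sinh_pos_iff.2 hb
  set h : ℝ → ℝ := fun z => Real.sinh (b * z) / Real.sinh b * g 1 with hh
  set h' : ℝ → ℝ := fun z => b * Real.cosh (b * z) / Real.sinh b * g 1 with hh'
  have dh : ∀ z, HasDerivAt h (h' z) z := fun z =>
    ((((hasDerivAt_id' z).const_mul b).sinh.div_const (Real.sinh b)).mul_const (g 1)).congr_deriv
      (by simp only [hh']; ring)
  have dh' : ∀ z, HasDerivAt h' (b ^ 2 * h z) z := fun z =>
    (((((hasDerivAt_id' z).const_mul b).cosh.const_mul b).div_const (Real.sinh b)).mul_const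
      (g 1)).congr_deriv (by simp only [hh]; ring)
  have ch : Continuous h := continuous_iff_continuousAt.2 fun z => (dh z).continuousAt
  have ch' : Continuous h' := continuous_iff_continuousAt.2 fun z => (dh' z).continuousAt
  have hint : ∀ {k : ℝ → ℝ}, ContinuousOn k (Set.Icc 0 1) →
      IntervalIntegrable k MeasureTheory.volume 0 1 := fun hk =>
    ContinuousOn.intervalIntegrable (by rwa [Set.uIcc_of_le zero_le_one])
  have cR : ContinuousOn (fun z => 2 * (g' z * h' z + b ^ 2 * g z * h z)
      - (h' z ^ 2 + b ^ 2 * h z ^ 2)) (Set.Icc 0 1) :=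
    (continuousOn_const.mul ((hg'.mul ch'.continuousOn).add
      ((continuousOn_const.mul hg).mul ch.continuousOn))).sub (by fun_prop)
  have hF : ∫ z in (0 : ℝ)..1, (2 * (g' z * h' z + b ^ 2 * g z * h z)
      - (h' z ^ 2 + b ^ 2 * h z ^ 2)) = xCoth b * g 1 ^ 2 := by
    rw [intervalIntegral.integral_eq_sub_of_hasDerivAt_of_le zero_le_one
      (f := fun z => 2 * (g z * h' z) - h z * h' z)
      ((continuousOn_const.mul (hg.mul ch'.continuousOn)).sub (ch.mul ch').continuousOn)
      (fun z hz => ((((hd z hz).mul (dh' z)).const_mul 2).sub ((dh z).mul (dh' z))).congr_deriv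
        (by ring)) (hint cR)]
    simp only [hh, hh', h0, mul_one, mul_zero, Real.sinh_zero, zero_div, zero_mul, sub_zero, xCoth]
    field_simp
    ring
  rw [← hF]
  refine intervalIntegral.integral_mono_on zero_le_one (hint cR)
    (hint ((hg'.pow 2).add (continuousOn_const.mul (hg.pow 2)))) fun z _ => ?_
  nlinarith [sq_nonneg (g' z - h' z), sq_nonneg (b * (g z - h z))]

/-- The integral of the square without the modes `0` and `1`. -/
theorem integral_sq_sub_modes {τ : ℝ} (hτ : 0 < τ) {f : ℝ → ℝ} (hf : Continuous f) :
    ∫ x in (0 : ℝ)..2 * Real.pi / τ,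
        (f x - cosCoef τ f 0 - 2 * cosCoef τ f 1 * Real.cos (τ * x)) ^ 2
      = (∫ x in (0 : ℝ)..2 * Real.pi / τ, f x ^ 2)
        - 2 * Real.pi / τ * (cosCoef τ f 0 ^ 2 + 2 * cosCoef τ f 1 ^ 2) := by
  set Λ := 2 * Real.pi / τ with hΛ
  set c := cosCoef τ f 0 with hc
  set k := cosCoef τ f 1 with hk
  have hc' : ∫ x in (0 : ℝ)..Λ, f x = Λ * c := by
    have : ∫ x in (0 : ℝ)..Λ, f x = ∫ x in (0 : ℝ)..Λ, f x * Real.cos (((0 : ℤ) : ℝ) * (τ * x)) := by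
      simp
    rw [hc, cosCoef, this, hΛ]
    field_simp
  have hk' : ∫ x in (0 : ℝ)..Λ, f x * Real.cos (τ * x) = Λ * k := by
    have : ∫ x in (0 : ℝ)..Λ, f x * Real.cos (τ * x)
        = ∫ x in (0 : ℝ)..Λ, f x * Real.cos (((1 : ℤ) : ℝ) * (τ * x)) := by simp
    rw [hk, cosCoef, this, hΛ]
    field_simp
  have hcos : ∫ x in (0 : ℝ)..Λ, Real.cos (τ * x) = 0 := by
    rw [intervalIntegral.integral_comp_mul_left _ hτ.ne', mul_zero, integral_cos,
      show τ * Λ = 2 * Real.pi by rw [hΛ]; field_simp]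
    simp
  have hcos2 : ∫ x in (0 : ℝ)..Λ, Real.cos (τ * x) ^ 2 = Λ / 2 := by
    rw [intervalIntegral.integral_comp_mul_left (fun y => Real.cos y ^ 2) hτ.ne', mul_zero,
      integral_cos_sq, show τ * Λ = 2 * Real.pi by rw [hΛ]; field_simp]
    simp [hΛ]
    field_simp
  have e : ∀ x, (f x - c - 2 * k * Real.cos (τ * x)) ^ 2 = f x ^ 2 + (-(2 * c)) * f x
      + (-(4 * k)) * (f x * Real.cos (τ * x)) + 4 * c * k * Real.cos (τ * x)
      + 4 * k ^ 2 * Real.cos (τ * x) ^ 2 + c ^ 2 := fun x => by ring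
  simp_rw [e]
  rw [intervalIntegral.integral_add, intervalIntegral.integral_add, intervalIntegral.integral_add,
    intervalIntegral.integral_add, intervalIntegral.integral_add,
    intervalIntegral.integral_const_mul, intervalIntegral.integral_const_mul,
    intervalIntegral.integral_const_mul, intervalIntegral.integral_const_mul,
    intervalIntegral.integral_const, hc', hk', hcos, hcos2]
  · simp only [sub_zero, smul_eq_mul]; ring
  all_goals exact Continuous.intervalIntegrable (by fun_prop) _ _

/-- The cosine coefficients of a family of functions depend differentiably on the parameter. -/
theorem hasDerivAt_cosCoef {τ : ℝ} (hτ : 0 < τ) {w wz : ℝ → ℝ → ℝ}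
    (cw : ContinuousOn (fun p : ℝ × ℝ => w p.1 p.2) (Set.univ ×ˢ Set.Icc 0 1))
    (cwz : ContinuousOn (fun p : ℝ × ℝ => wz p.1 p.2) (Set.univ ×ˢ Set.Icc 0 1))
    (hz : ∀ x, ∀ z ∈ Set.Icc (0 : ℝ) 1, HasDerivAt (w x) (wz x z) z) (n : ℤ) {z : ℝ}
    (hz1 : z ∈ Set.Ioo (0 : ℝ) 1) :
    HasDerivAt (fun z => cosCoef τ (fun x => w x z) n) (cosCoef τ (fun x => wz x z) n) z := by
  have hsl : ∀ {f : ℝ → ℝ → ℝ}, ContinuousOn (fun p : ℝ × ℝ => f p.1 p.2)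
      (Set.univ ×ˢ Set.Icc 0 1) → ∀ z ∈ Set.Icc (0 : ℝ) 1,
      Continuous fun x => f x z * Real.cos (n * (τ * x)) := fun hf z hz =>
    (hf.comp_continuous (f := fun x : ℝ => (x, z)) (by fun_prop) fun _ => ⟨trivial, hz⟩).mul
      (by fun_prop)
  have hIcc : Set.Icc (0 : ℝ) 1 ∈ 𝓝 z := Icc_mem_nhds hz1.1 hz1.2
  have hK : IsCompact (Set.Icc 0 (2 * Real.pi / τ) ×ˢ Set.Icc (0 : ℝ) 1) :=
    isCompact_Icc.prod isCompact_Icc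
  obtain ⟨C, hC⟩ := hK.exists_bound_of_continuousOn
    (cwz.mono (Set.prod_mono (Set.subset_univ _) subset_rfl))
  have hz' := Set.Ioo_subset_Icc_self hz1
  refine HasDerivAt.const_mul _ (intervalIntegral.hasDerivAt_integral_of_dominated_loc_of_deriv_le
    (F := fun z x => w x z * Real.cos (n * (τ * x)))
    (F' := fun z x => wz x z * Real.cos (n * (τ * x))) (bound := fun _ => C)
    (s := Set.Icc (0 : ℝ) 1) hIcc ?_ ((hsl cw z hz').intervalIntegrable _ _)
    (hsl cwz z hz').aestronglyMeasurable ?_ intervalIntegrable_const ?_).2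
  · filter_upwards [hIcc] with s hs using (hsl cw s hs).aestronglyMeasurable
  · refine Eventually.of_forall fun x hx s hs => ?_
    rw [Set.uIoc_of_le (period_pos hτ).le] at hx
    rw [norm_mul]
    exact (mul_le_of_le_one_right (norm_nonneg _) (Real.abs_cos_le_one _)).trans
      (hC (x, s) ⟨Set.Ioc_subset_Icc_self hx, hs⟩)
  · exact Eventually.of_forall fun x _ s hs => (hz x s hs).mul_const _

theorem continuous_cosCoef_clamped {τ : ℝ} {f : ℝ → ℝ → ℝ}
    (hf : ContinuousOn (fun p : ℝ × ℝ => f p.1 p.2) (Set.univ ×ˢ Set.Icc 0 1)) (n : ℤ) :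
    Continuous fun z => cosCoef τ (fun x => f x (max 0 (min 1 z))) n := by
  unfold cosCoef
  refine continuous_const.mul (intervalIntegral.continuous_parametric_intervalIntegral_of_continuous'
    (f := fun z x => f x (max 0 (min 1 z)) * Real.cos (n * (τ * x))) ?_ _ _)
  have h := (continuous_clamped hf).comp continuous_swap
  exact h.mul (f := fun p : ℝ × ℝ => f p.2 (max 0 (min 1 p.1))) (by fun_prop)

theorem integral_sq_comb {f g : ℝ → ℝ} (hf : Continuous f) (hg : Continuous g) (α β a b : ℝ) :
    ∫ x in a..b, (α * f x ^ 2 + β * g x ^ 2)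
      = α * (∫ x in a..b, f x ^ 2) + β * ∫ x in a..b, g x ^ 2 := by
  rw [intervalIntegral.integral_add (Continuous.intervalIntegrable (by fun_prop) _ _)
    (Continuous.intervalIntegrable (by fun_prop) _ _), intervalIntegral.integral_const_mul,
    intervalIntegral.integral_const_mul]

theorem integral_swap_clamped {Λ : ℝ} (hΛ : 0 ≤ Λ) {f : ℝ → ℝ → ℝ}
    (hf : ContinuousOn (fun p : ℝ × ℝ => f p.1 p.2) (Set.univ ×ˢ Set.Icc 0 1)) :
    ∫ x in (0 : ℝ)..Λ, ∫ z in (0 : ℝ)..1, f x z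
      = ∫ z in (0 : ℝ)..1, ∫ x in (0 : ℝ)..Λ, f x z := by
  simp_rw [intervalIntegral.integral_of_le hΛ, intervalIntegral.integral_of_le zero_le_one]
  refine MeasureTheory.integral_integral_swap ?_
  rw [MeasureTheory.Measure.prod_restrict]
  have h : MeasureTheory.IntegrableOn (fun p : ℝ × ℝ => f p.1 p.2)
      (Set.Icc 0 Λ ×ˢ Set.Icc (0 : ℝ) 1) (MeasureTheory.volume.prod MeasureTheory.volume) :=
    (hf.mono (Set.prod_mono (Set.subset_univ _) subset_rfl)).integrableOn_compact
      (isCompact_Icc.prod isCompact_Icc)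
  exact h.mono_set (Set.prod_mono Set.Ioc_subset_Icc_self Set.Ioc_subset_Icc_self)

/-- The spectral gap in the flat strip. -/
theorem strip_gap {τ d : ℝ} (hτ : 0 < τ) (hd : 0 < d) {w wx wz : ℝ → ℝ → ℝ}
    (cw : ContinuousOn (fun p : ℝ × ℝ => w p.1 p.2) (Set.univ ×ˢ Set.Icc 0 1))
    (cwx : ContinuousOn (fun p : ℝ × ℝ => wx p.1 p.2) (Set.univ ×ˢ Set.Icc 0 1))
    (cwz : ContinuousOn (fun p : ℝ × ℝ => wz p.1 p.2) (Set.univ ×ˢ Set.Icc 0 1))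
    (hx : ∀ x, ∀ z ∈ Set.Icc (0 : ℝ) 1, HasDerivAt (fun x => w x z) (wx x z) x)
    (hz : ∀ x, ∀ z ∈ Set.Icc (0 : ℝ) 1, HasDerivAt (w x) (wz x z) z)
    (hp : ∀ x, ∀ z ∈ Set.Icc (0 : ℝ) 1, w (x + 2 * Real.pi / τ) z = w x z)
    (he : ∀ x, ∀ z ∈ Set.Icc (0 : ℝ) 1, w (-x) z = w x z) (h0 : ∀ x, w x 0 = 0)
    (m0 : cosCoef τ (fun x => w x 1) 0 = 0) (m1 : cosCoef τ (fun x => w x 1) 1 = 0) :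
    xCoth (2 * τ * d) / d * ∫ x in (0 : ℝ)..2 * Real.pi / τ, w x 1 ^ 2
      ≤ ∫ x in (0 : ℝ)..2 * Real.pi / τ, ∫ z in (0 : ℝ)..1,
        (d * wx x z ^ 2 + wz x z ^ 2 / d) := by
  set b := 2 * τ * d with hb
  have hb0 : 0 < b := by positivity
  set W : ℝ → ℝ → ℝ := fun x z => w x z - cosCoef τ (fun x => w x z) 0
    - 2 * cosCoef τ (fun x => w x z) 1 * Real.cos (τ * x) with hW
  set Wz : ℝ → ℝ → ℝ := fun x z => wz x z - cosCoef τ (fun x => wz x z) 0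
    - 2 * cosCoef τ (fun x => wz x z) 1 * Real.cos (τ * x) with hWz
  have ccoef : ∀ {f : ℝ → ℝ → ℝ} (n : ℤ), ContinuousOn (fun p : ℝ × ℝ => f p.1 p.2)
      (Set.univ ×ˢ Set.Icc 0 1) →
      ContinuousOn (fun p : ℝ × ℝ => cosCoef τ (fun x => f x p.2) n) (Set.univ ×ˢ Set.Icc 0 1) := by
    intro f n hf
    refine ((continuous_cosCoef_clamped (τ := τ) hf n).comp continuous_snd).continuousOn.congr
      fun p hp => ?_
    simp only [Function.comp, clamped_of_mem hp.2]
  have ccos : ContinuousOn (fun p : ℝ × ℝ => Real.cos (τ * p.1)) (Set.univ ×ˢ Set.Icc 0 1) := by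
    fun_prop
  have cW : ContinuousOn (fun p : ℝ × ℝ => W p.1 p.2) (Set.univ ×ˢ Set.Icc 0 1) :=
    (cw.sub (ccoef 0 cw)).sub ((continuousOn_const.mul (ccoef 1 cw)).mul ccos)
  have cWz : ContinuousOn (fun p : ℝ × ℝ => Wz p.1 p.2) (Set.univ ×ˢ Set.Icc 0 1) :=
    (cwz.sub (ccoef 0 cwz)).sub ((continuousOn_const.mul (ccoef 1 cwz)).mul ccos)
  have cE : ContinuousOn (fun p : ℝ × ℝ => d * wx p.1 p.2 ^ 2 + wz p.1 p.2 ^ 2 / d)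
      (Set.univ ×ˢ Set.Icc 0 1) :=
    (continuousOn_const.mul (cwx.pow 2)).add ((cwz.pow 2).div_const d)
  have cE' : ContinuousOn (fun p : ℝ × ℝ => (Wz p.1 p.2 ^ 2 + b ^ 2 * W p.1 p.2 ^ 2) / d)
      (Set.univ ×ˢ Set.Icc 0 1) :=
    ((cWz.pow 2).add (continuousOn_const.mul (cW.pow 2))).div_const d
  have hsl : ∀ {f : ℝ → ℝ → ℝ}, ContinuousOn (fun p : ℝ × ℝ => f p.1 p.2)
      (Set.univ ×ˢ Set.Icc 0 1) → ∀ z ∈ Set.Icc (0 : ℝ) 1, Continuous fun x => f x z :=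
    fun hf z hz => hf.comp_continuous (f := fun x : ℝ => (x, z)) (by fun_prop)
      fun _ => ⟨trivial, hz⟩
  have hsw : ∀ {f : ℝ → ℝ → ℝ}, ContinuousOn (fun p : ℝ × ℝ => f p.1 p.2)
      (Set.univ ×ˢ Set.Icc 0 1) →
      ContinuousOn (fun z => ∫ x in (0 : ℝ)..2 * Real.pi / τ, f x z) (Set.Icc 0 1) := by
    intro f hf
    have h := intervalIntegral.continuous_parametric_intervalIntegral_of_continuous'
      (f := fun z x => f x (max 0 (min 1 z))) (μ := MeasureTheory.volume)
      ((continuous_clamped hf).comp continuous_swap) 0 (2 * Real.pi / τ)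
    refine h.continuousOn.congr fun z hz => ?_
    simp only [clamped_of_mem hz]
  have hii : ∀ {f : ℝ → ℝ → ℝ}, ContinuousOn (fun p : ℝ × ℝ => f p.1 p.2)
      (Set.univ ×ˢ Set.Icc 0 1) → IntervalIntegrable
      (fun z => ∫ x in (0 : ℝ)..2 * Real.pi / τ, f x z) MeasureTheory.volume 0 1 := fun hf =>
    ContinuousOn.intervalIntegrable (by rw [Set.uIcc_of_le zero_le_one]; exact hsw hf)
  have step1 : ∫ x in (0 : ℝ)..2 * Real.pi / τ, ∫ z in (0 : ℝ)..1,
      (Wz x z ^ 2 + b ^ 2 * W x z ^ 2) / d ≤ ∫ x in (0 : ℝ)..2 * Real.pi / τ, ∫ z in (0 : ℝ)..1,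
        (d * wx x z ^ 2 + wz x z ^ 2 / d) := by
    rw [integral_swap_clamped (period_pos hτ).le (f := fun x z => (Wz x z ^ 2 + b ^ 2 * W x z ^ 2) / d) cE',
      integral_swap_clamped (period_pos hτ).le (f := fun x z => d * wx x z ^ 2 + wz x z ^ 2 / d) cE]
    refine intervalIntegral.integral_mono_on zero_le_one
      (hii (f := fun x z => (Wz x z ^ 2 + b ^ 2 * W x z ^ 2) / d) cE')
      (hii (f := fun x z => d * wx x z ^ 2 + wz x z ^ 2 / d) cE) fun z hz1 => ?_
    have i1 := integral_sq_sub_modes hτ (hsl cw z hz1)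
    have i2 := integral_sq_sub_modes hτ (hsl cwz z hz1)
    have i3 := wirtinger_two hτ (fun x => hx x z hz1) (hsl cwx z hz1) (fun x => hp x z hz1)
      (fun x => he x z hz1)
    have hW' : Continuous fun x => W x z := hsl cW z hz1
    have hWz' : Continuous fun x => Wz x z := hsl cWz z hz1
    have hwx' := hsl cwx z hz1
    have hwz' := hsl cwz z hz1
    have e1 : ∀ x, (Wz x z ^ 2 + b ^ 2 * W x z ^ 2) / d
        = 1 / d * Wz x z ^ 2 + b ^ 2 / d * W x z ^ 2 := fun x => by ring
    have e2 : ∀ x, d * wx x z ^ 2 + wz x z ^ 2 / d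
        = d * wx x z ^ 2 + 1 / d * wz x z ^ 2 := fun x => by ring
    simp_rw [e1, e2]
    rw [integral_sq_comb hWz' hW', integral_sq_comb hwx' hwz']
    simp only [hW, hWz]
    rw [i1, i2]
    have hb2 : b ^ 2 / d = d * (4 * τ ^ 2) := by rw [hb]; field_simp; ring
    have h3 := mul_le_mul_of_nonneg_left i3 hd.le
    have h4 : 0 ≤ 1 / d * (2 * Real.pi / τ * (cosCoef τ (fun x => wz x z) 0 ^ 2
      + 2 * cosCoef τ (fun x => wz x z) 1 ^ 2)) := by positivity
    rw [hb2, mul_assoc d]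
    linarith
  refine le_trans ?_ step1
  rw [← intervalIntegral.integral_const_mul]
  have h1mem : (1 : ℝ) ∈ Set.Icc (0 : ℝ) 1 := ⟨zero_le_one, le_rfl⟩
  refine intervalIntegral.integral_mono_on (period_pos hτ).le
    ((((hsl cw 1 h1mem).pow 2).const_mul _).intervalIntegrable _ _)
    ((continuous_integral_param (f := fun x z => (Wz x z ^ 2 + b ^ 2 * W x z ^ 2) / d)
      cE').intervalIntegrable _ _) fun x _ => ?_
  have hW1 : W x 1 = w x 1 := by simp only [hW, m0, m1]; ring
  have hW0 : W x 0 = 0 := by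
    have : ∀ n, cosCoef τ (fun _ => 0) n = 0 := fun n => by simp [cosCoef]
    simp only [hW, h0, this]; ring
  have h := xCoth_mul_sq_le hb0 (g := W x) (g' := Wz x) (continuousOn_slice cW x)
    (fun z hz1 => ((hz x z (Set.Ioo_subset_Icc_self hz1)).sub
      (hasDerivAt_cosCoef hτ cw cwz hz 0 hz1)).sub
      (((hasDerivAt_cosCoef hτ cw cwz hz 1 hz1).const_mul 2).mul_const _))
    (continuousOn_slice cWz x) hW0
  rw [hW1] at h
  rw [intervalIntegral.integral_div, div_mul_eq_mul_div]
  gcongr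

theorem sq_add_mul_le {a b h k : ℝ} (hk : |h| ≤ k) :
    (a + h * b) ^ 2 ≤ a ^ 2 * (1 + k) + b ^ 2 * (k + k ^ 2) := by
  have h0 := abs_nonneg h
  have h1 : h ^ 2 ≤ k ^ 2 := by rw [← sq_abs]; gcongr
  have h2 : 2 * (h * (a * b)) ≤ k * (a ^ 2 + b ^ 2) := by
    calc 2 * (h * (a * b)) ≤ 2 * (|h| * |a * b|) := by rw [← abs_mul]; gcongr; exact le_abs_self _
      _ = |h| * (2 * |a| * |b|) := by rw [abs_mul]; ring
      _ ≤ |h| * (a ^ 2 + b ^ 2) := by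
          gcongr; nlinarith [sq_nonneg (|a| - |b|), sq_abs a, sq_abs b]
      _ ≤ k * (a ^ 2 + b ^ 2) := by gcongr
  nlinarith [mul_le_mul_of_nonneg_right h1 (sq_nonneg b)]

/-- The spectral gap below a nearly flat surface. -/
theorem dirichletForm_gap {τ d lam θ : ℝ} (hτ : 0 < τ) (hd : 0 < d) (hθ : 0 ≤ θ) {η : ℝ → ℝ}
    {v : ℝ → ℝ → ℝ} (hη : SurfaceProfile (2 * Real.pi / τ) η) (hηe : ∀ x, η (-x) = η x)
    (hv : HarmonicBelow (2 * Real.pi / τ) η lam v)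
    (he : ∀ x y, 0 ≤ y → y ≤ η x → v (-x) y = v x y)
    (H1 : ∀ x ∈ Set.Icc 0 (2 * Real.pi / τ), θ * (d * (1 + |deriv η x|)) ≤ lam ^ 2 * η x)
    (H2 : ∀ x ∈ Set.Icc 0 (2 * Real.pi / τ),
      θ * (d * (|deriv η x| + |deriv η x| ^ 2) + η x ^ 2 / d) ≤ η x)
    (m0 : cosCoef τ (fun x => v x (η x)) 0 = 0) (m1 : cosCoef τ (fun x => v x (η x)) 1 = 0) :
    θ * (xCoth (2 * τ * d) / d * ∫ x in (0 : ℝ)..2 * Real.pi / τ, v x (η x) ^ 2)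
      ≤ dirichletForm (2 * Real.pi / τ) η lam v v := by
  have cη : ContinuousOn (fun p : ℝ × ℝ => η p.1) (Set.univ ×ˢ Set.Icc 0 1) :=
    (hη.continuous.comp continuous_fst).continuousOn
  have cη' : ContinuousOn (fun p : ℝ × ℝ => deriv η p.1) (Set.univ ×ˢ Set.Icc 0 1) :=
    (hη.continuous_deriv.comp continuous_fst).continuousOn
  have cz : ContinuousOn (fun p : ℝ × ℝ => p.2) (Set.univ ×ˢ Set.Icc 0 1) :=
    continuous_snd.continuousOn
  have c0 := hη.continuousOn_flatten hv.continuousAt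
  have c1 := hη.continuousOn_flatten hv.continuousAt_dX
  have c2 := hη.continuousOn_flatten hv.continuousAt_dY
  have hx : ∀ x, ∀ z ∈ Set.Icc (0 : ℝ) 1, HasDerivAt (fun x => v x (z * η x))
      (dX v x (z * η x) + z * deriv η x * dY v x (z * η x)) x := by
    intro x z hz
    have hm := hη.mem x hz
    exact ((hv.differentiableAt hm.1 hm.2).hasDerivAt_comp₂ (f := fun s => s)
      (g := fun s => z * η s) (hasDerivAt_id' x) ((hη.hasDerivAt x).const_mul z)).congr_deriv
      (by ring)
  have hz : ∀ x, ∀ z ∈ Set.Icc (0 : ℝ) 1, HasDerivAt (fun z => v x (z * η x))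
      (dY v x (z * η x) * η x) z := by
    intro x z hz
    have hm := hη.mem x hz
    have hg : HasDerivAt (fun s => s * η x) (η x) z := by
      simpa using (hasDerivAt_id' z).mul_const (η x)
    exact ((hv.differentiableAt hm.1 hm.2).hasDerivAt_comp₂ (f := fun _ => x)
      (g := fun s => s * η x) (hasDerivAt_const z x) hg).congr_deriv (by ring)
  have cwx : ContinuousOn (fun p : ℝ × ℝ =>
      dX v p.1 (p.2 * η p.1) + p.2 * deriv η p.1 * dY v p.1 (p.2 * η p.1))
      (Set.univ ×ˢ Set.Icc 0 1) := c1.add ((cz.mul cη').mul c2)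
  have cwz : ContinuousOn (fun p : ℝ × ℝ => dY v p.1 (p.2 * η p.1) * η p.1)
      (Set.univ ×ˢ Set.Icc 0 1) := c2.mul cη
  have hgap := strip_gap hτ hd (w := fun x z => v x (z * η x))
    (wx := fun x z => dX v x (z * η x) + z * deriv η x * dY v x (z * η x))
    (wz := fun x z => dY v x (z * η x) * η x) c0 cwx cwz hx hz
    (fun x z hz => by
      have hm := hη.mem x hz
      simp only [hη.periodic]; exact hv.periodic x _ hm.1 hm.2)
    (fun x z hz => by
      have hm := hη.mem x hz
      simp only [hηe]; exact he x _ hm.1 hm.2)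
    (fun x => by simp only [zero_mul]; exact hv.bottom x)
    (by simpa only [one_mul] using m0) (by simpa only [one_mul] using m1)
  simp only [one_mul] at hgap
  refine (mul_le_mul_of_nonneg_left hgap hθ).trans ?_
  have cS : ContinuousOn (fun p : ℝ × ℝ => θ * (d * (dX v p.1 (p.2 * η p.1)
      + p.2 * deriv η p.1 * dY v p.1 (p.2 * η p.1)) ^ 2
      + (dY v p.1 (p.2 * η p.1) * η p.1) ^ 2 / d)) (Set.univ ×ˢ Set.Icc 0 1) :=
    continuousOn_const.mul ((continuousOn_const.mul (cwx.pow 2)).add ((cwz.pow 2).div_const d))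
  have cE := hη.continuousOn_energyDensity hv hv
  rw [dirichletForm, ← intervalIntegral.integral_const_mul]
  simp_rw [← intervalIntegral.integral_const_mul]
  refine intervalIntegral.integral_mono_on (period_pos hτ).le
    ((continuous_integral_param (f := fun x z => θ * (d * (dX v x (z * η x)
      + z * deriv η x * dY v x (z * η x)) ^ 2 + (dY v x (z * η x) * η x) ^ 2 / d))
      cS).intervalIntegrable _ _)
    ((continuous_integral_param cE).intervalIntegrable _ _) fun x hx => ?_
  refine intervalIntegral.integral_mono_on zero_le_one
    (intervalIntegrable_slice (f := fun x z => θ * (d * (dX v x (z * η x)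
      + z * deriv η x * dY v x (z * η x)) ^ 2 + (dY v x (z * η x) * η x) ^ 2 / d)) cS x)
    (intervalIntegrable_slice cE x) fun z hz => ?_
  set A := dX v x (z * η x)
  set B := dY v x (z * η x)
  have hk : |z * deriv η x| ≤ |deriv η x| := by
    rw [abs_mul, abs_of_nonneg hz.1]
    exact mul_le_of_le_one_left (abs_nonneg _) hz.2
  have h1 := mul_le_mul_of_nonneg_left (sq_add_mul_le (a := A) (b := B) hk)
    (mul_nonneg hθ hd.le)
  have h2 := mul_le_mul_of_nonneg_right (H1 x hx) (sq_nonneg A)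
  have h3 := mul_le_mul_of_nonneg_right (H2 x hx) (sq_nonneg B)
  have h4 : energyDensity η lam v v x z = lam ^ 2 * η x * A ^ 2 + η x * B ^ 2 := by
    unfold energyDensity; ring
  have h5 : (B * η x) ^ 2 / d = η x ^ 2 / d * B ^ 2 := by ring
  rw [h4, h5]
  linarith

end Gap

section LinearCombinations

variable {Λ lam : ℝ} {η : ℝ → ℝ} {u v : ℝ → ℝ → ℝ}

theorem dX_const_mul (c : ℝ) (v : ℝ → ℝ → ℝ) :
    dX (fun x y => c * v x y) = fun x y => c * dX v x y := by
  ext x y; exact deriv_const_mul_field c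

theorem dY_const_mul (c : ℝ) (v : ℝ → ℝ → ℝ) :
    dY (fun x y => c * v x y) = fun x y => c * dY v x y := by
  ext x y; exact deriv_const_mul_field c

theorem HarmonicBelow.const_mul (hv : HarmonicBelow Λ η lam v) (c : ℝ) :
    HarmonicBelow Λ η lam (fun x y => c * v x y) where
  smooth x y h0 h1 := contDiffAt_const.mul (hv.smooth x y h0 h1)
  periodic x y h0 h1 := by rw [hv.periodic x y h0 h1]
  equation x y h0 h1 := by
    rw [dX_const_mul, dX_const_mul, dY_const_mul, dY_const_mul]
    linear_combination c * hv.equation x y h0 h1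
  bottom x := by rw [hv.bottom, mul_zero]

theorem conormal_const_mul (c x : ℝ) :
    conormal η lam (fun x y => c * v x y) x = c * conormal η lam v x := by
  rw [conormal, dX_const_mul, dY_const_mul, conormal]; ring

theorem dX_add_of_contDiffAt {x y : ℝ}
    (hu : DifferentiableAt ℝ (fun p : ℝ × ℝ => u p.1 p.2) (x, y))
    (hv : DifferentiableAt ℝ (fun p : ℝ × ℝ => v p.1 p.2) (x, y)) :
    dX (fun x y => u x y + v x y) x y = dX u x y + dX v x y :=
  (hu.hasDerivAt_dX.add hv.hasDerivAt_dX).deriv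

theorem dY_add_of_contDiffAt {x y : ℝ}
    (hu : DifferentiableAt ℝ (fun p : ℝ × ℝ => u p.1 p.2) (x, y))
    (hv : DifferentiableAt ℝ (fun p : ℝ × ℝ => v p.1 p.2) (x, y)) :
    dY (fun x y => u x y + v x y) x y = dY u x y + dY v x y :=
  (hu.hasDerivAt_dY.add hv.hasDerivAt_dY).deriv

theorem dXX_add_of_contDiffAt {x y : ℝ}
    (hu : ContDiffAt ℝ 2 (fun p : ℝ × ℝ => u p.1 p.2) (x, y))
    (hv : ContDiffAt ℝ 2 (fun p : ℝ × ℝ => v p.1 p.2) (x, y)) :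
    dX (dX fun x y => u x y + v x y) x y = dX (dX u) x y + dX (dX v) x y := by
  have hu' : ContDiffAt ℝ ((1 : ℕ) + 1) (fun p : ℝ × ℝ => u p.1 p.2) (x, y) := by norm_num; exact hu
  have hv' : ContDiffAt ℝ ((1 : ℕ) + 1) (fun p : ℝ × ℝ => v p.1 p.2) (x, y) := by norm_num; exact hv
  have h1 := (hu'.dX.differentiableAt (by simp)).hasDerivAt_dX
  have h2 := (hv'.dX.differentiableAt (by simp)).hasDerivAt_dX
  refine ((h1.add h2).congr_of_eventuallyEq ?_).deriv
  have e := (hasDerivAt_prodMk_left x y).continuousAt.eventually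
    (hu'.eventually_differentiableAt.and hv'.eventually_differentiableAt)
  filter_upwards [e] with s hs using dX_add_of_contDiffAt hs.1 hs.2

theorem dYY_add_of_contDiffAt {x y : ℝ}
    (hu : ContDiffAt ℝ 2 (fun p : ℝ × ℝ => u p.1 p.2) (x, y))
    (hv : ContDiffAt ℝ 2 (fun p : ℝ × ℝ => v p.1 p.2) (x, y)) :
    dY (dY fun x y => u x y + v x y) x y = dY (dY u) x y + dY (dY v) x y := by
  have hu' : ContDiffAt ℝ ((1 : ℕ) + 1) (fun p : ℝ × ℝ => u p.1 p.2) (x, y) := by norm_num; exact hu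
  have hv' : ContDiffAt ℝ ((1 : ℕ) + 1) (fun p : ℝ × ℝ => v p.1 p.2) (x, y) := by norm_num; exact hv
  have h1 := (hu'.dY.differentiableAt (by simp)).hasDerivAt_dY
  have h2 := (hv'.dY.differentiableAt (by simp)).hasDerivAt_dY
  refine ((h1.add h2).congr_of_eventuallyEq ?_).deriv
  have e := (hasDerivAt_prodMk_right x y).continuousAt.eventually
    (hu'.eventually_differentiableAt.and hv'.eventually_differentiableAt)
  filter_upwards [e] with s hs using dY_add_of_contDiffAt hs.1 hs.2

theorem HarmonicBelow.add (hu : HarmonicBelow Λ η lam u) (hv : HarmonicBelow Λ η lam v) :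
    HarmonicBelow Λ η lam (fun x y => u x y + v x y) where
  smooth x y h0 h1 := (hu.smooth x y h0 h1).add (hv.smooth x y h0 h1)
  periodic x y h0 h1 := by rw [hu.periodic x y h0 h1, hv.periodic x y h0 h1]
  equation x y h0 h1 := by
    have h2 := hu.smooth x y h0.le h1.le
    have h3 := hv.smooth x y h0.le h1.le
    rw [dXX_add_of_contDiffAt h2 h3, dYY_add_of_contDiffAt h2 h3]
    linear_combination hu.equation x y h0 h1 + hv.equation x y h0 h1
  bottom x := by rw [hu.bottom, hv.bottom, add_zero]

theorem HarmonicBelow.conormal_add (hη : ∀ x, 0 < η x) (hu : HarmonicBelow Λ η lam u)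
    (hv : HarmonicBelow Λ η lam v) (x : ℝ) :
    conormal η lam (fun x y => u x y + v x y) x = conormal η lam u x + conormal η lam v x := by
  have h1 := hu.differentiableAt (hη x).le le_rfl
  have h2 := hv.differentiableAt (hη x).le le_rfl
  rw [conormal, dX_add_of_contDiffAt h1 h2, dY_add_of_contDiffAt h1 h2, conormal, conormal]
  ring

/-- A function which vanishes over one period vanishes everywhere. -/
theorem HarmonicBelow.eq_zero_of_period (hη : SurfaceProfile Λ η) (hu : HarmonicBelow Λ η lam u)
    (h : ∀ x ∈ Set.Icc 0 Λ, ∀ y, 0 ≤ y → y ≤ η x → u x y = 0) {x y : ℝ} (h0 : 0 ≤ y)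
    (h1 : y ≤ η x) : u x y = 0 := by
  classical
  set g : ℝ → ℝ := fun x => if y ≤ η x then u x y else 0 with hg
  have hp : Function.Periodic g Λ := fun s => by
    simp only [hg, hη.periodic]
    split_ifs with hs
    · exact hu.periodic s y h0 hs
    · rfl
  obtain ⟨s, hs, he⟩ := hp.exists_mem_Ico₀ hη.period_pos x
  have hgs : g s = 0 := by
    simp only [hg]
    split_ifs with hy
    · exact h s (Set.Ico_subset_Icc_self hs) y h0 hy
    · rfl
  rw [hgs] at he
  simpa [hg, h1] using he

end LinearCombinations

/-- The scalar product on the surface with the weight `1/s²`. -/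
noncomputable def surfaceProd (Λ : ℝ) (s f g : ℝ → ℝ) : ℝ := ∫ x in (0 : ℝ)..Λ, f x * g x / s x ^ 2

section SurfaceProd

variable {Λ : ℝ} {s f g h : ℝ → ℝ}

theorem surfaceProd_comm : surfaceProd Λ s f g = surfaceProd Λ s g f := by
  simp only [surfaceProd, mul_comm (f _)]

theorem continuous_weighted (hs : Continuous s) (hs0 : ∀ x, s x ≠ 0) (hf : Continuous f)
    (hg : Continuous g) : Continuous fun x => f x * g x / s x ^ 2 :=
  (hf.mul hg).div (hs.pow 2) fun x => pow_ne_zero 2 (hs0 x)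

theorem surfaceProd_comb (hs : Continuous s) (hs0 : ∀ x, s x ≠ 0) (hf : Continuous f)
    (hg : Continuous g) (hh : Continuous h) (α β : ℝ) :
    surfaceProd Λ s (fun x => α * f x + β * g x) h
      = α * surfaceProd Λ s f h + β * surfaceProd Λ s g h := by
  unfold surfaceProd
  rw [← intervalIntegral.integral_const_mul, ← intervalIntegral.integral_const_mul,
    ← intervalIntegral.integral_add
      (((continuous_weighted hs hs0 hf hh).const_mul α).intervalIntegrable _ _)
      (((continuous_weighted hs hs0 hg hh).const_mul β).intervalIntegrable _ _)]
  refine intervalIntegral.integral_congr fun x _ => ?_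
  ring

theorem surfaceProd_self_nonneg (hΛ : 0 ≤ Λ) : 0 ≤ surfaceProd Λ s f f :=
  intervalIntegral.integral_nonneg hΛ fun _ _ => div_nonneg (mul_self_nonneg _) (sq_nonneg _)

theorem surfaceProd_self_pos (hΛ : 0 < Λ) (hs : Continuous s) (hs0 : ∀ x, s x ≠ 0)
    (hf : Continuous f) (h0 : f 0 ≠ 0) : 0 < surfaceProd Λ s f f :=
  intervalIntegral.integral_pos hΛ (continuous_weighted hs hs0 hf hf).continuousOn
    (fun _ _ => div_nonneg (mul_self_nonneg _) (sq_nonneg _))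
    ⟨0, ⟨le_rfl, hΛ.le⟩, div_pos (mul_self_pos.2 h0) (sq_pos_of_ne_zero (hs0 0))⟩

end SurfaceProd

section Counting

theorem exists_kernel_vector (a b : Fin 3 → ℝ) :
    ∃ c : Fin 3 → ℝ, c ≠ 0 ∧ c 0 * a 0 + c 1 * a 1 + c 2 * a 2 = 0 ∧
      c 0 * b 0 + c 1 * b 1 + c 2 * b 2 = 0 := by
  have h := LinearMap.ker_ne_bot_of_finrank_lt (f := Matrix.mulVecLin (R := ℝ) !![a 0, a 1, a 2; b 0, b 1, b 2])
    (by simp)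
  obtain ⟨c, hc, hc0⟩ := (Submodule.ne_bot_iff _).1 h
  rw [LinearMap.mem_ker, Matrix.mulVecLin_apply] at hc
  refine ⟨c, hc0, ?_, ?_⟩
  · have := congrFun hc 0
    simp [Matrix.mulVec, dotProduct, Fin.sum_univ_three] at this
    linarith
  · have := congrFun hc 1
    simp [Matrix.mulVec, dotProduct, Fin.sum_univ_three] at this
    linarith

theorem exists_pair_of_two_le_rank_span {V : Type*} [AddCommGroup V] [Module ℝ V] {S : Set V}
    (h : (2 : Cardinal) ≤ Module.rank ℝ (Submodule.span ℝ S)) :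
    ∃ x ∈ S, ∃ y ∈ S, ∀ α β : ℝ, α • x + β • y = 0 → α = 0 ∧ β = 0 := by
  obtain ⟨b, hb, hspan, hli⟩ := exists_linearIndependent ℝ S
  rw [← hspan, rank_span_set hli, Cardinal.two_le_iff] at h
  obtain ⟨x, y, hxy⟩ := h
  refine ⟨x, hb x.2, y, hb y.2, ?_⟩
  have h2 : LinearIndependent ℝ ![(x : V), y] := by
    have := hli.comp ![x, y] (by
      intro i j hij
      fin_cases i <;> fin_cases j <;> simp_all)
    have h3 : (Subtype.val ∘ ![x, y] : Fin 2 → V) = ![(x : V), y] := by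
      ext i; fin_cases i <;> rfl
    rw [h3] at this
    exact this
  exact LinearIndependent.pair_iff.1 h2

variable {Λ lam μ ν : ℝ} {ψ v v' : ℝ → ℝ → ℝ} {η : ℝ → ℝ}

theorem SolvesSpectralProblem.conormal_eq (hs : ∀ x, dY ψ x (η x) ≠ 0)
    (hsx : ∀ x, dX ψ x (η x) = -(dY ψ x (η x) * deriv η x))
    (hv : SolvesSpectralProblem Λ ψ η lam μ v) (x : ℝ) :
    conormal η lam v x = (rhoHat ψ η lam x + μ) * v x (η x) / dY ψ x (η x) ^ 2 := by
  have h := hv.surface x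
  have h1 := hs x
  rw [hsx] at h
  rw [conormal, eq_div_iff (pow_ne_zero 2 h1)]
  field_simp at h
  linear_combination h

theorem SolvesSpectralProblem.orthogonal (hη : SurfaceProfile Λ η) (hs : ∀ x, dY ψ x (η x) ≠ 0)
    (hsc : Continuous fun x => dY ψ x (η x)) (hρ : Continuous (rhoHat ψ η lam))
    (hsx : ∀ x, dX ψ x (η x) = -(dY ψ x (η x) * deriv η x))
    (hv : SolvesSpectralProblem Λ ψ η lam μ v) (hv' : SolvesSpectralProblem Λ ψ η lam ν v') :
    (μ - ν) * surfaceProd Λ (fun x => dY ψ x (η x)) (fun x => v x (η x)) (fun x => v' x (η x))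
      = 0 := by
  have h := integral_conormal_comm hη hv.harmonicBelow hv'.harmonicBelow
  have c1 := hη.continuous_trace hv.harmonicBelow.continuousAt
  have c2 := hη.continuous_trace hv'.harmonicBelow.continuousAt
  simp_rw [hv.conormal_eq hs hsx, hv'.conormal_eq hs hsx] at h
  rw [surfaceProd, ← intervalIntegral.integral_const_mul]
  have i1 : Continuous fun x => (rhoHat ψ η lam x + μ) * v x (η x) / dY ψ x (η x) ^ 2 * v' x (η x) :=
    (((hρ.add continuous_const).mul c1).div (hsc.pow 2) fun x => pow_ne_zero 2 (hs x)).mul c2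
  have i2 : Continuous fun x => (rhoHat ψ η lam x + ν) * v' x (η x) / dY ψ x (η x) ^ 2 * v x (η x) :=
    (((hρ.add continuous_const).mul c2).div (hsc.pow 2) fun x => pow_ne_zero 2 (hs x)).mul c1
  rw [← sub_eq_zero, ← intervalIntegral.integral_sub (i1.intervalIntegrable _ _)
    (i2.intervalIntegrable _ _)] at h
  rw [← h]
  congr 1
  ext x
  ring

theorem cosCoef_comb {τ : ℝ} {f g h : ℝ → ℝ} (hf : Continuous f) (hg : Continuous g)
    (hh : Continuous h) (α β γ : ℝ) (n : ℤ) :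
    cosCoef τ (fun x => α * f x + β * g x + γ * h x) n
      = α * cosCoef τ f n + β * cosCoef τ g n + γ * cosCoef τ h n := by
  have e : ∀ x, (α * f x + β * g x + γ * h x) * Real.cos (n * (τ * x))
      = α * (f x * Real.cos (n * (τ * x))) + β * (g x * Real.cos (n * (τ * x)))
        + γ * (h x * Real.cos (n * (τ * x))) := fun x => by ring
  unfold cosCoef
  simp_rw [e]
  rw [intervalIntegral.integral_add, intervalIntegral.integral_add,
    intervalIntegral.integral_const_mul, intervalIntegral.integral_const_mul,
    intervalIntegral.integral_const_mul]
  · ring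
  all_goals exact Continuous.intervalIntegrable (by fun_prop) _ _

/-- Two eigenfunctions with smaller eigenvalues are impossible below the second eigenvalue. -/
theorem dependent_of_eigenvalues_lt {τ d θ c μ₁ ν ν' : ℝ} {v₁ : ℝ → ℝ → ℝ} (hτ : 0 < τ) (hd : 0 < d)
    (hθ : 0 ≤ θ) (hη : SurfaceProfile (2 * Real.pi / τ) η) (hηe : ∀ x, η (-x) = η x)
    (hs : ∀ x, dY ψ x (η x) ≠ 0) (hsc : Continuous fun x => dY ψ x (η x))
    (hρ : Continuous (rhoHat ψ η lam)) (hsx : ∀ x, dX ψ x (η x) = -(dY ψ x (η x) * deriv η x))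
    (H1 : ∀ x ∈ Set.Icc 0 (2 * Real.pi / τ), θ * (d * (1 + |deriv η x|)) ≤ lam ^ 2 * η x)
    (H2 : ∀ x ∈ Set.Icc 0 (2 * Real.pi / τ),
      θ * (d * (|deriv η x| + |deriv η x| ^ 2) + η x ^ 2 / d) ≤ η x)
    (hc : ∀ x ∈ Set.Icc 0 (2 * Real.pi / τ), (rhoHat ψ η lam x + μ₁) / dY ψ x (η x) ^ 2 ≤ c)
    (hgap : c < θ * (xCoth (2 * τ * d) / d))
    (hv₁ : SolvesSpectralProblem (2 * Real.pi / τ) ψ η lam μ₁ v₁) (h₁ : v₁ 0 (η 0) ≠ 0)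
    (hv : SolvesSpectralProblem (2 * Real.pi / τ) ψ η lam ν v)
    (hv' : SolvesSpectralProblem (2 * Real.pi / τ) ψ η lam ν' v') (hν : ν < μ₁) (hν' : ν' < μ₁) :
    ∃ α β : ℝ, (α ≠ 0 ∨ β ≠ 0) ∧
      ∀ x y, 0 ≤ y → y ≤ η x → α * v x y + β * v' x y = 0 := by
  set Λ := 2 * Real.pi / τ with hΛ
  set s : ℝ → ℝ := fun x => dY ψ x (η x) with hsdef
  set f : ℝ → ℝ := fun x => v x (η x) with hf
  set f' : ℝ → ℝ := fun x => v' x (η x) with hf'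
  set f₁ : ℝ → ℝ := fun x => v₁ x (η x) with hf₁
  have cf : Continuous f := hη.continuous_trace hv.harmonicBelow.continuousAt
  have cf' : Continuous f' := hη.continuous_trace hv'.harmonicBelow.continuousAt
  have cf₁ : Continuous f₁ := hη.continuous_trace hv₁.harmonicBelow.continuousAt
  obtain ⟨k, hk0, hk1, hk2⟩ := exists_kernel_vector
    ![cosCoef τ f 0, cosCoef τ f' 0, cosCoef τ f₁ 0] ![cosCoef τ f 1, cosCoef τ f' 1, cosCoef τ f₁ 1]
  set α := k 0
  set β := k 1
  set γ := k 2
  set u : ℝ → ℝ → ℝ := fun x y => α * v x y + β * v' x y + γ * v₁ x y with hu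
  have hua : HarmonicBelow Λ η lam (fun x y => α * v x y + β * v' x y) :=
    (hv.harmonicBelow.const_mul α).add (hv'.harmonicBelow.const_mul β)
  have huh : HarmonicBelow Λ η lam u := hua.add (hv₁.harmonicBelow.const_mul γ)
  have hcon : ∀ x, conormal η lam u x = (rhoHat ψ η lam x + μ₁) / s x ^ 2 * u x (η x)
      - (α * (μ₁ - ν) * f x + β * (μ₁ - ν') * f' x) / s x ^ 2 := by
    intro x
    rw [hua.conormal_add hη.pos (hv₁.harmonicBelow.const_mul γ),
      (hv.harmonicBelow.const_mul α).conormal_add hη.pos (hv'.harmonicBelow.const_mul β),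
      conormal_const_mul, conormal_const_mul, conormal_const_mul, hv.conormal_eq hs hsx,
      hv'.conormal_eq hs hsx, hv₁.conormal_eq hs hsx]
    simp only [hu, hf, hf', hsdef]
    ring
  have cu : Continuous fun x => u x (η x) := hη.continuous_trace huh.continuousAt
  have hE := dirichletForm_eq hη huh huh
  -- orthogonality
  have o1 : surfaceProd Λ s f₁ f = 0 :=
    (mul_eq_zero.1 (hv₁.orthogonal hη hs hsc hρ hsx hv)).resolve_left (sub_pos.2 hν).ne'
  have o2 : surfaceProd Λ s f₁ f' = 0 :=
    (mul_eq_zero.1 (hv₁.orthogonal hη hs hsc hρ hsx hv')).resolve_left (sub_pos.2 hν').ne'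
  have o3 := hv.orthogonal hη hs hsc hρ hsx hv'
  have hexp : ∀ {g : ℝ → ℝ}, Continuous g → surfaceProd Λ s g (fun x => u x (η x))
      = α * surfaceProd Λ s g f + β * surfaceProd Λ s g f' + γ * surfaceProd Λ s g f₁ := by
    intro g hg
    have e : (fun x => u x (η x)) = fun x => 1 * (α * f x + β * f' x) + γ * f₁ x := by
      ext x; simp only [hu, hf, hf', hf₁]; ring
    rw [surfaceProd_comm, e, surfaceProd_comb hsc hs (by fun_prop) cf₁ hg,
      surfaceProd_comb hsc hs cf cf' hg, surfaceProd_comm (f := f), surfaceProd_comm (f := f'),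
      surfaceProd_comm (f := f₁)]
    ring
  have hquad : 0 ≤ surfaceProd Λ s (fun x => α * (μ₁ - ν) * f x + β * (μ₁ - ν') * f' x)
      (fun x => u x (η x)) := by
    rw [surfaceProd_comb hsc hs cf cf' cu, hexp cf, hexp cf', surfaceProd_comm (f := f) (g := f₁),
      surfaceProd_comm (f := f') (g := f₁), o1, o2, surfaceProd_comm (f := f') (g := f)]
    have p1 := surfaceProd_self_nonneg (s := s) (f := f) (period_pos hτ).le
    have p2 := surfaceProd_self_nonneg (s := s) (f := f') (period_pos hτ).le
    have hν0 := (sub_pos.2 hν).le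
    have hν0' := (sub_pos.2 hν').le
    rcases mul_eq_zero.1 o3 with h | h
    · have hνν : ν' = ν := by linarith
      have p3 : 0 ≤ surfaceProd Λ s (fun x => α * f x + β * f' x) (fun x => α * f x + β * f' x) :=
        surfaceProd_self_nonneg (period_pos hτ).le
      rw [surfaceProd_comb hsc hs cf cf' (by fun_prop), surfaceProd_comm (f := f),
        surfaceProd_comm (f := f'), surfaceProd_comb hsc hs cf cf' cf,
        surfaceProd_comb hsc hs cf cf' cf', surfaceProd_comm (f := f') (g := f)] at p3
      have p4 := mul_nonneg hν0 p3
      rw [hνν]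
      linarith
    · rw [h]
      have p5 : 0 ≤ (μ₁ - ν) * (α ^ 2 * surfaceProd Λ s f f) := by positivity
      have p6 : 0 ≤ (μ₁ - ν') * (β ^ 2 * surfaceProd Λ s f' f') := by positivity
      linarith
  have cw : Continuous fun x => (rhoHat ψ η lam x + μ₁) / s x ^ 2 * u x (η x) * u x (η x) :=
    (((hρ.add continuous_const).div (hsc.pow 2) fun x => pow_ne_zero 2 (hs x)).mul cu).mul cu
  have hupper : dirichletForm Λ η lam u u ≤ c * ∫ x in (0 : ℝ)..Λ, u x (η x) ^ 2 := by
    have h1 : dirichletForm Λ η lam u u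
        = (∫ x in (0 : ℝ)..Λ, (rhoHat ψ η lam x + μ₁) / s x ^ 2 * u x (η x) * u x (η x))
          - surfaceProd Λ s (fun x => α * (μ₁ - ν) * f x + β * (μ₁ - ν') * f' x)
            (fun x => u x (η x)) := by
      rw [hE, surfaceProd, ← intervalIntegral.integral_sub (cw.intervalIntegrable _ _)
        ((continuous_weighted hsc hs (by fun_prop) cu).intervalIntegrable _ _)]
      refine intervalIntegral.integral_congr fun x _ => ?_
      simp only [hcon]
      ring
    rw [h1, ← intervalIntegral.integral_const_mul]
    refine (sub_le_self _ hquad).trans (intervalIntegral.integral_mono_on (period_pos hτ).le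
      (cw.intervalIntegrable _ _) (((cu.pow 2).const_mul c).intervalIntegrable _ _) fun x hx => ?_)
    have := mul_le_mul_of_nonneg_right (hc x hx) (sq_nonneg (u x (η x)))
    simp only [hsdef]
    linarith
  have hue : ∀ x y, 0 ≤ y → y ≤ η x → u (-x) y = u x y := fun x y h0 h1 => by
    simp only [hu, hv.even x y h0 h1, hv'.even x y h0 h1, hv₁.even x y h0 h1]
  have hlower := dirichletForm_gap hτ hd hθ hη hηe huh hue H1 H2
    (by rw [← hk1]
        refine (cosCoef_comb cf cf' cf₁ α β γ 0).trans ?_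
        simp)
    (by rw [← hk2]
        refine (cosCoef_comb cf cf' cf₁ α β γ 1).trans ?_
        simp)
  have hI : 0 ≤ ∫ x in (0 : ℝ)..Λ, u x (η x) ^ 2 :=
    intervalIntegral.integral_nonneg (period_pos hτ).le fun x _ => sq_nonneg _
  have hI0 : ∫ x in (0 : ℝ)..Λ, u x (η x) ^ 2 = 0 := by
    by_contra hne
    have hpos := lt_of_le_of_ne hI (Ne.symm hne)
    have := mul_lt_mul_of_pos_right hgap hpos
    linarith
  rw [hI0, mul_zero] at hupper
  have hu0 : ∀ x y, 0 ≤ y → y ≤ η x → u x y = 0 := fun x y h0 h1 =>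
    huh.eq_zero_of_period hη (fun x hx y h0 h1 =>
      huh.eq_zero_of_dirichletForm_nonpos hη hupper hx h0 h1) h0 h1
  have hγ : γ = 0 := by
    have h := hexp cf₁
    rw [o1, o2] at h
    have h0 : surfaceProd Λ s f₁ (fun x => u x (η x)) = 0 := by
      simp [surfaceProd, hu0 _ _ (hη.pos _).le le_rfl]
    have hp := surfaceProd_self_pos (s := s) (f := f₁) (period_pos hτ) hsc hs cf₁ h₁
    rw [h0] at h
    have : γ * surfaceProd Λ s f₁ f₁ = 0 := by linarith
    exact (mul_eq_zero.1 this).resolve_right hp.ne'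
  refine ⟨α, β, ?_, fun x y h0 h1 => ?_⟩
  · by_contra! hne
    refine hk0 (funext fun i => ?_)
    fin_cases i
    exacts [hne.1, hne.2, hγ]
  · have := hu0 x y h0 h1
    simpa only [hu, hγ, zero_mul, add_zero] using this

/-- The second eigenvalue. -/
theorem isKthEigenvalue_two {τ d θ c μ₀ μ₁ : ℝ} {v₀ v₁ : ℝ → ℝ → ℝ} (hτ : 0 < τ) (hd : 0 < d)
    (hθ : 0 ≤ θ) (hη : SurfaceProfile (2 * Real.pi / τ) η) (hηe : ∀ x, η (-x) = η x)
    (hs : ∀ x, dY ψ x (η x) ≠ 0) (hsc : Continuous fun x => dY ψ x (η x))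
    (hρ : Continuous (rhoHat ψ η lam)) (hsx : ∀ x, dX ψ x (η x) = -(dY ψ x (η x) * deriv η x))
    (H1 : ∀ x ∈ Set.Icc 0 (2 * Real.pi / τ), θ * (d * (1 + |deriv η x|)) ≤ lam ^ 2 * η x)
    (H2 : ∀ x ∈ Set.Icc 0 (2 * Real.pi / τ),
      θ * (d * (|deriv η x| + |deriv η x| ^ 2) + η x ^ 2 / d) ≤ η x)
    (hc : ∀ x ∈ Set.Icc 0 (2 * Real.pi / τ), (rhoHat ψ η lam x + μ₁) / dY ψ x (η x) ^ 2 ≤ c)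
    (hgap : c < θ * (xCoth (2 * τ * d) / d))
    (hv₀ : SolvesSpectralProblem (2 * Real.pi / τ) ψ η lam μ₀ v₀)
    (hv₁ : SolvesSpectralProblem (2 * Real.pi / τ) ψ η lam μ₁ v₁) (hμ : μ₀ ≤ μ₁)
    (h₀ : ∀ x, |v₀ x (η x) - 1| ≤ 1 / 4) (h₁ : ∀ x, |v₁ x (η x) - Real.cos (τ * x)| ≤ 1 / 4) :
    IsKthEigenvalue 2 (2 * Real.pi / τ) ψ η lam μ₁ := by
  have a0 := abs_le.1 (h₀ 0)
  have a1 := abs_le.1 (h₀ (Real.pi / τ))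
  have b0 := abs_le.1 (h₁ 0)
  have b1 := abs_le.1 (h₁ (Real.pi / τ))
  rw [mul_zero, Real.cos_zero] at b0
  rw [mul_div_cancel₀ _ hτ.ne', Real.cos_pi] at b1
  constructor
  · change ((2 : ℕ) : Cardinal) ≤ Module.rank ℝ (eigenspaceUpTo (2 * Real.pi / τ) ψ η lam μ₁)
    set w : Fin 2 → eigenspaceUpTo (2 * Real.pi / τ) ψ η lam μ₁ :=
      ![⟨fun p => v₀ p.1.1 p.1.2, Submodule.subset_span ⟨μ₀, hμ, v₀, hv₀, rfl⟩⟩,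
        ⟨fun p => v₁ p.1.1 p.1.2, Submodule.subset_span ⟨μ₁, le_rfl, v₁, hv₁, rfl⟩⟩] with hw
    have hli : LinearIndependent ℝ w := by
      rw [hw, LinearIndependent.pair_iff]
      intro α β h
      have h' : ∀ x, α * v₀ x (η x) + β * v₁ x (η x) = 0 := fun x => by
        have h2 := congrArg (fun g : eigenspaceUpTo (2 * Real.pi / τ) ψ η lam μ₁ =>
          (g : fluidDomain η → ℝ) ⟨(x, η x), (hη.pos x).le, le_rfl⟩) h
        simpa using h2
      have e0 := h' 0
      have e1 := h' (Real.pi / τ)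
      set A := v₀ 0 (η 0)
      set B := v₁ 0 (η 0)
      set A' := v₀ (Real.pi / τ) (η (Real.pi / τ))
      set B' := v₁ (Real.pi / τ) (η (Real.pi / τ))
      have hdet : A * B' - A' * B < 0 := by nlinarith
      have hα : α * (A * B' - A' * B) = 0 := by linear_combination B' * e0 - B * e1
      have hβ : β * (A * B' - A' * B) = 0 := by linear_combination A * e1 - A' * e0
      exact ⟨(mul_eq_zero.1 hα).resolve_right hdet.ne, (mul_eq_zero.1 hβ).resolve_right hdet.ne⟩
    simpa using hli.cardinal_le_rank
  · intro m hm
    by_contra! hlt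
    obtain ⟨x, ⟨ν, hν, v, hv, rfl⟩, y, ⟨ν', hν', v', hv', rfl⟩, hind⟩ :=
      exists_pair_of_two_le_rank_span (S := {w : fluidDomain η → ℝ | ∃ ν ≤ m, ∃ v : ℝ → ℝ → ℝ,
        SolvesSpectralProblem (2 * Real.pi / τ) ψ η lam ν v ∧ w = fun p => v p.1.1 p.1.2})
        (by
          have h2 : ((2 : ℕ) : Cardinal) ≤
            Module.rank ℝ (eigenspaceUpTo (2 * Real.pi / τ) ψ η lam m) := hm
          rw [Nat.cast_ofNat] at h2
          exact h2)
    obtain ⟨α, β, hne, h⟩ := dependent_of_eigenvalues_lt hτ hd hθ hη hηe hs hsc hρ hsx H1 H2 hc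
      hgap hv₁ (by intro h0; rw [h0] at b0; linarith) hv hv' (hν.trans_lt hlt) (hν'.trans_lt hlt)
    have h2 := hind α β (by
      ext p
      simpa using h p.1.1 p.1.2 p.2.1 p.2.2)
    rcases hne with h3 | h3
    · exact h3 h2.1
    · exact h3 h2.2

end Counting

/-- A function of `(t, x)` which is analytic at all points with `0 ≤ t < T`. -/
def StripAnalytic (T : ℝ) (f : ℝ → ℝ → ℝ) : Prop :=
  ∀ t x, 0 ≤ t → t < T → AnalyticAt ℝ (fun p : ℝ × ℝ => f p.1 p.2) (t, x)

/-- `f t x` is `O(t ^ n)`, uniformly for `0 ≤ x ≤ L`. -/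
def UnifO (L : ℝ) (n : ℕ) (f : ℝ → ℝ → ℝ) : Prop :=
  ∃ C, ∀ᶠ t in 𝓝[>] (0 : ℝ), ∀ x ∈ Set.Icc 0 L, |f t x| ≤ C * t ^ n

section Strip

variable {T : ℝ} {f g : ℝ → ℝ → ℝ}

namespace StripAnalytic

theorem diff_fst (h : StripAnalytic T f) : StripAnalytic T (dX f) :=
  fun t x h0 h1 => (h t x h0 h1).dX

theorem diff_snd (h : StripAnalytic T f) : StripAnalytic T (dY f) :=
  fun t x h0 h1 => (h t x h0 h1).dY

theorem iterate_dX (h : StripAnalytic T f) (n : ℕ) : StripAnalytic T (dX^[n] f) := by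
  induction n generalizing f with
  | zero => exact h
  | succ n ih => exact ih h.diff_fst

theorem iterate_dY (h : StripAnalytic T f) (n : ℕ) : StripAnalytic T (dY^[n] f) := by
  induction n generalizing f with
  | zero => exact h
  | succ n ih => exact ih h.diff_snd

theorem add (hf : StripAnalytic T f) (hg : StripAnalytic T g) :
    StripAnalytic T (fun t x => f t x + g t x) := fun t x h0 h1 => (hf t x h0 h1).add (hg t x h0 h1)

theorem sub (hf : StripAnalytic T f) (hg : StripAnalytic T g) :
    StripAnalytic T (fun t x => f t x - g t x) := fun t x h0 h1 => (hf t x h0 h1).sub (hg t x h0 h1)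

theorem mul (hf : StripAnalytic T f) (hg : StripAnalytic T g) :
    StripAnalytic T (fun t x => f t x * g t x) := fun t x h0 h1 => (hf t x h0 h1).mul (hg t x h0 h1)

theorem neg (hf : StripAnalytic T f) : StripAnalytic T (fun t x => -f t x) :=
  fun t x h0 h1 => (hf t x h0 h1).neg

theorem pow (hf : StripAnalytic T f) (n : ℕ) : StripAnalytic T (fun t x => f t x ^ n) :=
  fun t x h0 h1 => (hf t x h0 h1).pow n

theorem div (hf : StripAnalytic T f) (hg : StripAnalytic T g)
    (h0 : ∀ t x, 0 ≤ t → t < T → g t x ≠ 0) : StripAnalytic T (fun t x => f t x / g t x) :=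
  fun t x h1 h2 => (hf t x h1 h2).div (hg t x h1 h2) (h0 t x h1 h2)

theorem const (c : ℝ) : StripAnalytic T (fun _ _ => c) := fun _ _ _ _ => analyticAt_const

theorem of_snd {h : ℝ → ℝ} (hh : ∀ x, AnalyticAt ℝ h x) : StripAnalytic T (fun _ x => h x) :=
  fun _ x _ _ => AnalyticAt.fun_comp (f := fun p : ℝ × ℝ => p.2) (g := h) (hh x) analyticAt_snd

theorem of_fst {h : ℝ → ℝ} (hh : ∀ t, 0 ≤ t → t < T → AnalyticAt ℝ h t) :
    StripAnalytic T (fun t _ => h t) :=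
  fun t _ h0 h1 => AnalyticAt.fun_comp (f := fun p : ℝ × ℝ => p.1) (g := h) (hh t h0 h1) analyticAt_fst

theorem comp {h : ℝ → ℝ} (hf : StripAnalytic T f) (hh : ∀ x, AnalyticAt ℝ h x) :
    StripAnalytic T (fun t x => h (f t x)) :=
  fun t x h0 h1 => AnalyticAt.fun_comp (f := fun p : ℝ × ℝ => f p.1 p.2) (g := h) (hh _) (hf t x h0 h1)

theorem hasDerivAt_fst (hf : StripAnalytic T f) {t x : ℝ} (h0 : 0 ≤ t) (h1 : t < T) :
    HasDerivAt (fun s => f s x) (dX f t x) t :=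
  (hf t x h0 h1).differentiableAt.hasDerivAt_dX

theorem hasDerivAt_snd (hf : StripAnalytic T f) {t x : ℝ} (h0 : 0 ≤ t) (h1 : t < T) :
    HasDerivAt (f t) (dY f t x) x :=
  (hf t x h0 h1).differentiableAt.hasDerivAt_dY

theorem continuous (hf : StripAnalytic T f) {t : ℝ} (h0 : 0 ≤ t) (h1 : t < T) :
    Continuous (f t) :=
  continuous_iff_continuousAt.2 fun x => (hf.hasDerivAt_snd h0 h1 (x := x)).continuousAt

theorem contDiff_slice (hf : StripAnalytic T f) {t : ℝ} (h0 : 0 ≤ t) (h1 : t < T) :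
    ContDiff ℝ 1 (f t) :=
  contDiff_iff_contDiffAt.2 fun x => (AnalyticAt.fun_comp (f := fun s : ℝ => (t, s))
    (g := fun p : ℝ × ℝ => f p.1 p.2) (hf t x h0 h1)
    (analyticAt_const.prod analyticAt_id)).contDiffAt

end StripAnalytic

theorem eventually_lt_of_pos {T : ℝ} (hT : 0 < T) : ∀ᶠ t in 𝓝[≥] (0 : ℝ), 0 ≤ t ∧ t < T := by
  filter_upwards [self_mem_nhdsWithin, mem_nhdsWithin_of_mem_nhds (Iio_mem_nhds hT)] with t h0 h1
    using ⟨h0, h1⟩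

theorem StripAnalytic.bounded (hT : 0 < T) (hf : StripAnalytic T f) (L : ℝ) :
    ∃ C, ∀ᶠ t in 𝓝[≥] (0 : ℝ), ∀ x ∈ Set.Icc 0 L, |f t x| ≤ C := by
  have hc : Continuous fun x => f 0 x := hf.continuous le_rfl hT
  obtain ⟨C, hC⟩ := (isCompact_Icc (a := (0 : ℝ)) (b := L)).exists_bound_of_continuousOn
    hc.continuousOn
  refine ⟨C + 1, eventually_nhdsWithin_of_eventually_nhds ?_⟩
  refine isCompact_Icc.eventually_forall_of_forall_eventually fun x hx => ?_
  have h1 : ContinuousAt (fun p : ℝ × ℝ => |f p.1 p.2|) (0, x) := (hf 0 x le_rfl hT).continuousAt.abs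
  exact h1.eventually (Iic_mem_nhds (lt_of_le_of_lt (hC x hx) (lt_add_one C)))

/-- Taylor's formula in the first variable, with a uniform remainder. -/
theorem StripAnalytic.taylor (hT : 0 < T) (hf : StripAnalytic T f) (L : ℝ) (n : ℕ) :
    ∃ C, ∀ᶠ t in 𝓝[≥] (0 : ℝ), ∀ x ∈ Set.Icc 0 L,
      |f t x - ∑ j ∈ Finset.range n, t ^ j / j.factorial * (dX^[j] f) 0 x| ≤ C * t ^ n := by
  induction n generalizing f with
  | zero => simpa using hf.bounded hT L
  | succ n ih =>
    obtain ⟨C, hC⟩ := ih hf.diff_fst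
    refine ⟨C, ?_⟩
    have h := hC.and (eventually_lt_of_pos hT)
    obtain ⟨δ, hδ, hsub⟩ := mem_nhdsGE_iff_exists_Ico_subset.1 h
    filter_upwards [Ico_mem_nhdsGE (show (0 : ℝ) < δ from hδ)] with t ht x hx
    set P : ℝ → ℝ := fun s => f s x - ∑ j ∈ Finset.range (n + 1),
      s ^ j / j.factorial * (dX^[j] f) 0 x with hP
    have hP0 : P 0 = 0 := by
      simp only [hP]
      rw [Finset.sum_range_succ', Finset.sum_eq_zero fun j _ => by simp]
      simp
    have hPd : ∀ s ∈ Set.Icc 0 t, HasDerivWithinAt P (dX f s x - ∑ j ∈ Finset.range n,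
        s ^ j / j.factorial * (dX^[j] (dX f)) 0 x) (Set.Icc 0 t) s := by
      intro s hs
      have hsT := (hsub (⟨hs.1, hs.2.trans_lt ht.2⟩ : s ∈ Set.Ico 0 δ)).2
      have h1 := hf.hasDerivAt_fst (x := x) hsT.1 hsT.2
      have h2 : HasDerivAt (fun s : ℝ => ∑ j ∈ Finset.range (n + 1),
          s ^ j / j.factorial * (dX^[j] f) 0 x) (∑ j ∈ Finset.range n,
          s ^ j / j.factorial * (dX^[j] (dX f)) 0 x) s := by
        have h3 : HasDerivAt (fun s : ℝ => ∑ j ∈ Finset.range (n + 1),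
            s ^ j / j.factorial * (dX^[j] f) 0 x) (∑ j ∈ Finset.range (n + 1),
            (j * s ^ (j - 1)) / j.factorial * (dX^[j] f) 0 x) s :=
          HasDerivAt.fun_sum fun j _ => ((hasDerivAt_pow j s).div_const _).mul_const _
        refine h3.congr_deriv ?_
        rw [Finset.sum_range_succ']
        simp only [CharP.cast_eq_zero, zero_mul, zero_div, add_zero]
        refine Finset.sum_congr rfl fun j _ => ?_
        rw [Nat.factorial_succ, Function.iterate_succ_apply]
        push_cast
        have : (j.factorial : ℝ) ≠ 0 := by positivity
        have : (j : ℝ) + 1 ≠ 0 := by positivity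
        field_simp
      exact (h1.sub h2).hasDerivWithinAt
    have hb : ∀ s ∈ Set.Icc 0 t, ‖dX f s x - ∑ j ∈ Finset.range n,
        s ^ j / j.factorial * (dX^[j] (dX f)) 0 x‖ ≤ C * t ^ n := by
      intro s hs
      have h1 := (hsub (⟨hs.1, hs.2.trans_lt ht.2⟩ : s ∈ Set.Ico 0 δ)).1 x hx
      have h2 := (hsub (⟨ht.1, ht.2⟩ : t ∈ Set.Ico 0 δ)).1 x hx
      have hs0 := hs.1
      rcases eq_or_lt_of_le ht.1 with h0 | h0
      · have : s = t := le_antisymm hs.2 (by rw [← h0]; exact hs.1)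
        rw [this]; exact h2
      · have hC0 : 0 ≤ C := nonneg_of_mul_nonneg_left ((abs_nonneg _).trans h2) (by positivity)
        exact h1.trans (by gcongr; exact hs.2)
    have := (convex_Icc 0 t).norm_image_sub_le_of_norm_hasDerivWithin_le hPd hb
      (Set.left_mem_Icc.2 ht.1) (Set.right_mem_Icc.2 ht.1)
    rw [hP0, sub_zero, sub_zero, Real.norm_eq_abs, Real.norm_eq_abs, abs_of_nonneg ht.1] at this
    rw [pow_succ, ← mul_assoc]
    exact this

theorem StripAnalytic.unifO_one (hT : 0 < T) (hf : StripAnalytic T f) (L : ℝ) :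
    UnifO L 1 (fun t x => f t x - f 0 x) := by
  obtain ⟨C, hC⟩ := hf.taylor hT L 1
  refine ⟨C, Filter.Eventually.filter_mono (nhdsWithin_mono _ Set.Ioi_subset_Ici_self) ?_⟩
  simpa using hC

end Strip

section UnifO

variable {L : ℝ} {n m : ℕ} {f g : ℝ → ℝ → ℝ}

theorem UnifO.add (hf : UnifO L n f) (hg : UnifO L n g) : UnifO L n (fun t x => f t x + g t x) := by
  obtain ⟨C, hC⟩ := hf
  obtain ⟨D, hD⟩ := hg
  refine ⟨C + D, ?_⟩
  filter_upwards [hC, hD] with t h1 h2 x hx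
  rw [add_mul]
  exact (abs_add_le _ _).trans (add_le_add (h1 x hx) (h2 x hx))

theorem UnifO.mul (hf : UnifO L n f) (hg : UnifO L m g) :
    UnifO L (n + m) (fun t x => f t x * g t x) := by
  obtain ⟨C, hC⟩ := hf
  obtain ⟨D, hD⟩ := hg
  refine ⟨C * D, ?_⟩
  filter_upwards [hC, hD] with t h1 h2 x hx
  rw [abs_mul, pow_add, show C * D * (t ^ n * t ^ m) = C * t ^ n * (D * t ^ m) by ring]
  exact mul_le_mul (h1 x hx) (h2 x hx) (abs_nonneg _) ((abs_nonneg _).trans (h1 x hx))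

theorem UnifO.congr (hf : UnifO L n f) (h : ∀ t x, f t x = g t x) : UnifO L n g := by
  obtain ⟨C, hC⟩ := hf
  refine ⟨C, ?_⟩
  filter_upwards [hC] with t h1 x hx using by rw [← h]; exact h1 x hx

theorem UnifO.isBigO_integral (hL : 0 ≤ L) (hf : UnifO L n f) :
    (fun t => ∫ x in (0 : ℝ)..L, f t x) =O[𝓝[>] 0] fun t => t ^ n := by
  obtain ⟨C, hC⟩ := hf
  refine IsBigO.of_bound (C * L) ?_
  filter_upwards [hC, self_mem_nhdsWithin] with t ht ht0
  have ht0' : 0 < t := ht0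
  have h := intervalIntegral.norm_integral_le_of_norm_le_const (a := 0) (b := L)
    (C := C * t ^ n) (f := f t) (fun x hx => by
      rw [Set.uIoc_of_le hL] at hx
      exact ht x (Set.Ioc_subset_Icc_self hx))
  rw [sub_zero, abs_of_nonneg hL] at h
  rw [Real.norm_eq_abs (t ^ n), abs_of_pos (by positivity)]
  linarith

theorem unifO_of_continuous {h : ℝ → ℝ} (hh : Continuous h) (L : ℝ) :
    UnifO L 0 (fun _ x => h x) := by
  obtain ⟨C, hC⟩ := (isCompact_Icc (a := (0 : ℝ)) (b := L)).exists_bound_of_continuousOn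
    hh.continuousOn
  exact ⟨C, Eventually.of_forall fun t x hx => by simpa using hC x hx⟩

end UnifO

section Series

variable {T τ : ℝ} {f : ℝ → ℝ → ℝ}

theorem StripAnalytic.iterate_dY_periodic {Λ : ℝ} {t : ℝ}
    (hp : ∀ x, f t (x + Λ) = f t x) (k : ℕ) (x : ℝ) :
    (dY^[k] f) t (x + Λ) = (dY^[k] f) t x := by
  induction k generalizing x with
  | zero => exact hp x
  | succ k ih =>
    rw [Function.iterate_succ_apply', dY, dY, ← deriv_comp_add_const]
    congr 1
    ext s
    exact ih s

theorem iterate_dY_zero (h0 : ∀ x, f 0 x = 0) (k : ℕ) (x : ℝ) : (dY^[k] f) 0 x = 0 := by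
  induction k generalizing x with
  | zero => exact h0 x
  | succ k ih =>
    rw [Function.iterate_succ_apply', dY]
    simp only [ih, deriv_const']

theorem StripAnalytic.deriv_bound (hT : 0 < T) (hf : StripAnalytic T f) (h0 : ∀ x, f 0 x = 0) (L : ℝ) :
    ∃ C, ∀ᶠ t in 𝓝[>] (0 : ℝ), ∀ k ≤ 5, ∀ x ∈ Set.Icc 0 L, |(dY^[k] f) t x| ≤ C * t := by
  have hk : ∀ k : ℕ, ∃ C, ∀ᶠ t in 𝓝[>] (0 : ℝ), ∀ x ∈ Set.Icc 0 L, |(dY^[k] f) t x| ≤ C * t := by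
    intro k
    obtain ⟨C, hC⟩ := (hf.iterate_dY k).unifO_one hT L
    have hz := iterate_dY_zero h0 k
    refine ⟨C, ?_⟩
    filter_upwards [hC] with t ht x hx
    simpa [hz] using ht x hx
  choose C hC using hk
  refine ⟨∑ k ∈ Finset.range 6, |C k|, ?_⟩
  have h := (Filter.eventually_all_finset (Finset.range 6)).2 fun k _ => hC k
  filter_upwards [h, self_mem_nhdsWithin] with t ht ht0 k hk x hx
  have ht0' : 0 < t := ht0
  refine (ht k (Finset.mem_range.2 (by omega)) x hx).trans ?_
  gcongr
  exact (le_abs_self _).trans (Finset.single_le_sum (f := fun k => |C k|)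
    (fun _ _ => abs_nonneg _) (Finset.mem_range.2 (by omega)))

theorem StripAnalytic.exists_series (hT : 0 < T) (hτ : 0 < τ) (hf : StripAnalytic T f)
    (h0 : ∀ x, f 0 x = 0) (hp : ∀ t x, 0 ≤ t → t < T → f t (x + 2 * Real.pi / τ) = f t x)
    {e : ℕ} (he : e ≤ 1) (hpar : ∀ t x, 0 ≤ t → t < T → f t (-x) = (-1) ^ e * f t x) :
    ∃ C, ∀ᶠ t in 𝓝[>] (0 : ℝ), ∃ a, FourierBound 3 (C * t) a ∧ ∀ x, trigSeries τ e a x = f t x := by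
  obtain ⟨C, hC⟩ := hf.deriv_bound hT h0 (2 * Real.pi / τ)
  refine ⟨coefConst τ * C, ?_⟩
  filter_upwards [hC, nhdsWithin_mono _ Set.Ioi_subset_Ici_self (eventually_lt_of_pos hT)]
    with t ht htT
  have hd : ∀ k x, HasDerivAt ((dY^[k] f) t) ((dY^[k + 1] f) t x) x := fun k x => by
    rw [Function.iterate_succ_apply']
    exact (hf.iterate_dY k).hasDerivAt_snd htT.1 htT.2
  have hp' : ∀ k x, (dY^[k] f) t (x + 2 * Real.pi / τ) = (dY^[k] f) t x :=
    StripAnalytic.iterate_dY_periodic fun x => hp t x htT.1 htT.2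
  interval_cases e
  · obtain ⟨a, h1, h2⟩ := exists_cos_series hτ (F := fun k => (dY^[k] f) t) hd hp'
      (fun x => by simpa using hpar t x htT.1 htT.2) (C := C * t) ht
    exact ⟨a, by rwa [mul_assoc], h2⟩
  · obtain ⟨a, h1, h2⟩ := exists_sin_series hτ (F := fun k => (dY^[k] f) t) hd hp'
      (fun x => by simpa using hpar t x htT.1 htT.2) (C := C * t) ht
    exact ⟨a, by rwa [mul_assoc], h2⟩

end Series

section Jets

/-- `f t = a + b t + c t² + e t³ + O(t⁴)`. -/
def HasJet (f : ℝ → ℝ) (a b c e : ℝ) : Prop :=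
  (fun t => f t - (a + b * t + c * t ^ 2 + e * t ^ 3)) =O[𝓝[>] 0] fun t : ℝ => t ^ 4

theorem isBigO_one_of_continuous {g : ℝ → ℝ} (hg : Continuous g) :
    g =O[𝓝[>] 0] fun _ => (1 : ℝ) :=
  (hg.continuousAt.isBigO_one ℝ).mono nhdsWithin_le_nhds

theorem isBigO_pow_of_le {m n : ℕ} (h : m ≤ n) :
    (fun t : ℝ => t ^ n) =O[𝓝[>] 0] fun t : ℝ => t ^ m := by
  obtain ⟨k, rfl⟩ := Nat.exists_eq_add_of_le h
  have h1 := (isBigO_refl (fun t : ℝ => t ^ m) (𝓝[>] 0)).mul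
    (isBigO_one_of_continuous (continuous_pow k))
  simpa only [mul_one, ← pow_add] using h1

theorem coef_eq_zero_of_isBigO {c : ℝ} {n : ℕ} {g : ℝ → ℝ} (hg : g =O[𝓝[>] 0] fun _ => (1 : ℝ))
    (h : (fun t => c + t * g t) =O[𝓝[>] 0] fun t : ℝ => t ^ (n + 1)) :
    c = 0 ∧ g =O[𝓝[>] 0] fun t : ℝ => t ^ n := by
  have ht : Tendsto (fun t : ℝ => t) (𝓝[>] 0) (𝓝 0) := tendsto_id.mono_left nhdsWithin_le_nhds
  have h1 : Tendsto (fun t => c + t * g t) (𝓝[>] 0) (𝓝 0) :=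
    h.trans_tendsto (by simpa using ht.pow (n + 1))
  have h2 : Tendsto (fun t => t * g t) (𝓝[>] 0) (𝓝 0) := by
    have : (fun t => t * g t) =O[𝓝[>] 0] fun t : ℝ => t * 1 := (isBigO_refl _ _).mul hg
    exact this.trans_tendsto (by simpa using ht)
  have hc : c = 0 := by
    have := tendsto_nhds_unique (h2.const_add c) h1
    linarith
  refine ⟨hc, ?_⟩
  subst hc
  have h3 := (isBigO_refl (fun t : ℝ => t⁻¹) (𝓝[>] 0)).mul h
  refine (h3.congr' ?_ ?_)
  · filter_upwards [self_mem_nhdsWithin] with t ht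
    have : t ≠ 0 := ne_of_gt ht
    field_simp
    ring
  · filter_upwards [self_mem_nhdsWithin] with t ht
    have : t ≠ 0 := ne_of_gt ht
    rw [pow_succ]
    field_simp

theorem linear_eq_zero_of_isBigO {a b : ℝ}
    (h : (fun t => a + b * t) =O[𝓝[>] 0] fun t : ℝ => t ^ 2) : a = 0 ∧ b = 0 := by
  have h1 := coef_eq_zero_of_isBigO (c := a) (g := fun _ => b) (n := 1)
    (isBigO_one_of_continuous (by fun_prop)) (h.congr_left fun t => by ring)
  have h2 := coef_eq_zero_of_isBigO (c := b) (g := fun _ => 0) (n := 0)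
    (isBigO_one_of_continuous (by fun_prop)) (h1.2.congr_left fun t => by ring)
  exact ⟨h1.1, h2.1⟩

theorem HasJet.unique {f : ℝ → ℝ} {a b c e a' b' c' e' : ℝ} (h : HasJet f a b c e)
    (h' : HasJet f a' b' c' e') : a = a' ∧ b = b' ∧ c = c' ∧ e = e' := by
  have h0 := IsBigO.sub h' h
  have h1 := coef_eq_zero_of_isBigO (c := a - a')
    (g := fun t => (b - b') + (c - c') * t + (e - e') * t ^ 2) (n := 3)
    (isBigO_one_of_continuous (by fun_prop)) (h0.congr_left fun t => by ring)
  have h2 := coef_eq_zero_of_isBigO (c := b - b')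
    (g := fun t => (c - c') + (e - e') * t) (n := 2)
    (isBigO_one_of_continuous (by fun_prop)) (h1.2.congr_left fun t => by ring)
  have h3 := linear_eq_zero_of_isBigO h2.2
  exact ⟨by linarith [h1.1], by linarith [h2.1], by linarith [h3.1], by linarith [h3.2]⟩

theorem HasJet.congr' {f g : ℝ → ℝ} {a b c e : ℝ} (h : HasJet f a b c e)
    (hfg : ∀ᶠ t in 𝓝[>] (0 : ℝ), f t = g t) : HasJet g a b c e :=
  IsBigO.congr' h (hfg.mono fun t ht => by simp only [ht]) EventuallyEq.rfl

theorem HasJet.add {f g : ℝ → ℝ} {a b c e a' b' c' e' : ℝ} (h : HasJet f a b c e)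
    (h' : HasJet g a' b' c' e') :
    HasJet (fun t => f t + g t) (a + a') (b + b') (c + c') (e + e') :=
  (IsBigO.add h h').congr_left fun t => by ring

theorem HasJet.const (k : ℝ) : HasJet (fun _ => k) k 0 0 0 :=
  (isBigO_zero _ _).congr_left fun t => by ring

theorem HasJet.isBigO_one {f : ℝ → ℝ} {a b c e : ℝ} (h : HasJet f a b c e) :
    f =O[𝓝[>] 0] fun _ => (1 : ℝ) := by
  have h1 : (fun t : ℝ => t ^ 4) =O[𝓝[>] 0] fun _ => (1 : ℝ) :=
    isBigO_one_of_continuous (by fun_prop)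
  refine ((IsBigO.trans h h1).add (isBigO_one_of_continuous
    (g := fun t => a + b * t + c * t ^ 2 + e * t ^ 3) (by fun_prop))).congr_left fun t => by ring

theorem HasJet.mul {f g : ℝ → ℝ} {a b c e a' b' c' e' : ℝ} (h : HasJet f a b c e)
    (h' : HasJet g a' b' c' e') :
    HasJet (fun t => f t * g t) (a * a') (a * b' + b * a') (a * c' + b * b' + c * a')
      (a * e' + b * c' + c * b' + e * a') := by
  have h1 := IsBigO.mul h h'.isBigO_one
  have h2 := (isBigO_one_of_continuous (g := fun t => a + b * t + c * t ^ 2 + e * t ^ 3)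
    (by fun_prop)).mul h'
  have h3 : (fun t : ℝ => t ^ 4 * (b * e' + c * c' + e * b' + (c * e' + e * c') * t + e * e' * t ^ 2))
      =O[𝓝[>] 0] fun t : ℝ => t ^ 4 * 1 :=
    (isBigO_refl _ _).mul (isBigO_one_of_continuous (by fun_prop))
  simp only [mul_one, one_mul] at h1 h2 h3
  exact ((h1.add h2).add h3).congr_left fun t => by ring

theorem HasJet.const_mul {f : ℝ → ℝ} {a b c e : ℝ} (h : HasJet f a b c e) (k : ℝ) :
    HasJet (fun t => k * f t) (k * a) (k * b) (k * c) (k * e) :=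
  (IsBigO.const_mul_left h k).congr_left fun t => by ring

theorem HasJet.sub {f g : ℝ → ℝ} {a b c e a' b' c' e' : ℝ} (h : HasJet f a b c e)
    (h' : HasJet g a' b' c' e') :
    HasJet (fun t => f t - g t) (a - a') (b - b') (c - c') (e - e') :=
  (IsBigO.sub h h').congr_left fun t => by ring

theorem isBigO_taylor {T : ℝ} (hT : 0 < T) {h : ℝ → ℝ}
    (hh : ∀ t, 0 ≤ t → t < T → AnalyticAt ℝ h t) (n : ℕ) :
    (fun t => h t - ∑ j ∈ Finset.range n, t ^ j / j.factorial * (dX^[j] fun t _ => h t) 0 0)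
      =O[𝓝[>] 0] fun t => t ^ n := by
  obtain ⟨C, hC⟩ := (StripAnalytic.of_fst hh).taylor hT 0 n
  refine IsBigO.of_bound C ?_
  have h1 : 𝓝[>] (0 : ℝ) ≤ 𝓝[≥] 0 := nhdsWithin_mono _ Set.Ioi_subset_Ici_self
  filter_upwards [h1 hC, self_mem_nhdsWithin] with t ht ht0
  have ht0' : 0 < t := ht0
  rw [Real.norm_eq_abs (t ^ n), abs_of_pos (by positivity)]
  exact ht 0 (by simp)

theorem exists_hasJet {T : ℝ} (hT : 0 < T) {h : ℝ → ℝ}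
    (hh : ∀ t, 0 ≤ t → t < T → AnalyticAt ℝ h t) :
    ∃ c e, HasJet h (h 0) (deriv h 0) c e := by
  have := isBigO_taylor hT hh 4
  refine ⟨(dX^[2] fun t _ => h t) 0 0 / 2, (dX^[3] fun t _ => h t) 0 0 / 6,
    this.congr_left fun t => ?_⟩
  simp only [Finset.sum_range_succ, Finset.sum_range_zero, Nat.factorial, Function.iterate_zero,
    Function.iterate_one, id, dX]
  norm_num
  ring

theorem eq_of_isBigO_sq {T : ℝ} (hT : 0 < T) {h : ℝ → ℝ}
    (hh : ∀ t, 0 ≤ t → t < T → AnalyticAt ℝ h t) {a b : ℝ}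
    (h' : (fun t => h t - (a + t * b)) =O[𝓝[>] 0] fun t => t ^ 2) : h 0 = a ∧ deriv h 0 = b := by
  have h1 := isBigO_taylor hT hh 2
  have h2 := linear_eq_zero_of_isBigO (a := h 0 - a) (b := deriv h 0 - b)
    ((h'.sub h1).congr_left fun t => by
      simp only [Finset.sum_range_succ, Finset.sum_range_zero, Nat.factorial, Function.iterate_zero,
        Function.iterate_one, id, dX]
      norm_num
      ring)
  exact ⟨by linarith [h2.1], by linarith [h2.2]⟩

end Jets

section OneSided

theorem HasDerivAt.eq_of_eqOn_Icc {f g : ℝ → ℝ} {f' g' a b : ℝ} (hab : a < b)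
    (hf : HasDerivAt f f' b) (hg : HasDerivAt g g' b) (h : ∀ y ∈ Set.Icc a b, f y = g y) :
    f' = g' := by
  have hu : UniqueDiffWithinAt ℝ (Set.Icc a b) b := uniqueDiffOn_Icc hab b ⟨hab.le, le_rfl⟩
  refine hu.eq_deriv _ (hf.hasDerivWithinAt) ?_
  exact hg.hasDerivWithinAt.congr h (h b ⟨hab.le, le_rfl⟩)

theorem eq_zero_of_continuousAt_left {g : ℝ → ℝ} {a b : ℝ} (hab : a < b) (hg : ContinuousAt g b)
    (h : ∀ y, a < y → y < b → g y = 0) : g b = 0 := by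
  have h1 : Tendsto g (𝓝[<] b) (𝓝 (g b)) := hg.tendsto.mono_left nhdsWithin_le_nhds
  refine tendsto_nhds_unique h1 (tendsto_const_nhds.congr' ?_)
  filter_upwards [Ioo_mem_nhdsLT hab] with y hy using (h y hy.1 hy.2).symm

theorem deriv_laminarU (a d y : ℝ) : HasDerivAt (laminarU a d) (-a / 2 * (2 * y - d) + 1 / d) y := by
  have h1 : HasDerivAt (fun y : ℝ => -a / 2 * y * (y - d) + y / d)
      (-a / 2 * 1 * (y - d) + -a / 2 * y * 1 + 1 / d) y :=
    (((hasDerivAt_id' y).const_mul (-a / 2)).mul ((hasDerivAt_id' y).sub_const d)).add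
      ((hasDerivAt_id' y).div_const d)
  exact h1.congr_deriv (by ring)

end OneSided

/-- The relations on the surface of a branch of waves, in terms of the elevation `η`, the wave
number `lam`, and the vertical derivative `s` of the stream function on the surface. -/
structure SurfaceRelations (a d κ τ T : ℝ) (ψ : ℝ → ℝ → ℝ → ℝ) (η s : ℝ → ℝ → ℝ) (lam : ℝ → ℝ) :
    Prop where
  T_pos : 0 < T
  d_pos : 0 < d
  kappa_pos : 0 < κ
  tau_pos : 0 < τ
  eta_analytic : StripAnalytic T η
  s_analytic : StripAnalytic T s
  lam_analytic : ∀ t, 0 ≤ t → t < T → AnalyticAt ℝ lam t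
  eta_pos : ∀ t x, 0 ≤ t → t < T → 0 < η t x
  s_pos : ∀ t x, 0 ≤ t → t < T → 0 < s t x
  lam_pos : ∀ t, 0 ≤ t → t < T → 0 < lam t
  eta_even : ∀ t x, 0 ≤ t → t < T → η t (-x) = η t x
  s_even : ∀ t x, 0 ≤ t → t < T → s t (-x) = s t x
  eta_periodic : ∀ t x, 0 ≤ t → t < T → η t (x + 2 * Real.pi / τ) = η t x
  s_periodic : ∀ t x, 0 ≤ t → t < T → s t (x + 2 * Real.pi / τ) = s t x
  eta_zero : ∀ x, η 0 x = d
  eta_deriv : ∀ x, dX η 0 x = Real.cos (τ * x)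
  s_zero : ∀ x, s 0 x = κ
  lam_zero : lam 0 = 1
  lam_deriv : deriv lam 0 = 0
  dY_psi : ∀ t x, dY (ψ t) x (η t x) = s t x
  dX_psi : ∀ t x, 0 ≤ t → t < T → dX (ψ t) x (η t x) = -(s t x * dY η t x)
  bernoulli : ∀ t x, 0 ≤ t → t < T →
    s t x ^ 2 * (1 + lam t ^ 2 * dY η t x ^ 2) = κ ^ 2 - 2 * (η t x - d)
  rho : ∀ t x, 0 ≤ t → t < T → rhoHat (ψ t) (η t) (lam t) x
    = 1 + s t x * (lam t ^ 2 * (dY s t x * dY η t x + s t x * dY (dY η) t x) - a)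

section Branch

variable {a d T : ℝ} {ψ : ℝ → ℝ → ℝ → ℝ} {η : ℝ → ℝ → ℝ} {lam : ℝ → ℝ}

theorem IsStokesBranch.mono (hB : IsStokesBranch a d T ψ η lam) {T' : ℝ} (h0 : 0 < T')
    (h : T' ≤ T) : IsStokesBranch a d T' ψ η lam where
  T_pos := h0
  wave t h1 h2 := hB.wave t h1 (h2.trans_le h)
  analytic_lam t h1 h2 := hB.analytic_lam t h1 (h2.trans_le h)
  analytic_eta t x h1 h2 := hB.analytic_eta t x h1 (h2.trans_le h)
  analytic_psi t x y h1 h2 := hB.analytic_psi t x y h1 (h2.trans_le h)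
  expand_psi := hB.expand_psi
  expand_eta := hB.expand_eta
  expand_lam := hB.expand_lam

theorem IsStokesBranch.analytic₃ (hB : IsStokesBranch a d T ψ η lam) {t x y : ℝ} (h0 : 0 ≤ t)
    (h1 : t < T) (h2 : 0 ≤ y) (h3 : y ≤ η t x) : Analytic₃ ψ t x y :=
  hB.analytic_psi t x y h0 h1 h2 h3

theorem IsStokesBranch.strip_eta (hB : IsStokesBranch a d T ψ η lam) : StripAnalytic T η :=
  hB.analytic_eta

/-- The restriction of an analytic function to the surface. -/
theorem IsStokesBranch.strip_trace (hB : IsStokesBranch a d T ψ η lam) {φ : ℝ → ℝ → ℝ → ℝ}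
    (hφ : ∀ t x y, Analytic₃ ψ t x y → Analytic₃ φ t x y) :
    StripAnalytic T (fun t x => φ t x (η t x)) := fun t x h0 h1 =>
  Analytic₃.comp₂ (p := (t, x)) (f := Prod.fst) (g := Prod.snd) (h := fun p => η p.1 p.2)
    (hφ _ _ _ (hB.analytic₃ h0 h1 ((hB.wave t h0 h1).eta_pos x).le le_rfl))
    analyticAt_fst analyticAt_snd (hB.analytic_eta t x h0 h1)

theorem IsStokesBranch.eta_jet (hB : IsStokesBranch a d T ψ η lam) (x : ℝ) :
    η 0 x = d ∧ dX η 0 x = Real.cos (tauStar a d * x) :=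
  eq_of_isBigO_sq (h := fun t => η t x) hB.T_pos (fun t h0 h1 =>
    AnalyticAt.fun_comp (f := fun s : ℝ => (s, x)) (g := fun p : ℝ × ℝ => η p.1 p.2)
      (hB.analytic_eta t x h0 h1) (analyticAt_id.prod analyticAt_const)) (hB.expand_eta x)

theorem IsStokesBranch.lam_jet (hB : IsStokesBranch a d T ψ η lam) :
    lam 0 = 1 ∧ deriv lam 0 = 0 := by
  obtain ⟨l, hl⟩ := hB.expand_lam
  refine eq_of_isBigO_sq hB.T_pos hB.analytic_lam ?_
  have h1 := (hl.trans (isBigO_pow_of_le (m := 2) (by norm_num))).add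
    ((isBigO_refl (fun t : ℝ => t ^ 2) (𝓝[>] 0)).const_mul_left l)
  exact h1.congr_left fun t => by ring

theorem IsStokesBranch.psi_zero (hB : IsStokesBranch a d T ψ η lam) {x y : ℝ} (h0 : 0 ≤ y)
    (h1 : y ≤ d) : ψ 0 x y = laminarU a d y := by
  have hη0 := (hB.eta_jet x).1
  have hA := hB.analytic₃ le_rfl hB.T_pos h0 (h1.trans_eq hη0.symm)
  have hc : ContinuousAt (fun t => ψ t x y) 0 :=
    (hA.slice_tx.differentiableAt.hasDerivAt_dX (v := fun t x => ψ t x y)).continuousAt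
  have ht : Tendsto (fun t : ℝ => t) (𝓝[>] 0) (𝓝 0) := tendsto_id.mono_left nhdsWithin_le_nhds
  have h2 := (hB.expand_psi x y h0 h1).trans_tendsto (by simpa using ht.pow 2)
  have h3 : Tendsto (fun t => ψ t x y) (𝓝[>] 0) (𝓝 (ψ 0 x y)) :=
    hc.tendsto.mono_left nhdsWithin_le_nhds
  have h4 := h3.sub (tendsto_const_nhds.sub (ht.mul_const (kappa a d * gammaFn d (tauStar a d) y *
      Real.cos (tauStar a d * x))) (a := laminarU a d y))
  have h5 := tendsto_nhds_unique h4 h2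
  linarith

theorem kappa_eq (a : ℝ) {d : ℝ} : -a / 2 * (2 * d - d) + 1 / d = kappa a d := by
  rw [kappa]; ring

theorem IsSteadyWave.dX_psi {R Λ l : ℝ} {ψ : ℝ → ℝ → ℝ} {η : ℝ → ℝ}
    (hW : IsSteadyWave a R Λ ψ η l) {x η' : ℝ} (hη : HasDerivAt η η' x)
    (hψ : DifferentiableAt ℝ (fun p : ℝ × ℝ => ψ p.1 p.2) (x, η x)) :
    dX ψ x (η x) = -(dY ψ x (η x) * η') := by
  have h1 := hψ.hasDerivAt_comp₂ (f := fun s => s) (g := η) (hasDerivAt_id' x) hη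
  have h2 : HasDerivAt (fun s => ψ s (η s)) 0 x := by
    simp only [hW.surface]; exact hasDerivAt_const _ _
  have := h1.unique h2
  linarith

theorem IsStokesBranch.exists_surfaceRelations (hB : IsStokesBranch a d T ψ η lam) (hd : 0 < d)
    (hκ : 0 < kappa a d) (hτ : 0 < tauStar a d) :
    ∃ T', 0 < T' ∧ T' ≤ T ∧ SurfaceRelations a d (kappa a d) (tauStar a d) T' ψ η
      (fun t x => dY (ψ t) x (η t x)) lam := by
  have hs : StripAnalytic T (fun t x => dY (ψ t) x (η t x)) := hB.strip_trace fun t x y h => h.dY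
  have hsx : StripAnalytic T (fun t x => dX (ψ t) x (η t x)) := hB.strip_trace fun t x y h => h.dX
  have hA : ∀ t x, 0 ≤ t → t < T → Analytic₃ ψ t x (η t x) := fun t x h0 h1 =>
    hB.analytic₃ h0 h1 ((hB.wave t h0 h1).eta_pos x).le le_rfl
  have hdY : ∀ t x x' y, 0 ≤ t → t < T → 0 ≤ y → y ≤ η t x → Analytic₃ ψ t x' y →
      HasDerivAt (fun y => ψ t x' y) (dY (ψ t) x' y) y := fun t x x' y _ _ _ _ h =>
    h.slice_xy.differentiableAt.hasDerivAt_dY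
  have s_periodic : ∀ t x, 0 ≤ t → t < T → dY (ψ t) (x + 2 * Real.pi / tauStar a d)
      (η t (x + 2 * Real.pi / tauStar a d)) = dY (ψ t) x (η t x) := by
    intro t x h0 h1
    have hW := hB.wave t h0 h1
    have h2 := (hA t (x + 2 * Real.pi / tauStar a d) h0 h1).slice_xy.differentiableAt.hasDerivAt_dY
    rw [hW.eta_periodic] at h2 ⊢
    exact h2.eq_of_eqOn_Icc (hW.eta_pos x) (hA t x h0 h1).slice_xy.differentiableAt.hasDerivAt_dY
      fun y hy => hW.psi_periodic x y hy.1 hy.2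
  have s_even : ∀ t x, 0 ≤ t → t < T → dY (ψ t) (-x) (η t (-x)) = dY (ψ t) x (η t x) := by
    intro t x h0 h1
    have hW := hB.wave t h0 h1
    have h2 := (hA t (-x) h0 h1).slice_xy.differentiableAt.hasDerivAt_dY
    rw [hW.eta_even] at h2 ⊢
    exact h2.eq_of_eqOn_Icc (hW.eta_pos x) (hA t x h0 h1).slice_xy.differentiableAt.hasDerivAt_dY
      fun y hy => hW.psi_even x y hy.1 hy.2
  have s_zero : ∀ x, dY (ψ 0) x (η 0 x) = kappa a d := by
    intro x
    have h2 := (hA 0 x le_rfl hB.T_pos).slice_xy.differentiableAt.hasDerivAt_dY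
    rw [(hB.eta_jet x).1] at h2 ⊢
    rw [← kappa_eq a]
    exact h2.eq_of_eqOn_Icc hd (deriv_laminarU a d d) fun y hy => hB.psi_zero hy.1 hy.2
  obtain ⟨C, hC⟩ := hs.taylor hB.T_pos (2 * Real.pi / tauStar a d) 1
  have hpos : ∀ᶠ t in 𝓝[≥] (0 : ℝ), C * t < kappa a d := by
    have h2 : Tendsto (fun t : ℝ => C * t) (𝓝[≥] 0) (𝓝 0) := by
      have : Continuous fun t : ℝ => C * t := by fun_prop
      simpa using this.continuousAt (x := 0) |>.tendsto.mono_left nhdsWithin_le_nhds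
    exact h2.eventually (gt_mem_nhds hκ)
  obtain ⟨δ, hδ, hsub⟩ := mem_nhdsGE_iff_exists_Ico_subset.1
    ((hC.and hpos).and (eventually_lt_of_pos hB.T_pos))
  have hδ0 : (0 : ℝ) < δ := hδ
  have hT' : 0 < min δ T := lt_min hδ0 hB.T_pos
  have hB' := hB.mono hT' (min_le_right _ _)
  have hle : ∀ t, t < min δ T → t < T := fun t h => h.trans_le (min_le_right _ _)
  refine ⟨min δ T, hT', min_le_right _ _, ?_⟩
  have dX_psi : ∀ t x, 0 ≤ t → t < T → dX (ψ t) x (η t x)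
      = -(dY (ψ t) x (η t x) * dY η t x) := fun t x h0 h1 =>
    (hB.wave t h0 h1).dX_psi (hB.strip_eta.hasDerivAt_snd h0 h1)
      (hA t x h0 h1).slice_xy.differentiableAt
  have s_pos : ∀ t x, 0 ≤ t → t < min δ T → 0 < dY (ψ t) x (η t x) := by
    intro t x h0 h1
    have ht := hsub (⟨h0, h1.trans_le (min_le_left _ _)⟩ : t ∈ Set.Ico 0 δ)
    have hp : Function.Periodic (fun x => dY (ψ t) x (η t x)) (2 * Real.pi / tauStar a d) :=
      fun x => s_periodic t x h0 (hle t h1)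
    obtain ⟨x', hx', he⟩ := hp.exists_mem_Ico₀ (period_pos hτ) x
    have h2 := ht.1.1 x' (Set.Ico_subset_Icc_self hx')
    simp only [Finset.range_one, Finset.sum_singleton, pow_zero, Nat.factorial_zero, Nat.cast_one,
      div_one, one_mul, Function.iterate_zero, id, s_zero, pow_one] at h2
    have h3 := (abs_le.1 h2).1
    have h4 := ht.1.2
    have he' : dY (ψ t) x (η t x) = dY (ψ t) x' (η t x') := he
    rw [he']
    linarith
  exact {
    T_pos := hT'
    d_pos := hd
    kappa_pos := hκ
    tau_pos := hτ
    eta_analytic := hB'.strip_eta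
    s_analytic := fun t x h0 h1 => hs t x h0 (hle t h1)
    lam_analytic := hB'.analytic_lam
    eta_pos := fun t x h0 h1 => (hB'.wave t h0 h1).eta_pos x
    s_pos := s_pos
    lam_pos := fun t h0 h1 => (hB'.wave t h0 h1).lam_pos
    eta_even := fun t x h0 h1 => (hB'.wave t h0 h1).eta_even x
    s_even := fun t x h0 h1 => s_even t x h0 (hle t h1)
    eta_periodic := fun t x h0 h1 => (hB'.wave t h0 h1).eta_periodic x
    s_periodic := fun t x h0 h1 => s_periodic t x h0 (hle t h1)
    eta_zero := fun x => (hB.eta_jet x).1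
    eta_deriv := fun x => (hB.eta_jet x).2
    s_zero := s_zero
    lam_zero := hB.lam_jet.1
    lam_deriv := hB.lam_jet.2
    dY_psi := fun _ _ => rfl
    dX_psi := fun t x h0 h1 => dX_psi t x h0 (hle t h1)
    bernoulli := fun t x h0 h1 => by
      have h2 := (hB'.wave t h0 h1).bernoulli x
      rw [dX_psi t x h0 (hle t h1)] at h2
      have h3 : bernoulliR a d = kappa a d ^ 2 / 2 + d := by
        rw [bernoulliR, kappa]
        field_simp
        ring
      rw [h3] at h2
      linear_combination 2 * h2
    rho := fun t x h0 h1 => by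
      have h1' := hle t h1
      have hW := hB.wave t h0 h1'
      have hAx := hA t x h0 h1'
      have hpde : lam t ^ 2 * dX (dX (ψ t)) x (η t x) + dY (dY (ψ t)) x (η t x) + a = 0 := by
        refine eq_zero_of_continuousAt_left (g := fun y => lam t ^ 2 * dX (dX (ψ t)) x y
          + dY (dY (ψ t)) x y + a) (hW.eta_pos x) ?_ fun y hy0 hy1 => hW.equation x y hy0 hy1
        have c1 := (hAx.dX.dX.slice_xy.differentiableAt.hasDerivAt_dY).continuousAt
        have c2 := (hAx.dY.dY.slice_xy.differentiableAt.hasDerivAt_dY).continuousAt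
        exact ((continuousAt_const.mul c1).add c2).add continuousAt_const
      have h2 := hAx.dX.slice_xy.differentiableAt.hasDerivAt_comp₂ (f := fun s => s) (g := η t)
        (hasDerivAt_id' x) (hB.strip_eta.hasDerivAt_snd h0 h1')
      have h3 := ((hs.hasDerivAt_snd h0 h1' (x := x)).mul
        (hB.strip_eta.diff_snd.hasDerivAt_snd h0 h1' (x := x))).neg
      have h4 := h2.unique (h3.congr_of_eventuallyEq
        (Eventually.of_forall fun x => dX_psi t x h0 h1'))
      rw [rhoHat, dX_psi t x h0 h1']
      linear_combination (-(lam t ^ 2 * dY (ψ t) x (η t x))) * h4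
        + dY (ψ t) x (η t x) * hpde }

end Branch

section PullBack

variable {η η₁ η₂ : ℝ → ℝ} {w : ℝ → ℝ → ℝ}

theorem hasDerivAt_div_surface {x y : ℝ} (h0 : η x ≠ 0) (h1 : HasDerivAt η (η₁ x) x) :
    HasDerivAt (fun s => y / η s) (-(y / η x * (η₁ x / η x))) x :=
  ((hasDerivAt_const x y).div h1 h0).congr_deriv (by field_simp; ring)

theorem differentiableAt_of_contDiffAt_two {v : ℝ → ℝ → ℝ} {x y : ℝ}
    (h : ContDiffAt ℝ 2 (fun p : ℝ × ℝ => v p.1 p.2) (x, y)) :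
    DifferentiableAt ℝ (fun p : ℝ × ℝ => v p.1 p.2) (x, y) ∧
    DifferentiableAt ℝ (fun p : ℝ × ℝ => dX v p.1 p.2) (x, y) ∧
    DifferentiableAt ℝ (fun p : ℝ × ℝ => dY v p.1 p.2) (x, y) := by
  have h' : ContDiffAt ℝ ((1 : ℕ) + 1) (fun p : ℝ × ℝ => v p.1 p.2) (x, y) := by
    norm_num; exact h
  exact ⟨h.differentiableAt (by simp), h'.dX.differentiableAt (by simp),
    h'.dY.differentiableAt (by simp)⟩

/-- The derivatives of `v x y = w x (y / η x)`. -/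
theorem pullBack_derivs (hη : ∀ x, 0 < η x) (h1 : ∀ x, HasDerivAt η (η₁ x) x)
    (h2 : ∀ x, HasDerivAt η₁ (η₂ x) x)
    (hw : ∀ x, ∀ z ∈ Set.Ioo (-1 : ℝ) 2, ContDiffAt ℝ 2 (fun p : ℝ × ℝ => w p.1 p.2) (x, z))
    {x y : ℝ} (hz : y / η x ∈ Set.Ioo (-1 : ℝ) 2) :
    dX (fun x y => w x (y / η x)) x y
        = dX w x (y / η x) - y / η x * (η₁ x / η x) * dY w x (y / η x) ∧
    dY (fun x y => w x (y / η x)) x y = dY w x (y / η x) / η x ∧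
    dY (dY (fun x y => w x (y / η x))) x y = dY (dY w) x (y / η x) / η x ^ 2 ∧
    dX (dX (fun x y => w x (y / η x))) x y = dX (dX w) x (y / η x)
      - 2 * (y / η x) * (η₁ x / η x) * dX (dY w) x (y / η x)
      + (y / η x) ^ 2 * (η₁ x / η x) ^ 2 * dY (dY w) x (y / η x)
      + y / η x * (2 * (η₁ x / η x) ^ 2 - η₂ x / η x) * dY w x (y / η x) := by
  have hX : ∀ x y, y / η x ∈ Set.Ioo (-1 : ℝ) 2 → dX (fun x y => w x (y / η x)) x y
      = dX w x (y / η x) - y / η x * (η₁ x / η x) * dY w x (y / η x) := fun x y hz => by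
    have h := (differentiableAt_of_contDiffAt_two (hw x _ hz)).1.hasDerivAt_comp₂
      (f := fun s => s) (g := fun s => y / η s) (hasDerivAt_id' x)
      (hasDerivAt_div_surface (hη x).ne' (h1 x))
    exact (h.congr_deriv (by ring)).deriv
  have hY : ∀ x y, y / η x ∈ Set.Ioo (-1 : ℝ) 2 →
      dY (fun x y => w x (y / η x)) x y = dY w x (y / η x) / η x := fun x y hz => by
    have h := (differentiableAt_of_contDiffAt_two (hw x _ hz)).1.hasDerivAt_comp₂
      (f := fun _ => x) (g := fun s => s / η x) (hasDerivAt_const y x)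
      ((hasDerivAt_id' y).div_const (η x))
    exact (h.congr_deriv (by ring)).deriv
  obtain ⟨-, hd1, hd2⟩ := differentiableAt_of_contDiffAt_two (hw x _ hz)
  refine ⟨hX x y hz, hY x y hz, ?_, ?_⟩
  · have h := (hd2.hasDerivAt_comp₂ (f := fun _ => x) (g := fun s => s / η x)
      (hasDerivAt_const y x) ((hasDerivAt_id' y).div_const (η x))).div_const (η x)
    have hev : ∀ᶠ s in 𝓝 y, s / η x ∈ Set.Ioo (-1 : ℝ) 2 :=
      ((hasDerivAt_id' y).div_const (η x)).continuousAt.eventually (isOpen_Ioo.mem_nhds hz)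
    have h' := h.congr_of_eventuallyEq (hev.mono fun s hs => hY x s hs)
    exact (h'.congr_deriv (by have := (hη x).ne'; field_simp; ring)).deriv
  · have hg := hasDerivAt_div_surface (y := y) (hη x).ne' (h1 x)
    have e1 := hd1.hasDerivAt_comp₂ (f := fun s => s) (g := fun s => y / η s)
      (hasDerivAt_id' x) hg
    have e2 := hd2.hasDerivAt_comp₂ (f := fun s => s) (g := fun s => y / η s)
      (hasDerivAt_id' x) hg
    have e3 := (h2 x).div (h1 x) (hη x).ne'
    have h := e1.sub ((hg.mul e3).mul e2)
    have hev : ∀ᶠ s in 𝓝 x, y / η s ∈ Set.Ioo (-1 : ℝ) 2 :=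
      hg.continuousAt.eventually (isOpen_Ioo.mem_nhds hz)
    have h' := h.congr_of_eventuallyEq (hev.mono fun s hs => hX s y hs)
    refine (h'.congr_deriv ?_).deriv
    rw [← ContDiffAt.dX_dY_comm (hw x _ hz)]
    have := (hη x).ne'
    simp only [Pi.mul_apply, Pi.div_apply]
    field_simp
    ring

theorem solvesSpectralProblem_pullBack {Λ d lam μ : ℝ} {ψ : ℝ → ℝ → ℝ} (hd : d ≠ 0)
    (hlam : lam ≠ 0) (hη : ∀ x, 0 < η x) (hη2 : ContDiff ℝ 2 η) (h1 : ∀ x, HasDerivAt η (η₁ x) x)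
    (h2 : ∀ x, HasDerivAt η₁ (η₂ x) x) (hηe : ∀ x, η (-x) = η x) (hηp : ∀ x, η (x + Λ) = η x)
    (hs : ∀ x, dY ψ x (η x) ≠ 0) (hsx : ∀ x, dX ψ x (η x) = -(dY ψ x (η x) * η₁ x))
    (hw : ∀ x, ∀ z ∈ Set.Ioo (-1 : ℝ) 2, ContDiffAt ℝ 2 (fun p : ℝ × ℝ => w p.1 p.2) (x, z))
    (hwe : ∀ x z, w (-x) z = w x z) (hwp : ∀ x z, w (x + Λ) z = w x z) (hw0 : ∀ x, w x 0 = 0)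
    (heq : ∀ x z, 0 ≤ z → z ≤ 1 → dY (dY w) x z + d ^ 2 * dX (dX w) x z
      = 2 * d ^ 2 * (η₁ x / η x) * (z * dX (dY w) x z)
        + (-(d ^ 2 * (η₁ x / η x) ^ 2) * z ^ 2 + (1 - d ^ 2 / (lam ^ 2 * η x ^ 2)))
          * dY (dY w) x z
        + -(d ^ 2 * (2 * (η₁ x / η x) ^ 2 - η₂ x / η x)) * (z * dY w x z))
    (hsurf : ∀ x, dY w x 1 = lam ^ 2 * η x * η₁ x / (1 + lam ^ 2 * η₁ x ^ 2) * dX w x 1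
      + η x / ((1 + lam ^ 2 * η₁ x ^ 2) * dY ψ x (η x) ^ 2) * (rhoHat ψ η lam x + μ) * w x 1) :
    SolvesSpectralProblem Λ ψ η lam μ (fun x y => w x (y / η x)) := by
  have hz : ∀ {x y}, 0 ≤ y → y ≤ η x → 0 ≤ y / η x ∧ y / η x ≤ 1 := fun {x y} h0 h1 =>
    ⟨div_nonneg h0 (hη x).le, (div_le_one (hη x)).2 h1⟩
  have hz' : ∀ {x y}, 0 ≤ y → y ≤ η x → y / η x ∈ Set.Ioo (-1 : ℝ) 2 := fun {x y} h0 h1 =>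
    ⟨by linarith [(hz h0 h1).1], by linarith [(hz h0 h1).2]⟩
  refine ⟨fun x y h0 h3 => ?_, fun x y _ _ => ?_, fun x y _ _ => ?_, fun x y h0 h3 => ?_,
    fun x => ?_, fun x => ?_⟩
  · exact ContDiffAt.comp (x, y) (f := fun p : ℝ × ℝ => (p.1, p.2 / η p.1))
      (g := fun p : ℝ × ℝ => w p.1 p.2) (hw x _ (hz' h0 h3))
      (contDiffAt_fst.prodMk (contDiffAt_snd.div
        (ContDiffAt.comp (x, y) hη2.contDiffAt contDiffAt_fst) (hη x).ne'))
  · simp only [hηe, hwe]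
  · simp only [hηp, hwp]
  · obtain ⟨-, -, e1, e2⟩ := pullBack_derivs hη h1 h2 hw (hz' h0.le h3.le)
    rw [e1, e2]
    have h := heq x _ (hz h0.le h3.le).1 (hz h0.le h3.le).2
    have := (hη x).ne'
    set z := y / η x
    set θ := η₁ x / η x
    have h5 : d ^ 2 / (lam ^ 2 * η x ^ 2) * lam ^ 2 = d ^ 2 / η x ^ 2 := by field_simp
    have h6 : d ^ 2 * (lam ^ 2 * (dX (dX w) x z - 2 * z * θ * dX (dY w) x z
        + z ^ 2 * θ ^ 2 * dY (dY w) x z + z * (2 * θ ^ 2 - η₂ x / η x) * dY w x z)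
        + dY (dY w) x z / η x ^ 2) = 0 := by
      linear_combination lam ^ 2 * h - dY (dY w) x z * h5
    exact (mul_eq_zero.1 h6).resolve_left (pow_ne_zero 2 hd)
  · simp only [zero_div, hw0]
  · obtain ⟨e1, e2, -, -⟩ := pullBack_derivs hη h1 h2 hw (hz' (hη x).le le_rfl)
    rw [e1, e2, hsx, div_self (hη x).ne', hsurf]
    have := (hη x).ne'
    have := hs x
    have : 1 + lam ^ 2 * η₁ x ^ 2 ≠ 0 := by positivity
    field_simp
    ring

end PullBack

section Eigen

variable {a d κ τ T : ℝ} {ψ : ℝ → ℝ → ℝ → ℝ} {η s : ℝ → ℝ → ℝ} {lam : ℝ → ℝ}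

theorem deriv_odd_of_even {f : ℝ → ℝ} (h : ∀ x, f (-x) = f x) (x : ℝ) :
    deriv f (-x) = -deriv f x := by
  have h1 : deriv (fun x => f (-x)) x = -deriv f (-x) := deriv_comp_neg f x
  simp only [h] at h1
  linarith

theorem deriv_even_of_odd {f : ℝ → ℝ} (h : ∀ x, f (-x) = -f x) (x : ℝ) :
    deriv f (-x) = deriv f x := by
  have h1 : deriv (fun x => f (-x)) x = -deriv f (-x) := deriv_comp_neg f x
  simp only [h, deriv.fun_neg] at h1
  linarith

namespace SurfaceRelations

theorem lam_strip (S : SurfaceRelations a d κ τ T ψ η s lam) :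
    StripAnalytic T (fun t _ => lam t) := .of_fst S.lam_analytic

theorem dEta_periodic (S : SurfaceRelations a d κ τ T ψ η s lam)
    {t : ℝ} (h0 : 0 ≤ t) (h1 : t < T) (x : ℝ) :
    dY η t (x + 2 * Real.pi / τ) = dY η t x :=
  StripAnalytic.iterate_dY_periodic (f := η) (fun x => S.eta_periodic t x h0 h1) 1 x

theorem ddEta_periodic (S : SurfaceRelations a d κ τ T ψ η s lam)
    {t : ℝ} (h0 : 0 ≤ t) (h1 : t < T) (x : ℝ) :
    dY (dY η) t (x + 2 * Real.pi / τ) = dY (dY η) t x :=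
  StripAnalytic.iterate_dY_periodic (f := η) (fun x => S.eta_periodic t x h0 h1) 2 x

theorem ds_periodic (S : SurfaceRelations a d κ τ T ψ η s lam)
    {t : ℝ} (h0 : 0 ≤ t) (h1 : t < T) (x : ℝ) :
    dY s t (x + 2 * Real.pi / τ) = dY s t x :=
  StripAnalytic.iterate_dY_periodic (f := s) (fun x => S.s_periodic t x h0 h1) 1 x

theorem dEta_odd (S : SurfaceRelations a d κ τ T ψ η s lam)
    {t : ℝ} (h0 : 0 ≤ t) (h1 : t < T) (x : ℝ) : dY η t (-x) = -dY η t x :=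
  deriv_odd_of_even (fun x => S.eta_even t x h0 h1) x

theorem ds_odd (S : SurfaceRelations a d κ τ T ψ η s lam)
    {t : ℝ} (h0 : 0 ≤ t) (h1 : t < T) (x : ℝ) : dY s t (-x) = -dY s t x :=
  deriv_odd_of_even (fun x => S.s_even t x h0 h1) x

theorem ddEta_even (S : SurfaceRelations a d κ τ T ψ η s lam)
    {t : ℝ} (h0 : 0 ≤ t) (h1 : t < T) (x : ℝ) :
    dY (dY η) t (-x) = dY (dY η) t x :=
  deriv_even_of_odd (f := dY η t) (fun x => S.dEta_odd h0 h1 x) x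

theorem dEta_zero (S : SurfaceRelations a d κ τ T ψ η s lam)
    (x : ℝ) : dY η 0 x = 0 := by
  simp only [dY, S.eta_zero, deriv_const']

theorem ddEta_zero (S : SurfaceRelations a d κ τ T ψ η s lam)
    (x : ℝ) : dY (dY η) 0 x = 0 := by
  simp only [dY, S.eta_zero, deriv_const']

theorem ds_zero (S : SurfaceRelations a d κ τ T ψ η s lam)
    (x : ℝ) : dY s 0 x = 0 := by
  simp only [dY, S.s_zero, deriv_const']

/-- The coefficient `ρ̂` on the surface. -/
theorem rho_strip (S : SurfaceRelations a d κ τ T ψ η s lam) :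
    StripAnalytic T
    (fun t x => 1 + s t x * (lam t ^ 2 * (dY s t x * dY η t x + s t x * dY (dY η) t x) - a)) :=
  (StripAnalytic.const 1).add (S.s_analytic.mul (((S.lam_strip.pow 2).mul
    ((S.s_analytic.diff_snd.mul S.eta_analytic.diff_snd).add
      (S.s_analytic.mul S.eta_analytic.diff_snd.diff_snd))).sub (.const a)))

/-- Near the laminar flow there is an eigenvalue near the eigenvalue of each mode. -/
theorem exists_eigenfunction (S : SurfaceRelations a d κ τ T ψ η s lam)
    (K : ℕ) : ∃ C, ∀ᶠ t in 𝓝[>] (0 : ℝ), ∃ μ v,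
    SolvesSpectralProblem (2 * Real.pi / τ) (ψ t) (η t) (lam t) μ v ∧
    |μ - (κ ^ 2 * modeNu (τ * d) K / d - (1 - a * κ))| ≤ C * t ∧
    ∀ x, |v x (η t x) - Real.cos (K * (τ * x))| ≤ C * t := by
  have hd := S.d_pos
  have hκ := S.kappa_pos
  have hτ := S.tau_pos
  have hη := S.eta_analytic
  have hη1 := hη.diff_snd
  have hη2 := hη1.diff_snd
  have ne_eta : ∀ t x, 0 ≤ t → t < T → η t x ≠ 0 := fun t x h0 h1 => (S.eta_pos t x h0 h1).ne'
  have ne_N : ∀ t x, 0 ≤ t → t < T → 1 + lam t ^ 2 * dY η t x ^ 2 ≠ 0 := fun t x _ _ => by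
    positivity
  set νK := modeNu (τ * d) K with hνK
  set μK := κ ^ 2 * νK / d - (1 - a * κ) with hμK
  have hθ := hη1.div hη ne_eta
  have hN : StripAnalytic T (fun t x => 1 + lam t ^ 2 * dY η t x ^ 2) :=
    (StripAnalytic.const 1).add ((S.lam_strip.pow 2).mul (hη1.pow 2))
  have hE := hη.div (hN.mul (S.s_analytic.pow 2)) fun t x h0 h1 =>
    mul_ne_zero (ne_N t x h0 h1) (pow_ne_zero 2 (S.s_pos t x h0 h1).ne')
  have hA1 := (StripAnalytic.const (T := T) (2 * d ^ 2)).mul hθ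
  have hA2 := ((StripAnalytic.const (T := T) (d ^ 2)).mul (hθ.pow 2)).neg
  have hA3 := (StripAnalytic.const (T := T) 1).sub ((StripAnalytic.const (d ^ 2)).div
    ((S.lam_strip.pow 2).mul (hη.pow 2)) fun t x h0 h1 =>
      mul_ne_zero (pow_ne_zero 2 (S.lam_pos t h0 h1).ne') (pow_ne_zero 2 (ne_eta t x h0 h1)))
  have hA4 := ((StripAnalytic.const (T := T) (d ^ 2)).mul
    (((StripAnalytic.const 2).mul (hθ.pow 2)).sub (hη2.div hη ne_eta))).neg
  have hB1 := (((S.lam_strip.pow 2).mul hη).mul hη1).div hN ne_N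
  have hB2 := (hE.mul (S.rho_strip.add (.const μK))).sub (.const νK)
  have hB3 := hE.sub (.const (d / κ ^ 2))
  obtain ⟨C1, h1⟩ := hA1.exists_series S.T_pos hτ (e := 1) (fun x => by simp [S.dEta_zero])
    (fun t x h0 h1 => by simp only [S.dEta_periodic h0 h1, S.eta_periodic t _ h0 h1]) le_rfl
    (fun t x h0 h1 => by rw [S.dEta_odd h0 h1, S.eta_even t x h0 h1]; ring)
  obtain ⟨C2, h2⟩ := hA2.exists_series S.T_pos hτ (e := 0) (fun x => by simp [S.dEta_zero])
    (fun t x h0 h1 => by simp only [S.dEta_periodic h0 h1, S.eta_periodic t _ h0 h1]) (by norm_num)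
    (fun t x h0 h1 => by rw [S.dEta_odd h0 h1, S.eta_even t x h0 h1]; ring)
  obtain ⟨C3, h3⟩ := hA3.exists_series S.T_pos hτ (e := 0)
    (fun x => by simp only [S.eta_zero, S.lam_zero]; field_simp; ring)
    (fun t x h0 h1 => by simp only [S.eta_periodic t _ h0 h1]) (by norm_num)
    (fun t x h0 h1 => by rw [S.eta_even t x h0 h1]; ring)
  obtain ⟨C4, h4⟩ := hA4.exists_series S.T_pos hτ (e := 0)
    (fun x => by simp [S.dEta_zero, S.ddEta_zero])
    (fun t x h0 h1 => by
      simp only [S.dEta_periodic h0 h1, S.ddEta_periodic h0 h1, S.eta_periodic t _ h0 h1])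
    (by norm_num)
    (fun t x h0 h1 => by rw [S.dEta_odd h0 h1, S.ddEta_even h0 h1, S.eta_even t x h0 h1]; ring)
  obtain ⟨D1, k1⟩ := hB1.exists_series S.T_pos hτ (e := 1) (fun x => by simp [S.dEta_zero])
    (fun t x h0 h1 => by simp only [S.dEta_periodic h0 h1, S.eta_periodic t _ h0 h1]) le_rfl
    (fun t x h0 h1 => by
      rw [S.dEta_odd h0 h1, S.eta_even t x h0 h1, neg_sq]; ring)
  obtain ⟨D2, k2⟩ := hB2.exists_series S.T_pos hτ (e := 0)
    (fun x => by
      simp only [S.dEta_zero, S.ddEta_zero, S.ds_zero, S.eta_zero, S.lam_zero, S.s_zero, hμK]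
      field_simp; ring)
    (fun t x h0 h1 => by
      simp only [S.dEta_periodic h0 h1, S.ddEta_periodic h0 h1, S.eta_periodic t _ h0 h1,
        S.ds_periodic h0 h1, S.s_periodic t _ h0 h1])
    (by norm_num)
    (fun t x h0 h1 => by
      rw [S.dEta_odd h0 h1, S.ddEta_even h0 h1, S.eta_even t x h0 h1, S.s_even t x h0 h1,
        S.ds_odd h0 h1, neg_sq]; ring)
  obtain ⟨D3, k3⟩ := hB3.exists_series S.T_pos hτ (e := 0)
    (fun x => by
      simp only [S.dEta_zero, S.eta_zero, S.lam_zero, S.s_zero]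
      field_simp; ring)
    (fun t x h0 h1 => by
      simp only [S.dEta_periodic h0 h1, S.eta_periodic t _ h0 h1, S.s_periodic t _ h0 h1])
    (by norm_num)
    (fun t x h0 h1 => by
      rw [S.dEta_odd h0 h1, S.eta_even t x h0 h1, S.s_even t x h0 h1, neg_sq]; ring)
  set M := 1 + |C1| + |C2| + |C3| + |C4| + |D1| + |D2| + |D3| with hM
  have hM0 : 0 < M := by positivity
  have e₃ne : d / κ ^ 2 ≠ 0 := by positivity
  obtain ⟨δ, hδ, C, hC, hB⟩ := exists_flattened_eigenfunction (mul_pos hτ hd) hτ K e₃ne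
  refine ⟨C * M, ?_⟩
  have hsmall : ∀ᶠ t in 𝓝[>] (0 : ℝ), M * t ≤ δ := by
    filter_upwards [mem_nhdsWithin_of_mem_nhds (Iio_mem_nhds (div_pos hδ hM0))] with t ht
    exact (le_div_iff₀' hM0).1 (le_of_lt ht)
  filter_upwards [h1, h2, h3, h4, k1, k2, k3, hsmall, self_mem_nhdsWithin,
    nhdsWithin_mono _ Set.Ioi_subset_Ici_self (eventually_lt_of_pos S.T_pos)]
    with t ⟨a1, f1, g1⟩ ⟨a2, f2, g2⟩ ⟨a3, f3, g3⟩ ⟨a4, f4, g4⟩ ⟨b1, f5, g5⟩ ⟨b2, f6, g6⟩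
      ⟨b3, f7, g7⟩ hs ht hT
  have ht0 : 0 < t := ht
  have hle : ∀ {c : ℝ} {a : ℤ → ℝ}, FourierBound 3 (c * t) a → |c| ≤ M → FourierBound 3 (M * t) a :=
    fun {c a} h hc => ⟨h.1, h.2.trans (by gcongr; exact (le_abs_self c).trans hc)⟩
  have p1 := abs_nonneg C1
  have p2 := abs_nonneg C2
  have p3 := abs_nonneg C3
  have p4 := abs_nonneg C4
  have p5 := abs_nonneg D1
  have p6 := abs_nonneg D2
  have p7 := abs_nonneg D3
  obtain ⟨m, w, hm, hwc, hws, hwe, hwp, hw0, heq, hsurf⟩ := hB (M * t) (by positivity) hs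
    a1 a2 a3 a4 b1 b2 b3 (hle f1 (by linarith)) (hle f2 (by linarith)) (hle f3 (by linarith))
    (hle f4 (by linarith)) (hle f5 (by linarith)) (hle f6 (by linarith)) (hle f7 (by linarith))
  refine ⟨μK + m, fun x y => w x (y / η t x), ?_, by
    rw [add_sub_cancel_left, mul_assoc]; exact hm, fun x => ?_⟩
  · refine solvesSpectralProblem_pullBack (η₁ := dY η t) (η₂ := dY (dY η) t) hd.ne'
      (S.lam_pos t hT.1 hT.2).ne' (fun x => S.eta_pos t x hT.1 hT.2) ?_
      (fun x => hη.hasDerivAt_snd hT.1 hT.2) (fun x => hη1.hasDerivAt_snd hT.1 hT.2)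
      (fun x => S.eta_even t x hT.1 hT.2) (fun x => S.eta_periodic t x hT.1 hT.2)
      (fun x => by rw [S.dY_psi]; exact (S.s_pos t x hT.1 hT.2).ne')
      (fun x => by rw [S.dY_psi, S.dX_psi t x hT.1 hT.2]) hws hwe hwp hw0 ?_ ?_
    · refine contDiff_iff_contDiffAt.2 fun x => (AnalyticAt.fun_comp (f := fun s : ℝ => (t, s))
        (g := fun p : ℝ × ℝ => η p.1 p.2) (hη t x hT.1 hT.2)
        (analyticAt_const.prod analyticAt_id)).contDiffAt
    · intro x z hz0 hz1
      have h := heq x z hz0 hz1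
      rw [g1, g2, g3, g4, show τ * d / τ = d by field_simp] at h
      exact h
    · intro x
      rw [hsurf x, g5, g6, g7, S.dY_psi, S.rho t x hT.1 hT.2]
      ring
  · have h := hwc x
    simp only [div_self (S.eta_pos t x hT.1 hT.2).ne', mul_assoc] at h ⊢
    exact h

end SurfaceRelations

end Eigen

theorem StripAnalytic.eventually_lt {T : ℝ} {f : ℝ → ℝ → ℝ} (hT : 0 < T) (hf : StripAnalytic T f)
    {k c : ℝ} (h0 : ∀ x, f 0 x = k) (hk : k < c) (L : ℝ) :
    ∀ᶠ t in 𝓝[>] (0 : ℝ), ∀ x ∈ Set.Icc 0 L, f t x < c := by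
  obtain ⟨C, hC⟩ := hf.unifO_one hT L
  have h1 : Tendsto (fun t : ℝ => k + C * t ^ 1) (𝓝[>] 0) (𝓝 k) := by
    have : Continuous fun t : ℝ => k + C * t ^ 1 := by fun_prop
    simpa using this.continuousAt (x := 0) |>.tendsto.mono_left nhdsWithin_le_nhds
  filter_upwards [hC, h1.eventually (gt_mem_nhds hk)] with t h2 h3 x hx
  have h4 := (abs_le.1 (h2 x hx)).2
  rw [h0] at h4
  linarith

namespace SurfaceRelations

variable {a d κ τ T : ℝ} {ψ : ℝ → ℝ → ℝ → ℝ} {η s : ℝ → ℝ → ℝ} {lam : ℝ → ℝ}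

theorem surfaceProfile (S : SurfaceRelations a d κ τ T ψ η s lam) {t : ℝ} (h0 : 0 ≤ t)
    (h1 : t < T) : SurfaceProfile (2 * Real.pi / τ) (η t) where
  period_pos := period_pos S.tau_pos
  smooth := S.eta_analytic.contDiff_slice h0 h1
  pos x := S.eta_pos t x h0 h1
  periodic x := S.eta_periodic t x h0 h1

/-- The second eigenvalue of the waves near a laminar flow with `κ² τ coth τd = 1 - a κ`. -/
theorem exists_second_eigenvalue (S : SurfaceRelations a d κ τ T ψ η s lam)
    (hdis : κ ^ 2 * xCoth (τ * d) = d * (1 - a * κ)) :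
    ∃ C, ∀ᶠ t in 𝓝[>] (0 : ℝ), ∃ μ v,
      IsKthEigenvalue 2 (2 * Real.pi / τ) (ψ t) (η t) (lam t) μ ∧
      SolvesSpectralProblem (2 * Real.pi / τ) (ψ t) (η t) (lam t) μ v ∧ |μ| ≤ C * t ∧
      ∀ x, |v x (η t x) - Real.cos (τ * x)| ≤ C * t := by
  have hd := S.d_pos
  have hκ := S.kappa_pos
  have hτ := S.tau_pos
  have hη := S.eta_analytic
  obtain ⟨C0, h0⟩ := S.exists_eigenfunction 0
  obtain ⟨C1, h1⟩ := S.exists_eigenfunction 1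
  have hx1 : 1 < xCoth (τ * d) := one_lt_xCoth (by positivity)
  have hx12 : xCoth (τ * d) < xCoth (2 * τ * d) := strictMonoOn_xCoth
    (Set.mem_Ioi.2 (by positivity)) (Set.mem_Ioi.2 (by positivity)) (by nlinarith [mul_pos hτ hd])
  set X1 := xCoth (τ * d) with hX1
  set X2 := xCoth (2 * τ * d) with hX2
  set θ := (1 + X1 / X2) / 2 with hθ
  have hX2 : 0 < X2 := by linarith
  have hr0 : 0 < X1 / X2 := by positivity
  have hr1 : X1 / X2 < 1 := (div_lt_one hX2).2 hx12
  have hθX : X1 < θ * X2 := by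
    have : θ * X2 = (X2 + X1) / 2 := by rw [hθ]; field_simp
    linarith
  set c := (X1 / d + θ * (X2 / d)) / 2 with hc
  have hgap : X1 / d < θ * (X2 / d) := by
    rw [← mul_div_assoc]; gcongr
  set ε := κ ^ 2 * (c - X1 / d) / 2 with hε
  have hcX : X1 / d < c := by rw [hc]; linarith
  have hε0 : 0 < ε := by rw [hε]; have := sub_pos.2 hcX; positivity
  set δ := (1 - θ) / 3 with hδ
  have hδ0 : 0 < δ := by rw [hδ, hθ]; linarith
  have hδ1 : δ < 1 := by rw [hδ, hθ]; linarith
  have hθ0 : 0 < θ := by rw [hθ]; linarith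
  have hθ1 : θ < 1 := by rw [hθ]; linarith
  have hδθ : θ * (1 + δ + δ ^ 2) < 1 := by
    have e1 : δ ^ 2 ≤ δ := by nlinarith
    have e2 : θ * (1 + δ + δ ^ 2) ≤ θ * 1 + 1 * (2 * δ) := by nlinarith
    have e3 : 1 - θ = 3 * δ := by rw [hδ]; ring
    linarith
  set L := 2 * Real.pi / τ with hL
  have q1 := (hη.diff_snd.pow 2).eventually_lt S.T_pos (k := 0) (c := δ ^ 2)
    (fun x => by rw [S.dEta_zero]; ring) (by positivity) L
  have q2 := (((StripAnalytic.const (T := T) (θ * (d * (1 + δ)))).sub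
    ((S.lam_strip.pow 2).mul hη))).eventually_lt S.T_pos (k := θ * (d * (1 + δ)) - 1 ^ 2 * d)
    (c := 0) (fun x => by rw [S.eta_zero, S.lam_zero]) (by
      have e1 : θ * (1 + δ) < 1 := by nlinarith [mul_nonneg hθ0.le (sq_nonneg δ)]
      nlinarith [mul_pos hd (sub_pos.2 e1)]) L
  have q3 := (((StripAnalytic.const (T := T) θ).mul ((StripAnalytic.const (d * (δ + δ ^ 2))).add
    ((hη.pow 2).div (.const d) fun _ _ _ _ => hd.ne'))).sub hη).eventually_lt S.T_pos
    (k := θ * (d * (δ + δ ^ 2) + d ^ 2 / d) - d) (c := 0) (fun x => by rw [S.eta_zero])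
    (by rw [pow_two d, mul_div_cancel_right₀ _ hd.ne']; nlinarith) L
  have q4 := (((S.rho_strip.add (.const ε)).div (S.s_analytic.pow 2) fun t x e1 e2 =>
    pow_ne_zero 2 (S.s_pos t x e1 e2).ne')).eventually_lt S.T_pos
    (k := (1 - a * κ + ε) / κ ^ 2) (c := c)
    (fun x => by rw [S.ds_zero, S.ddEta_zero, S.dEta_zero, S.s_zero, S.lam_zero]; ring)
    (by
      rw [div_lt_iff₀ (by positivity)]
      have e1 : 1 - a * κ = κ ^ 2 * (X1 / d) := by field_simp; linarith
      have e2 : 0 < κ ^ 2 * (c - X1 / d) := by have := sub_pos.2 hcX; positivity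
      rw [e1, hε]
      linarith) L
  have hsmall : ∀ A : ℝ, ∀ b > 0, ∀ᶠ t in 𝓝[>] (0 : ℝ), A * t < b := fun A b hb => by
    have : Continuous fun t : ℝ => A * t := by fun_prop
    exact ((this.continuousAt (x := 0)).tendsto.mono_left nhdsWithin_le_nhds).eventually
      (gt_mem_nhds (by simpa using hb))
  refine ⟨C1, ?_⟩
  have hμ0 : 0 < (d * (1 - a * κ) - κ ^ 2) / d := by
    rw [← hdis]
    have : 0 < κ ^ 2 * (X1 - 1) := by have := sub_pos.2 hx1; positivity
    exact div_pos (by linarith) hd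
  filter_upwards [h0, h1, q1, q2, q3, q4, hsmall C0 (1 / 4) (by norm_num),
    hsmall C1 (1 / 4) (by norm_num), hsmall C1 ε hε0, hsmall (C0 + C1) _ hμ0,
    nhdsWithin_mono _ Set.Ioi_subset_Ici_self (eventually_lt_of_pos S.T_pos)]
    with t ⟨μ₀, v₀, hv₀, hm₀, ht₀⟩ ⟨μ₁, v₁, hv₁, hm₁, ht₁⟩ r1 r2 r3 r4 s1 s2 s3 s4 hT
  have e0 : κ ^ 2 * modeNu (τ * d) 0 / d - (1 - a * κ) = -((d * (1 - a * κ) - κ ^ 2) / d) := by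
    rw [modeNu, if_pos rfl]; field_simp; ring
  have e1 : κ ^ 2 * modeNu (τ * d) 1 / d - (1 - a * κ) = 0 := by
    rw [modeNu, if_neg one_ne_zero, Nat.cast_one, mul_one, hdis]; field_simp; ring
  rw [e0, sub_neg_eq_add] at hm₀
  rw [e1, sub_zero] at hm₁
  simp only [Nat.cast_zero, zero_mul, Real.cos_zero] at ht₀
  simp only [Nat.cast_one, one_mul] at ht₁
  refine ⟨μ₁, v₁, ?_, hv₁, hm₁, ht₁⟩
  have hab : ∀ x ∈ Set.Icc 0 L, |deriv (η t) x| < δ := fun x hx =>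
    abs_lt_of_sq_lt_sq (r1 x hx) hδ0.le
  have hρ : rhoHat (ψ t) (η t) (lam t) = fun x => 1 + s t x * (lam t ^ 2 * (dY s t x * dY η t x
      + s t x * dY (dY η) t x) - a) := funext fun x => S.rho t x hT.1 hT.2
  refine isKthEigenvalue_two hτ hd hθ0.le (S.surfaceProfile hT.1 hT.2)
    (fun x => S.eta_even t x hT.1 hT.2)
    (fun x => by rw [S.dY_psi]; exact (S.s_pos t x hT.1 hT.2).ne')
    (by simp only [S.dY_psi]; exact S.s_analytic.continuous hT.1 hT.2)
    (by rw [hρ]; exact S.rho_strip.continuous hT.1 hT.2)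
    (fun x => by rw [S.dY_psi]; exact S.dX_psi t x hT.1 hT.2)
    (fun x hx => ?_) (fun x hx => ?_) (c := c) (fun x hx => ?_) ?_ hv₀ hv₁ ?_
    (fun x => (ht₀ x).trans s1.le) (fun x => (ht₁ x).trans s2.le)
  · have e2 : θ * (d * (1 + |deriv (η t) x|)) ≤ θ * (d * (1 + δ)) := by
      gcongr; exact (hab x hx).le
    linarith [r2 x hx]
  · have e2 : θ * (d * (|deriv (η t) x| + |deriv (η t) x| ^ 2) + η t x ^ 2 / d)
        ≤ θ * (d * (δ + δ ^ 2) + η t x ^ 2 / d) := by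
      gcongr
      · exact (hab x hx).le
      · exact (hab x hx).le
    linarith [r3 x hx]
  · rw [hρ, S.dY_psi]
    refine le_trans ?_ (r4 x hx).le
    gcongr
    exact (le_abs_self _).trans (hm₁.trans s3.le)
  · rw [hc]; linarith
  · have e2 := (abs_le.1 hm₀).2
    have e3 := (abs_le.1 hm₁).1
    linarith

end SurfaceRelations

section JetCalculus

variable {f g : ℝ → ℝ} {a b c e : ℝ}

theorem HasJet.isBigO_self (h : HasJet f 0 b c e) : f =O[𝓝[>] 0] fun t : ℝ => t := by
  have h1 : (fun t : ℝ => t ^ 4) =O[𝓝[>] 0] fun t : ℝ => t := by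
    simpa using isBigO_pow_of_le (m := 1) (n := 4) (by norm_num)
  have h2 : (fun t : ℝ => t * (b + c * t + e * t ^ 2)) =O[𝓝[>] 0] fun t : ℝ => t * 1 :=
    (isBigO_refl _ _).mul (isBigO_one_of_continuous (by fun_prop))
  simp only [mul_one] at h2
  exact ((IsBigO.trans h h1).add h2).congr_left fun t => by ring

theorem HasJet.congr_coef {a' b' c' e' : ℝ} (h : HasJet f a b c e) (ha : a = a') (hb : b = b')
    (hc : c = c') (he : e = e') : HasJet f a' b' c' e' := by
  rwa [← ha, ← hb, ← hc, ← he]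

theorem HasJet.exp (h : HasJet f 0 b c e) :
    HasJet (fun t => Real.exp (f t)) 1 b (c + b ^ 2 / 2) (e + b * c + b ^ 3 / 6) := by
  have h0 := h.isBigO_self
  have ht : Tendsto (fun t : ℝ => t) (𝓝[>] 0) (𝓝 0) := tendsto_id.mono_left nhdsWithin_le_nhds
  have h1 := (Real.exp_sub_sum_range_isBigO_pow 4).comp_tendsto (h0.trans_tendsto ht)
  have h2 := h1.trans (h0.pow 4)
  have h3 := ((((HasJet.const 1).add h).add ((h.mul h).const_mul (1 / 2))).add
    (((h.mul h).mul h).const_mul (1 / 6)))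
  have h4 := IsBigO.add h2 h3
  refine h4.congr_left fun t => ?_
  simp only [Finset.sum_range_succ, Finset.sum_range_zero, Nat.factorial, Function.comp]
  norm_num
  ring

theorem HasJet.exp' (h : HasJet f a b c e) :
    HasJet (fun t => Real.exp (f t)) (Real.exp a) (Real.exp a * b)
      (Real.exp a * (c + b ^ 2 / 2)) (Real.exp a * (e + b * c + b ^ 3 / 6)) := by
  have h1 : HasJet (fun t => f t - a) 0 b c e :=
    (h.sub (HasJet.const a)).congr_coef (by ring) (by ring) (by ring) (by ring)
  refine ((h1.exp.const_mul (Real.exp a)).congr' (Eventually.of_forall fun t => ?_)).congr_coef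
    (by ring) rfl rfl rfl
  rw [← Real.exp_add]
  ring_nf

theorem HasJet.sinh_cosh (h : HasJet f a b c e) :
    HasJet (fun t => Real.sinh (f t)) (Real.sinh a) (Real.cosh a * b)
      (Real.cosh a * c + Real.sinh a * b ^ 2 / 2)
      (Real.cosh a * e + Real.sinh a * b * c + Real.cosh a * b ^ 3 / 6) ∧
    HasJet (fun t => Real.cosh (f t)) (Real.cosh a) (Real.sinh a * b)
      (Real.sinh a * c + Real.cosh a * b ^ 2 / 2)
      (Real.sinh a * e + Real.cosh a * b * c + Real.sinh a * b ^ 3 / 6) := by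
  have h1 := h.exp'
  have h2 := (h.const_mul (-1)).exp'
  have e2 : -1 * a = -a := by ring
  rw [e2] at h2
  constructor
  · refine ((((h1.sub h2).const_mul (1 / 2)).congr' (g := fun t => Real.sinh (f t))
      (Eventually.of_forall fun t => ?_))).congr_coef ?_ ?_ ?_ ?_
    · rw [Real.sinh_eq]; ring_nf
    all_goals simp only [Real.sinh_eq, Real.cosh_eq]; ring
  · refine ((((h1.add h2).const_mul (1 / 2)).congr' (g := fun t => Real.cosh (f t))
      (Eventually.of_forall fun t => ?_))).congr_coef ?_ ?_ ?_ ?_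
    · rw [Real.cosh_eq]; ring_nf
    all_goals simp only [Real.sinh_eq, Real.cosh_eq]; ring

theorem StripAnalytic.hasJet {T : ℝ} (hT : 0 < T) {F : ℝ → ℝ → ℝ} (hF : StripAnalytic T F)
    (x : ℝ) : HasJet (fun t => F t x) (F 0 x) (dX F 0 x) ((dX^[2] F) 0 x / 2)
      ((dX^[3] F) 0 x / 6) := by
  obtain ⟨C, hC⟩ := hF.taylor hT |x| 4
  obtain ⟨D, hD⟩ := (show StripAnalytic T (fun t y => F t (-y)) from fun t y h0 h1 =>
    AnalyticAt.fun_comp (f := fun p : ℝ × ℝ => (p.1, -p.2)) (g := fun p : ℝ × ℝ => F p.1 p.2)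
      (hF t (-y) h0 h1) (analyticAt_fst.prod analyticAt_snd.neg)).taylor hT |x| 4
  have hle : 𝓝[>] (0 : ℝ) ≤ 𝓝[≥] 0 := nhdsWithin_mono _ Set.Ioi_subset_Ici_self
  have hcomm : ∀ n : ℕ, ∀ t y, (dX^[n] fun t y => F t (-y)) t y = (dX^[n] F) t (-y) := by
    intro n
    induction n with
    | zero => exact fun _ _ => rfl
    | succ n ih =>
      intro t y
      rw [Function.iterate_succ_apply', Function.iterate_succ_apply', dX]
      simp only [ih]
      rfl
  have key : ∃ E, ∀ᶠ t in 𝓝[>] (0 : ℝ), |F t x - ∑ j ∈ Finset.range 4,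
      t ^ j / j.factorial * (dX^[j] F) 0 x| ≤ E * t ^ 4 := by
    rcases abs_choice x with hx | hx
    · exact ⟨C, (hC.filter_mono hle).mono fun t ht => ht x ⟨by rw [← hx]; exact abs_nonneg x, hx.ge⟩⟩
    · refine ⟨D, (hD.filter_mono hle).mono fun t ht => ?_⟩
      have := ht (-x) ⟨by rw [← hx]; exact abs_nonneg x, hx.ge⟩
      simpa only [hcomm, neg_neg] using this
  obtain ⟨E, hE⟩ := key
  have h1 : (fun t => F t x - ∑ j ∈ Finset.range 4, t ^ j / j.factorial * (dX^[j] F) 0 x)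
      =O[𝓝[>] 0] fun t => t ^ 4 := by
    refine IsBigO.of_bound E ?_
    filter_upwards [hE, self_mem_nhdsWithin] with t ht ht0
    have ht0' : 0 < t := ht0
    rwa [Real.norm_eq_abs (t ^ 4), abs_of_pos (by positivity)]
  refine h1.congr_left fun t => ?_
  simp only [Finset.sum_range_succ, Finset.sum_range_zero, Nat.factorial, Function.iterate_zero,
    Function.iterate_one, id]
  norm_num
  ring

/-- If the integrals of an analytic family vanish, then so do the integrals of its Taylor
coefficients. -/
theorem StripAnalytic.integral_coef_eq_zero {T L : ℝ} (hT : 0 < T) (hL : 0 ≤ L) {F : ℝ → ℝ → ℝ}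
    (hF : StripAnalytic T F) (h0 : ∀ᶠ t in 𝓝[>] (0 : ℝ), ∫ x in (0 : ℝ)..L, F t x = 0)
    {f₀ f₁ f₂ f₃ : ℝ → ℝ} (hj : ∀ x, HasJet (fun t => F t x) (f₀ x) (f₁ x) (f₂ x) (f₃ x)) :
    ∫ x in (0 : ℝ)..L, f₂ x = 0 ∧ ∫ x in (0 : ℝ)..L, f₃ x = 0 := by
  have hu := fun x => (hj x).unique (hF.hasJet hT x)
  have e0 : f₀ = F 0 := funext fun x => (hu x).1
  have e1 : f₁ = dX F 0 := funext fun x => (hu x).2.1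
  have e2 : f₂ = fun x => (dX^[2] F) 0 x / 2 := funext fun x => (hu x).2.2.1
  have e3 : f₃ = fun x => (dX^[3] F) 0 x / 6 := funext fun x => (hu x).2.2.2
  have c0 : Continuous f₀ := by rw [e0]; exact hF.continuous le_rfl hT
  have c1 : Continuous f₁ := by rw [e1]; exact hF.diff_fst.continuous le_rfl hT
  have c2 : Continuous f₂ := by
    rw [e2]; exact ((hF.iterate_dX 2).continuous le_rfl hT).div_const 2
  have c3 : Continuous f₃ := by
    rw [e3]; exact ((hF.iterate_dX 3).continuous le_rfl hT).div_const 6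
  obtain ⟨C, hC⟩ := hF.taylor hT L 4
  have hle : 𝓝[>] (0 : ℝ) ≤ 𝓝[≥] 0 := nhdsWithin_mono _ Set.Ioi_subset_Ici_self
  have h1 : UnifO L 4 (fun t x => F t x - (f₀ x + f₁ x * t + f₂ x * t ^ 2 + f₃ x * t ^ 3)) := by
    refine ⟨C, (hC.filter_mono hle).mono fun t ht x hx => ?_⟩
    refine le_of_eq_of_le (congrArg abs ?_) (ht x hx)
    simp only [Finset.sum_range_succ, Finset.sum_range_zero, Nat.factorial,
      Function.iterate_zero, Function.iterate_one, id, e0, e1, e2, e3]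
    norm_num
    ring
  have h2 : HasJet (fun _ => 0) (∫ x in (0 : ℝ)..L, f₀ x) (∫ x in (0 : ℝ)..L, f₁ x)
      (∫ x in (0 : ℝ)..L, f₂ x) (∫ x in (0 : ℝ)..L, f₃ x) := by
    refine (h1.isBigO_integral hL).congr' ?_ EventuallyEq.rfl
    filter_upwards [h0, (eventually_lt_of_pos hT).filter_mono hle] with t ht htT
    have i0 := c0.intervalIntegrable (μ := MeasureTheory.volume) 0 L
    have i1 := (c1.mul_const t).intervalIntegrable (μ := MeasureTheory.volume) 0 L
    have i2 := (c2.mul_const (t ^ 2)).intervalIntegrable (μ := MeasureTheory.volume) 0 L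
    have i3 := (c3.mul_const (t ^ 3)).intervalIntegrable (μ := MeasureTheory.volume) 0 L
    rw [intervalIntegral.integral_sub
      ((hF.continuous htT.1 htT.2).intervalIntegrable _ _) (((i0.add i1).add i2).add i3),
      intervalIntegral.integral_add ((i0.add i1).add i2) i3,
      intervalIntegral.integral_add (i0.add i1) i2, intervalIntegral.integral_add i0 i1, ht]
    simp only [intervalIntegral.integral_mul_const]
  have h3 := h2.unique (HasJet.const 0)
  exact ⟨h3.2.2.1, h3.2.2.2⟩

end JetCalculus

section Modes

/-- The harmonic functions of a horizontal strip which vanish at the bottom. -/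
noncomputable def stripMode (τ lam : ℝ) (k : ℕ) (x y : ℝ) : ℝ :=
  if k = 0 then y else Real.sinh (k * τ * lam * y) * Real.cos (k * τ * x)

theorem sinh_mul_cos_derivs (p q x y : ℝ) :
    dY (fun x y => Real.sinh (q * y) * Real.cos (p * x)) x y
    = q * Real.cosh (q * y) * Real.cos (p * x) ∧
    dX (fun x y => Real.sinh (q * y) * Real.cos (p * x)) x y
      = -(p * Real.sinh (q * y) * Real.sin (p * x)) ∧
    dY (dY (fun x y => Real.sinh (q * y) * Real.cos (p * x))) x y
      = q ^ 2 * (Real.sinh (q * y) * Real.cos (p * x)) ∧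
    dX (dX (fun x y => Real.sinh (q * y) * Real.cos (p * x))) x y
      = -(p ^ 2 * (Real.sinh (q * y) * Real.cos (p * x))) := by
  have hl : ∀ q y : ℝ, HasDerivAt (fun y : ℝ => q * y) q y := fun q y => by
    simpa using (hasDerivAt_id' y).const_mul q
  have hY : ∀ x y, dY (fun x y => Real.sinh (q * y) * Real.cos (p * x)) x y
      = q * Real.cosh (q * y) * Real.cos (p * x) := fun x y =>
    (((hl q y).sinh.mul_const (Real.cos (p * x))).congr_deriv (by ring)).deriv
  have hX : ∀ x y, dX (fun x y => Real.sinh (q * y) * Real.cos (p * x)) x y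
      = -(p * Real.sinh (q * y) * Real.sin (p * x)) := fun x y =>
    (((hl p x).cos.const_mul (Real.sinh (q * y))).congr_deriv (by ring)).deriv
  refine ⟨hY x y, hX x y, ?_, ?_⟩
  · rw [funext fun x => funext fun y => hY x y]
    exact ((((hl q y).cosh.const_mul q).mul_const (Real.cos (p * x))).congr_deriv (by ring)).deriv
  · rw [funext fun x => funext fun y => hX x y]
    exact (((hl p x).sin.const_mul (p * Real.sinh (q * y))).neg.congr_deriv (by ring)).deriv

theorem harmonicBelow_stripMode {τ lam : ℝ} (hτ : 0 < τ) (k : ℕ) (η : ℝ → ℝ) :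
    HarmonicBelow (2 * Real.pi / τ) η lam (stripMode τ lam k) := by
  rcases Nat.eq_zero_or_pos k with rfl | hk
  · have h : stripMode τ lam 0 = fun _ y => y := by ext x y; simp [stripMode]
    rw [h]
    refine ⟨fun x y _ _ => contDiffAt_snd, fun _ _ _ _ => rfl, fun x y _ _ => ?_, fun _ => rfl⟩
    simp [dX, dY]
  · have h : stripMode τ lam k = fun x y => Real.sinh (k * τ * lam * y) * Real.cos (k * τ * x) := by
      ext x y; rw [stripMode, if_neg hk.ne']
    rw [h]
    refine ⟨fun x y _ _ => ?_, fun x y _ _ => ?_, fun x y _ _ => ?_, fun x => by simp⟩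
    · have h1 : ContDiff ℝ 2 fun p : ℝ × ℝ => Real.sinh (k * τ * lam * p.2) :=
        Real.contDiff_sinh.comp (by fun_prop)
      have h2 : ContDiff ℝ 2 fun p : ℝ × ℝ => Real.cos (k * τ * p.1) :=
        Real.contDiff_cos.comp (by fun_prop)
      exact (h1.mul h2).contDiffAt
    · have e : (k : ℝ) * τ * (x + 2 * Real.pi / τ) = k * τ * x + k * (2 * Real.pi) := by
        field_simp
      simp only [e, Real.cos_add_nat_mul_two_pi]
    · obtain ⟨-, -, e1, e2⟩ := sinh_mul_cos_derivs (k * τ) (k * τ * lam) x y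
      rw [e1, e2]; ring

theorem conormal_stripMode {τ lam : ℝ} {η : ℝ → ℝ} (k : ℕ) (x : ℝ) :
    conormal η lam (stripMode τ lam k) x = if k = 0 then 1 else
      k * τ * (lam * Real.cosh (k * τ * lam * η x) * Real.cos (k * τ * x)
        + lam ^ 2 * deriv η x * Real.sinh (k * τ * lam * η x) * Real.sin (k * τ * x)) := by
  rcases Nat.eq_zero_or_pos k with rfl | hk
  · have h : stripMode τ lam 0 = fun _ y => y := by ext x y; simp [stripMode]
    simp [h, conormal, dX, dY]
  · have h : stripMode τ lam k = fun x y => Real.sinh (k * τ * lam * y) * Real.cos (k * τ * x) := by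
      ext x y; rw [stripMode, if_neg hk.ne']
    obtain ⟨e1, e2, -, -⟩ := sinh_mul_cos_derivs (k * τ) (k * τ * lam) x (η x)
    rw [if_neg hk.ne', h, conormal, e1, e2]
    ring

end Modes

/-- The integral form of the equations for the waves, tested with the mode `k`. -/
theorem IsStokesBranch.integral_eq_zero {a d T T' : ℝ} {ψ : ℝ → ℝ → ℝ → ℝ} {η s : ℝ → ℝ → ℝ}
    {lam : ℝ → ℝ} (hB : IsStokesBranch a d T ψ η lam) (hT' : T' ≤ T)
    (S : SurfaceRelations a d (kappa a d) (tauStar a d) T' ψ η s lam) {t : ℝ} (h0 : 0 ≤ t)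
    (h1 : t < T') (k : ℕ) :
    ∫ x in (0 : ℝ)..2 * Real.pi / tauStar a d,
      ((s t x * (1 + lam t ^ 2 * dY η t x ^ 2) - kappa a d + a * (η t x - d))
          * stripMode (tauStar a d) (lam t) k x (η t x)
        + (kappa a d * (η t x - d) - a / 2 * (η t x - d) ^ 2)
          * conormal (η t) (lam t) (stripMode (tauStar a d) (lam t) k) x) = 0 := by
  have hP := S.surfaceProfile h0 h1
  have hW := hB.wave t h0 (h1.trans_le hT')
  have hM := harmonicBelow_stripMode (lam := lam t) S.tau_pos k (η t)
  have hA : ∀ x y, 0 ≤ y → y ≤ η t x → Analytic₃ ψ t x y := fun x y e0 e1 =>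
    hB.analytic₃ h0 (h1.trans_le hT') e0 e1
  have hUs : ContDiff ℝ 2 (fun p : ℝ × ℝ => laminarU a d p.2) := by
    unfold laminarU; fun_prop
  set Φ : ℝ → ℝ → ℝ := fun x y => ψ t x y - laminarU a d y with hΦ
  have hdX : dX Φ = dX (ψ t) := by
    ext x y; simp only [dX, hΦ, deriv_sub_const_fun]
  have hdY : ∀ x y, 0 ≤ y → y ≤ η t x → dY Φ x y = dY (ψ t) x y - (-a / 2 * (2 * y - d) + 1 / d) :=
    fun x y e0 e1 =>
    ((hA x y e0 e1).slice_xy.differentiableAt.hasDerivAt_dY.sub (deriv_laminarU a d y)).deriv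
  have hH : HarmonicBelow (2 * Real.pi / tauStar a d) (η t) (lam t) Φ := by
    refine ⟨fun x y e0 e1 => ((hA x y e0 e1).slice_xy.contDiffAt).sub hUs.contDiffAt,
      fun x y e0 e1 => ?_, fun x y e0 e1 => ?_, fun x => ?_⟩
    · simp only [hΦ, hW.psi_periodic x y e0 e1]
    · have h2 : dY (dY Φ) x y = dY (dY (ψ t)) x y - -a := by
        have h3 := (hA x y e0.le e1.le).dY.slice_xy.differentiableAt.hasDerivAt_dY
        have h4 : HasDerivAt (fun y : ℝ => -a / 2 * (2 * y - d) + 1 / d) (-a) y :=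
          ((((((hasDerivAt_id' y).const_mul 2).sub_const d).const_mul (-a / 2)).add_const
            (1 / d)).congr_deriv (by ring))
        have h5 : (fun y => dY Φ x y) =ᶠ[𝓝 y]
            fun y => dY (ψ t) x y - (-a / 2 * (2 * y - d) + 1 / d) := by
          filter_upwards [Ioo_mem_nhds e0 e1] with z hz using hdY x z hz.1.le hz.2.le
        exact ((h3.sub h4).congr_of_eventuallyEq h5).deriv
      rw [hdX, h2]
      linarith [hW.equation x y e0 e1]
    · simp [hΦ, hW.bottom, laminarU]
  have hG := integral_conormal_comm hP hH hM
  have hd := S.d_pos.ne'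
  have hΦs : ∀ x, Φ x (η t x) = -(kappa a d * (η t x - d) - a / 2 * (η t x - d) ^ 2) := fun x => by
    simp only [hΦ, hW.surface, laminarU, kappa]
    field_simp
    ring
  have hΦc : ∀ x, conormal (η t) (lam t) Φ x
      = s t x * (1 + lam t ^ 2 * dY η t x ^ 2) - kappa a d + a * (η t x - d) := fun x => by
    rw [conormal, hdX, hdY x _ (hP.pos x).le le_rfl, S.dX_psi t x h0 h1, S.dY_psi]
    simp only [kappa, dY]
    ring
  have c1 : Continuous fun x => (s t x * (1 + lam t ^ 2 * dY η t x ^ 2) - kappa a d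
      + a * (η t x - d)) * stripMode (tauStar a d) (lam t) k x (η t x) := by
    have e1 := S.s_analytic.continuous h0 h1
    have e2 := S.eta_analytic.continuous h0 h1
    have e3 := S.eta_analytic.diff_snd.continuous h0 h1
    have e4 : Continuous fun x => stripMode (tauStar a d) (lam t) k x (η t x) := by
      unfold stripMode; split_ifs <;> fun_prop
    fun_prop
  have c2 : Continuous fun x => (kappa a d * (η t x - d) - a / 2 * (η t x - d) ^ 2)
      * conormal (η t) (lam t) (stripMode (tauStar a d) (lam t) k) x := by
    have e2 := S.eta_analytic.continuous h0 h1
    have e3 : Continuous (deriv (η t)) := S.eta_analytic.diff_snd.continuous h0 h1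
    simp only [conormal_stripMode]
    split_ifs <;> fun_prop
  rw [intervalIntegral.integral_add (c1.intervalIntegrable _ _) (c2.intervalIntegrable _ _)]
  simp only [hΦs, hΦc, mul_neg, intervalIntegral.integral_neg] at hG
  rw [hG, ← intervalIntegral.integral_neg, ← intervalIntegral.integral_add]
  · simp [mul_comm]
  · exact ((c2.congr fun x => mul_comm _ _).neg).intervalIntegrable _ _
  · exact c2.intervalIntegrable _ _

theorem integral_trig_form {τ : ℝ} (hτ : 0 < τ) {e : ℝ → ℝ} (he : Continuous e)
    (α β γ α' β' : ℝ) :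
    ∫ x in (0 : ℝ)..2 * Real.pi / τ, (α + β * Real.cos (2 * (τ * x)) + γ * Real.cos (4 * (τ * x))
        + e x * (α' + β' * Real.cos (2 * (τ * x))))
      = 2 * Real.pi / τ * α + α' * (∫ x in (0 : ℝ)..2 * Real.pi / τ, e x)
        + β' * ∫ x in (0 : ℝ)..2 * Real.pi / τ, e x * Real.cos (2 * (τ * x)) := by
  have h1 : ∫ x in (0 : ℝ)..2 * Real.pi / τ,
      (α + β * Real.cos (2 * (τ * x)) + γ * Real.cos (4 * (τ * x))) = 2 * Real.pi / τ * α := by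
    have hd : ∀ x ∈ Set.uIcc 0 (2 * Real.pi / τ), HasDerivAt (fun x => α * x
        + β / (2 * τ) * Real.sin (2 * (τ * x)) + γ / (4 * τ) * Real.sin (4 * (τ * x)))
        (α + β * Real.cos (2 * (τ * x)) + γ * Real.cos (4 * (τ * x))) x := fun x _ => by
      have h2 := ((((hasDerivAt_id' x).const_mul τ).const_mul 2).sin).const_mul (β / (2 * τ))
      have h3 := ((((hasDerivAt_id' x).const_mul τ).const_mul 4).sin).const_mul (γ / (4 * τ))
      exact (((((hasDerivAt_id' x).const_mul α).add h2).add h3)).congr_deriv (by field_simp)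
    rw [intervalIntegral.integral_eq_sub_of_hasDerivAt hd
      (Continuous.intervalIntegrable (by fun_prop) _ _)]
    have e1 : τ * (2 * Real.pi / τ) = 2 * Real.pi := by field_simp
    have e2 : Real.sin (2 * (2 * Real.pi)) = 0 := by
      have := Real.sin_nat_mul_pi 4
      rw [← this]; norm_num; ring_nf
    have e4 : Real.sin (4 * (2 * Real.pi)) = 0 := by
      have := Real.sin_nat_mul_pi 8
      rw [← this]; norm_num; ring_nf
    rw [e1, e2, e4]
    simp
    ring
  have h2 : ∀ x, e x * (α' + β' * Real.cos (2 * (τ * x)))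
      = α' * e x + β' * (e x * Real.cos (2 * (τ * x))) := fun x => by ring
  simp only [h2]
  rw [intervalIntegral.integral_add (Continuous.intervalIntegrable (by fun_prop) _ _)
    (Continuous.intervalIntegrable (by fun_prop) _ _), h1,
    intervalIntegral.integral_add (Continuous.intervalIntegrable (by fun_prop) _ _)
    (Continuous.intervalIntegrable (by fun_prop) _ _), intervalIntegral.integral_const_mul,
    intervalIntegral.integral_const_mul]
  ring

/-- The expansion of the integrand of the integral equations. -/
theorem hasJet_integrand {W η η' lam : ℝ → ℝ} {w₁ w₂ w₃ d c e₂ e₃ b₁ b₂ b₃ l₂ l₃ κ a p K Z : ℝ}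
    (hW : HasJet W 0 w₁ w₂ w₃) (hη : HasJet η d c e₂ e₃) (hη' : HasJet η' 0 b₁ b₂ b₃)
    (hl : HasJet lam 1 0 l₂ l₃) :
    HasJet (fun t => W t * (Real.sinh (p * lam t * η t) * K)
      + (κ * (η t - d) - a / 2 * (η t - d) ^ 2) * (p * (lam t * Real.cosh (p * lam t * η t) * K
        + lam t ^ 2 * η' t * Real.sinh (p * lam t * η t) * Z))) 0
      (K * w₁ * Real.sinh (p * d) + p * K * κ * c * Real.cosh (p * d))
      (K * (w₁ * (p * Real.cosh (p * d) * c) + w₂ * Real.sinh (p * d))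
        + p * (κ * c * (K * (p * Real.sinh (p * d) * c) + Z * (b₁ * Real.sinh (p * d)))
          + (κ * e₂ - a / 2 * c ^ 2) * (K * Real.cosh (p * d))))
      (K * (w₁ * (p * Real.cosh (p * d) * (e₂ + l₂ * d) + Real.sinh (p * d) * p ^ 2 * c ^ 2 / 2)
          + w₂ * (p * Real.cosh (p * d) * c) + w₃ * Real.sinh (p * d))
        + p * (κ * c * (K * (p * Real.sinh (p * d) * (e₂ + l₂ * d)
              + Real.cosh (p * d) * p ^ 2 * c ^ 2 / 2 + l₂ * Real.cosh (p * d))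
            + Z * (b₂ * Real.sinh (p * d) + b₁ * (p * Real.cosh (p * d) * c)))
          + (κ * e₂ - a / 2 * c ^ 2) * (K * (p * Real.sinh (p * d) * c)
            + Z * (b₁ * Real.sinh (p * d)))
          + (κ * e₃ - a * c * e₂) * (K * Real.cosh (p * d)))) := by
  have hε : HasJet (fun t => η t - d) 0 c e₂ e₃ :=
    (hη.sub (HasJet.const d)).congr_coef (by ring) (by ring) (by ring) (by ring)
  have hP : HasJet (fun t => κ * (η t - d) - a / 2 * (η t - d) ^ 2) 0 (κ * c)
      (κ * e₂ - a / 2 * c ^ 2) (κ * e₃ - a * c * e₂) :=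
    (((hε.const_mul κ).sub ((hε.mul hε).const_mul (a / 2))).congr'
      (Eventually.of_forall fun t => by ring)).congr_coef (by ring) (by ring) (by ring) (by ring)
  have hA : HasJet (fun t => p * lam t * η t) (p * d) (p * c) (p * (e₂ + l₂ * d))
      (p * (e₃ + l₂ * c + l₃ * d)) :=
    ((hl.const_mul p).mul hη).congr_coef (by ring) (by ring) (by ring) (by ring)
  obtain ⟨hs, hc⟩ := hA.sinh_cosh
  have hl2 : HasJet (fun t => lam t ^ 2 * η' t) 0 b₁ b₂ (b₃ + 2 * l₂ * b₁) :=
    (((hl.mul hl).mul hη').congr' (Eventually.of_forall fun t => by ring)).congr_coef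
      (by ring) (by ring) (by ring) (by ring)
  refine ((hW.mul (hs.mul (HasJet.const K))).add (hP.mul ((((hl.mul hc).mul (HasJet.const K)).add
    ((hl2.mul hs).mul (HasJet.const Z))).const_mul p))).congr_coef ?_ ?_ ?_ ?_ <;> ring

namespace SurfaceRelations

variable {a d κ τ T : ℝ} {ψ : ℝ → ℝ → ℝ → ℝ} {η s : ℝ → ℝ → ℝ} {lam : ℝ → ℝ}

theorem dEta_jet (S : SurfaceRelations a d κ τ T ψ η s lam) (x : ℝ) :
    dX (dY η) 0 x = -(τ * Real.sin (τ * x)) := by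
  rw [ContDiffAt.dX_dY_comm (S.eta_analytic 0 x le_rfl S.T_pos).contDiffAt]
  have h : HasDerivAt (fun x => Real.cos (τ * x)) (-(τ * Real.sin (τ * x))) x :=
    (((hasDerivAt_id' x).const_mul τ).cos).congr_deriv (by ring)
  simp only [dY, S.eta_deriv]
  exact h.deriv

/-- The expansions on the surface; `e₂` and `e₃` are the coefficients of the elevation. -/
theorem exists_jets (S : SurfaceRelations a d κ τ T ψ η s lam) :
    ∃ (e₂ e₃ b₂ b₃ : ℝ → ℝ) (l₂ l₃ : ℝ), Continuous e₂ ∧ HasJet lam 1 0 l₂ l₃ ∧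
      ∀ x, HasJet (fun t => η t x) d (Real.cos (τ * x)) (e₂ x) (e₃ x) ∧
        HasJet (fun t => dY η t x) 0 (-(τ * Real.sin (τ * x))) (b₂ x) (b₃ x) ∧
        HasJet (fun t => s t x * (1 + lam t ^ 2 * dY η t x ^ 2) - κ + a * (η t x - d)) 0
          ((a - 1 / κ) * Real.cos (τ * x))
          (κ * τ ^ 2 * Real.sin (τ * x) ^ 2 / 2 - e₂ x / κ - Real.cos (τ * x) ^ 2 / (2 * κ ^ 3)
            + a * e₂ x)
          (-(κ * τ * Real.sin (τ * x) * b₂ x) - Real.cos (τ * x) * τ ^ 2 * Real.sin (τ * x) ^ 2 / κ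
            - e₃ x / κ + Real.cos (τ * x) / κ ^ 2 * (κ * τ ^ 2 * Real.sin (τ * x) ^ 2 / 2
              - e₂ x / κ - Real.cos (τ * x) ^ 2 / (2 * κ ^ 3)) + a * e₃ x) := by
  have hκ := S.kappa_pos
  obtain ⟨l₂, l₃, hl⟩ := exists_hasJet S.T_pos S.lam_analytic
  rw [S.lam_zero, S.lam_deriv] at hl
  refine ⟨fun x => (dX^[2] η) 0 x / 2, fun x => (dX^[3] η) 0 x / 6,
    fun x => (dX^[2] (dY η)) 0 x / 2, fun x => (dX^[3] (dY η)) 0 x / 6, l₂, l₃,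
    ((S.eta_analytic.iterate_dX 2).continuous le_rfl S.T_pos).div_const 2, hl, fun x => ?_⟩
  have h1 := S.eta_analytic.hasJet S.T_pos x
  have h2 := S.eta_analytic.diff_snd.hasJet S.T_pos x
  rw [S.eta_zero, S.eta_deriv] at h1
  rw [S.dEta_zero, S.dEta_jet] at h2
  refine ⟨h1, h2, ?_⟩
  set c := Real.cos (τ * x)
  set sn := Real.sin (τ * x)
  set e₂ := (dX^[2] η) 0 x / 2
  set e₃ := (dX^[3] η) 0 x / 6
  set b₂ := (dX^[2] (dY η)) 0 x / 2
  obtain ⟨n₁, n₂, n₃, hN⟩ : ∃ n₁ n₂ n₃,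
      HasJet (fun t => s t x * (1 + lam t ^ 2 * dY η t x ^ 2)) κ n₁ n₂ n₃ :=
    ⟨_, _, _, ((S.s_analytic.mul ((StripAnalytic.const 1).add ((S.lam_strip.pow 2).mul
      (S.eta_analytic.diff_snd.pow 2)))).hasJet S.T_pos x).congr_coef
      (by rw [S.s_zero, S.dEta_zero]; ring) rfl rfl rfl⟩
  have hsq := (hN.mul hN).unique ((((HasJet.const (κ ^ 2)).sub
    ((h1.sub (HasJet.const d)).const_mul 2)).mul ((HasJet.const 1).add
      ((hl.mul hl).mul (h2.mul h2)))).congr' (by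
      filter_upwards [(eventually_lt_of_pos S.T_pos).filter_mono
        (nhdsWithin_mono _ Set.Ioi_subset_Ici_self)] with t ht
      linear_combination -(1 + lam t ^ 2 * dY η t x ^ 2) * S.bernoulli t x ht.1 ht.2))
  obtain ⟨-, q1, q2, q3⟩ := hsq
  have r1 : n₁ = -c / κ := by
    rw [eq_div_iff hκ.ne']
    linarith
  have r2 : n₂ = κ * τ ^ 2 * sn ^ 2 / 2 - e₂ / κ - c ^ 2 / (2 * κ ^ 3) := by
    have h3 : 2 * κ * n₂ = κ ^ 2 * τ ^ 2 * sn ^ 2 - 2 * e₂ - n₁ ^ 2 := by linarith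
    rw [r1] at h3
    have h4 : n₂ = (2 * κ * n₂) / (2 * κ) := by field_simp
    rw [h4, h3]
    field_simp
  have r3 : n₃ = -(κ * τ * sn * b₂) - c * τ ^ 2 * sn ^ 2 / κ - e₃ / κ - n₁ * n₂ / κ := by
    have h3 : κ * n₃ = -(κ ^ 2 * τ * sn * b₂) - c * τ ^ 2 * sn ^ 2 - e₃ - n₁ * n₂ := by
      linarith
    have h4 : n₃ = (κ * n₃) / κ := by field_simp
    rw [h4, h3]
    field_simp
  refine ((hN.sub (HasJet.const κ)).add ((h1.sub (HasJet.const d)).const_mul a)).congr_coef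
    (by ring) (by rw [r1]; ring) (by rw [r2]; ring) ?_
  rw [r3, r2, r1]
  field_simp
  ring

end SurfaceRelations

theorem third_order_algebra {a d κ τ g g₂ l m₀ m₂ A₁ B₁ C₁ a₁ b₁ c₁ d₁ : ℝ} (hκ : 0 < κ)
    (ha : a = 1 / κ - κ * g) (hA : A₁ = -a / 4 - κ * g / 2) (hC : C₁ = τ ^ 2 * κ ^ 2 / 2)
    (hB : B₁ = -(3 / 4) * τ ^ 2 * κ ^ 2 + a ^ 2 / 4 + a * κ * g / 2 + κ ^ 2 * g ^ 2 / 4)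
    (ha₁ : a₁ = m₀) (hb₁ : b₁ = 2 * m₂) (hc₁ : κ * c₁ = -(B₁ + C₁) - (1 - a * κ) * a₁)
    (hd₁ : d₁ = -A₁ - κ * b₁) (hg : κ * (g₂ * d₁) = -B₁ - (1 - a * κ) * b₁)
    (hE : 3 / 8 * (-τ ^ 2 / (2 * κ) - g / (2 * κ ^ 3) - 1 / (2 * κ ^ 5) + κ * g * τ ^ 2 / 2)
      + (-κ * τ ^ 2 * g / 2 - τ ^ 2 / (2 * κ) + a * τ ^ 2 / 2) / 8
      + l * (κ * (d * τ ^ 2 + g - d * g ^ 2)) / 2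
      + ((a - 2 / κ) * g - 1 / κ ^ 3 + κ * τ ^ 2) / 2 * m₀
      + ((a - 2 / κ) * g - 1 / κ ^ 3 + 3 * κ * τ ^ 2) / 2 * m₂ = 0) :
    l * (κ ^ 3 * (d * τ ^ 2 + g) - d * κ * (1 - a * κ) * g)
      = κ * (-(a₁ + b₁ / 2) * (a * (-a - κ * g) + κ ^ 2 * τ ^ 2) + c₁ * (-a - κ * g)
          + d₁ * (κ * τ ^ 2 + (-a - κ * g) * g₂ / 2) + 3 / 4 * a * κ * τ ^ 2
          + 5 / 8 * κ ^ 2 * τ ^ 2 * g)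
        - (1 - a * κ) * ((a₁ + b₁ / 2) * (-a - κ * g) + c₁ + g₂ * d₁ / 2
          - 3 / 8 * κ * τ ^ 2) := by
  have h1 : 1 - a * κ = κ ^ 2 * g := by rw [ha]; field_simp; ring
  have h2 : -a - κ * g = -(1 / κ) := by rw [ha]; ring
  have h3 : a ^ 2 / 4 + a * κ * g / 2 + κ ^ 2 * g ^ 2 / 4 = 1 / (4 * κ ^ 2) := by
    rw [ha]; field_simp; ring
  have hB' : B₁ = -(3 / 4) * τ ^ 2 * κ ^ 2 + 1 / (4 * κ ^ 2) := by rw [hB]; linarith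
  rw [h1] at hc₁ hg ⊢
  rw [h2]
  have e1 : c₁ = (-(B₁ + C₁) - κ ^ 2 * g * a₁) / κ := by rw [← hc₁]; field_simp
  have e2 : g₂ * d₁ = (-B₁ - κ ^ 2 * g * b₁) / κ := by rw [← hg]; field_simp
  have e3 : d₁ * (κ * τ ^ 2 + -(1 / κ) * g₂ / 2) = d₁ * (κ * τ ^ 2) - 1 / κ * (g₂ * d₁) / 2 := by
    ring
  rw [e3, e2, e1, hd₁, hA, hB', hC, ha₁, hb₁, ha]
  rw [ha] at hE
  field_simp at hE ⊢
  linear_combination 8 * hE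

section Averages

variable {a d T T' : ℝ} {ψ : ℝ → ℝ → ℝ → ℝ} {η s : ℝ → ℝ → ℝ} {lam : ℝ → ℝ}

/-- The averages over a period of the terms of second and third order. -/
theorem IsStokesBranch.integral_orders (hB : IsStokesBranch a d T ψ η lam) (hT' : T' ≤ T)
    (S : SurfaceRelations a d (kappa a d) (tauStar a d) T' ψ η s lam) (k : ℕ)
    {f₀ f₁ f₂ f₃ : ℝ → ℝ} (hj : ∀ x, HasJet (fun t =>
      (s t x * (1 + lam t ^ 2 * dY η t x ^ 2) - kappa a d + a * (η t x - d))
          * stripMode (tauStar a d) (lam t) k x (η t x)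
        + (kappa a d * (η t x - d) - a / 2 * (η t x - d) ^ 2)
          * conormal (η t) (lam t) (stripMode (tauStar a d) (lam t) k) x)
      (f₀ x) (f₁ x) (f₂ x) (f₃ x)) :
    ∫ x in (0 : ℝ)..2 * Real.pi / tauStar a d, f₂ x = 0 ∧
      ∫ x in (0 : ℝ)..2 * Real.pi / tauStar a d, f₃ x = 0 := by
  have hη := S.eta_analytic
  have hη1 := hη.diff_snd
  have hl := S.lam_strip
  have hsh : ∀ p : ℝ, StripAnalytic T' fun t x => Real.sinh (p * lam t * η t x) := fun p =>
    (((StripAnalytic.const p).mul hl).mul hη).comp fun _ => Real.analyticAt_sinh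
  have hch : ∀ p : ℝ, StripAnalytic T' fun t x => Real.cosh (p * lam t * η t x) := fun p =>
    (((StripAnalytic.const p).mul hl).mul hη).comp fun _ => Real.analyticAt_cosh
  have hlin : ∀ p : ℝ, StripAnalytic T' fun _ x => p * x := fun p =>
    .of_snd fun x => analyticAt_const.mul analyticAt_id
  have hcos : ∀ p : ℝ, StripAnalytic T' fun _ x => Real.cos (p * x) := fun p =>
    (hlin p).comp fun _ => Real.analyticAt_cos
  have hsin : ∀ p : ℝ, StripAnalytic T' fun _ x => Real.sin (p * x) := fun p =>
    (hlin p).comp fun _ => Real.analyticAt_sin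
  have hε := hη.sub (.const d)
  refine StripAnalytic.integral_coef_eq_zero S.T_pos (period_pos S.tau_pos).le ?_ ?_ hj
  · refine ((((S.s_analytic.mul ((StripAnalytic.const 1).add ((hl.pow 2).mul (hη1.pow 2)))).sub
      (.const _)).add ((StripAnalytic.const a).mul hε)).mul ?_).add
      ((((StripAnalytic.const _).mul hε).sub ((StripAnalytic.const _).mul (hε.pow 2))).mul ?_)
    · rcases Nat.eq_zero_or_pos k with rfl | hk
      · simpa only [stripMode, if_pos] using hη
      · simp only [stripMode, if_neg hk.ne']
        exact (hsh _).mul (hcos _)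
    · change StripAnalytic T' fun t x =>
        conormal (η t) (lam t) (stripMode (tauStar a d) (lam t) k) x
      simp only [conormal_stripMode]
      rcases Nat.eq_zero_or_pos k with rfl | hk
      · simpa only [if_pos] using StripAnalytic.const 1
      · simp only [if_neg hk.ne']
        exact (StripAnalytic.const _).mul (((hl.mul (hch _)).mul (hcos _)).add
          ((((hl.pow 2).mul hη1).mul (hsh _)).mul (hsin _)))
  · filter_upwards [(eventually_lt_of_pos S.T_pos).filter_mono
      (nhdsWithin_mono _ Set.Ioi_subset_Ici_self)] with t ht
    exact hB.integral_eq_zero hT' S ht.1 ht.2 k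

theorem trig_identities (θ : ℝ) : Real.sin θ ^ 2 = 1 - Real.cos θ ^ 2 ∧
    Real.cos (2 * θ) = 2 * Real.cos θ ^ 2 - 1 ∧ Real.sin (2 * θ) = 2 * Real.sin θ * Real.cos θ ∧
    Real.cos (4 * θ) = 2 * (2 * Real.cos θ ^ 2 - 1) ^ 2 - 1 := by
  refine ⟨by rw [Real.sin_sq], Real.cos_two_mul θ, Real.sin_two_mul θ, ?_⟩
  rw [show 4 * θ = 2 * (2 * θ) by ring, Real.cos_two_mul, Real.cos_two_mul]

/-- The three solvability conditions. -/
theorem IsStokesBranch.exists_conditions (hB : IsStokesBranch a d T ψ η lam) (hT' : T' ≤ T)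
    {κ τ : ℝ} (hκ' : κ = kappa a d) (hτ' : τ = tauStar a d)
    (S : SurfaceRelations a d κ τ T' ψ η s lam) {g : ℝ}
    (hg : τ * Real.cosh (τ * d) = g * Real.sinh (τ * d)) (ha : a = 1 / κ - κ * g) :
    ∃ l l₃ m₀ m₂, HasJet lam 1 0 l l₃ ∧
      ((a / 2 - 1 / κ) / 2 + d * κ * τ ^ 2 / 4 - d / (4 * κ ^ 3) + (κ + a * d - d / κ) * m₀ = 0) ∧
      (((a / 2 - 1 / κ) * (2 * τ * Real.cosh (2 * τ * d))
          + (3 / 2 * τ ^ 2 * κ - 1 / (2 * κ ^ 3)) * Real.sinh (2 * τ * d)) / 4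
        + ((a - 1 / κ) * Real.sinh (2 * τ * d) + κ * (2 * τ * Real.cosh (2 * τ * d))) * m₂ = 0) ∧
      (3 / 8 * (-τ ^ 2 / (2 * κ) - g / (2 * κ ^ 3) - 1 / (2 * κ ^ 5) + κ * g * τ ^ 2 / 2)
        + (-κ * τ ^ 2 * g / 2 - τ ^ 2 / (2 * κ) + a * τ ^ 2 / 2) / 8
        + l * (κ * (d * τ ^ 2 + g - d * g ^ 2)) / 2
        + ((a - 2 / κ) * g - 1 / κ ^ 3 + κ * τ ^ 2) / 2 * m₀
        + ((a - 2 / κ) * g - 1 / κ ^ 3 + 3 * κ * τ ^ 2) / 2 * m₂ = 0) := by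
  obtain ⟨e₂, e₃, b₂, b₃, l₂, l₃, he, hl, hjet⟩ := S.exists_jets
  have hκ := S.kappa_pos
  have hτ := S.tau_pos
  have hd := S.d_pos
  have hS : 0 < Real.sinh (τ * d) := Real.sinh_pos_iff.2 (by positivity)
  have hord := fun k f₀ f₁ f₂ f₃ => hB.integral_orders hT' (hκ' ▸ hτ' ▸ S) k
    (f₀ := f₀) (f₁ := f₁) (f₂ := f₂) (f₃ := f₃)
  rw [← hκ', ← hτ'] at hord
  have hL := period_pos hτ
  set L := 2 * Real.pi / τ with hLdef
  set m₀ := (∫ x in (0 : ℝ)..L, e₂ x) / L with hm₀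
  set m₂ := (∫ x in (0 : ℝ)..L, e₂ x * Real.cos (2 * (τ * x))) / L with hm₂
  have key : ∀ {f : ℝ → ℝ} (α β γ α' β' : ℝ), ∫ x in (0 : ℝ)..L, f x = 0 →
      (∀ x, f x = α + β * Real.cos (2 * (τ * x)) + γ * Real.cos (4 * (τ * x))
        + e₂ x * (α' + β' * Real.cos (2 * (τ * x)))) → α + α' * m₀ + β' * m₂ = 0 := by
    intro f α β γ α' β' h0 hf
    simp only [hf] at h0
    rw [integral_trig_form hτ he] at h0
    have h1 : L * (α + α' * m₀ + β' * m₂) = 0 := by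
      have e0 : L * m₀ = ∫ x in (0 : ℝ)..L, e₂ x := mul_div_cancel₀ _ hL.ne'
      have e2 : L * m₂ = ∫ x in (0 : ℝ)..L, e₂ x * Real.cos (2 * (τ * x)) :=
        mul_div_cancel₀ _ hL.ne'
      linear_combination h0 + α' * e0 + β' * e2
    exact (mul_eq_zero.1 h1).resolve_left hL.ne'
  refine ⟨l₂, l₃, m₀, m₂, hl, ?_, ?_, ?_⟩
  · have h := (hord 0 _ _ _ _ fun x => by
      obtain ⟨h1, h2, h3⟩ := hjet x
      have hε := h1.sub (HasJet.const d)
      have h4 := (h3.mul h1).add ((hε.const_mul κ).sub ((hε.mul hε).const_mul (a / 2)))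
      refine h4.congr' (Eventually.of_forall fun t => ?_)
      simp only [stripMode, conormal_stripMode, if_pos]
      ring).1
    have h5 := key ((a / 2 - 1 / κ) / 2 + d * κ * τ ^ 2 / 4 - d / (4 * κ ^ 3))
      ((a / 2 - 1 / κ) / 2 - d * κ * τ ^ 2 / 4 - d / (4 * κ ^ 3)) 0 (κ + a * d - d / κ) 0 h
      fun x => by
        obtain ⟨t1, t2, -, -⟩ := trig_identities (τ * x)
        rw [t1, t2]
        field_simp
        ring
    linarith
  · have h := (hord 2 _ _ _ _ fun x => by
      obtain ⟨h1, h2, h3⟩ := hjet x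
      have h4 := hasJet_integrand (κ := κ) (a := a) (p := 2 * τ) (K := Real.cos (2 * τ * x))
        (Z := Real.sin (2 * τ * x)) h3 h1 h2 hl
      refine h4.congr' (Eventually.of_forall fun t => ?_)
      simp only [stripMode, conormal_stripMode, if_neg two_ne_zero, Nat.cast_ofNat]
      rfl).1
    set S₂ := Real.sinh (2 * τ * d)
    set C₂ := Real.cosh (2 * τ * d)
    have h5 := key
      (((a - 1 / κ) * (2 * τ * C₂) - S₂ / (2 * κ ^ 3) + 4 * τ ^ 2 * κ * S₂ - a * τ * C₂) / 4
        - κ * τ ^ 2 * S₂ / 8 - 2 * τ ^ 2 * κ * S₂ / 4)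
      (((a - 1 / κ) * (2 * τ * C₂) - S₂ / (2 * κ ^ 3) + 4 * τ ^ 2 * κ * S₂ - a * τ * C₂) / 2
        + κ * τ ^ 2 * S₂ / 4)
      (((a - 1 / κ) * (2 * τ * C₂) - S₂ / (2 * κ ^ 3) + 4 * τ ^ 2 * κ * S₂ - a * τ * C₂) / 4
        - κ * τ ^ 2 * S₂ / 8 + τ ^ 2 * κ * S₂ / 2) 0
      ((a - 1 / κ) * S₂ + κ * (2 * τ * C₂)) h
      fun x => by
        obtain ⟨t1, t2, t3, t4⟩ := trig_identities (τ * x)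
        rw [t4, mul_assoc 2 τ x, t2, t3]
        set c := Real.cos (τ * x)
        set sn := Real.sin (τ * x)
        field_simp
        ring_nf
        simp only [t1]
        ring
    linear_combination h5
  · have h := (hord 1 _ _ _ _ fun x => by
      obtain ⟨h1, h2, h3⟩ := hjet x
      have h4 := hasJet_integrand (κ := κ) (a := a) (p := τ) (K := Real.cos (τ * x))
        (Z := Real.sin (τ * x)) h3 h1 h2 hl
      refine h4.congr' (Eventually.of_forall fun t => ?_)
      simp only [stripMode, conormal_stripMode, if_neg one_ne_zero, Nat.cast_one, one_mul]
      rfl).2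
    set S₁ := Real.sinh (τ * d)
    have hC : Real.cosh (τ * d) = g * S₁ / τ := by rw [eq_div_iff hτ.ne']; linarith
    rw [hC] at h
    set Y₄ := -τ ^ 2 / (2 * κ) - g / (2 * κ ^ 3) - 1 / (2 * κ ^ 5) + κ * g * τ ^ 2 / 2 with hY₄
    set Y₂ := -κ * τ ^ 2 * g / 2 - τ ^ 2 / (2 * κ) + a * τ ^ 2 / 2 with hY₂
    set Y := κ * (d * τ ^ 2 + g - d * g ^ 2) with hY
    set X := (a - 2 / κ) * g - 1 / κ ^ 3 + 2 * κ * τ ^ 2 with hX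
    have h5 := key (S₁ * (3 / 8 * Y₄ + Y₂ / 8 + l₂ * Y / 2)) (S₁ * (Y₄ / 2 + l₂ * Y / 2))
      (S₁ * (Y₄ / 8 - Y₂ / 8)) (S₁ * ((X - κ * τ ^ 2) / 2)) (S₁ * ((X + κ * τ ^ 2) / 2)) h
      fun x => by
        obtain ⟨t1, t2, -, t4⟩ := trig_identities (τ * x)
        rw [t4, t2, hY₄, hY₂, hY, hX, ha]
        set c := Real.cos (τ * x)
        set sn := Real.sin (τ * x)
        field_simp
        ring_nf
        simp only [t1]
        ring
    have h6 : S₁ * (3 / 8 * Y₄ + Y₂ / 8 + l₂ * Y / 2 + (X - κ * τ ^ 2) / 2 * m₀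
        + (X + κ * τ ^ 2) / 2 * m₂) = 0 := by linear_combination h5
    have h7 := (mul_eq_zero.1 h6).resolve_left hS.ne'
    rw [hX] at h7
    linear_combination h7

end Averages

theorem gammaD_eq (d : ℝ) {τ : ℝ} (hτ : τ ≠ 0) :
    gammaD d τ = τ * (Real.cosh (τ * d) / Real.sinh (τ * d)) := by
  have h1 : gammaFn d τ = fun y => Real.sinh (τ * y) / Real.sinh (τ * d) := by
    ext y; rw [gammaFn, if_neg hτ]
  have h2 := (((hasDerivAt_id' d).const_mul τ).sinh).div_const (Real.sinh (τ * d))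
  rw [gammaD, h1]
  exact (h2.congr_deriv (by ring)).deriv

theorem gammaD_zero (d : ℝ) : gammaD d 0 = 1 / d := by
  have h1 : gammaFn d 0 = fun y => y / d := by ext y; rw [gammaFn, if_pos rfl]
  rw [gammaD, h1]
  exact ((hasDerivAt_id' d).div_const d).deriv

theorem mul_gammaD {d τ : ℝ} (hτ : τ ≠ 0) : d * gammaD d τ = xCoth (τ * d) := by
  rw [gammaD_eq d hτ, xCoth]; ring

section Dispersion

variable {a d : ℝ}

/-- The sizes of the numbers `γ'(d; k τ_*)`, `k = 0, 1, 2`. -/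
theorem gammaD_bounds (hd : 0 < d) {τ : ℝ} (hτ : 0 < τ) :
    1 / d < gammaD d τ ∧ gammaD d τ < gammaD d (2 * τ) ∧
      0 < d * τ ^ 2 + gammaD d τ - d * gammaD d τ ^ 2 := by
  have h1 := mul_gammaD (d := d) hτ.ne'
  have h2 := mul_gammaD (d := d) (mul_pos two_pos hτ).ne'
  have hτd : 0 < τ * d := by positivity
  have hx : xCoth (τ * d) < xCoth (2 * τ * d) := strictMonoOn_xCoth (Set.mem_Ioi.2 hτd)
    (Set.mem_Ioi.2 (by positivity)) (by nlinarith)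
  have hx1 := one_lt_xCoth hτd
  refine ⟨by rw [div_lt_iff₀ hd]; linarith, ?_, ?_⟩
  · exact lt_of_mul_lt_mul_left (by rw [h1, h2]; exact hx) hd.le
  · rw [gammaD_eq d hτ.ne']
    have hS : 0 < Real.sinh (τ * d) := Real.sinh_pos_iff.2 hτd
    have hCS := Real.cosh_sq (τ * d)
    have hlt : τ * d < Real.sinh (τ * d) * Real.cosh (τ * d) := by
      have h3 := Real.self_lt_sinh_iff.2 hτd
      have h4 := Real.one_le_cosh (τ * d)
      nlinarith
    set S := Real.sinh (τ * d)
    set C := Real.cosh (τ * d)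
    have e : d * τ ^ 2 + τ * (C / S) - d * (τ * (C / S)) ^ 2 = τ * (S * C - τ * d) / S ^ 2 := by
      field_simp
      rw [hCS]
      ring
    rw [e]
    have := sub_pos.2 hlt
    positivity

theorem dispersion_relation (hκ : 0 < kappa a d) (hσ : sigmaFn a d (tauStar a d) = 0) :
    a = 1 / kappa a d - kappa a d * gammaD d (tauStar a d) := by
  rw [sigmaFn] at hσ
  have h1 : a * kappa a d = 1 - kappa a d ^ 2 * gammaD d (tauStar a d) := by linarith
  rw [← mul_left_inj' hκ.ne', h1]
  field_simp

/-- The denominators in the coefficients do not vanish, and the coefficients solve the linear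
systems of second and third order. -/
theorem coef_relations (hd : 0 < d) (hκ : 0 < kappa a d) (hτ : 0 < tauStar a d)
    (hσ : sigmaFn a d (tauStar a d) = 0) :
    sigmaFn a d 0 ≠ 0 ∧ sigmaFn a d (2 * tauStar a d) ≠ 0 ∧
    kappa a d * coefc1 a d = -(coefB1 a d + coefC1 a d) - (1 - a * kappa a d) * coefa1 a d ∧
    coefd1 a d = -coefA1 a d - kappa a d * coefb1 a d ∧
    kappa a d * (gammaD d (2 * tauStar a d) * coefd1 a d)
      = -coefB1 a d - (1 - a * kappa a d) * coefb1 a d := by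
  obtain ⟨g1, g2, g3⟩ := gammaD_bounds hd hτ
  have hσ0 : sigmaFn a d 0 = kappa a d ^ 2 * (1 / d - gammaD d (tauStar a d)) := by
    rw [sigmaFn] at hσ ⊢
    rw [gammaD_zero]; linarith
  have hσ2 : sigmaFn a d (2 * tauStar a d)
      = kappa a d ^ 2 * (gammaD d (2 * tauStar a d) - gammaD d (tauStar a d)) := by
    rw [sigmaFn] at hσ ⊢
    linarith
  have hn0 : sigmaFn a d 0 ≠ 0 := by
    rw [hσ0]; exact mul_ne_zero (by positivity) (sub_neg.2 g1).ne
  have hn2 : sigmaFn a d (2 * tauStar a d) ≠ 0 := by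
    rw [hσ2]; exact mul_ne_zero (by positivity) (sub_pos.2 g2).ne'
  have hc₁ : kappa a d * coefc1 a d
      = -(coefB1 a d + coefC1 a d) - (1 - a * kappa a d) * coefa1 a d := by
    have hx : d * sigmaFn a d 0 = kappa a d ^ 2 - d * (1 - a * kappa a d) := by
      rw [sigmaFn, gammaD_zero]; field_simp; ring
    have hne := mul_ne_zero hd.ne' hn0
    rw [coefc1, coefa1, ← mul_left_inj' hne, mul_assoc, div_mul_cancel₀ _ hne, sub_mul, mul_assoc (1 - a * kappa a d), div_mul_cancel₀ _ hne, hx]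
    ring
  have hd₁ : coefd1 a d = -coefA1 a d - kappa a d * coefb1 a d := by
    rw [coefd1, coefb1, ← mul_left_inj' hn2, div_mul_cancel₀ _ hn2, sub_mul, mul_assoc (kappa a d),
      div_mul_cancel₀ _ hn2, sigmaFn]
    ring
  have hgd : kappa a d * (gammaD d (2 * tauStar a d) * coefd1 a d)
      = -coefB1 a d - (1 - a * kappa a d) * coefb1 a d := by
    rw [coefd1, coefb1, ← mul_left_inj' hn2, mul_assoc, mul_assoc, div_mul_cancel₀ _ hn2, sub_mul,
      mul_assoc (1 - a * kappa a d), div_mul_cancel₀ _ hn2, sigmaFn]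
    ring
  exact ⟨hn0, hn2, hc₁, hd₁, hgd⟩

/-- The solvability condition of third order determines `lambda2`. -/
theorem lambda2_eq (hd : 0 < d) (hκ : 0 < kappa a d) (hτ : 0 < tauStar a d)
    (hσ : sigmaFn a d (tauStar a d) = 0) {l : ℝ}
    (hE : 3 / 8 * (-tauStar a d ^ 2 / (2 * kappa a d)
          - gammaD d (tauStar a d) / (2 * kappa a d ^ 3) - 1 / (2 * kappa a d ^ 5)
          + kappa a d * gammaD d (tauStar a d) * tauStar a d ^ 2 / 2)
        + (-kappa a d * tauStar a d ^ 2 * gammaD d (tauStar a d) / 2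
          - tauStar a d ^ 2 / (2 * kappa a d) + a * tauStar a d ^ 2 / 2) / 8
        + l * (kappa a d * (d * tauStar a d ^ 2 + gammaD d (tauStar a d)
          - d * gammaD d (tauStar a d) ^ 2)) / 2
        + ((a - 2 / kappa a d) * gammaD d (tauStar a d) - 1 / kappa a d ^ 3
          + kappa a d * tauStar a d ^ 2) / 2 * coefa1 a d
        + ((a - 2 / kappa a d) * gammaD d (tauStar a d) - 1 / kappa a d ^ 3
          + 3 * kappa a d * tauStar a d ^ 2) / 2 * (coefb1 a d / 2) = 0) : lambda2 a d = l := by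
  obtain ⟨-, -, hc₁, hd₁, hgd⟩ := coef_relations hd hκ hτ hσ
  obtain ⟨-, -, g3⟩ := gammaD_bounds hd hτ
  have hσa := hσ
  rw [sigmaFn] at hσa
  have hfin := third_order_algebra hκ (dispersion_relation hκ hσ) rfl rfl rfl rfl
    (by ring : coefb1 a d = 2 * (coefb1 a d / 2)) hc₁ hd₁ hgd hE
  have hden : kappa a d ^ 3 * (d * tauStar a d ^ 2 + gammaD d (tauStar a d))
      - d * kappa a d * (1 - a * kappa a d) * gammaD d (tauStar a d) ≠ 0 := by
    have e : kappa a d ^ 3 * (d * tauStar a d ^ 2 + gammaD d (tauStar a d))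
      - d * kappa a d * (1 - a * kappa a d) * gammaD d (tauStar a d) = kappa a d ^ 3 *
        (d * tauStar a d ^ 2 + gammaD d (tauStar a d) - d * gammaD d (tauStar a d) ^ 2) := by
      linear_combination d * kappa a d * gammaD d (tauStar a d) * hσa
    rw [e]
    positivity
  rw [lambda2, div_eq_iff hden]
  refine Eq.trans ?_ hfin.symm
  rw [coefC2, coefA2, coefXi]

variable {T T' : ℝ} {ψ : ℝ → ℝ → ℝ → ℝ} {η s : ℝ → ℝ → ℝ} {lam : ℝ → ℝ}

/-- The second coefficient of the wave number. -/
theorem IsStokesBranch.exists_lam_jet (hB : IsStokesBranch a d T ψ η lam) (hT' : T' ≤ T)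
    (S : SurfaceRelations a d (kappa a d) (tauStar a d) T' ψ η s lam)
    (hσ : sigmaFn a d (tauStar a d) = 0) : ∃ l₃, HasJet lam 1 0 (lambda2 a d) l₃ := by
  have hκ := S.kappa_pos
  have hτ := S.tau_pos
  have hd := S.d_pos
  obtain ⟨g1, g2, g3⟩ := gammaD_bounds hd hτ
  have ha := dispersion_relation hκ hσ
  obtain ⟨hn0, hn2, -, -, -⟩ := coef_relations hd hκ hτ hσ
  have hS1 : 0 < Real.sinh (tauStar a d * d) := Real.sinh_pos_iff.2 (by positivity)
  have hS2 : 0 < Real.sinh (2 * tauStar a d * d) := Real.sinh_pos_iff.2 (by positivity)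
  have hg : tauStar a d * Real.cosh (tauStar a d * d)
      = gammaD d (tauStar a d) * Real.sinh (tauStar a d * d) := by
    rw [gammaD_eq d hτ.ne']; field_simp
  have hg2 : 2 * tauStar a d * Real.cosh (2 * tauStar a d * d)
      = gammaD d (2 * tauStar a d) * Real.sinh (2 * tauStar a d * d) := by
    rw [gammaD_eq d (mul_pos two_pos hτ).ne']; field_simp
  obtain ⟨l, l₃, m₀, m₂, hl, E0, E2, E3⟩ := hB.exists_conditions hT' rfl rfl S hg ha
  refine ⟨l₃, ?_⟩
  have hA : coefA1 a d = -a / 4 - kappa a d * gammaD d (tauStar a d) / 2 := rfl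
  have hBc : coefB1 a d = -(3 / 4) * tauStar a d ^ 2 * kappa a d ^ 2
      + 1 / (4 * kappa a d ^ 2) := by
    have e : a ^ 2 / 4 + a * kappa a d * gammaD d (tauStar a d) / 2
        + kappa a d ^ 2 * gammaD d (tauStar a d) ^ 2 / 4 = 1 / (4 * kappa a d ^ 2) := by
      rw [show a ^ 2 / 4 + a * kappa a d * gammaD d (tauStar a d) / 2
        + kappa a d ^ 2 * gammaD d (tauStar a d) ^ 2 / 4
        = (a + kappa a d * gammaD d (tauStar a d)) ^ 2 / 4 by ring,
        show a + kappa a d * gammaD d (tauStar a d) = 1 / kappa a d by linarith]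
      field_simp
    rw [coefB1]; linarith
  have hC : coefC1 a d = tauStar a d ^ 2 * kappa a d ^ 2 / 2 := rfl
  have hσa := hσ
  rw [sigmaFn] at hσa
  have ha₁ : coefa1 a d = m₀ := by
    rw [coefa1, div_eq_iff (mul_ne_zero hd.ne' hn0), hBc, hC, hA, sigmaFn, gammaD_zero]
    have E0' := congrArg (fun r => kappa a d * r) E0
    simp only [mul_zero] at E0'
    have e1 : d * (1 / d) = 1 := by field_simp
    have e2 : kappa a d * (1 / kappa a d) = 1 := by field_simp
    have e3 : kappa a d * (d / (4 * kappa a d ^ 3)) = d * (1 / (4 * kappa a d ^ 2)) := by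
      field_simp
    have e4 : kappa a d * (d / kappa a d) = d := by field_simp
    linear_combination -E0' - kappa a d ^ 2 * m₀ * e1 - 1 / 2 * e2 - e3 - m₀ * e4 + 1 / 2 * hσa
  have hb₁ : coefb1 a d = 2 * m₂ := by
    rw [coefb1, div_eq_iff hn2, hBc, hA, sigmaFn]
    have e2 : kappa a d * (1 / kappa a d) = 1 := by field_simp
    have e3 : kappa a d * (1 / (2 * kappa a d ^ 3)) = 2 * (1 / (4 * kappa a d ^ 2)) := by
      field_simp
      norm_num
    rw [hg2] at E2
    have E2' : Real.sinh (2 * tauStar a d * d) * (kappa a d *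
        (((a / 2 - 1 / kappa a d) * gammaD d (2 * tauStar a d)
          + (3 / 2 * tauStar a d ^ 2 * kappa a d - 1 / (2 * kappa a d ^ 3))) / 4
          + ((a - 1 / kappa a d) + kappa a d * gammaD d (2 * tauStar a d)) * m₂)) = 0 := by
      linear_combination kappa a d * E2
    have E2'' := (mul_eq_zero.1 E2').resolve_left hS2.ne'
    linear_combination (-2) * E2'' - (1 / 2 * gammaD d (2 * tauStar a d) + 2 * m₂) * e2
      - 1 / 2 * e3 + 1 / 2 * gammaD d (2 * tauStar a d) * hσa
  have hl2 : lambda2 a d = l := by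
    refine lambda2_eq hd hκ hτ hσ ?_
    rw [ha₁, hb₁]
    linear_combination E3
  rw [hl2]
  exact hl

end Dispersion

section TwoVariables

variable {v w : ℝ → ℝ → ℝ} {x y : ℝ}

theorem eventuallyEq_fst (f g : ℝ → ℝ → ℝ) (h : ∀ᶠ r : ℝ × ℝ in 𝓝 (x, y), f r.1 r.2 = g r.1 r.2) :
    (fun s => f s y) =ᶠ[𝓝 x] fun s => g s y :=
  (hasDerivAt_prodMk_left x y).continuousAt.eventually h

theorem eventuallyEq_snd (f g : ℝ → ℝ → ℝ) (h : ∀ᶠ r : ℝ × ℝ in 𝓝 (x, y), f r.1 r.2 = g r.1 r.2) :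
    (fun s => f x s) =ᶠ[𝓝 y] fun s => g x s :=
  (hasDerivAt_prodMk_right x y).continuousAt.eventually h

theorem AnalyticAt.dX_dX_dY (h : AnalyticAt ℝ (fun p : ℝ × ℝ => v p.1 p.2) (x, y)) :
    _root_.dX (_root_.dX (_root_.dY v)) x y = _root_.dY (_root_.dX (_root_.dX v)) x y := by
  rw [← ContDiffAt.dX_dY_comm (v := _root_.dX v) h.dX.contDiffAt]
  refine Filter.EventuallyEq.deriv_eq ?_
  exact eventuallyEq_fst (_root_.dX (_root_.dY v)) (_root_.dY (_root_.dX v))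
    (h.eventually_analyticAt.mono fun r hr =>
    ContDiffAt.dX_dY_comm (x := r.1) (y := r.2) hr.contDiffAt)

theorem AnalyticAt.derivs_sub_const_mul
    (hv : AnalyticAt ℝ (fun p : ℝ × ℝ => v p.1 p.2) (x, y))
    (hw : AnalyticAt ℝ (fun p : ℝ × ℝ => w p.1 p.2) (x, y)) (m : ℝ) :
    _root_.dX (fun x y => v x y - m * w x y) x y = _root_.dX v x y - m * _root_.dX w x y ∧
    _root_.dY (fun x y => v x y - m * w x y) x y = _root_.dY v x y - m * _root_.dY w x y ∧
    _root_.dX (_root_.dX (fun x y => v x y - m * w x y)) x y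
      = _root_.dX (_root_.dX v) x y - m * _root_.dX (_root_.dX w) x y ∧
    _root_.dY (_root_.dY (fun x y => v x y - m * w x y)) x y
      = _root_.dY (_root_.dY v) x y - m * _root_.dY (_root_.dY w) x y := by
  have hX : ∀ r : ℝ × ℝ, AnalyticAt ℝ (fun p : ℝ × ℝ => v p.1 p.2) r →
      AnalyticAt ℝ (fun p : ℝ × ℝ => w p.1 p.2) r →
      _root_.dX (fun x y => v x y - m * w x y) r.1 r.2
        = _root_.dX v r.1 r.2 - m * _root_.dX w r.1 r.2 := fun r h1 h2 =>
    ((h1.differentiableAt (x := (r.1, r.2))).hasDerivAt_dX.sub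
      ((h2.differentiableAt (x := (r.1, r.2))).hasDerivAt_dX.const_mul m)).deriv
  have hY : ∀ r : ℝ × ℝ, AnalyticAt ℝ (fun p : ℝ × ℝ => v p.1 p.2) r →
      AnalyticAt ℝ (fun p : ℝ × ℝ => w p.1 p.2) r →
      _root_.dY (fun x y => v x y - m * w x y) r.1 r.2
        = _root_.dY v r.1 r.2 - m * _root_.dY w r.1 r.2 := fun r h1 h2 =>
    ((h1.differentiableAt (x := (r.1, r.2))).hasDerivAt_dY.sub
      ((h2.differentiableAt (x := (r.1, r.2))).hasDerivAt_dY.const_mul m)).deriv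
  have hev := hv.eventually_analyticAt.and hw.eventually_analyticAt
  refine ⟨hX _ hv hw, hY _ hv hw, ?_, ?_⟩
  · have h1 := hv.dX.differentiableAt.hasDerivAt_dX.sub
      (hw.dX.differentiableAt.hasDerivAt_dX.const_mul m)
    exact (h1.congr_of_eventuallyEq (eventuallyEq_fst
      (_root_.dX fun x y => v x y - m * w x y) (fun x y => _root_.dX v x y - m * _root_.dX w x y)
      (hev.mono fun r hr => hX r hr.1 hr.2))).deriv
  · have h1 := hv.dY.differentiableAt.hasDerivAt_dY.sub
      (hw.dY.differentiableAt.hasDerivAt_dY.const_mul m)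
    exact (h1.congr_of_eventuallyEq (eventuallyEq_snd
      (_root_.dY fun x y => v x y - m * w x y) (fun x y => _root_.dY v x y - m * _root_.dY w x y)
      (hev.mono fun r hr => hY r hr.1 hr.2))).deriv

/-- The derivatives of `y w + a y² + β y`. -/
theorem AnalyticAt.derivs_stretch (hw : AnalyticAt ℝ (fun p : ℝ × ℝ => w p.1 p.2) (x, y))
    (a β : ℝ) :
    AnalyticAt ℝ (fun p : ℝ × ℝ => p.2 * w p.1 p.2 + a * p.2 ^ 2 + β * p.2) (x, y) ∧
    _root_.dX (fun x y => y * w x y + a * y ^ 2 + β * y) x y = y * _root_.dX w x y ∧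
    _root_.dY (fun x y => y * w x y + a * y ^ 2 + β * y) x y
      = w x y + y * _root_.dY w x y + 2 * a * y + β ∧
    _root_.dX (_root_.dX (fun x y => y * w x y + a * y ^ 2 + β * y)) x y
      = y * _root_.dX (_root_.dX w) x y ∧
    _root_.dY (_root_.dY (fun x y => y * w x y + a * y ^ 2 + β * y)) x y
      = 2 * _root_.dY w x y + y * _root_.dY (_root_.dY w) x y + 2 * a := by
  have hX : ∀ r : ℝ × ℝ, AnalyticAt ℝ (fun p : ℝ × ℝ => w p.1 p.2) r →
      _root_.dX (fun x y => y * w x y + a * y ^ 2 + β * y) r.1 r.2 = r.2 * _root_.dX w r.1 r.2 :=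
    fun r h =>
    ((((h.differentiableAt (x := (r.1, r.2))).hasDerivAt_dX.const_mul r.2).add_const
      (a * r.2 ^ 2)).add_const (β * r.2)).deriv
  have hY : ∀ r : ℝ × ℝ, AnalyticAt ℝ (fun p : ℝ × ℝ => w p.1 p.2) r →
      _root_.dY (fun x y => y * w x y + a * y ^ 2 + β * y) r.1 r.2
        = w r.1 r.2 + r.2 * _root_.dY w r.1 r.2 + 2 * a * r.2 + β := fun r h =>
    (((((hasDerivAt_id' r.2).mul (h.differentiableAt (x := (r.1, r.2))).hasDerivAt_dY).add
      (((hasDerivAt_pow 2 r.2).const_mul a))).add ((hasDerivAt_id' r.2).const_mul β)).congr_deriv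
      (by simp; ring)).deriv
  refine ⟨((analyticAt_snd.mul hw).add (analyticAt_const.mul (analyticAt_snd.pow 2))).add
    (analyticAt_const.mul analyticAt_snd), hX _ hw, hY _ hw, ?_, ?_⟩
  · have h1 := hw.dX.differentiableAt.hasDerivAt_dX.const_mul y
    exact (h1.congr_of_eventuallyEq (eventuallyEq_fst
      (_root_.dX fun x y => y * w x y + a * y ^ 2 + β * y) (fun x y => y * _root_.dX w x y)
      (hw.eventually_analyticAt.mono fun r hr => hX r hr))).deriv
  · have h1 := ((hw.differentiableAt.hasDerivAt_dY.add ((hasDerivAt_id' y).mul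
      hw.dY.differentiableAt.hasDerivAt_dY)).add ((hasDerivAt_id' y).const_mul (2 * a))).add_const β
    exact ((h1.congr_of_eventuallyEq (eventuallyEq_snd
      (_root_.dY fun x y => y * w x y + a * y ^ 2 + β * y)
      (fun x y => w x y + y * _root_.dY w x y + 2 * a * y + β)
      (hw.eventually_analyticAt.mono fun r hr => hY r hr))).congr_deriv (by ring)).deriv

theorem Analytic₃.eventually_snd {ψ : ℝ → ℝ → ℝ → ℝ} {t : ℝ} (h : Analytic₃ ψ t x y) :
    ∀ᶠ r : ℝ × ℝ in 𝓝 (x, y), Analytic₃ ψ t r.1 r.2 :=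
  (Continuous.prodMk_right t).continuousAt.eventually h.eventually

theorem Analytic₃.dT_second {ψ : ℝ → ℝ → ℝ → ℝ} {t : ℝ} (h : Analytic₃ ψ t x y) :
    _root_.dX (_root_.dX (_root_.dT ψ t)) x y
      = _root_.dT (fun t => _root_.dX (_root_.dX (ψ t))) t x y ∧
    _root_.dY (_root_.dY (_root_.dT ψ t)) x y
      = _root_.dT (fun t => _root_.dY (_root_.dY (ψ t))) t x y := by
  constructor
  · rw [h.dX.dT_dX]
    exact (Filter.EventuallyEq.deriv_eq (eventuallyEq_fst
      (_root_.dT (fun t => _root_.dX (ψ t)) t) (_root_.dX (_root_.dT ψ t)) (h.eventually_snd.mono fun r hr => hr.dT_dX))).symm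
  · rw [h.dY.dT_dY]
    exact (Filter.EventuallyEq.deriv_eq (eventuallyEq_snd
      (_root_.dT (fun t => _root_.dY (ψ t)) t) (_root_.dY (_root_.dT ψ t)) (h.eventually_snd.mono fun r hr => hr.dT_dY))).symm

end TwoVariables

section Variation

variable {a d κ τ T T' : ℝ} {ψ : ℝ → ℝ → ℝ → ℝ} {η s : ℝ → ℝ → ℝ} {lam : ℝ → ℝ}

/-- The derivative of the branch, corrected so that it is harmonic. -/
noncomputable def branchVariation (a β : ℝ) (ψ : ℝ → ℝ → ℝ → ℝ) (lam : ℝ → ℝ) (t x y : ℝ) : ℝ :=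
  dT ψ t x y - deriv lam t / lam t * (y * dY (ψ t) x y + a * y ^ 2 + β * y)

theorem IsStokesBranch.eventually_interior (hB : IsStokesBranch a d T ψ η lam) {t : ℝ}
    (h0 : 0 < t) (h1 : t < T) (x : ℝ) {y : ℝ} (hy : y < η t x) :
    ∀ᶠ r in 𝓝 t, 0 < r ∧ r < T ∧ y < η r x := by
  have hc := (hB.strip_eta.hasDerivAt_fst h0.le h1 (x := x)).continuousAt
  filter_upwards [Ioi_mem_nhds h0, Iio_mem_nhds h1, hc.eventually (lt_mem_nhds hy)] with r e1 e2 e3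
    using ⟨e1, e2, e3⟩

theorem IsStokesBranch.analyticAt_variation (hB : IsStokesBranch a d T ψ η lam) {t x y : ℝ}
    (β : ℝ) (h0 : 0 ≤ t) (h1 : t < T) (hy0 : 0 ≤ y) (hy1 : y ≤ η t x) :
    AnalyticAt ℝ (fun p : ℝ × ℝ => branchVariation a β ψ lam t p.1 p.2) (x, y) := by
  have h := hB.analytic₃ h0 h1 hy0 hy1
  exact h.dT.slice_xy.sub (analyticAt_const.mul (h.dY.slice_xy.derivs_stretch a β).1)

theorem IsStokesBranch.harmonicBelow_variation (hB : IsStokesBranch a d T ψ η lam) {t : ℝ}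
    (β : ℝ) (h0 : 0 < t) (h1 : t < T) :
    HarmonicBelow (2 * Real.pi / tauStar a d) (η t) (lam t) (branchVariation a β ψ lam t) := by
  have hW := hB.wave t h0.le h1
  have hbot : ∀ x, branchVariation a β ψ lam t x 0 = 0 := fun x => by
    have h2 : (fun r => ψ r x 0) =ᶠ[𝓝 t] fun _ => 0 := by
      filter_upwards [Ioi_mem_nhds h0, Iio_mem_nhds h1] with r e1 e2
        using (hB.wave r (le_of_lt e1) e2).bottom x
    have h3 : dT ψ t x 0 = 0 := by
      rw [dT, h2.deriv_eq, deriv_const]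
    rw [branchVariation, h3]
    ring
  have hper : ∀ x y, 0 < y → y < η t x →
      branchVariation a β ψ lam t (x + 2 * Real.pi / tauStar a d) y
        - branchVariation a β ψ lam t x y = 0 := fun x y e0 e1 => by
    have h2 : (fun r => ψ r (x + 2 * Real.pi / tauStar a d) y) =ᶠ[𝓝 t] fun r => ψ r x y := by
      filter_upwards [hB.eventually_interior h0 h1 x e1] with r hr
        using (hB.wave r hr.1.le hr.2.1).psi_periodic x y e0.le hr.2.2.le
    have h3 : (fun y => ψ t (x + 2 * Real.pi / tauStar a d) y) =ᶠ[𝓝 y] fun y => ψ t x y := by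
      filter_upwards [Ioo_mem_nhds e0 e1] with z hz using hW.psi_periodic x z hz.1.le hz.2.le
    have e2 : dT ψ t (x + 2 * Real.pi / tauStar a d) y = dT ψ t x y := h2.deriv_eq
    have e3 : dY (ψ t) (x + 2 * Real.pi / tauStar a d) y = dY (ψ t) x y := h3.deriv_eq
    rw [branchVariation, branchVariation, e2, e3]
    ring
  have han : ∀ x y, 0 ≤ y → y ≤ η t x →
      AnalyticAt ℝ (fun p : ℝ × ℝ => branchVariation a β ψ lam t p.1 p.2) (x, y) :=
    fun x y e0 e1 => hB.analyticAt_variation β h0.le h1 e0 e1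
  refine ⟨fun x y e0 e1 => (han x y e0 e1).contDiffAt, fun x y e0 e1 => ?_, fun x y e0 e1 => ?_,
    hbot⟩
  · rcases eq_or_lt_of_le e0 with rfl | e0
    · rw [hbot, hbot]
    · rcases eq_or_lt_of_le e1 with rfl | e1
      · have e2 : η t (x + 2 * Real.pi / tauStar a d) = η t x := hW.eta_periodic x
        refine sub_eq_zero.1 (eq_zero_of_continuousAt_left (g := fun y => branchVariation a β ψ lam t
          (x + 2 * Real.pi / tauStar a d) y - branchVariation a β ψ lam t x y) (hW.eta_pos x) ?_
          fun y q0 q1 => hper x y q0 q1)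
        exact ((han _ _ e0.le e2.ge).differentiableAt.hasDerivAt_dY.continuousAt).sub
          ((han _ _ e0.le le_rfl).differentiableAt.hasDerivAt_dY.continuousAt)
      · exact sub_eq_zero.1 (hper x y e0 e1)
  · have hA := hB.analytic₃ h0.le h1 e0.le e1.le
    obtain ⟨hs0, -, -, s3, s4⟩ := hA.dY.slice_xy.derivs_stretch a β
    obtain ⟨-, -, d3, d4⟩ := AnalyticAt.derivs_sub_const_mul (v := dT ψ t)
      (w := fun x y => y * dY (ψ t) x y + a * y ^ 2 + β * y) hA.dT.slice_xy hs0
      (deriv lam t / lam t)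
    have hlam := (hW.lam_pos).ne'
    have hpt : lam t ^ 2 * dT (fun t => dX (dX (ψ t))) t x y
        + dT (fun t => dY (dY (ψ t))) t x y = -(2 * lam t * deriv lam t * dX (dX (ψ t)) x y) := by
      have q1 := (hB.analytic_lam t h0.le h1).differentiableAt.hasDerivAt
      have q2 := DifferentiableAt.hasDerivAt_dX (v := fun t x => dX (dX (ψ t)) x y)
        hA.dX.dX.slice_tx.differentiableAt
      have q3 := DifferentiableAt.hasDerivAt_dX (v := fun t x => dY (dY (ψ t)) x y)
        hA.dY.dY.slice_tx.differentiableAt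
      have q4 := (((q1.pow 2).mul q2).add q3).add_const a
      have q5 : HasDerivAt (fun _ : ℝ => (0 : ℝ)) 0 t := hasDerivAt_const _ _
      have q6 := q4.unique (q5.congr_of_eventuallyEq (by
        filter_upwards [hB.eventually_interior h0 h1 x e1] with r hr
          using (hB.wave r hr.1.le hr.2.1).equation x y e0 hr.2.2))
      have q7 : dX (fun t x => dX (dX (ψ t)) x y) t x = dT (fun t => dX (dX (ψ t))) t x y := rfl
      have q8 : dX (fun t x => dY (dY (ψ t)) x y) t x = dT (fun t => dY (dY (ψ t))) t x y := rfl
      rw [q7, q8] at q6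
      simp only [Pi.pow_apply, Nat.cast_ofNat, Nat.add_one_sub_one, pow_one] at q6
      linear_combination q6
    have hpy : lam t ^ 2 * dX (dX (dY (ψ t))) x y + dY (dY (dY (ψ t))) x y = 0 := by
      rw [hA.slice_xy.dX_dX_dY]
      have q2 := hA.dX.dX.slice_xy.differentiableAt.hasDerivAt_dY
      have q3 := hA.dY.dY.slice_xy.differentiableAt.hasDerivAt_dY
      have q4 := ((q2.const_mul (lam t ^ 2)).add q3).add_const a
      have q5 : HasDerivAt (fun _ : ℝ => (0 : ℝ)) 0 y := hasDerivAt_const _ _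
      exact q4.unique (q5.congr_of_eventuallyEq (by
        filter_upwards [Ioo_mem_nhds e0 e1] with z hz using hW.equation x z hz.1 hz.2))
    have hp := hW.equation x y e0 e1
    have r1 : dX (dX (branchVariation a β ψ lam t)) x y = _ := d3
    have r2 : dY (dY (branchVariation a β ψ lam t)) x y = _ := d4
    rw [r1, r2, s3, s4, hA.dT_second.1, hA.dT_second.2]
    have hm : deriv lam t / lam t * lam t = deriv lam t := by field_simp
    linear_combination hpt - deriv lam t / lam t * y * hpy - 2 * (deriv lam t / lam t) * hp
      + 2 * lam t * dX (dX (ψ t)) x y * hm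

/-- The values of the corrected derivative of the branch, and of its conormal derivative, on the
surface. -/
theorem IsStokesBranch.variation_surface (hB : IsStokesBranch a d T ψ η lam) (hT' : T' ≤ T)
    (S : SurfaceRelations a d κ τ T' ψ η s lam) {t : ℝ} (β : ℝ) (h0 : 0 < t) (h1 : t < T')
    (x : ℝ) :
    branchVariation a β ψ lam t x (η t x) = -(s t x * dX η t x)
      - deriv lam t / lam t * (η t x * s t x + a * η t x ^ 2 + β * η t x) ∧
    s t x * conormal (η t) (lam t) (branchVariation a β ψ lam t) x
      - rhoHat (ψ t) (η t) (lam t) x / s t x * branchVariation a β ψ lam t x (η t x)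
      = -(deriv lam t / lam t) * (lam t ^ 2 * (s t x * dY η t x) ^ 2 - η t x + s t x ^ 2
        + 2 * a * η t x * s t x + β * s t x
        - rhoHat (ψ t) (η t) (lam t) x * (a * η t x ^ 2 + β * η t x) / s t x) := by
  have h1' := h1.trans_le hT'
  have hW := hB.wave t h0.le h1'
  have hA := hB.analytic₃ h0.le h1' (hW.eta_pos x).le le_rfl
  have hη := hB.strip_eta.hasDerivAt_fst h0.le h1' (x := x)
  have hev : ∀ᶠ r in 𝓝 t, 0 ≤ r ∧ r < T := by
    filter_upwards [Ioi_mem_nhds h0, Iio_mem_nhds h1'] with r e1 e2 using ⟨le_of_lt e1, e2⟩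
  have hlin := DifferentiableAt.hasDerivAt_comp₂ (v := fun t y => ψ t x y)
      hA.slice_ty.differentiableAt (f := fun r => r)
    (g := fun r => η r x) (hasDerivAt_id' t) hη
  have hψt : dT ψ t x (η t x) = -(s t x * dX η t x) := by
    have q := hlin.unique ((hasDerivAt_const t (1 : ℝ)).congr_of_eventuallyEq
      (hev.mono fun r hr => (hB.wave r hr.1 hr.2).surface x))
    have q1 : dX (fun t y => ψ t x y) t (η t x) = dT ψ t x (η t x) := rfl
    have q2 : dY (fun t y => ψ t x y) t (η t x) = s t x := S.dY_psi t x
    rw [q1, q2] at q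
    linarith
  have hval : branchVariation a β ψ lam t x (η t x) = -(s t x * dX η t x)
      - deriv lam t / lam t * (η t x * s t x + a * η t x ^ 2 + β * η t x) := by
    rw [branchVariation, hψt, S.dY_psi]
  refine ⟨hval, ?_⟩
  obtain ⟨hs0, s1, s2, -, -⟩ := hA.dY.slice_xy.derivs_stretch a β
  obtain ⟨d1, d2, -, -⟩ := AnalyticAt.derivs_sub_const_mul (v := dT ψ t)
      (w := fun x y => y * dY (ψ t) x y + a * y ^ 2 + β * y) hA.dT.slice_xy hs0
    (deriv lam t / lam t)
  have r1 : dX (branchVariation a β ψ lam t) x (η t x) = _ := d1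
  have r2 : dY (branchVariation a β ψ lam t) x (η t x) = _ := d2
  rw [s1] at r1
  rw [s2] at r2
  have hber : s t x * (dY (dT ψ t) x (η t x) + dY (dY (ψ t)) x (η t x) * dX η t x)
      + lam t * deriv lam t * (s t x * dY η t x) ^ 2
      - lam t ^ 2 * (s t x * dY η t x) * (dX (dT ψ t) x (η t x)
        + dY (dX (ψ t)) x (η t x) * dX η t x) + dX η t x = 0 := by
    have q1 := DifferentiableAt.hasDerivAt_comp₂ (v := fun t y => dY (ψ t) x y)
        hA.dY.slice_ty.differentiableAt (f := fun r => r)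
      (g := fun r => η r x) (hasDerivAt_id' t) hη
    have q2 := DifferentiableAt.hasDerivAt_comp₂ (v := fun t y => dX (ψ t) x y)
        hA.dX.slice_ty.differentiableAt (f := fun r => r)
      (g := fun r => η r x) (hasDerivAt_id' t) hη
    have q3 := (hB.analytic_lam t h0.le h1').differentiableAt.hasDerivAt
    have q4 := ((((q1.pow 2).add ((q3.pow 2).mul (q2.pow 2))).div_const 2).add hη)
    have q5 := q4.unique ((hasDerivAt_const t (bernoulliR a d)).congr_of_eventuallyEq
      (hev.mono fun r hr => (hB.wave r hr.1 hr.2).bernoulli x))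
    have q6 : dX (fun t y => dY (ψ t) x y) t (η t x) = dY (dT ψ t) x (η t x) := hA.dT_dY
    have q7 : dX (fun t y => dX (ψ t) x y) t (η t x) = dX (dT ψ t) x (η t x) := hA.dT_dX
    have q8 : dY (fun t y => dY (ψ t) x y) t (η t x) = dY (dY (ψ t)) x (η t x) := rfl
    have q9 : dY (fun t y => dX (ψ t) x y) t (η t x) = dY (dX (ψ t)) x (η t x) := rfl
    simp only [Pi.pow_apply, Nat.cast_ofNat, Nat.add_one_sub_one, pow_one] at q5
    rw [q6, q7, q8, q9, S.dY_psi, S.dX_psi t x h0.le h1] at q5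
    linear_combination q5
  have hsne := (S.s_pos t x h0.le h1).ne'
  have hlne := (hW.lam_pos).ne'
  have hcomm : dX (dY (ψ t)) x (η t x) = dY (dX (ψ t)) x (η t x) :=
    ContDiffAt.dX_dY_comm hA.slice_xy.contDiffAt
  have hrho : rhoHat (ψ t) (η t) (lam t) x = 1 - lam t ^ 2 * dY (dX (ψ t)) x (η t x)
      * (s t x * dY η t x) + dY (dY (ψ t)) x (η t x) * s t x := by
    rw [rhoHat, S.dX_psi t x h0.le h1, S.dY_psi]; ring
  have hηx : deriv (η t) x = dY η t x := rfl
  rw [conormal, r1, r2, hval, hcomm, S.dY_psi, hηx]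
  set ρ := rhoHat (ψ t) (η t) (lam t) x
  set m := deriv lam t / lam t with hm
  have hm' : deriv lam t = m * lam t := by rw [hm]; field_simp
  rw [hm'] at hber
  have e1 : ρ / s t x * (-(s t x * dX η t x) - m * (η t x * s t x + a * η t x ^ 2 + β * η t x))
      = -(ρ * dX η t x) - m * (ρ * η t x) - m * (ρ * (a * η t x ^ 2 + β * η t x) / s t x) := by
    field_simp
    ring
  rw [e1]
  linear_combination hber + (dX η t x + m * η t x) * hrho

end Variation

theorem StripAnalytic.unifO_zero {T : ℝ} {f : ℝ → ℝ → ℝ} (hT : 0 < T) (hf : StripAnalytic T f)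
    (L : ℝ) : UnifO L 0 f := by
  obtain ⟨C, hC⟩ := hf.bounded hT L
  refine ⟨C, (hC.filter_mono (nhdsWithin_mono _ Set.Ioi_subset_Ici_self)).mono fun t ht x hx => ?_⟩
  rw [pow_zero, mul_one]
  exact ht x hx

theorem StripAnalytic.unifO_two {T : ℝ} {f : ℝ → ℝ → ℝ} (hT : 0 < T) (hf : StripAnalytic T f)
    (h0 : ∀ x, f 0 x = 0) (L : ℝ) : UnifO L 2 (fun t x => f t x - t * dX f 0 x) := by
  obtain ⟨C, hC⟩ := hf.taylor hT L 2
  refine ⟨C, (hC.filter_mono (nhdsWithin_mono _ Set.Ioi_subset_Ici_self)).mono fun t ht x hx => ?_⟩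
  have h := ht x hx
  simp only [Finset.sum_range_succ, Finset.sum_range_zero, Nat.factorial, Function.iterate_zero,
    Function.iterate_one, id, h0] at h
  norm_num at h
  exact h

theorem UnifO.isBigO_integral_sub {L : ℝ} {n : ℕ} {f g : ℝ → ℝ → ℝ} (hL : 0 ≤ L)
    (h : UnifO L n (fun t x => f t x - g t x)) (hf : ∀ᶠ t in 𝓝[>] (0 : ℝ), Continuous (f t))
    (hg : ∀ t, Continuous (g t)) :
    (fun t => (∫ x in (0 : ℝ)..L, f t x) - ∫ x in (0 : ℝ)..L, g t x) =O[𝓝[>] 0] fun t => t ^ n := by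
  refine (h.isBigO_integral hL).congr' ?_ EventuallyEq.rfl
  filter_upwards [hf] with t ht
  exact intervalIntegral.integral_sub (ht.intervalIntegrable _ _) ((hg t).intervalIntegrable _ _)

/-- If `μ D = -m N` with `D ≈ D₀`, `N ≈ N₁ t` and `m ≈ m₁ t`, then `μ ≈ k t²`. -/
theorem isBigO_ratio {μ D N m : ℝ → ℝ} {D₀ N₁ m₁ k : ℝ}
    (h : ∀ᶠ t in 𝓝[>] (0 : ℝ), μ t * D t = -(m t * N t))
    (hD : (fun t => D t - D₀) =O[𝓝[>] 0] fun t : ℝ => t ^ 1) (hD₀ : D₀ ≠ 0)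
    (hN : (fun t => N t - t * N₁) =O[𝓝[>] 0] fun t : ℝ => t ^ 2)
    (hm : (fun t => m t - t * m₁) =O[𝓝[>] 0] fun t : ℝ => t ^ 2) (hk : k * D₀ = -(m₁ * N₁)) :
    (fun t => μ t - k * t ^ 2) =O[𝓝[>] 0] fun t : ℝ => t ^ 3 := by
  have ht : Tendsto (fun t : ℝ => t) (𝓝[>] 0) (𝓝 0) := tendsto_id.mono_left nhdsWithin_le_nhds
  have hDt : Tendsto D (𝓝[>] 0) (𝓝 D₀) := by
    have h1 := (hD.trans_tendsto (by simpa using ht)).add_const D₀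
    simpa using h1
  have hinv : (fun t => (D t)⁻¹) =O[𝓝[>] 0] fun _ => (1 : ℝ) :=
    (hDt.inv₀ hD₀).isBigO_one ℝ
  have h1 := hm.mul (isBigO_one_of_continuous (g := fun t : ℝ => t * N₁) (by fun_prop))
  have hm' := hm.mul hN
  have e1 : (fun t : ℝ => (m t - t * m₁) * (t * N₁)) =O[𝓝[>] 0] fun t : ℝ => t ^ 3 := by
    have h2 := hm.mul (IsBigO.const_mul_left (isBigO_refl (fun t : ℝ => t) (𝓝[>] 0)) N₁)
    exact h2.congr (fun t => by ring) fun t => by ring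
  have e2 : (fun t : ℝ => (m t - t * m₁) * (N t - t * N₁)) =O[𝓝[>] 0] fun t : ℝ => t ^ 3 :=
    (hm'.congr_right fun t => by ring).trans (isBigO_pow_of_le (m := 3) (n := 4) (by norm_num))
  have e3 : (fun t : ℝ => t * (N t - t * N₁)) =O[𝓝[>] 0] fun t : ℝ => t ^ 3 :=
    ((isBigO_refl (fun t : ℝ => t) (𝓝[>] 0)).mul hN).congr_right fun t => by ring
  have e4 : (fun t : ℝ => t ^ 2 * (D t - D₀)) =O[𝓝[>] 0] fun t : ℝ => t ^ 3 :=
    ((isBigO_refl (fun t : ℝ => t ^ 2) (𝓝[>] 0)).mul hD).congr_right fun t => by ring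
  have e5 := ((((e1.add e2).add (e3.const_mul_left m₁)).add (e4.const_mul_left k)).neg_left).mul
    hinv
  simp only [mul_one] at e5
  refine e5.congr' ?_ EventuallyEq.rfl
  filter_upwards [h, hDt.eventually_ne hD₀] with t h2 h3
  rw [mul_inv_eq_iff_eq_mul₀ h3]
  linear_combination -h2 + t ^ 2 * hk

namespace SurfaceRelations

variable {a d κ τ T : ℝ} {ψ : ℝ → ℝ → ℝ → ℝ} {η s : ℝ → ℝ → ℝ} {lam : ℝ → ℝ}

theorem mu_strip (S : SurfaceRelations a d κ τ T ψ η s lam) :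
    ∀ t, 0 ≤ t → t < T → AnalyticAt ℝ (fun t => deriv lam t / lam t) t := fun t h0 h1 =>
  (S.lam_analytic t h0 h1).deriv.div (S.lam_analytic t h0 h1) (S.lam_pos t h0 h1).ne'

/-- The expansion of the logarithmic derivative of the wave number. -/
theorem log_deriv_lam (S : SurfaceRelations a d κ τ T ψ η s lam) {l l₃ : ℝ}
    (hl : HasJet lam 1 0 l l₃) :
    (fun t => deriv lam t / lam t - t * (2 * l)) =O[𝓝[>] 0] fun t : ℝ => t ^ 2 := by
  have h1 := hl.unique (S.lam_strip.hasJet S.T_pos 0)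
  have h2 : deriv (deriv lam) 0 = 2 * l := by
    have : (dX^[2] fun t _ => lam t) 0 0 = deriv (deriv lam) 0 := rfl
    linarith [h1.2.2.1]
  have hA := S.lam_analytic 0 le_rfl S.T_pos
  have h3 : deriv (fun t => deriv lam t / lam t) 0 = 2 * l := by
    have h4 : deriv (fun t => deriv lam t / lam t) 0 = _ := (hA.deriv.differentiableAt.hasDerivAt.div hA.differentiableAt.hasDerivAt
      (by rw [S.lam_zero]; exact one_ne_zero)).deriv
    rw [S.lam_deriv, S.lam_zero, h2] at h4
    simpa using h4
  have h5 := isBigO_taylor S.T_pos S.mu_strip 2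
  refine h5.congr_left fun t => ?_
  have h6 : (dX^[1] fun t _ => deriv lam t / lam t) 0 0 = 2 * l := h3
  simp only [Finset.sum_range_succ, Finset.sum_range_zero, Nat.factorial, Function.iterate_zero, id,
    h6, S.lam_zero, S.lam_deriv]
  norm_num

/-- The value on the surface of the corrected derivative of the branch, divided by `s²`. -/
noncomputable def variationTrace (a β : ℝ) (η s : ℝ → ℝ → ℝ) (lam : ℝ → ℝ) (t x : ℝ) : ℝ :=
  (-(s t x * dX η t x)
    - deriv lam t / lam t * (η t x * s t x + a * η t x ^ 2 + β * η t x)) / s t x ^ 2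

/-- The defect of the corrected derivative of the branch in the linearized surface condition. -/
noncomputable def variationDefect (a β : ℝ) (η s : ℝ → ℝ → ℝ) (lam : ℝ → ℝ) (t x : ℝ) : ℝ :=
  (s t x * (lam t ^ 2 * (s t x * dY η t x) ^ 2 - η t x + s t x ^ 2 + 2 * a * η t x * s t x
      + β * s t x)
    - (1 + s t x * (lam t ^ 2 * (dY s t x * dY η t x + s t x * dY (dY η) t x) - a))
      * (a * η t x ^ 2 + β * η t x)) / s t x ^ 2

theorem strip_trace (S : SurfaceRelations a d κ τ T ψ η s lam) (β : ℝ) :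
    StripAnalytic T (variationTrace a β η s lam) := by
  have hm : StripAnalytic T fun t _ => deriv lam t / lam t := .of_fst S.mu_strip
  have hη := S.eta_analytic
  have hs := S.s_analytic
  exact (((hs.mul hη.diff_fst).neg).sub (hm.mul (((hη.mul hs).add
    ((StripAnalytic.const a).mul (hη.pow 2))).add ((StripAnalytic.const β).mul hη)))).div
    (hs.pow 2) fun t x h0 h1 => pow_ne_zero 2 (S.s_pos t x h0 h1).ne'

theorem strip_defect (S : SurfaceRelations a d κ τ T ψ η s lam) (β : ℝ) :
    StripAnalytic T (variationDefect a β η s lam) := by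
  have hη := S.eta_analytic
  have hs := S.s_analytic
  refine ((hs.mul ((((((S.lam_strip.pow 2).mul ((hs.mul hη.diff_snd).pow 2)).sub hη).add
    (hs.pow 2)).add ((((StripAnalytic.const (2 * a)).mul hη)).mul hs)).add
    ((StripAnalytic.const β).mul hs))).sub (S.rho_strip.mul
      (((StripAnalytic.const a).mul (hη.pow 2)).add ((StripAnalytic.const β).mul hη)))).div
    (hs.pow 2) fun t x h0 h1 => pow_ne_zero 2 (S.s_pos t x h0 h1).ne'

theorem trace_zero (S : SurfaceRelations a d κ τ T ψ η s lam) (β x : ℝ) :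
    variationTrace a β η s lam 0 x = -(1 / κ) * Real.cos (τ * x) := by
  have hκ := S.kappa_pos.ne'
  rw [variationTrace, S.s_zero, S.eta_deriv, S.lam_deriv]
  field_simp
  ring

theorem defect_zero (S : SurfaceRelations a d κ τ T ψ η s lam) {β : ℝ}
    (hβ : β * (κ ^ 2 - (1 - a * κ) * d) = (1 - a * κ) * (a * d ^ 2)
      - κ * (κ ^ 2 - d + 2 * a * d * κ)) (x : ℝ) :
    variationDefect a β η s lam 0 x = 0 := by
  rw [variationDefect, S.s_zero, S.eta_zero, S.dEta_zero, S.ddEta_zero, div_eq_zero_iff]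
  left
  linear_combination hβ

theorem defect_deriv (S : SurfaceRelations a d κ τ T ψ η s lam) {β : ℝ}
    (hβ : β * (κ ^ 2 - (1 - a * κ) * d) = (1 - a * κ) * (a * d ^ 2)
      - κ * (κ ^ 2 - d + 2 * a * d * κ)) {b : ℝ}
    (hb : b * κ ^ 2 = -(1 / κ) * (-d + κ ^ 2 + 2 * a * d * κ + β * κ)
      + κ * (-1 - 2 + 2 * a * (κ - d / κ) - β / κ) - (a / κ - κ ^ 2 * τ ^ 2) * (a * d ^ 2 + β * d)
      - (1 - a * κ) * (2 * a * d + β)) (x : ℝ) :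
    dX (variationDefect a β η s lam) 0 x = b * Real.cos (τ * x) := by
  have hκ := S.kappa_pos
  have hT := S.T_pos
  have jη := S.eta_analytic.hasJet hT x
  have jη1 := S.eta_analytic.diff_snd.hasJet hT x
  have jη2 := S.eta_analytic.diff_snd.diff_snd.hasJet hT x
  have js := S.s_analytic.hasJet hT x
  have js1 := S.s_analytic.diff_snd.hasJet hT x
  have jl := S.lam_strip.hasJet hT x
  have jQ := (S.strip_defect β).hasJet hT x
  have e2 : dX (dY (dY η)) 0 x = -(τ ^ 2 * Real.cos (τ * x)) := by
    rw [ContDiffAt.dX_dY_comm (S.eta_analytic.diff_snd 0 x le_rfl hT).contDiffAt]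
    have h : HasDerivAt (fun x => -(τ * Real.sin (τ * x))) (-(τ ^ 2 * Real.cos (τ * x))) x :=
      ((((hasDerivAt_id' x).const_mul τ).sin).const_mul τ).neg.congr_deriv (by ring)
    rw [dY, funext fun x => S.dEta_jet x]
    exact h.deriv
  have el : dX (fun t _ => lam t) 0 x = 0 := S.lam_deriv
  rw [S.eta_zero, S.eta_deriv] at jη
  rw [S.dEta_zero, S.dEta_jet] at jη1
  rw [S.ddEta_zero, e2] at jη2
  rw [S.s_zero] at js
  rw [S.ds_zero] at js1
  rw [S.lam_zero, el] at jl
  rw [S.defect_zero hβ] at jQ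
  set c := Real.cos (τ * x)
  have hev := (eventually_lt_of_pos hT).filter_mono
    (nhdsWithin_mono (0 : ℝ) Set.Ioi_subset_Ici_self)
  have hs1 : dX s 0 x = -(c / κ) := by
    have h1 := ((js.mul js).mul ((HasJet.const 1).add ((jl.mul jl).mul (jη1.mul jη1)))).unique
      (((HasJet.const (κ ^ 2)).sub ((jη.sub (HasJet.const d)).const_mul 2)).congr' (by
        filter_upwards [hev] with t ht
        rw [← S.bernoulli t x ht.1 ht.2]; ring))
    have h2 : 2 * κ * dX s 0 x = -(2 * c) := by linear_combination h1.2.1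
    have h3 : dX s 0 x = 2 * κ * dX s 0 x / (2 * κ) := by field_simp
    rw [h3, h2]
    field_simp
  rw [hs1] at js
  have hρ := (HasJet.const 1).add (js.mul (((jl.mul jl).mul ((js1.mul jη1).add
    (js.mul jη2))).sub (HasJet.const a)))
  have hR := (js.mul ((((((jl.mul jl).mul ((js.mul jη1).mul (js.mul jη1))).sub jη).add
    (js.mul js)).add ((jη.const_mul (2 * a)).mul js)).add (js.const_mul β))).sub (hρ.mul
      (((jη.mul jη).const_mul a).add (jη.const_mul β)))
  have hu := ((jQ.mul (js.mul js)).unique (hR.congr' (by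
    filter_upwards [hev] with t ht
    have := (S.s_pos t x ht.1 ht.2).ne'
    rw [variationDefect]
    field_simp))).2.1
  have hfin : κ ^ 2 * (dX (variationDefect a β η s lam) 0 x - b * c) = 0 := by
    have h1 : dX (variationDefect a β η s lam) 0 x * κ ^ 2
      = c * (-(1 / κ) * (-d + κ ^ 2 + 2 * a * d * κ + β * κ)
      + κ * (-1 - 2 + 2 * a * (κ - d / κ) - β / κ) - (a / κ - κ ^ 2 * τ ^ 2) * (a * d ^ 2 + β * d)
      - (1 - a * κ) * (2 * a * d + β)) := by
      have e1 : κ * (1 / κ) = 1 := by field_simp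
      linear_combination hu - 2 * κ * c * e1
    linear_combination h1 - c * hb
  exact sub_eq_zero.1 ((mul_eq_zero.1 hfin).resolve_left (by positivity))

end SurfaceRelations

section SecondEigenvalue

variable {a d T T' : ℝ} {ψ : ℝ → ℝ → ℝ → ℝ} {η s : ℝ → ℝ → ℝ} {lam : ℝ → ℝ}

open SurfaceRelations in
/-- The identity of Green for an eigenfunction and the corrected derivative of the branch. -/
theorem IsStokesBranch.eigenvalue_identity (hB : IsStokesBranch a d T ψ η lam) (hT' : T' ≤ T)
    (S : SurfaceRelations a d (kappa a d) (tauStar a d) T' ψ η s lam) {t : ℝ} (β : ℝ)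
    (h0 : 0 < t) (h1 : t < T') {μ : ℝ} {v : ℝ → ℝ → ℝ}
    (hv : SolvesSpectralProblem (2 * Real.pi / tauStar a d) (ψ t) (η t) (lam t) μ v) :
    μ * ∫ x in (0 : ℝ)..2 * Real.pi / tauStar a d,
        v x (η t x) * variationTrace a β η s lam t x
      = -(deriv lam t / lam t * ∫ x in (0 : ℝ)..2 * Real.pi / tauStar a d,
        v x (η t x) * variationDefect a β η s lam t x) := by
  have hP := S.surfaceProfile h0.le h1
  have hV := hB.harmonicBelow_variation β h0 (h1.trans_le hT')
  have hH := hv.harmonicBelow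
  have hvc : Continuous fun x => v x (η t x) := hP.continuous_trace hH.continuousAt
  have hG := (S.strip_trace β).continuous h0.le h1
  have hQ := (S.strip_defect β).continuous h0.le h1
  have hρc := S.rho_strip.continuous h0.le h1
  have hg := integral_conormal_comm hP hH hV
  set m := deriv lam t / lam t
  set ρ : ℝ → ℝ := fun x => 1 + s t x * (lam t ^ 2 * (dY s t x * dY η t x
    + s t x * dY (dY η) t x) - a) with hρ
  set L := 2 * Real.pi / tauStar a d
  have e1 : ∀ x, conormal (η t) (lam t) v x * branchVariation a β ψ lam t x (η t x)
      = ρ x * (v x (η t x) * variationTrace a β η s lam t x)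
        + μ * (v x (η t x) * variationTrace a β η s lam t x) := fun x => by
    have hs := (S.s_pos t x h0.le h1).ne'
    rw [hv.conormal_eq (fun x => by rw [S.dY_psi]; exact (S.s_pos t x h0.le h1).ne')
      (fun x => by rw [S.dY_psi]; exact S.dX_psi t x h0.le h1), S.rho t x h0.le h1, S.dY_psi,
      (hB.variation_surface hT' S β h0 h1 x).1, variationTrace]
    simp only [hρ]
    field_simp
  have e2 : ∀ x, conormal (η t) (lam t) (branchVariation a β ψ lam t) x * v x (η t x)
      = ρ x * (v x (η t x) * variationTrace a β η s lam t x)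
        - m * (v x (η t x) * variationDefect a β η s lam t x) := fun x => by
    have hs := (S.s_pos t x h0.le h1).ne'
    obtain ⟨r1, r2⟩ := hB.variation_surface hT' S β h0 h1 x
    rw [S.rho t x h0.le h1] at r2
    change _ = -m * _ at r2
    have r3 : variationTrace a β η s lam t x * s t x ^ 2
        = branchVariation a β ψ lam t x (η t x) := by
      rw [r1, variationTrace]; field_simp
    have r4 : variationDefect a β η s lam t x * s t x = lam t ^ 2 * (s t x * dY η t x) ^ 2 - η t x
        + s t x ^ 2 + 2 * a * η t x * s t x + β * s t x
        - ρ x * (a * η t x ^ 2 + β * η t x) / s t x := by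
      rw [variationDefect]; simp only [hρ]; field_simp
    change s t x * _ - ρ x / s t x * _ = -m * (_ - ρ x * _ / s t x) at r2
    rw [← r4, ← r3] at r2
    have r5 : ρ x / s t x * (variationTrace a β η s lam t x * s t x ^ 2)
        = s t x * (ρ x * variationTrace a β η s lam t x) := by field_simp
    rw [r5] at r2
    have r6 : s t x * (conormal (η t) (lam t) (branchVariation a β ψ lam t) x
        - (ρ x * variationTrace a β η s lam t x - m * variationDefect a β η s lam t x)) = 0 := by
      linear_combination r2
    have r7 := (mul_eq_zero.1 r6).resolve_left hs
    linear_combination v x (η t x) * r7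
  simp only [e1, e2] at hg
  have i1 : IntervalIntegrable (fun x => ρ x * (v x (η t x) * variationTrace a β η s lam t x))
      MeasureTheory.volume 0 L := (hρc.mul (hvc.mul hG)).intervalIntegrable _ _
  have i2 : IntervalIntegrable (fun x => μ * (v x (η t x) * variationTrace a β η s lam t x))
      MeasureTheory.volume 0 L := (continuous_const.mul (hvc.mul hG)).intervalIntegrable _ _
  have i3 : IntervalIntegrable (fun x => m * (v x (η t x) * variationDefect a β η s lam t x))
      MeasureTheory.volume 0 L := (continuous_const.mul (hvc.mul hQ)).intervalIntegrable _ _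
  rw [intervalIntegral.integral_add i1 i2, intervalIntegral.integral_sub i1 i3,
    intervalIntegral.integral_const_mul, intervalIntegral.integral_const_mul] at hg
  linarith

/-- The second eigenvalue of the waves on a Stokes branch. -/
theorem IsStokesBranch.exists_second_eigenvalue (hB : IsStokesBranch a d T ψ η lam) (hd : 0 < d)
    (hκ : 0 < kappa a d) (hτ : 0 < tauStar a d) (hσ : sigmaFn a d (tauStar a d) = 0) :
    ∃ μ : ℝ → ℝ, (∀ᶠ t in 𝓝[>] (0 : ℝ),
        IsKthEigenvalue 2 (2 * Real.pi / tauStar a d) (ψ t) (η t) (lam t) (μ t)) ∧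
      (fun t => μ t - mu2 a d * t ^ 2) =O[𝓝[>] (0 : ℝ)] fun t => t ^ 3 := by
  obtain ⟨T', hT0, hT', S⟩ := hB.exists_surfaceRelations hd hκ hτ
  obtain ⟨l₃, hl⟩ := hB.exists_lam_jet hT' S hσ
  set s : ℝ → ℝ → ℝ := fun t x => dY (ψ t) x (η t x)
  set κ := kappa a d with hκdef
  set τ := tauStar a d with hτdef
  set g := gammaD d τ with hgdef
  have hg : κ ^ 2 * g = 1 - a * κ := by
    rw [sigmaFn] at hσ; linarith
  have hxg : d * g = xCoth (τ * d) := mul_gammaD hτ.ne'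
  have hdis : κ ^ 2 * xCoth (τ * d) = d * (1 - a * κ) := by rw [← hxg, ← hg]; ring
  obtain ⟨C, hC⟩ := S.exists_second_eigenvalue hdis
  obtain ⟨F, hF⟩ := (show ∀ᶠ t in 𝓝[>] (0 : ℝ), ∃ p : ℝ × (ℝ → ℝ → ℝ),
      IsKthEigenvalue 2 (2 * Real.pi / τ) (ψ t) (η t) (lam t) p.1 ∧
      SolvesSpectralProblem (2 * Real.pi / τ) (ψ t) (η t) (lam t) p.1 p.2 ∧ |p.1| ≤ C * t ∧
      ∀ x, |p.2 x (η t x) - Real.cos (τ * x)| ≤ C * t from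
    hC.mono fun t ⟨μ, v, h⟩ => ⟨(μ, v), h⟩).choice
  set β := -κ - a * d with hβdef
  have hβ : β * (κ ^ 2 - (1 - a * κ) * d) = (1 - a * κ) * (a * d ^ 2)
      - κ * (κ ^ 2 - d + 2 * a * d * κ) := by rw [hβdef]; ring
  set b := -(κ * (τ ^ 2 * d + g - d * g ^ 2)) with hbdef
  have hb : b * κ ^ 2 = -(1 / κ) * (-d + κ ^ 2 + 2 * a * d * κ + β * κ)
      + κ * (-1 - 2 + 2 * a * (κ - d / κ) - β / κ) - (a / κ - κ ^ 2 * τ ^ 2) * (a * d ^ 2 + β * d)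
      - (1 - a * κ) * (2 * a * d + β) := by
    have e1 : g = (1 - a * κ) / κ ^ 2 := by rw [← hg]; field_simp
    rw [hbdef, hβdef, e1]
    field_simp
    ring
  have hmu2 : mu2 a d = 2 * lambda2 a d * κ * b := by
    rw [mu2, ← hκdef, ← hτdef, ← hg, hbdef]
    have e1 : τ * (Real.cosh (τ * d) / Real.sinh (τ * d)) = g := (gammaD_eq d hτ.ne').symm
    have e2 : κ ^ 2 * g * d / κ ^ 2 = g * d := by field_simp
    rw [e2]
    linear_combination (-2 * κ ^ 2 * lambda2 a d * (1 - g * d)) * e1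
  set L := 2 * Real.pi / τ with hL
  have hL0 : 0 < L := period_pos hτ
  have hQ0 := S.defect_zero hβ
  have hQ1 := S.defect_deriv hβ hb
  have hvU : UnifO L 1 (fun t x => (F t).2 x (η t x) - Real.cos (τ * x)) :=
    ⟨C, hF.mono fun t ht x _ => by rw [pow_one]; exact ht.2.2.2 x⟩
  have hcU : UnifO L 0 (fun _ x => Real.cos (τ * x)) := unifO_of_continuous (by fun_prop) L
  have hcos : ∫ x in (0 : ℝ)..L, Real.cos (τ * x) ^ 2 = L / 2 := by
    have h := integral_trig_form hτ (e := fun _ => 0) continuous_const (1 / 2) (1 / 2) 0 0 0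
    simp only [zero_mul, add_zero] at h
    rw [intervalIntegral.integral_congr (g := fun x => 1 / 2 + 1 / 2 * Real.cos (2 * (τ * x)))
      fun x _ => by simp only [Real.cos_sq]; ring, h, ← hL]
    ring
  have hev : ∀ᶠ t in 𝓝[>] (0 : ℝ), 0 < t ∧ t < T' := by
    filter_upwards [self_mem_nhdsWithin, mem_nhdsWithin_of_mem_nhds (Iio_mem_nhds hT0)]
      with t e1 e2 using ⟨e1, e2⟩
  have hvc : ∀ᶠ t in 𝓝[>] (0 : ℝ), Continuous fun x => (F t).2 x (η t x) := by
    filter_upwards [hF, hev] with t ht h1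
    exact (S.surfaceProfile h1.1.le h1.2).continuous_trace ht.2.1.harmonicBelow.continuousAt
  refine ⟨fun t => (F t).1, hF.mono fun t ht => ht.1, ?_⟩
  rw [hmu2]
  refine isBigO_ratio (μ := fun t => (F t).1) (m := fun t => deriv lam t / lam t)
    (D := fun t => ∫ x in (0 : ℝ)..L,
      (F t).2 x (η t x) * SurfaceRelations.variationTrace a β η s lam t x)
    (N := fun t => ∫ x in (0 : ℝ)..L,
      (F t).2 x (η t x) * SurfaceRelations.variationDefect a β η s lam t x)
    (D₀ := -(1 / κ) * (L / 2)) (N₁ := b * (L / 2)) (m₁ := 2 * lambda2 a d) ?_ ?_ ?_ ?_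
    (S.log_deriv_lam hl) ?_
  · filter_upwards [hF, hev] with t ht h1
    exact hB.eigenvalue_identity hT' S β h1.1 h1.2 ht.2.1
  · have h1 : UnifO L 1 (fun t x => (F t).2 x (η t x) *
        SurfaceRelations.variationTrace a β η s lam t x - -(1 / κ) * Real.cos (τ * x) ^ 2) :=
      ((hvU.mul ((S.strip_trace β).unifO_zero hT0 L)).add
        (by simpa only [zero_add] using hcU.mul ((S.strip_trace β).unifO_one hT0 L))).congr
        fun t x => by rw [S.trace_zero]; ring
    have h2 := h1.isBigO_integral_sub hL0.le (by
      filter_upwards [hvc, hev] with t e1 e2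
      exact e1.mul ((S.strip_trace β).continuous e2.1.le e2.2)) fun t => by fun_prop
    refine h2.congr_left fun t => ?_
    rw [intervalIntegral.integral_const_mul, hcos]
  · have := hκ.ne'
    have := hL0.ne'
    exact mul_ne_zero (neg_ne_zero.2 (by positivity)) (by positivity)
  · have h3 := (S.strip_defect β).unifO_two hT0 hQ0 L
    have h4 : UnifO L 1 (SurfaceRelations.variationDefect a β η s lam) :=
      ((S.strip_defect β).unifO_one hT0 L).congr fun t x => by rw [hQ0, sub_zero]
    have h1 : UnifO L 2 (fun t x => (F t).2 x (η t x) *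
        SurfaceRelations.variationDefect a β η s lam t x - t * b * Real.cos (τ * x) ^ 2) :=
      ((hvU.mul h4).add (by simpa only [zero_add] using hcU.mul h3)).congr
        fun t x => by rw [hQ1]; ring
    have h2 := h1.isBigO_integral_sub hL0.le (by
      filter_upwards [hvc, hev] with t e1 e2
      exact e1.mul ((S.strip_defect β).continuous e2.1.le e2.2)) fun t => by fun_prop
    refine h2.congr_left fun t => ?_
    rw [intervalIntegral.integral_const_mul, hcos]
    ring
  · field_simp

end SecondEigenvalue

/-! ### The flows on the curve `a = -4 / d ^ 2` -/

section Curve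

theorem xCoth_pos_deriv {x : ℝ} (hx : 0 < x) :
    0 < (Real.cosh x * Real.sinh x - x) / Real.sinh x ^ 2 := by
  have h := Real.self_lt_sinh_iff.2 hx
  have h1 := Real.one_le_cosh x
  have : 0 < Real.sinh x := hx.trans h
  apply div_pos _ (by positivity)
  nlinarith

/-- `x coth x` takes every value `r > 1`, exactly once. -/
theorem exists_xCoth_eq {r : ℝ} (hr : 1 < r) : ∃ q, 0 < q ∧ xCoth q = r := by
  have hc : ContinuousOn xCoth (Set.Ioi 0) := fun x hx =>
    (hasDerivAt_xCoth hx).continuousAt.continuousWithinAt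
  obtain ⟨x, hx, hxr⟩ : ∃ x, 0 < x ∧ Real.cosh x < r := by
    have h : ∀ᶠ x in 𝓝[>] (0 : ℝ), Real.cosh x < r := by
      have : Tendsto Real.cosh (𝓝[>] (0 : ℝ)) (𝓝 (Real.cosh 0)) :=
        Real.continuous_cosh.continuousAt.tendsto.mono_left nhdsWithin_le_nhds
      exact this.eventually_lt_const (by simpa using hr)
    obtain ⟨x, hx, hx0⟩ := (h.and self_mem_nhdsWithin).exists
    exact ⟨x, hx0, hx⟩
  have h1 : xCoth x < r := by
    have hs := Real.self_lt_sinh_iff.2 hx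
    refine lt_of_le_of_lt ?_ hxr
    rw [xCoth, ← mul_div_assoc, div_le_iff₀ (hx.trans hs)]
    nlinarith [Real.cosh_pos x]
  have h2 : r < xCoth (max x r) := (le_max_right x r).trans_lt
    (lt_xCoth (hx.trans_le (le_max_left x r)))
  obtain ⟨q, hq, hqr⟩ := intermediate_value_Icc (le_max_left x r)
    (hc.mono fun y hy => hx.trans_le hy.1) ⟨h1.le, h2.le⟩
  exact ⟨q, hx.trans_le hq.1, hqr⟩

variable {d : ℝ}

theorem kappa_curve (hd : 0 < d) : kappa (-4 / d ^ 2) d = 3 / d := by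
  rw [kappa]
  field_simp
  ring

theorem sigmaFn_curve (hd : 0 < d) {τ : ℝ} (hτ : 0 < τ) :
    sigmaFn (-4 / d ^ 2) d τ = (9 * xCoth (τ * d) - 12 - d ^ 3) / d ^ 3 := by
  rw [sigmaFn, kappa_curve hd, ← mul_gammaD hτ.ne']
  field_simp
  ring

theorem sigmaFn_curve_eq_zero_iff (hd : 0 < d) {τ : ℝ} (hτ : 0 < τ) :
    sigmaFn (-4 / d ^ 2) d τ = 0 ↔ xCoth (τ * d) = (12 + d ^ 3) / 9 := by
  rw [sigmaFn_curve hd hτ, div_eq_zero_iff, or_iff_left (by positivity)]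
  constructor <;> intro h <;> linarith

theorem tauStar_curve (hd : 0 < d) : 0 < tauStar (-4 / d ^ 2) d ∧
    sigmaFn (-4 / d ^ 2) d (tauStar (-4 / d ^ 2) d) = 0 ∧
    ∀ s, 0 < s → sigmaFn (-4 / d ^ 2) d s = 0 → s = tauStar (-4 / d ^ 2) d := by
  have hd3 : 0 < d ^ 3 := by positivity
  obtain ⟨q, hq, hqr⟩ := exists_xCoth_eq (r := (12 + d ^ 3) / 9) (by linarith)
  have hS : {τ | 0 < τ ∧ sigmaFn (-4 / d ^ 2) d τ = 0} = {q / d} := by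
    ext τ
    constructor
    · rintro ⟨hτ, h⟩
      rw [sigmaFn_curve_eq_zero_iff hd hτ, ← hqr] at h
      have := strictMonoOn_xCoth.injOn (Set.mem_Ioi.2 (mul_pos hτ hd)) (Set.mem_Ioi.2 hq) h
      rw [Set.mem_singleton_iff, eq_div_iff hd.ne', this]
    · rintro rfl
      have h0 : 0 < q / d := by positivity
      exact ⟨h0, (sigmaFn_curve_eq_zero_iff hd h0).2 (by rw [div_mul_cancel₀ _ hd.ne', hqr])⟩
  have ht : tauStar (-4 / d ^ 2) d = q / d := by rw [tauStar, hS, csInf_singleton]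
  have hm : q / d ∈ {τ | 0 < τ ∧ sigmaFn (-4 / d ^ 2) d τ = 0} := by rw [hS]; rfl
  rw [ht]
  refine ⟨hm.1, hm.2, fun s hs h => ?_⟩
  have : s ∈ {τ | 0 < τ ∧ sigmaFn (-4 / d ^ 2) d τ = 0} := ⟨hs, h⟩
  rwa [hS] at this

theorem mem_upsilonMinus_curve (hd : 0 < d) : (-4 / d ^ 2, d) ∈ UpsilonMinus := by
  have h : -4 / d ^ 2 < 0 := div_neg_of_neg_of_pos (by norm_num) (by positivity)
  refine ⟨h, ?_⟩
  show stagnationDepth (-4 / d ^ 2) < d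
  rw [stagnationDepth, abs_of_neg h, Real.sqrt_lt' hd, neg_div, neg_neg, div_div_eq_mul_div,
    div_lt_iff₀ (by norm_num)]
  nlinarith [pow_pos hd 2]

theorem hasBottomCounterCurrent_curve (hd : 0 < d) :
    HasBottomCounterCurrent (-4 / d ^ 2) d := by
  have e : ∀ y, deriv (laminarU (-4 / d ^ 2) d) y = (4 * y - d) / d ^ 2 := fun y => by
    rw [(deriv_laminarU (-4 / d ^ 2) d y).deriv]
    field_simp
    ring
  refine ⟨d / 4, by positivity, by linarith, ?_, fun y _ hy => ?_, fun y hy _ => ?_⟩ <;> rw [e]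
  · ring
  · exact div_neg_of_neg_of_pos (by linarith) (by positivity)
  · exact div_pos (by linarith) (by positivity)

theorem exists_isCriticalDepth_curve (hd : 0 < d) :
    ∃ dc, IsCriticalDepth (-4 / d ^ 2) dc ∧ dc < d := by
  have hc : ContinuousOn (fun x : ℝ => 4 * x ^ 4 / d ^ 4 + x ^ 3 - 1) (Set.Icc 0 d) := by
    fun_prop
  obtain ⟨z, ⟨hz0, hzd⟩, hz⟩ := intermediate_value_Ioo hd.le hc (show (0 : ℝ) ∈ Set.Ioo _ _ by
    constructor
    · norm_num
    · show 0 < 4 * d ^ 4 / d ^ 4 + d ^ 3 - 1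
      rw [mul_div_cancel_right₀ _ (by positivity)]
      linarith [pow_pos hd 3])
  refine ⟨z, ⟨hz0, fun x hx => ?_⟩, hzd⟩
  have e : ∀ x, 0 < x → bernoulliR (-4 / d ^ 2) x
      = 1 / (2 * x ^ 2) + 2 / d ^ 2 + 2 * x ^ 2 / d ^ 4 + x := fun x hx => by
    rw [bernoulliR]
    field_simp
    ring
  have h4 : 1 / d ^ 4 = (1 - z ^ 3) / (4 * z ^ 4) := by
    have hz' : 4 * z ^ 4 / d ^ 4 + z ^ 3 - 1 = 0 := hz
    field_simp at hz' ⊢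
    linarith
  have h1 : z ^ 3 ≤ 1 := by
    by_contra! h
    have : 0 < 1 / d ^ 4 := by positivity
    rw [h4] at this
    exact absurd this (not_lt.2 (div_nonpos_of_nonpos_of_nonneg (by linarith) (by positivity)))
  rw [e z hz0, e x hx, ← sub_nonneg]
  have : 1 / (2 * x ^ 2) + 2 / d ^ 2 + 2 * x ^ 2 / d ^ 4 + x
      - (1 / (2 * z ^ 2) + 2 / d ^ 2 + 2 * z ^ 2 / d ^ 4 + z)
      = (x - z) ^ 2 * (z + 2 * x) / (2 * x ^ 2 * z ^ 3)
        + 2 * (1 / d ^ 4) * (x - z) ^ 2 := by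
    have e2 : ∀ x : ℝ, 2 * x ^ 2 / d ^ 4 = 2 * x ^ 2 * (1 / d ^ 4) := fun x => by ring
    rw [e2, e2, h4]
    field_simp
    ring
  rw [this]
  positivity

end Curve

/-! ### The constants `n₋` and `M` -/

section Constants

theorem xCoth_eq_iff_tanh {x : ℝ} (hx : 0 < x) : xCoth x = 4 / 3 ↔ x = 4 / 3 * Real.tanh x := by
  have hs := Real.sinh_pos_iff.2 hx
  have hc := Real.cosh_pos x
  rw [xCoth, Real.tanh_eq_sinh_div_cosh, ← mul_div_assoc, div_eq_iff hs.ne', ← mul_div_assoc,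
    eq_div_iff hc.ne']

theorem xCoth_sub_eq {x : ℝ} (hx : 0 < x) : xCoth x - 4 / 3 =
    (4 + 3 * x - Real.exp (2 * x) * (4 - 3 * x)) / (6 * Real.exp x * Real.sinh x) := by
  have hs := Real.sinh_pos_iff.2 hx
  have h1 : Real.exp x * Real.exp (-x) = 1 := by rw [← Real.exp_add, add_neg_cancel, Real.exp_zero]
  rw [xCoth, two_mul, Real.exp_add, eq_div_iff (by positivity)]
  have e : (x * (Real.cosh x / Real.sinh x) - 4 / 3) * (6 * Real.exp x * Real.sinh x)
      = 2 * Real.exp x * (3 * x * Real.cosh x - 4 * Real.sinh x) := by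
    field_simp
    ring
  rw [e, Real.cosh_eq, Real.sinh_eq]
  linear_combination (3 * x + 4) * h1

theorem xCoth_lower : xCoth 1.03402174 < 4 / 3 := by
  rw [← sub_neg, xCoth_sub_eq (by norm_num)]
  refine div_neg_of_neg_of_pos ?_
    (mul_pos (by positivity) (Real.sinh_pos_iff.2 (by norm_num)))
  have h1 : (2.7182818283 : ℝ) ^ 2 < Real.exp 2 := by
    rw [show (2 : ℝ) = 1 + 1 by norm_num, Real.exp_add, ← sq]
    have := Real.exp_one_gt_d9
    gcongr
  have h2 := Real.sum_le_exp_of_nonneg (x := 0.06804348) (by norm_num) 7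
  norm_num [Finset.sum_range_succ, Nat.factorial] at h2
  rw [show (2 : ℝ) * 1.03402174 = 2 + 0.06804348 by norm_num, Real.exp_add]
  have h3 := mul_le_mul h1.le h2 (by norm_num) (by positivity)
  norm_num at h3 ⊢
  linarith

theorem xCoth_upper : 4 / 3 < xCoth 1.03402176 := by
  rw [← sub_pos, xCoth_sub_eq (by norm_num)]
  refine div_pos ?_ (mul_pos (by positivity) (Real.sinh_pos_iff.2 (by norm_num)))
  have h1 : Real.exp 2 < (2.7182818286 : ℝ) ^ 2 := by
    rw [show (2 : ℝ) = 1 + 1 by norm_num, Real.exp_add, ← sq]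
    have := Real.exp_one_lt_d9
    gcongr
  have h2 := Real.exp_bound' (x := 0.06804352) (by norm_num) (by norm_num) (n := 7) (by norm_num)
  norm_num [Finset.sum_range_succ, Nat.factorial] at h2
  rw [show (2 : ℝ) * 1.03402176 = 2 + 0.06804352 by norm_num, Real.exp_add]
  have h3 := mul_le_mul h1.le h2 (by positivity) (by positivity)
  norm_num at h3 ⊢
  linarith

theorem leadingM_bounds {n : ℝ} (h0 : 1.03402174 < n) (h1 : n < 1.03402176) :
    |leadingM n - 4.287466| < 1 / 10 ^ 6 := by
  have hn : 0 < n := by linarith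
  obtain ⟨u, hu⟩ : ∃ u, u = n ^ 2 := ⟨_, rfl⟩
  have e : leadingM n = (729 * u ^ 3 - 3078 * u ^ 2 + 3168 * u - 512) / (54 * u) := by
    rw [leadingM, hu]
    ring
  have hu0 : (1.03402174 : ℝ) ^ 2 < u := by rw [hu]; gcongr
  have hu1 : u < (1.03402176 : ℝ) ^ 2 := by rw [hu]; gcongr
  norm_num at hu0 hu1
  have hup : 0 < 54 * u := by linarith
  have anti : ∀ c v w : ℝ, 4 ≤ c → 1.06 ≤ v → v ≤ w → w ≤ 1.08 →
      729 * w ^ 3 - 3078 * w ^ 2 + (3168 - 54 * c) * w - 512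
        ≤ 729 * v ^ 3 - 3078 * v ^ 2 + (3168 - 54 * c) * v - 512 := by
    intro c v w hc hv hvw hw
    have hQ : 729 * (w ^ 2 + w * v + v ^ 2) - 3078 * (w + v) + (3168 - 54 * c) ≤ 0 := by
      nlinarith
    nlinarith [mul_nonneg (sub_nonneg.2 hvw) (neg_nonneg.2 hQ)]
  rw [e, abs_lt, lt_sub_iff_add_lt, lt_div_iff₀ hup, sub_lt_iff_lt_add, div_lt_iff₀ hup]
  constructor
  · have := anti (4.287466 - 1 / 10 ^ 6) u _ (by norm_num) (by linarith) hu1.le (by norm_num)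
    norm_num at this ⊢
    linarith
  · have := anti (4.287466 + 1 / 10 ^ 6) _ u (by norm_num) (by norm_num) hu0.le (by linarith)
    norm_num at this ⊢
    linarith

theorem exists_nMinus : ∃ n : ℝ, xCoth n = 4 / 3 ∧
    (0 < n ∧ n = 4 / 3 * Real.tanh n ∧ ∀ s : ℝ, 0 < s → s = 4 / 3 * Real.tanh s → s = n) ∧
    |n - 1.034021| < 1 / 10 ^ 6 ∧ |leadingM n - 4.287466| < 1 / 10 ^ 6 ∧ 0 < leadingM n := by
  obtain ⟨n, hn, h⟩ := exists_xCoth_eq (r := 4 / 3) (by norm_num)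
  have h0 : 1.03402174 < n := by
    rw [← strictMonoOn_xCoth.lt_iff_lt (Set.mem_Ioi.2 (by norm_num)) hn, h]
    exact xCoth_lower
  have h1 : n < 1.03402176 := by
    rw [← strictMonoOn_xCoth.lt_iff_lt hn (Set.mem_Ioi.2 (by norm_num)), h]
    exact xCoth_upper
  have hM := leadingM_bounds h0 h1
  refine ⟨n, h, ⟨hn, (xCoth_eq_iff_tanh hn).1 h, fun s hs hsn => ?_⟩, ?_, hM, ?_⟩
  · exact strictMonoOn_xCoth.injOn hs hn (((xCoth_eq_iff_tanh hs).2 hsn).trans h.symm)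
  · rw [abs_lt]
    constructor <;> linarith
  · rw [abs_lt] at hM
    linarith [hM.1]

end Constants

/-! ### The coefficient `mu2` on the curve -/

section Curve

variable {a d : ℝ}

theorem mu2_eq (hd : 0 < d) (hκ : 0 < kappa a d) (hτ : 0 < tauStar a d)
    (hσ : sigmaFn a d (tauStar a d) = 0) : mu2 a d =
      4 * kappa a d * (3 / 8 * (-tauStar a d ^ 2 / (2 * kappa a d)
          - gammaD d (tauStar a d) / (2 * kappa a d ^ 3) - 1 / (2 * kappa a d ^ 5)
          + kappa a d * gammaD d (tauStar a d) * tauStar a d ^ 2 / 2)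
        + (-kappa a d * tauStar a d ^ 2 * gammaD d (tauStar a d) / 2
          - tauStar a d ^ 2 / (2 * kappa a d) + a * tauStar a d ^ 2 / 2) / 8
        + ((a - 2 / kappa a d) * gammaD d (tauStar a d) - 1 / kappa a d ^ 3
          + kappa a d * tauStar a d ^ 2) / 2 * coefa1 a d
        + ((a - 2 / kappa a d) * gammaD d (tauStar a d) - 1 / kappa a d ^ 3
          + 3 * kappa a d * tauStar a d ^ 2) / 2 * (coefb1 a d / 2)) := by
  obtain ⟨-, -, g3⟩ := gammaD_bounds hd hτ
  set Q := 3 / 8 * (-tauStar a d ^ 2 / (2 * kappa a d)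
          - gammaD d (tauStar a d) / (2 * kappa a d ^ 3) - 1 / (2 * kappa a d ^ 5)
          + kappa a d * gammaD d (tauStar a d) * tauStar a d ^ 2 / 2)
        + (-kappa a d * tauStar a d ^ 2 * gammaD d (tauStar a d) / 2
          - tauStar a d ^ 2 / (2 * kappa a d) + a * tauStar a d ^ 2 / 2) / 8
        + ((a - 2 / kappa a d) * gammaD d (tauStar a d) - 1 / kappa a d ^ 3
          + kappa a d * tauStar a d ^ 2) / 2 * coefa1 a d
        + ((a - 2 / kappa a d) * gammaD d (tauStar a d) - 1 / kappa a d ^ 3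
          + 3 * kappa a d * tauStar a d ^ 2) / 2 * (coefb1 a d / 2) with hQ
  set Y := d * tauStar a d ^ 2 + gammaD d (tauStar a d) - d * gammaD d (tauStar a d) ^ 2 with hY
  have hl : lambda2 a d = -2 * Q / (kappa a d * Y) := by
    apply lambda2_eq hd hκ hτ hσ
    rw [← hY]
    have : -2 * Q / (kappa a d * Y) * (kappa a d * Y) / 2 = -Q := by
      field_simp
    rw [this, hQ]
    ring
  have hg := gammaD_eq d hτ.ne'
  have h1 : 1 - a * kappa a d = kappa a d ^ 2 * gammaD d (tauStar a d) := by
    rw [sigmaFn] at hσ; linarith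
  have : mu2 a d = -2 * kappa a d ^ 2 * lambda2 a d * Y := by
    rw [mu2, h1, hY, mul_assoc (kappa a d ^ 2), mul_div_cancel_left₀ _ (by positivity)]
    linear_combination (2 * kappa a d ^ 2 * lambda2 a d * (1 - gammaD d (tauStar a d) * d)) * hg
  rw [this, hl]
  field_simp
  ring

/-- The value of `d ^ 5 * mu2` on the curve in terms of `q = τ_* d` and `e = d ^ 3`. -/
noncomputable def curveMu (q e : ℝ) : ℝ :=
  12 * (3 / 8 * (3 * ((12 + e) / 9) * q ^ 2 / 2 - q ^ 2 * e / 6 - (12 + e) / 9 * e ^ 2 / 54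
      - e ^ 3 / 486)
    + (-3 * q ^ 2 * ((12 + e) / 9) / 2 - q ^ 2 * e / 6 - 2 * q ^ 2) / 8
    + ((-4 - 2 * e / 3) * ((12 + e) / 9) - e ^ 2 / 27 + 3 * q ^ 2) / 2
      * (-(1 - 9 * q ^ 2 / 4 - 3 * ((12 + e) / 9) / 2 + 9 * ((12 + e) / 9) ^ 2 / 4) / (3 + e))
    + ((-4 - 2 * e / 3) * ((12 + e) / 9) - e ^ 2 / 27 + 9 * q ^ 2) / 2
      * (((12 + e) / 9 * (-27 * q ^ 2 / 4 + 4 - 6 * ((12 + e) / 9) + 9 * ((12 + e) / 9) ^ 2 / 4)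
        - 3 * (1 - 3 * ((12 + e) / 9) / 2) * (q ^ 2 + ((12 + e) / 9) ^ 2)) / (9 * q ^ 2) / 2))

theorem curveMu_zero {n : ℝ} (hn : 0 < n) : curveMu n 0 = leadingM n := by
  rw [curveMu, leadingM]
  field_simp
  ring

theorem xCoth_two_mul {q : ℝ} (hq : 0 < q) :
    xCoth (2 * q) = (q ^ 2 + xCoth q ^ 2) / xCoth q := by
  have hs := Real.sinh_pos_iff.2 hq
  have hc := Real.cosh_pos q
  rw [xCoth, xCoth, Real.cosh_two_mul, Real.sinh_two_mul]
  field_simp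
  ring

theorem mu2_curve (hd : 0 < d) :
    mu2 (-4 / d ^ 2) d = curveMu (tauStar (-4 / d ^ 2) d * d) (d ^ 3) / d ^ 5 := by
  obtain ⟨hτ, hσ, -⟩ := tauStar_curve hd
  have hκ := kappa_curve hd
  have hκ0 : 0 < kappa (-4 / d ^ 2) d := by rw [hκ]; positivity
  have hx := (sigmaFn_curve_eq_zero_iff hd hτ).1 hσ
  rw [mu2_eq hd hκ0 hτ hσ, coefa1, coefb1, coefB1, coefC1, coefA1]
  set τ := tauStar (-4 / d ^ 2) d
  obtain ⟨q, hq⟩ : ∃ q, q = τ * d := ⟨_, rfl⟩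
  have hq0 : 0 < q := by rw [hq]; positivity
  have hτq : τ = q / d := by rw [hq]; field_simp
  obtain ⟨K, hK⟩ : ∃ K, K = (12 + d ^ 3) / 9 := ⟨_, rfl⟩
  have hK0 : 0 < K := by rw [hK]; positivity
  have hg : gammaD d τ = K / d := by
    rw [eq_div_iff hd.ne', mul_comm, mul_gammaD hτ.ne', hx, hK]
  have hg2 : gammaD d (2 * τ) = (q ^ 2 + K ^ 2) / K / d := by
    rw [eq_div_iff hd.ne', mul_comm, mul_gammaD (by positivity), mul_assoc, ← hq,
      xCoth_two_mul hq0, hq, hx, hK]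
  have hs0 : sigmaFn (-4 / d ^ 2) d 0 = -(3 + d ^ 3) / d ^ 3 := by
    rw [sigmaFn, hκ, gammaD_zero]
    field_simp
    ring
  have hs2 : sigmaFn (-4 / d ^ 2) d (2 * τ) = 9 * q ^ 2 / (K * d ^ 3) := by
    rw [sigmaFn, hκ, hg2]
    have : d ^ 3 = 9 * K - 12 := by rw [hK]; ring
    field_simp
    rw [this]
    ring
  have ha : ((-(3 / 4) * τ ^ 2 * (3 / d) ^ 2 + (-4 / d ^ 2) ^ 2 / 4
      + -4 / d ^ 2 * (3 / d) * (K / d) / 2 + (3 / d) ^ 2 * (K / d) ^ 2 / 4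
      + τ ^ 2 * (3 / d) ^ 2 / 2) * d - (-(-4 / d ^ 2) / 4 - 3 / d * (K / d) / 2) * (3 / d))
      / (d * (-(3 + d ^ 3) / d ^ 3))
      = -(1 - 9 * q ^ 2 / 4 - 3 * K / 2 + 9 * K ^ 2 / 4) / (3 + d ^ 3) / d := by
    rw [hτq]
    field_simp
    ring
  have hb : (-(3 / 4) * τ ^ 2 * (3 / d) ^ 2 + (-4 / d ^ 2) ^ 2 / 4
      + -4 / d ^ 2 * (3 / d) * (K / d) / 2 + (3 / d) ^ 2 * (K / d) ^ 2 / 4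
      - (-(-4 / d ^ 2) / 4 - 3 / d * (K / d) / 2) * (3 / d) * ((q ^ 2 + K ^ 2) / K / d))
      / (9 * q ^ 2 / (K * d ^ 3))
      = (K * (-27 * q ^ 2 / 4 + 4 - 6 * K + 9 * K ^ 2 / 4)
        - 3 * (1 - 3 * K / 2) * (q ^ 2 + K ^ 2)) / (9 * q ^ 2) / d := by
    rw [hτq]
    field_simp
    ring
  rw [hκ, hg, hg2, hs0, hs2, ha, hb, ← hq, curveMu, ← hK, hτq]
  obtain ⟨α, hα⟩ : ∃ α, α = -(1 - 9 * q ^ 2 / 4 - 3 * K / 2 + 9 * K ^ 2 / 4) / (3 + d ^ 3) :=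
    ⟨_, rfl⟩
  obtain ⟨β, hβ⟩ : ∃ β, β = (K * (-27 * q ^ 2 / 4 + 4 - 6 * K + 9 * K ^ 2 / 4)
        - 3 * (1 - 3 * K / 2) * (q ^ 2 + K ^ 2)) / (9 * q ^ 2) := ⟨_, rfl⟩
  rw [← hα, ← hβ]
  field_simp
  ring

end Curve

section Curve

/-- The root of `xCoth q = r` depends differentiably on `r`. -/
theorem exists_differentiableAt_root {n : ℝ} (hn : 0 < n) : ∃ g : ℝ → ℝ,
    DifferentiableAt ℝ g (xCoth n) ∧ g (xCoth n) = n ∧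
    ∀ᶠ r in 𝓝 (xCoth n), ∀ q, 0 < q → xCoth q = r → q = g r := by
  have hs := Real.sinh_pos_iff.2 hn
  have h0 : HasStrictDerivAt xCoth _ n :=
    (hasStrictDerivAt_id n).mul ((Real.hasStrictDerivAt_cosh n).div
      (Real.hasStrictDerivAt_sinh n) hs.ne')
  have h := h0
  rw [h0.hasDerivAt.unique (hasDerivAt_xCoth hn)] at h
  have hne := (xCoth_pos_deriv hn).ne'
  have hd := (h.to_localInverse hne).hasDerivAt.differentiableAt
  have hr : ∀ᶠ r in 𝓝 (xCoth n), xCoth (h.localInverse _ _ _ hne r) = r :=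
    (h.hasStrictFDerivAt_equiv hne).eventually_right_inverse
  have hi : h.localInverse _ _ _ hne (xCoth n) = n :=
    (h.hasStrictFDerivAt_equiv hne).localInverse_apply_image
  refine ⟨_, hd, hi, ?_⟩
  have hp : ∀ᶠ r in 𝓝 (xCoth n), 0 < h.localInverse _ _ _ hne r :=
    hd.continuousAt.eventually_const_lt (by rw [hi]; exact hn)
  filter_upwards [hr, hp] with r h1 h2 q hq hqr
  exact strictMonoOn_xCoth.injOn hq h2 (hqr.trans h1.symm)

theorem tendsto_cube_nhdsGT_zero : Tendsto (fun d : ℝ => d ^ 3) (𝓝[>] 0) (𝓝 0) := by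
  have : Tendsto (fun d : ℝ => d ^ 3) (𝓝 0) (𝓝 (0 ^ 3)) := (continuous_pow 3).tendsto 0
  rw [zero_pow three_ne_zero] at this
  exact this.mono_left nhdsWithin_le_nhds

theorem mu2_curve_isBigO {n : ℝ} (hn : 0 < n) (h : xCoth n = 4 / 3) :
    (fun d : ℝ => mu2 (-4 / d ^ 2) d * d ^ 5 - leadingM n) =O[𝓝[>] (0 : ℝ)] fun d => d ^ 3 := by
  obtain ⟨g, hg, hgn, hgr⟩ := exists_differentiableAt_root hn
  rw [h] at hg hgn hgr
  have hg' : DifferentiableAt ℝ g ((12 + 0) / 9) := by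
    rwa [show (12 + 0 : ℝ) / 9 = 4 / 3 by norm_num]
  have hq : DifferentiableAt ℝ (fun e : ℝ => g ((12 + e) / 9)) 0 :=
    hg'.comp (f := fun e : ℝ => (12 + e) / 9) 0 (by fun_prop)
  have hq0 : g ((12 + 0) / 9) = n := by rw [← hgn]; norm_num
  have hF : DifferentiableAt ℝ (fun e => curveMu (g ((12 + e) / 9)) e) 0 := by
    have h1 : (3 : ℝ) + 0 ≠ 0 := by norm_num
    have h2 : 9 * g ((12 + 0) / 9) ^ 2 ≠ 0 := by rw [hq0]; positivity
    unfold curveMu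
    fun_prop (disch := assumption)
  have hO := hF.isBigO_sub
  simp only [hq0, curveMu_zero hn, sub_zero] at hO
  have ht' : Tendsto (fun d : ℝ => (12 + d ^ 3) / 9) (𝓝[>] 0) (𝓝 (4 / 3)) := by
    have := (tendsto_cube_nhdsGT_zero.const_add 12).div_const 9
    rwa [show (12 + 0 : ℝ) / 9 = 4 / 3 by norm_num] at this
  refine (hO.comp_tendsto tendsto_cube_nhdsGT_zero).congr' ?_ EventuallyEq.rfl
  filter_upwards [ht'.eventually hgr, self_mem_nhdsWithin] with d h1 hd
  obtain ⟨hτ, hσ, -⟩ := tauStar_curve hd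
  have hd0 : (0 : ℝ) < d := hd
  rw [mu2_curve hd, div_mul_cancel₀ _ (by positivity),
    h1 _ (mul_pos hτ hd) ((sigmaFn_curve_eq_zero_iff hd hτ).1 hσ)]
  rfl

theorem mu2_curve_expansion {n : ℝ} (hn : 0 < n) (h : xCoth n = 4 / 3) :
    (fun d : ℝ => mu2 (-4 / d ^ 2) d - leadingM n * (d ^ 5)⁻¹)
      =O[𝓝[>] (0 : ℝ)] fun d => (d ^ 2)⁻¹ := by
  have := (mu2_curve_isBigO hn h).mul (isBigO_refl (fun d : ℝ => (d ^ 5)⁻¹) (𝓝[>] (0 : ℝ)))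
  refine this.congr' ?_ ?_ <;> filter_upwards [self_mem_nhdsWithin] with d hd <;>
    have hd0 : d ≠ 0 := (Set.mem_Ioi.1 hd).ne'
  · rw [sub_mul, mul_assoc, mul_inv_cancel₀ (pow_ne_zero 5 hd0), mul_one]
  · field_simp

theorem eventually_mu2_curve_pos {n : ℝ} (hn : 0 < n) (h : xCoth n = 4 / 3)
    (hM : 0 < leadingM n) : ∀ᶠ d in 𝓝[>] (0 : ℝ), 0 < mu2 (-4 / d ^ 2) d := by
  have h0 := ((mu2_curve_isBigO hn h).trans_tendsto tendsto_cube_nhdsGT_zero).add_const (leadingM n)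
  simp only [sub_add_cancel, zero_add] at h0
  filter_upwards [h0.eventually_const_lt hM, self_mem_nhdsWithin] with d h1 hd
  exact pos_of_mul_pos_left h1 (pow_nonneg (Set.mem_Ioi.1 hd).le 5)

end Curve

theorem mainTheorem4 :
    ∃ n : ℝ,
      -- the positive number `n₋` and the constant `M`
      (0 < n ∧ n = 4 / 3 * Real.tanh n ∧ ∀ s : ℝ, 0 < s → s = 4 / 3 * Real.tanh s → s = n) ∧
      |n - 1.034021| < 1 / 10 ^ 6 ∧
      |leadingM n - 4.287466| < 1 / 10 ^ 6 ∧
      0 < leadingM n ∧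
      -- the flows on the curve, and the meaning of `mu2` for them
      (∀ d : ℝ, 0 < d →
        (-4 / d ^ 2, d) ∈ UpsilonMinus ∧
        (∃ dc : ℝ, IsCriticalDepth (-4 / d ^ 2) dc ∧ dc < d) ∧
        HasBottomCounterCurrent (-4 / d ^ 2) d ∧
        (0 < tauStar (-4 / d ^ 2) d ∧ sigmaFn (-4 / d ^ 2) d (tauStar (-4 / d ^ 2) d) = 0 ∧
          ∀ s : ℝ, 0 < s → sigmaFn (-4 / d ^ 2) d s = 0 → s = tauStar (-4 / d ^ 2) d) ∧
        ∀ (T : ℝ) (ψ : ℝ → ℝ → ℝ → ℝ) (η : ℝ → ℝ → ℝ) (lam : ℝ → ℝ),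
          IsStokesBranch (-4 / d ^ 2) d T ψ η lam →
          ∃ μ : ℝ → ℝ,
            (∀ᶠ t in 𝓝[>] (0 : ℝ),
              IsKthEigenvalue 2 (2 * Real.pi / tauStar (-4 / d ^ 2) d)
                (ψ t) (η t) (lam t) (μ t)) ∧
            (fun t => μ t - mu2 (-4 / d ^ 2) d * t ^ 2) =O[𝓝[>] (0 : ℝ)] (fun t => t ^ 3)) ∧
      -- the asymptotics along the curve, and positivity
      (fun d : ℝ => mu2 (-4 / d ^ 2) d - leadingM n * (d ^ 5)⁻¹)
        =O[𝓝[>] (0 : ℝ)] (fun d => (d ^ 2)⁻¹) ∧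
      (∀ᶠ d in 𝓝[>] (0 : ℝ), 0 < mu2 (-4 / d ^ 2) d) := by
  obtain ⟨n, h, h1, h2, h3, h4⟩ := exists_nMinus
  refine ⟨n, h1, h2, h3, h4, fun d hd => ?_, mu2_curve_expansion h1.1 h,
    eventually_mu2_curve_pos h1.1 h h4⟩
  obtain ⟨hτ, hσ, hu⟩ := tauStar_curve hd
  refine ⟨mem_upsilonMinus_curve hd, exists_isCriticalDepth_curve hd,
    hasBottomCounterCurrent_curve hd, ⟨hτ, hσ, hu⟩, fun T ψ η lam hB => ?_⟩
  exact hB.exists_second_eigenvalue hd (by rw [kappa_curve hd]; positivity) hτ hσ
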